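/- Let $m\ge 1$, let $\Omega\subset\mathbb{R}^m$ be open, let $\omega\Subset\Omega$, and let $K\subset\Omega$ be compact with $\overline\omega\subset\operatorname{int}K$. **Setting.** Let $f_1,\dots,f_\ell:\Omega\times\mathbb{R}\to\mathbb{R}$ be continuous, with $|f_i(x,s)|\le \bar c\,|s|$ for some $\bar c>0$ and all $x\in\Omega$, $|s|\le 1$, $1\le i\le\ell$. Let $\gamma>0$, let $a\in C^1(\Omega)$ with $a>0$, and let $A=(a_{hl})\in C^1(\Omega,\mathrm{Sym}_m)$ satisfy $\langle A(x)\xi,\xi\rangle\ge\theta|\xi|^2$ for all $x\in\Omega$, $\xi\in\mathbb{R}^m$, where $\theta>0$. For each $\lambda<0$ let $(u_{\lambda,1},\dots,u_{\lambda,\ell})$ be a nonnegative, continuous weak solution in $H^1(\Omega)$ of $$-\operatorname{div}(A(x)\nabla u_{\lambda,i})=f_i(x,u_{\lambda,i})+a(x)\sum_{j\ne i}\lambda\,|u_{\lambda,j}|^{\gamma+1}|u_{\lambda,i}|^{\gamma-1}u_{\lambda,i}\quad\text{in }\Omega,\qquad i=1,\dots,\ell .$$ Assume that, as $\lambda\to-\infty$,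 $u_{\lambda,i}\to u_i$ in $H^1(\Omega)$ and in $C^{0,\alpha}(\Omega)$ for every $\alpha\in(0,1)$; that for $i\ne j$ the functions $u_{\lambda,i}^{\gamma+1}u_{\lambda,j}^{\gamma+1}$ are integrable on $\Omega$ and $\int_\Omega\lambda\,u_{\lambda,i}^{\gamma+1}u_{\lambda,j}^{\gamma+1}\to0$; that $-\operatorname{div}(A\nabla u_i)=f_i(x,u_i)$ weakly in $\{x\in\Omega:u_i(x)>0\}$; and that $u=(u_1,\dots,u_\ell)$ does not vanish identically on any connected component of $\Omega$. **Normalized quantities.** For $x_0\in\omega$ put $T_{x_0}x=x_0+A(x_0)^{1/2}x$ and, on $T_{x_0}^{-1}(\Omega)$, $A_{x_0}(x)=A(x_0)^{-1/2}A(T_{x_0}x)A(x_0)^{-1/2}$, $f_{x_0,i}(x,s)=f_i(T_{x_0}x,s)$, $v_{i}=v_{i,x_0}=u_i\circ T_{x_0}$, $\mu_{x_0}(x)=\langle A_{x_0}(x)\tfrac{x}{|x|},\tfrac{x}{|x|}\rangle$, $Z(x)=A_{x_0}(x)x/\mu_{x_0}(x)$. With $B_r=B_r(0)$, let $$E(x_0,u,r)=\frac1{r^{m-2}}\sum_i\int_{B_r}\big(\langle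 A_{x_0}\nabla v_i,\nabla v_i\rangle-f_{x_0,i}(x,v_i)v_i\big)\,dx,\qquad H(x_0,u,r)=\frac1{r^{m-1}}\int_{\partial B_r}\mu_{x_0}\sum_iv_i^2\,d\sigma,$$ $N(x_0,u,r)=E(x_0,u,r)/H(x_0,u,r)$, and $\widetilde E(r)=r^{2-m}\sum_i\int_{B_r}\langle A_{x_0}\nabla v_i,\nabla v_i\rangle\,dx$. **Theorem.** There are $C,\bar r>0$, depending only on $m$, $\ell$, $\Omega$, $\omega$, $K$, the functions $f_i$, the ellipticity constant $\theta$, and upper bounds on $K$ for $A$ (as a quadratic form), for the first derivatives $|\partial_k a_{hl}|$ and for $|u_i|$ (in particular, independent of $x_0$), such that for every $x_0\in\omega$ one has $T_{x_0}(\overline{B_{\bar r}})\subset\Omega$, $v_i\in H^1(T_{x_0}^{-1}(\Omega))$ for every $i$, and: 1. For a.e. $r\in(0,\bar r)$, writing $A_{x_0}=(a_{hl})$, $\nu=x/|x|$, and summing over all repeated indices (including $i=1,\dots,\ell$), $$\begin{aligned} r\int_{\partial B_r}\langle A_{x_0}\nabla v_i,\nabla v_i\rangle&=\int_{B_r}\operatorname{div}Z\,\langle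 A_{x_0}\nabla v_i,\nabla v_i\rangle+2\int_{B_r}f_{x_0,i}(x,v_i)\langle\nabla v_i,Z\rangle+2\int_{\partial B_r}\langle Z,\nabla v_i\rangle\langle A_{x_0}\nabla v_i,\nu\rangle\\&\quad+\int_{B_r}\langle Z,\nabla a_{hl}\rangle\,\partial_hv_i\,\partial_lv_i-2\int_{B_r}a_{hl}\,\partial_hZ_j\,\partial_jv_i\,\partial_lv_i,\end{aligned}$$ and $\widetilde E$ is differentiable at $r$ with $$\begin{aligned}\widetilde E'(r)&=\frac2{r^{m-2}}\int_{\partial B_r}\frac{\langle A_{x_0}\nabla v_i,\nu\rangle^2}{\mu_{x_0}}+\frac2{r^{m-1}}\int_{B_r}f_{x_0,i}(x,v_i)\langle Z,\nabla v_i\rangle+\frac1{r^{m-1}}\int_{B_r}\langle Z,\nabla a_{hl}\rangle\,\partial_hv_i\,\partial_lv_i\\&\quad+\frac1{r^{m-1}}\int_{B_r}\operatorname{div}(Z-x)\langle A_{x_0}\nabla v_i,\nabla v_i\rangle-\frac2{r^{m-1}}\int_{B_r}a_{hl}\,\partial_h(Z_j-x_j)\,\partial_jv_i\,\partial_lv_i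 .\end{aligned}$$ 2. $H(x_0,u,r)\ne0$ (so $H(x_0,u,r)>0$) for every $r\in(0,\bar r)$. 3. The limit $N(x_0,u,0^+)=\lim_{r\to0^+}N(x_0,u,r)$ exists and is finite, and $r\mapsto N(x_0,u,r)$, extended by this limit at $r=0$, is absolutely continuous on $[0,\bar r]$. 4. For a.e. $r\in(0,\bar r)$, $N(x_0,u,\cdot)$ is differentiable at $r$ and $\partial_rN(x_0,u,r)\ge-C\,(N(x_0,u,r)+1)$; moreover $r\mapsto e^{Cr}(N(x_0,u,r)+1)$ is nondecreasing on $(0,\bar r)$. 5. For every $r\in(0,\bar r)$, $\log H(x_0,u,\cdot)$ is differentiable at $r$ and $\big|\partial_r\log H(x_0,u,r)-\tfrac2rN(x_0,u,r)\big|\le C$. -/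

import Mathlib

open MeasureTheory Set Filter Topology Metric
open scoped NNReal ENNReal

noncomputable section

namespace SegregatedProfile

/-- Euclidean space `ℝ^m`. -/
abbrev Euc (m : ℕ) : Type := EuclideanSpace ℝ (Fin m)

/-- The `k`-th vector of the standard basis. -/
abbrev stdVec {m : ℕ} (k : Fin m) : Euc m := EuclideanSpace.single k (1 : ℝ)

/-- The partial derivative `∂_k g` of a real function. -/
def partialDeriv {m : ℕ} (k : Fin m) (g : Euc m → ℝ) (x : Euc m) : ℝ :=
  fderiv ℝ g x (stdVec k)

/-- The action of a matrix on a vector of Euclidean space. -/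
def matAct {m : ℕ} (B : Matrix (Fin m) (Fin m) ℝ) (ξ : Euc m) : Euc m :=
  Matrix.toEuclideanLin B ξ

/-- The bilinear form `⟨B ξ, η⟩`. -/
def matForm {m : ℕ} (B : Matrix (Fin m) (Fin m) ℝ) (ξ η : Euc m) : ℝ :=
  inner ℝ (matAct B ξ) η

/-! ### Sobolev and Hölder spaces, weak solutions -/

/-- Test functions `φ ∈ C_c^∞(U)`. -/
def IsTestFunction {m : ℕ} (U : Set (Euc m)) (φ : Euc m → ℝ) : Prop :=
  ContDiff ℝ (⊤ : ℕ∞) φ ∧ HasCompactSupport φ ∧ tsupport φ ⊆ U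

/-- `G` is a weak (distributional) gradient of `w` in `U`. -/
def IsWeakGradient {m : ℕ} (U : Set (Euc m)) (w : Euc m → ℝ) (G : Euc m → Euc m) : Prop :=
  LocallyIntegrableOn w U ∧ LocallyIntegrableOn G U ∧
    ∀ φ : Euc m → ℝ, IsTestFunction U φ →
      ∫ x in U, w x • gradient φ x = -∫ x in U, φ x • G x

open Classical in
/-- The weak gradient `∇w` in `U` (a fixed representative; zero if there is none). -/
def weakGrad {m : ℕ} (U : Set (Euc m)) (w : Euc m → ℝ) : Euc m → Euc m :=
  if h : ∃ G, IsWeakGradient U w G then h.choose else 0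

/-- The Sobolev space `H^1(U)`. -/
def MemH1 {m : ℕ} (U : Set (Euc m)) (w : Euc m → ℝ) : Prop :=
  MemLp w 2 (volume.restrict U) ∧
    ∃ G, IsWeakGradient U w G ∧ MemLp G 2 (volume.restrict U)

/-- The norm of `C^{0,α}(U)`, with values in `[0, ∞]`: the supremum norm plus the
`α`-Hölder seminorm. -/
def holderNormOn {m : ℕ} (α : ℝ≥0) (U : Set (Euc m)) (w : Euc m → ℝ) : ℝ≥0∞ :=
  (⨆ x ∈ U, ‖w x‖ₑ) + eHolderNorm α (U.domRestrict w)

/-- `w ∈ H^1(U)` is a weak solution of `-div(A ∇w) = g` in `U`. -/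
def IsWeakSolution {m : ℕ} (U : Set (Euc m)) (A : Euc m → Matrix (Fin m) (Fin m) ℝ)
    (w g : Euc m → ℝ) : Prop :=
  MemH1 U w ∧ ∀ φ : Euc m → ℝ, IsTestFunction U φ →
    ∫ x in U, matForm (A x) (weakGrad U w x) (gradient φ x) = ∫ x in U, g x * φ x

/-! ### The competitive system and its segregated limit profiles -/

/-- The right-hand side of the `i`-th equation of the system,
`f_i(x,u_i) + a(x) ∑_{j ≠ i} lam |u_j|^{γ+1} |u_i|^{γ-1} u_i`. -/
def systemRHS {m ℓ : ℕ} (f : Fin ℓ → Euc m → ℝ → ℝ) (a : Euc m → ℝ) (γ lam : ℝ)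
    (w : Fin ℓ → Euc m → ℝ) (i : Fin ℓ) (x : Euc m) : ℝ :=
  f i x (w i x) + a x * ∑ j ∈ Finset.univ.erase i,
    lam * |w j x| ^ (γ + 1) * |w i x| ^ (γ - 1) * w i x

/-- `A ∈ C^1(U, Sym_m)`, with lower ellipticity constant `θ` in `U`. -/
def IsEllipticC1 {m : ℕ} (U : Set (Euc m)) (θ : ℝ)
    (A : Euc m → Matrix (Fin m) (Fin m) ℝ) : Prop :=
  (∀ i j, ContDiffOn ℝ 1 (fun x => A x i j) U) ∧ (∀ x ∈ U, (A x).IsSymm) ∧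
    ∀ x ∈ U, ∀ ξ : Euc m, θ * ‖ξ‖ ^ 2 ≤ matForm (A x) ξ ξ

/-- The hypotheses on the reactions `f_i`: continuity on `U × ℝ` and a bound
`|f_i(x,s)| ≤ c |s|` for `x ∈ U`, `|s| ≤ 1`. -/
def IsAdmissibleReaction {m ℓ : ℕ} (U : Set (Euc m)) (f : Fin ℓ → Euc m → ℝ → ℝ) : Prop :=
  (∀ i, ContinuousOn (fun p : Euc m × ℝ => f i p.1 p.2) (U ×ˢ univ)) ∧
    ∃ c > 0, ∀ i, ∀ x ∈ U, ∀ s : ℝ, |s| ≤ 1 → |f i x s| ≤ c * |s|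

/-- `u` is the segregated limit profile, as `lam → -∞`, of the nonnegative solutions `w lam` of
the competitive system. -/
structure IsSegregatedLimit {m ℓ : ℕ} (Ω : Set (Euc m)) (A : Euc m → Matrix (Fin m) (Fin m) ℝ)
    (f : Fin ℓ → Euc m → ℝ → ℝ) (a : Euc m → ℝ) (γ : ℝ)
    (w : ℝ → Fin ℓ → Euc m → ℝ) (u : Fin ℓ → Euc m → ℝ) : Prop where
  /-- the `w lam i` are continuous and nonnegative in `Ω` -/
  continuousOn : ∀ lam < 0, ∀ i, ContinuousOn (w lam i) Ω
  nonneg : ∀ lam < 0, ∀ i, ∀ x ∈ Ω, 0 ≤ w lam i x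
  /-- `w lam` solves the system -/
  solution : ∀ lam < 0, ∀ i, IsWeakSolution Ω A (w lam i) (systemRHS f a γ lam (w lam) i)
  /-- strong convergence in `H^1(Ω)` -/
  memH1 : ∀ i, MemH1 Ω (u i)
  tendsto_L2 : ∀ i, Tendsto (fun lam => eLpNorm (w lam i - u i) 2 (volume.restrict Ω))
    atBot (𝓝 0)
  tendsto_grad : ∀ i, Tendsto
    (fun lam => eLpNorm (weakGrad Ω (w lam i) - weakGrad Ω (u i)) 2 (volume.restrict Ω))
    atBot (𝓝 0)
  /-- convergence in `C^{0,α}(Ω)` for every `α ∈ (0,1)` -/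
  tendsto_holder : ∀ i, ∀ α : ℝ≥0, 0 < α → α < 1 →
    Tendsto (fun lam => holderNormOn α Ω (w lam i - u i)) atBot (𝓝 0)
  /-- the interaction energies are finite and vanish in the limit -/
  interaction_integrable : ∀ lam < 0, ∀ i j, i ≠ j →
    IntegrableOn (fun x => w lam i x ^ (γ + 1) * w lam j x ^ (γ + 1)) Ω
  interaction_tendsto : ∀ i j, i ≠ j →
    Tendsto (fun lam => ∫ x in Ω, lam * (w lam i x ^ (γ + 1) * w lam j x ^ (γ + 1)))
      atBot (𝓝 0)
  /-- the limit equation in the positivity sets -/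
  limit_equation : ∀ i, IsWeakSolution {x ∈ Ω | 0 < u i x} A (u i) (fun x => f i x (u i x))
  /-- `u` does not vanish identically on any connected component of `Ω` -/
  nontrivial : ∀ x ∈ Ω, ∃ y ∈ connectedComponentIn Ω x, ∃ i, u i y ≠ 0

/-! ### The Almgren quotient centred at the origin -/

/-- The surface integral `∫_{∂B_r(0)} g dσ`. Here `volume.toSphere` is the surface measure of the
unit sphere (the counting measure on the two points of the sphere if `m = 1`). -/
def sphereIntegral {m : ℕ} (r : ℝ) (g : Euc m → ℝ) : ℝ :=
  r ^ ((m : ℤ) - 1) *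
    ∫ s : sphere (0 : Euc m) 1, g (r • (s : Euc m)) ∂(volume : Measure (Euc m)).toSphere

/-- The unit vector `x / |x|`; it is the outer normal `ν(x)` of the sphere through `x`. -/
def unitVec {m : ℕ} (x : Euc m) : Euc m := ‖x‖⁻¹ • x

/-- `μ(x) = ⟨A(x) x/|x|, x/|x|⟩`. -/
def mu {m : ℕ} (A : Euc m → Matrix (Fin m) (Fin m) ℝ) (x : Euc m) : ℝ :=
  matForm (A x) (unitVec x) (unitVec x)

/-- The vector field `Z(x) = A(x) x / μ(x)`. -/
def fieldZ {m : ℕ} (A : Euc m → Matrix (Fin m) (Fin m) ℝ) (x : Euc m) : Euc m :=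
  (mu A x)⁻¹ • matAct (A x) x

/-- The divergence of a vector field. -/
def divergence {m : ℕ} (Y : Euc m → Euc m) (x : Euc m) : ℝ :=
  ∑ j, partialDeriv j (fun y => Y y j) x

/-- `E(r) = r^{2-m} ∑_i ∫_{B_r} (⟨A ∇v_i, ∇v_i⟩ - f_i(x,v_i) v_i)`, for functions `v_i` on `U`. -/
def energy {m ℓ : ℕ} (U : Set (Euc m)) (A : Euc m → Matrix (Fin m) (Fin m) ℝ)
    (f : Fin ℓ → Euc m → ℝ → ℝ) (v : Fin ℓ → Euc m → ℝ) (r : ℝ) : ℝ :=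
  1 / r ^ ((m : ℤ) - 2) * ∑ i, ∫ x in ball (0 : Euc m) r,
    (matForm (A x) (weakGrad U (v i) x) (weakGrad U (v i) x) - f i x (v i x) * v i x)

/-- The Dirichlet part `r^{2-m} ∑_i ∫_{B_r} ⟨A ∇v_i, ∇v_i⟩` of the energy. -/
def energyDirichlet {m ℓ : ℕ} (U : Set (Euc m)) (A : Euc m → Matrix (Fin m) (Fin m) ℝ)
    (v : Fin ℓ → Euc m → ℝ) (r : ℝ) : ℝ :=
  1 / r ^ ((m : ℤ) - 2) * ∑ i, ∫ x in ball (0 : Euc m) r,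
    matForm (A x) (weakGrad U (v i) x) (weakGrad U (v i) x)

/-- `H(r) = r^{1-m} ∫_{∂B_r} μ |v|²`. -/
def height {m ℓ : ℕ} (A : Euc m → Matrix (Fin m) (Fin m) ℝ) (v : Fin ℓ → Euc m → ℝ)
    (r : ℝ) : ℝ :=
  1 / r ^ ((m : ℤ) - 1) * sphereIntegral r (fun x => mu A x * ∑ i, v i x ^ 2)

/-- The local Pohozaev identity on `B_r`, summed over the components. -/
def PohozaevIdentity {m ℓ : ℕ} (U : Set (Euc m)) (A : Euc m → Matrix (Fin m) (Fin m) ℝ)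
    (f : Fin ℓ → Euc m → ℝ → ℝ) (v : Fin ℓ → Euc m → ℝ) (r : ℝ) : Prop :=
  let D : Fin ℓ → Euc m → Euc m := fun i => weakGrad U (v i)
  let Z : Euc m → Euc m := fieldZ A
  r * (∑ i, sphereIntegral r (fun x => matForm (A x) (D i x) (D i x))) =
    (∑ i, ∫ x in ball (0 : Euc m) r, divergence Z x * matForm (A x) (D i x) (D i x))
    + 2 * (∑ i, ∫ x in ball (0 : Euc m) r, f i x (v i x) * inner ℝ (D i x) (Z x))
    + 2 * (∑ i, sphereIntegral r
        (fun x => inner ℝ (Z x) (D i x) * matForm (A x) (D i x) (unitVec x)))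
    + (∑ i, ∫ x in ball (0 : Euc m) r, ∑ h, ∑ l,
        inner ℝ (Z x) (gradient (fun y => A y h l) x) * D i x h * D i x l)
    - 2 * (∑ i, ∫ x in ball (0 : Euc m) r, ∑ h, ∑ l, ∑ j,
        A x h l * partialDeriv h (fun y => Z y j) x * D i x j * D i x l)

/-- The formula for the derivative at `r` of the Dirichlet part of the energy. -/
def EnergyDerivIdentity {m ℓ : ℕ} (U : Set (Euc m)) (A : Euc m → Matrix (Fin m) (Fin m) ℝ)
    (f : Fin ℓ → Euc m → ℝ → ℝ) (v : Fin ℓ → Euc m → ℝ) (r : ℝ) : Prop :=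
  let D : Fin ℓ → Euc m → Euc m := fun i => weakGrad U (v i)
  let Z : Euc m → Euc m := fieldZ A
  HasDerivAt (energyDirichlet U A v)
    (2 / r ^ ((m : ℤ) - 2) *
        (∑ i, sphereIntegral r (fun x => matForm (A x) (D i x) (unitVec x) ^ 2 / mu A x))
      + 2 / r ^ ((m : ℤ) - 1) *
        (∑ i, ∫ x in ball (0 : Euc m) r, f i x (v i x) * inner ℝ (Z x) (D i x))
      + 1 / r ^ ((m : ℤ) - 1) *
        (∑ i, ∫ x in ball (0 : Euc m) r, ∑ h, ∑ l,
          inner ℝ (Z x) (gradient (fun y => A y h l) x) * D i x h * D i x l)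
      + 1 / r ^ ((m : ℤ) - 1) *
        (∑ i, ∫ x in ball (0 : Euc m) r,
          divergence (fun y => Z y - y) x * matForm (A x) (D i x) (D i x))
      - 2 / r ^ ((m : ℤ) - 1) *
        (∑ i, ∫ x in ball (0 : Euc m) r, ∑ h, ∑ l, ∑ j,
          A x h l * partialDeriv h (fun y => Z y j - y j) x * D i x j * D i x l)) r

/-! ### The coordinates that normalize the matrix at a point -/

section

open scoped MatrixOrder

/-- The square root of a positive semidefinite real matrix. -/
def matSqrt {m : ℕ} (B : Matrix (Fin m) (Fin m) ℝ) : Matrix (Fin m) (Fin m) ℝ := CFC.sqrt B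

theorem matSqrt_posSemidef {m : ℕ} (B : Matrix (Fin m) (Fin m) ℝ) : (matSqrt B).PosSemidef :=
  Matrix.nonneg_iff_posSemidef.mp (CFC.sqrt_nonneg B)

theorem matSqrt_mul_self {m : ℕ} {B : Matrix (Fin m) (Fin m) ℝ} (hB : B.PosSemidef) :
    matSqrt B * matSqrt B = B :=
  CFC.sqrt_mul_sqrt_self B hB.nonneg

end

/-- `T_{x₀} x = x₀ + A(x₀)^{1/2} x`. -/
def normMap {m : ℕ} (A : Euc m → Matrix (Fin m) (Fin m) ℝ) (x₀ x : Euc m) : Euc m :=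
  x₀ + matAct (matSqrt (A x₀)) x

/-- `A_{x₀}(x) = A(x₀)^{-1/2} A(T_{x₀} x) A(x₀)^{-1/2}`. -/
def normMatrix {m : ℕ} (A : Euc m → Matrix (Fin m) (Fin m) ℝ) (x₀ x : Euc m) :
    Matrix (Fin m) (Fin m) ℝ :=
  (matSqrt (A x₀))⁻¹ * A (normMap A x₀ x) * (matSqrt (A x₀))⁻¹

/-- `f_{x₀}(x,s) = f(T_{x₀} x, s)`. -/
def normReaction {m ℓ : ℕ} (A : Euc m → Matrix (Fin m) (Fin m) ℝ)
    (f : Fin ℓ → Euc m → ℝ → ℝ) (x₀ : Euc m) : Fin ℓ → Euc m → ℝ → ℝ :=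
  fun i x s => f i (normMap A x₀ x) s

/-- `v_{i,x₀}(x) = u_i(T_{x₀} x)`. -/
def normProfile {m ℓ : ℕ} (A : Euc m → Matrix (Fin m) (Fin m) ℝ)
    (u : Fin ℓ → Euc m → ℝ) (x₀ : Euc m) : Fin ℓ → Euc m → ℝ :=
  fun i x => u i (normMap A x₀ x)

/-- The domain `T_{x₀}⁻¹(Ω)` of `v_{x₀}`. -/
def normDomain {m : ℕ} (A : Euc m → Matrix (Fin m) (Fin m) ℝ) (Ω : Set (Euc m))
    (x₀ : Euc m) : Set (Euc m) :=
  normMap A x₀ ⁻¹' Ω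

/-- `E(x₀,u,r)`. -/
def energyAt {m ℓ : ℕ} (Ω : Set (Euc m)) (A : Euc m → Matrix (Fin m) (Fin m) ℝ)
    (f : Fin ℓ → Euc m → ℝ → ℝ) (u : Fin ℓ → Euc m → ℝ) (x₀ : Euc m) (r : ℝ) : ℝ :=
  energy (normDomain A Ω x₀) (normMatrix A x₀) (normReaction A f x₀) (normProfile A u x₀) r

/-- `H(x₀,u,r)`. -/
def heightAt {m ℓ : ℕ} (A : Euc m → Matrix (Fin m) (Fin m) ℝ)
    (u : Fin ℓ → Euc m → ℝ) (x₀ : Euc m) (r : ℝ) : ℝ :=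
  height (normMatrix A x₀) (normProfile A u x₀) r

/-- The Almgren quotient `N(x₀,u,r) = E(x₀,u,r) / H(x₀,u,r)`. -/
def almgrenQuotient {m ℓ : ℕ} (Ω : Set (Euc m)) (A : Euc m → Matrix (Fin m) (Fin m) ℝ)
    (f : Fin ℓ → Euc m → ℝ → ℝ) (u : Fin ℓ → Euc m → ℝ) (x₀ : Euc m) (r : ℝ) : ℝ :=
  energyAt Ω A f u x₀ r / heightAt A u x₀ r

end SegregatedProfile

end

open SegregatedProfile

noncomputable section

namespace SegregatedProfile

open scoped ContDiff InnerProductSpace Convolution Manifold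

variable {m : ℕ}

/-! The argument is Almgren's, for a profile that is only continuous and of class `H^1`. Everything
rests on three integral identities, collected in `IsCritical`: the summed Dirichlet energy is
stationary under inner variations, each component satisfies the identity obtained by testing its
equation with `η u i`, and the chain rule holds for `u i ^ 2`.

Stationarity is first proved for the solutions of the system at a fixed parameter, without second
derivatives. For `η ≥ 0` the integral of `η ⟨B (G_t - G), G_t - G⟩`, with `G_t` the gradient
translated by `t e`, is nonnegative and vanishes at `t = 0`. The weak equation tested with `η (U_t -
U)` rewrites it as a function differentiable at `t = 0`; its derivative there is the inner
variation, which is therefore zero (`integral_variationDensity_of_nonneg`). After summation over the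
components the interaction forces form the derivative of a potential. An integration by parts moves
that derivative to the cutoff, and what is left is controlled by the interaction energies, which
tend to zero (`sum_integral_variation_system`, `IsSegregatedLimit.isCritical`).

The affine map `normMap` makes the operator at the centre the identity. Testing with radial cutoffs
turns the integral identities into identities on almost every sphere (`ae_sphereIntegral_eq`). For
the field `Z`, whose normal component on the sphere of radius `r` is exactly `r`, this gives the
Pohozaev identity, hence the derivative of the Dirichlet energy. Since `Z - x` is quadratic and `DZ
- I` linear in `|x|`, all the error terms are of the order of `E + H`.

The monotonicity is then a statement about two functions of `r`, isolated in `FrequencyEstimates`: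
`H' = 2 E / r + O(H)`; `E'` is at least a surface flux `b` minus `O(E + H)`; Cauchy–Schwarz on the
sphere gives `2 E ^ 2 / r ≤ b H`; and `H / 2 ≤ E + H` on small balls. The quotient rule yields `N' ≥
-C (N + 1)`, whence the monotone quantity, its limit at zero and the absolute continuity.

The same inequalities show that `H` vanishes identically or nowhere. If it vanishes, `u` is zero on
a ball of a locally uniform size, so the interior of the zero set is relatively closed in its
component and the nontriviality of `u` is contradicted (`IsSegregatedLimit.not_eventually_eq_zero`).
-/

/-! ### Mollification of Sobolev functions -/

theorem inner_gradient_eq_fderiv (φ : Euc m → ℝ) (x v : Euc m) :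
    ⟪gradient φ x, v⟫_ℝ = fderiv ℝ φ x v := by
  simp [gradient]

/-- Translations are continuous in `L²`. -/
theorem tendsto_eLpNorm_translate_sub {F : Type*} [NormedAddCommGroup F] {G : Euc m → F}
    (hG : MemLp G 2 volume) :
    Tendsto (fun y : Euc m => eLpNorm (fun x => G (y + x) - G x) 2 volume) (𝓝 0) (𝓝 0) := by
  have : Fact ((2 : ℝ≥0∞) ≠ ⊤) := ⟨by norm_num⟩
  have h1 : Tendsto (fun y : Euc m => DomAddAct.mk y +ᵥ hG.toLp G) (𝓝 0)
      (𝓝 (DomAddAct.mk (0 : Euc m) +ᵥ hG.toLp G)) := by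
    have hc : Continuous fun y : Euc m => DomAddAct.mk y +ᵥ hG.toLp G :=
      (DomAddAct.continuous_mk).vadd continuous_const
    exact hc.tendsto 0
  have h2 := (tendsto_iff_edist_tendsto_0.mp h1)
  refine h2.congr fun y => ?_
  rw [DomAddAct.mk_vadd_toLp, DomAddAct.mk_vadd_toLp, Lp.edist_toLp_toLp]
  refine eLpNorm_congr_ae (Eventually.of_forall fun x => ?_)
  simp

theorem sq_lintegral_le_lintegral_sq {α : Type*} [MeasurableSpace α] (ν : Measure α)
    [IsProbabilityMeasure ν] {g : α → ℝ≥0∞} (hg : AEMeasurable g ν) :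
    (∫⁻ y, g y ∂ν) ^ 2 ≤ ∫⁻ y, g y ^ 2 ∂ν := by
  have h := ENNReal.lintegral_mul_le_Lp_mul_Lq ν
    (Real.HolderConjugate.two_two) hg (aemeasurable_const (b := (1 : ℝ≥0∞)))
  simp only [Pi.mul_apply, mul_one, ENNReal.one_rpow, lintegral_const, measure_univ] at h
  calc (∫⁻ y, g y ∂ν) ^ 2 ≤ ((∫⁻ y, g y ^ (2 : ℝ) ∂ν) ^ (1 / 2 : ℝ)) ^ 2 := by gcongr
    _ = ∫⁻ y, g y ^ 2 ∂ν := by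
      rw [← ENNReal.rpow_natCast, ← ENNReal.rpow_mul]
      norm_num

theorem eLpNorm_two_sq {α F : Type*} [MeasurableSpace α] [NormedAddCommGroup F] (ν : Measure α)
    (g : α → F) : eLpNorm g 2 ν ^ 2 = ∫⁻ x, ‖g x‖ₑ ^ 2 ∂ν := by
  rw [eLpNorm_eq_lintegral_rpow_enorm_toReal (by norm_num) (by norm_num),
    ← ENNReal.rpow_natCast, ← ENNReal.rpow_mul]
  norm_num

/-- Jensen's inequality for the probability measure with density `ρ`, followed by Tonelli: the
squared error of the average is at most the average of the squared errors of the translates. -/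
theorem eLpNorm_average_sub_le {F : Type*} [NormedAddCommGroup F] [NormedSpace ℝ F]
    [CompleteSpace F] {G : Euc m → F}
    (hG : MemLp G 2 volume) {ρ : Euc m → ℝ} (hρ : Continuous ρ) (hs : HasCompactSupport ρ)
    (h0 : ∀ y, 0 ≤ ρ y) (h1 : ∫ y, ρ y = 1) {ε : ℝ≥0∞}
    (hε : ∀ y ∈ Function.support ρ, eLpNorm (fun x => G (y + x) - G x) 2 volume ≤ ε) :
    eLpNorm (fun x => (∫ y, ρ y • G (y + x)) - G x) 2 volume ≤ ε := by
  have hρi : Integrable ρ := hρ.integrable_of_hasCompactSupport hs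
  set ν : Measure (Euc m) := volume.withDensity fun y => ENNReal.ofReal (ρ y) with hν
  have hm : Measurable fun y => ENNReal.ofReal (ρ y) := hρ.measurable.ennreal_ofReal
  have : IsProbabilityMeasure ν := ⟨by
    rw [hν, withDensity_apply _ MeasurableSet.univ, Measure.restrict_univ,
      ← ofReal_integral_eq_lintegral_ofReal hρi (Eventually.of_forall h0), h1, ENNReal.ofReal_one]⟩
  have hloc : LocallyIntegrable G volume := hG.locallyIntegrable (by norm_num)
  have hint : ∀ x, Integrable fun y => ρ y • G (y + x) := fun x => by
    have hl : LocallyIntegrable (fun y => G (y + x)) volume :=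
      (hG.comp_measurePreserving (measurePreserving_add_right volume x)).locallyIntegrable
        (by norm_num)
    exact hl.integrable_smul_left_of_hasCompactSupport hρ hs
  have hJ : ∀ x, ‖(∫ y, ρ y • G (y + x)) - G x‖ₑ ^ 2
      ≤ ∫⁻ y, ‖G (y + x) - G x‖ₑ ^ 2 ∂ν := fun x => by
    have e1 : (∫ y, ρ y • G (y + x)) - G x = ∫ y, ρ y • (G (y + x) - G x) := by
      simp_rw [smul_sub]
      rw [integral_sub (hint x) (hρi.smul_const _), integral_smul_const, h1, one_smul]
    have e2 : ‖(∫ y, ρ y • G (y + x)) - G x‖ₑ ≤ ∫⁻ y, ‖G (y + x) - G x‖ₑ ∂ν := by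
      rw [e1, hν, lintegral_withDensity_eq_lintegral_mul₀' hm.aemeasurable]
      · refine (enorm_integral_le_lintegral_enorm _).trans (le_of_eq ?_)
        refine lintegral_congr fun y => ?_
        simp [enorm_smul, Real.enorm_of_nonneg (h0 y)]
      · refine AEMeasurable.mono_ac ?_ (withDensity_absolutelyContinuous _ _)
        exact (((hG.comp_measurePreserving (measurePreserving_add_right volume x)).1).sub
          aestronglyMeasurable_const).enorm
    refine le_trans (by gcongr) (sq_lintegral_le_lintegral_sq ν ?_)
    refine AEMeasurable.mono_ac ?_ (withDensity_absolutelyContinuous _ _)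
    exact (((hG.comp_measurePreserving (measurePreserving_add_right volume x)).1).sub
          aestronglyMeasurable_const).enorm
  have key : eLpNorm (fun x => (∫ y, ρ y • G (y + x)) - G x) 2 volume ^ 2 ≤ ε ^ 2 := by
    rw [eLpNorm_two_sq]
    calc ∫⁻ x, ‖(∫ y, ρ y • G (y + x)) - G x‖ₑ ^ 2
        ≤ ∫⁻ x, (∫⁻ y, ‖G (y + x) - G x‖ₑ ^ 2 ∂ν) := lintegral_mono hJ
      _ = ∫⁻ y, (∫⁻ x, ‖G (y + x) - G x‖ₑ ^ 2) ∂ν := by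
          refine lintegral_lintegral_swap (μ := volume) (ν := ν)
            (f := fun x y => ‖G (y + x) - G x‖ₑ ^ 2) ?_
          -- The measure `ν` is not translation invariant; measurability comes from the shear
          -- preserving Lebesgue measure together with `ν ≪ volume`.
          have hq : Measure.QuasiMeasurePreserving (fun p : Euc m × Euc m => p.2 + p.1)
              (volume.prod ν) volume := by
            refine Measure.QuasiMeasurePreserving.mono_left ?_ (Measure.AbsolutelyContinuous.rfl.prod
              (withDensity_absolutelyContinuous volume fun y => ENNReal.ofReal (ρ y)))
            exact Measure.quasiMeasurePreserving_snd.comp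
              (measurePreserving_prod_add_swap volume volume).quasiMeasurePreserving
          have a1 := hG.1.comp_quasiMeasurePreserving hq
          have a2 : AEStronglyMeasurable (fun p : Euc m × Euc m => G p.1) (volume.prod ν) :=
            hG.1.comp_fst
          exact (a1.sub a2).enorm.pow_const 2
      _ ≤ ∫⁻ y, ε ^ 2 ∂ν := by
          have hae : ∀ᵐ y ∂ν, ∫⁻ x, ‖G (y + x) - G x‖ₑ ^ 2 ≤ ε ^ 2 := by
            rw [hν, ae_withDensity_iff hm]
            refine Eventually.of_forall fun y hy => ?_
            rw [← eLpNorm_two_sq volume fun x => G (y + x) - G x]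
            gcongr
            exact hε y fun h => hy (by simp [h])
          exact lintegral_mono_ae hae
      _ = ε ^ 2 := by simp
  exact (ENNReal.pow_le_pow_left_iff (by norm_num)).mp key

/-- A continuous compactly supported function `U`, with weak gradient `G ∈ L²` on `ℝ^m`. -/
structure IsH1Pair (U : Euc m → ℝ) (G : Euc m → Euc m) : Prop where
  continuous : Continuous U
  hasCompactSupport : HasCompactSupport U
  memLp : MemLp G 2 volume
  integral_eq : ∀ φ : Euc m → ℝ, ContDiff ℝ ∞ φ → HasCompactSupport φ → ∀ e,
    ∫ x, U x * fderiv ℝ φ x e = -∫ x, φ x * ⟪G x, e⟫_ℝ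

/-- The derivative falls on the kernel, and testing the weak gradient with `t ↦ ρ (x - t)` moves it
back to `U`. Evenness of `ρ` produces the average of translates estimated in
`eLpNorm_average_sub_le`. -/
theorem IsH1Pair.gradient_convolution {U : Euc m → ℝ} {G : Euc m → Euc m} (h : IsH1Pair U G)
    {ρ : Euc m → ℝ} (hρ : ContDiff ℝ ∞ ρ) (hs : HasCompactSupport ρ) (hneg : ∀ y, ρ (-y) = ρ y)
    (x : Euc m) :
    gradient (U ⋆[ContinuousLinearMap.mul ℝ ℝ] ρ) x = ∫ y, ρ y • G (y + x) := by
  have hU : LocallyIntegrable U volume := h.continuous.locallyIntegrable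
  have hint : Integrable fun y => ρ y • G (y + x) := by
    have hl : LocallyIntegrable (fun y => G (y + x)) volume :=
      (h.memLp.comp_measurePreserving (measurePreserving_add_right volume x)).locallyIntegrable
        (by norm_num)
    exact hl.integrable_smul_left_of_hasCompactSupport hρ.continuous hs
  refine ext_inner_right ℝ fun e => ?_
  rw [inner_gradient_eq_fderiv, (hs.hasFDerivAt_convolution_right (ContinuousLinearMap.mul ℝ ℝ) hU
    (hρ.of_le (by simp)) x).fderiv, convolution_precompR_apply _ hU (hs.fderiv ℝ)
    (hρ.continuous_fderiv (by simp)), real_inner_comm, ← integral_inner hint]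
  have hφ : ContDiff ℝ ∞ fun t : Euc m => ρ (x - t) := hρ.comp (contDiff_const.sub contDiff_id)
  have hφs : HasCompactSupport fun t : Euc m => ρ (x - t) :=
    hs.comp_homeomorph (Homeomorph.subLeft x)
  have hfd : ∀ t, fderiv ℝ (fun t : Euc m => ρ (x - t)) t e = -fderiv ℝ ρ (x - t) e := fun t => by
    have := ((hρ.differentiable (by simp) (x - t)).hasFDerivAt).comp t
      ((hasFDerivAt_const x t).sub (hasFDerivAt_id t))
    have h2 := this.fderiv
    simp only [Function.comp_def] at h2
    rw [show (fun t : Euc m => ρ (x - t)) = fun t => ρ (x - id t) from rfl]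
    simp only [id] at h2 ⊢
    rw [h2]; simp
  have hw := h.integral_eq _ hφ hφs e
  simp_rw [hfd] at hw
  simp only [mul_neg, integral_neg, neg_inj] at hw
  rw [convolution_def]
  simp only [ContinuousLinearMap.mul_apply']
  rw [hw, ← integral_add_right_eq_self _ x]
  refine integral_congr_ae (Eventually.of_forall fun y => ?_)
  simp only [inner_smul_right]
  rw [show x - (y + x) = -y by abel, hneg, real_inner_comm]

/-- The mollifying bump functions. -/
def bump (n : ℕ) : ContDiffBump (0 : Euc m) where
  rIn := 1 / (2 * ((n : ℝ) + 1))
  rOut := 1 / ((n : ℝ) + 1)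
  rIn_pos := by positivity
  rIn_lt_rOut := by
    apply one_div_lt_one_div_of_lt (by positivity)
    have : (0 : ℝ) ≤ n := Nat.cast_nonneg n
    linarith

theorem tendsto_bump_rOut : Tendsto (fun n => (bump (m := m) n).rOut) atTop (𝓝 0) :=
  tendsto_one_div_add_atTop_nhds_zero_nat

/-- Convolution with shrinking even bumps. Uniform convergence of the functions lets nonlinear
expressions in `U` pass to the limit, `L²` convergence handles the gradients, and the support
statement keeps the approximations admissible as test functions. -/
theorem IsH1Pair.exists_approx {U : Euc m → ℝ} {G : Euc m → Euc m} (h : IsH1Pair U G) :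
    ∃ φ : ℕ → Euc m → ℝ, (∀ n, ContDiff ℝ ∞ (φ n)) ∧ (∀ n, HasCompactSupport (φ n)) ∧
      TendstoUniformly φ U atTop ∧
      Tendsto (fun n => eLpNorm (fun x => gradient (φ n) x - G x) 2 volume) atTop (𝓝 0) ∧
      ∀ δ > 0, ∀ᶠ n in atTop, tsupport (φ n) ⊆ cthickening δ (tsupport U) := by
  have hUu : UniformContinuous U := h.hasCompactSupport.uniformContinuous_of_continuous h.continuous
  set ρ : ℕ → Euc m → ℝ := fun n => (bump (m := m) n).normed volume with hρ
  have hsm : ∀ n, ContDiff ℝ ∞ (ρ n) := fun n => (bump n).contDiff_normed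
  have hcs : ∀ n, HasCompactSupport (ρ n) := fun n => (bump n).hasCompactSupport_normed
  have hsup : ∀ n, Function.support (ρ n) = ball 0 (bump (m := m) n).rOut := fun n =>
    (bump n).support_normed_eq
  refine ⟨fun n => U ⋆[ContinuousLinearMap.mul ℝ ℝ] ρ n, fun n => ?_, fun n => ?_, ?_, ?_, ?_⟩
  · exact (hcs n).contDiff_convolution_right _ h.continuous.locallyIntegrable (hsm n)
  · exact h.hasCompactSupport.convolution _ (hcs n)
  · rw [Metric.tendstoUniformly_iff]
    intro ε hε
    obtain ⟨δ, hδ, hd⟩ := Metric.uniformContinuous_iff.mp hUu (ε / 2) (by positivity)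
    filter_upwards [(tendsto_bump_rOut (m := m)).eventually (gt_mem_nhds hδ)] with n hn x
    have := (bump (m := m) n).dist_normed_convolution_le (μ := volume) (g := U) (x₀ := x)
      (ε := ε / 2) h.continuous.aestronglyMeasurable
      (fun y hy => (hd (lt_of_lt_of_le hy hn.le)).le)
    have e : (U ⋆[ContinuousLinearMap.mul ℝ ℝ] ρ n) x
        = (ρ n ⋆[ContinuousLinearMap.lsmul ℝ ℝ] U) x := by
      rw [← convolution_flip]
      simp only [convolution_def]
      refine integral_congr_ae (Eventually.of_forall fun y => ?_)
      simp [mul_comm]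
    rw [e, dist_comm]
    exact lt_of_le_of_lt this (by linarith)
  · have ht := tendsto_eLpNorm_translate_sub h.memLp
    rw [ENNReal.tendsto_atTop_zero]
    intro ε hε
    obtain ⟨δ, hδ, hd⟩ := Metric.eventually_nhds_iff_ball.mp
      ((ENNReal.tendsto_nhds_zero.mp ht) ε hε)
    obtain ⟨N, hN⟩ := eventually_atTop.mp ((tendsto_bump_rOut (m := m)).eventually (gt_mem_nhds hδ))
    refine ⟨N, fun n hn => ?_⟩
    simp_rw [h.gradient_convolution (hsm n) (hcs n) (fun y => (bump n).normed_neg y)]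
    refine eLpNorm_average_sub_le h.memLp (hsm n).continuous (hcs n)
      (fun y => (bump n).nonneg_normed y) (bump n).integral_normed fun y hy => hd y ?_
    rw [hsup] at hy
    exact ball_subset_ball (hN n hn).le hy
  · intro δ hδ
    filter_upwards [(tendsto_bump_rOut (m := m)).eventually (gt_mem_nhds hδ)] with n hn
    refine closure_minimal ?_ isClosed_cthickening
    refine (support_convolution_subset _).trans ?_
    rintro _ ⟨a, ha, b, hb, rfl⟩
    rw [hsup, mem_ball_zero_iff] at hb
    refine mem_cthickening_of_dist_le _ a _ _ (subset_tsupport _ ha) ?_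
    simp only [dist_self_add_left]
    exact (hb.trans hn).le

/-! ### Convergence of integrals of products -/

section L2

variable {α F F₁ F₂ : Type*} [MeasurableSpace α] {μ : Measure α}
  [NormedAddCommGroup F] [InnerProductSpace ℝ F]
  [NormedAddCommGroup F₁] [NormedSpace ℝ F₁] [NormedAddCommGroup F₂] [NormedSpace ℝ F₂]

theorem integrable_inner_of_memLp {a b : α → F} (ha : MemLp a 2 μ) (hb : MemLp b 2 μ) :
    Integrable (fun x => ⟪a x, b x⟫_ℝ) μ := by
  refine (L2.integrable_inner (𝕜 := ℝ) (ha.toLp a) (hb.toLp b)).congr ?_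
  filter_upwards [ha.coeFn_toLp, hb.coeFn_toLp] with x h1 h2
  rw [h1, h2]

/-- The integral is the inner product of the Hilbert space `L²`, which is jointly continuous. -/
theorem tendsto_integral_inner {ι : Type*} {l : Filter ι} {a b : ι → α → F} {a₀ b₀ : α → F}
    (ha : ∀ n, MemLp (a n) 2 μ) (hb : ∀ n, MemLp (b n) 2 μ) (ha₀ : MemLp a₀ 2 μ)
    (hb₀ : MemLp b₀ 2 μ) (hat : Tendsto (fun n => eLpNorm (a n - a₀) 2 μ) l (𝓝 0))
    (hbt : Tendsto (fun n => eLpNorm (b n - b₀) 2 μ) l (𝓝 0)) :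
    Tendsto (fun n => ∫ x, ⟪a n x, b n x⟫_ℝ ∂μ) l (𝓝 (∫ x, ⟪a₀ x, b₀ x⟫_ℝ ∂μ)) := by
  have h1 := (Lp.tendsto_Lp_iff_tendsto_eLpNorm'' a ha a₀ ha₀).mpr hat
  have h2 := (Lp.tendsto_Lp_iff_tendsto_eLpNorm'' b hb b₀ hb₀).mpr hbt
  have h3 := h1.inner (𝕜 := ℝ) h2
  have e : ∀ {a b : α → F} (ha : MemLp a 2 μ) (hb : MemLp b 2 μ),
      ⟪ha.toLp a, hb.toLp b⟫_ℝ = ∫ x, ⟪a x, b x⟫_ℝ ∂μ := fun ha hb => by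
    rw [L2.inner_def]
    refine integral_congr_ae ?_
    filter_upwards [ha.coeFn_toLp, hb.coeFn_toLp] with x h1 h2
    rw [h1, h2]
  simpa only [e] using h3

theorem memLp_clm_apply {B : α → F₁ →L[ℝ] F₂} {f : α → F₁} {p : ℝ≥0∞} {C : ℝ}
    (hB : AEStronglyMeasurable B μ) (hC : ∀ᵐ x ∂μ, ‖B x‖ ≤ C) (hf : MemLp f p μ) :
    MemLp (fun x => B x (f x)) p μ := by
  refine hf.of_le_mul (c := C)
    ((ContinuousLinearMap.id ℝ (F₁ →L[ℝ] F₂)).aestronglyMeasurable_comp₂ hB hf.1) ?_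
  filter_upwards [hC] with x hx
  exact ((B x).le_opNorm _).trans (by gcongr)

omit [NormedSpace ℝ F₁] [NormedSpace ℝ F₂] in
theorem tendsto_eLpNorm_of_le_mul {ι : Type*} {l : Filter ι} {f : ι → α → F₁} {g : ι → α → F₂}
    {p : ℝ≥0∞} (C : ℝ) (h : ∀ n, ∀ᵐ x ∂μ, ‖f n x‖ ≤ C * ‖g n x‖)
    (hg : Tendsto (fun n => eLpNorm (g n) p μ) l (𝓝 0)) :
    Tendsto (fun n => eLpNorm (f n) p μ) l (𝓝 0) := by
  have h2 : Tendsto (fun n => ENNReal.ofReal C * eLpNorm (g n) p μ) l (𝓝 0) := by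
    simpa using ENNReal.Tendsto.const_mul hg (Or.inr ENNReal.ofReal_ne_top)
  exact tendsto_of_tendsto_of_tendsto_of_le_of_le tendsto_const_nhds h2 (fun _ => zero_le)
    fun n => eLpNorm_le_mul_eLpNorm_of_ae_le_mul (h n) p

theorem tendsto_eLpNorm_of_tendstoUniformly {ι : Type*} {l : Filter ι} {c : ι → α → ℝ}
    {c₀ : α → ℝ} {k : α → F₁} {p : ℝ≥0∞} (hk : MemLp k p μ) (hc : TendstoUniformly c c₀ l) :
    Tendsto (fun n => eLpNorm ((fun x => c n x • k x) - fun x => c₀ x • k x) p μ) l (𝓝 0) := by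
  rw [ENNReal.tendsto_nhds_zero]
  intro ε hε
  by_cases hε' : ε = ⊤
  · simp [hε']
  have hk' : eLpNorm k p μ ≠ ⊤ := hk.2.ne
  -- The added `1` covers the case in which `k` has norm zero.
  set δ : ℝ := ε.toReal / ((eLpNorm k p μ).toReal + 1) with hδ
  have hpos : 0 < ε.toReal := ENNReal.toReal_pos hε.ne' hε'
  have hδ0 : 0 < δ := by positivity
  filter_upwards [Metric.tendstoUniformly_iff.mp hc δ hδ0] with n hn
  refine (eLpNorm_le_mul_eLpNorm_of_ae_le_mul (c := δ) (g := k)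
    (Eventually.of_forall fun x => ?_) p).trans ?_
  · have := hn x
    rw [dist_comm, Real.dist_eq] at this
    simp only [Pi.sub_apply, ← sub_smul, norm_smul, Real.norm_eq_abs]
    gcongr
  · rw [← ENNReal.ofReal_toReal hk', ← ENNReal.ofReal_mul hδ0.le]
    refine (ENNReal.ofReal_le_iff_le_toReal hε').mpr ?_
    rw [hδ, div_mul_eq_mul_div, div_le_iff₀ (by positivity)]
    nlinarith [ENNReal.toReal_nonneg (a := eLpNorm k p μ)]

theorem tendsto_integral_mul_of_tendstoUniformly {ι : Type*} {l : Filter ι} {c : ι → α → ℝ}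
    {c₀ : α → ℝ} {k : α → ℝ} (hk : Integrable k μ) (hc : TendstoUniformly c c₀ l)
    (hcm : ∀ n, AEStronglyMeasurable (c n) μ) (hc₀ : AEStronglyMeasurable c₀ μ)
    (hci : Integrable (fun x => c₀ x * k x) μ) :
    Tendsto (fun n => ∫ x, c n x * k x ∂μ) l (𝓝 (∫ x, c₀ x * k x ∂μ)) := by
  have h := tendsto_eLpNorm_of_tendstoUniformly (memLp_one_iff_integrable.mpr hk) hc
  refine tendsto_integral_of_L1' _ hci.1 ?_ h
  filter_upwards [Metric.tendstoUniformly_iff.mp hc 1 one_pos] with n hn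
  have : Integrable (fun x => (c n x - c₀ x) * k x) μ := by
    refine hk.bdd_mul (c := 1) ((hcm n).sub hc₀) (Eventually.of_forall fun x => ?_)
    have := hn x
    rw [dist_comm, Real.dist_eq] at this
    exact this.le
  refine (this.add hci).congr (Eventually.of_forall fun x => ?_)
  simp; ring

end L2

/-! ### Coefficients with compact support -/

section CompactSupport

variable {F₁ F₂ : Type*} [NormedAddCommGroup F₁] [NormedSpace ℝ F₁] [NormedAddCommGroup F₂]
  [NormedSpace ℝ F₂]

theorem memLp_clm_apply_of_hasCompactSupport {B : Euc m → F₁ →L[ℝ] F₂} {f : Euc m → F₁} {p : ℝ≥0∞}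
    (hB : Continuous B) (hs : HasCompactSupport B) (hf : MemLp f p volume) :
    MemLp (fun x => B x (f x)) p volume := by
  obtain ⟨C, hC⟩ := hs.exists_bound_of_continuous hB
  exact memLp_clm_apply hB.aestronglyMeasurable (Eventually.of_forall hC) hf

theorem memLp_smul_of_hasCompactSupport {η : Euc m → ℝ} {f : Euc m → F₁} {p : ℝ≥0∞}
    (hη : Continuous η) (hs : HasCompactSupport η) (hf : MemLp f p volume) :
    MemLp (fun x => η x • f x) p volume := by
  obtain ⟨C, hC⟩ := hs.exists_bound_of_continuous hη
  refine hf.of_le_mul (c := C) (hη.aestronglyMeasurable.smul hf.1) (Eventually.of_forall fun x => ?_)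
  rw [norm_smul]
  gcongr
  exact hC x

omit [NormedSpace ℝ F₁] in
theorem integrable_of_memLp_of_hasCompactSupport {f : Euc m → F₁} (hf : MemLp f 2 volume)
    (hs : HasCompactSupport f) : Integrable f := by
  have h1 : IntegrableOn f (tsupport f) volume := by
    have : IsFiniteMeasure (volume.restrict (tsupport f)) :=
      ⟨by simpa using hs.isCompact.measure_lt_top⟩
    exact (hf.restrict _).integrable (by norm_num)
  rwa [integrableOn_iff_integrable_of_support_subset (subset_tsupport f)] at h1

theorem hasCompactSupport_clm_apply {B : Euc m → F₁ →L[ℝ] F₂} (hs : HasCompactSupport B)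
    (f : Euc m → F₁) : HasCompactSupport fun x => B x (f x) := by
  refine hs.mono fun x hx => ?_
  contrapose! hx
  simp only [Function.mem_support, not_not] at hx ⊢
  simp [hx]

theorem integral_fderiv_eq_zero {φ : Euc m → ℝ} (hφ : ContDiff ℝ 1 φ) (hs : HasCompactSupport φ)
    (e : Euc m) : ∫ x, fderiv ℝ φ x e = 0 := by
  have hc : Continuous fun x => fderiv ℝ φ x e :=
    (hφ.continuous_fderiv one_ne_zero).clm_apply continuous_const
  have hcs : HasCompactSupport fun x => fderiv ℝ φ x e :=
    hasCompactSupport_clm_apply (hs.fderiv ℝ) _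
  have h := integral_mul_fderiv_eq_neg_fderiv_mul_of_integrable (μ := volume)
    (f := fun _ : Euc m => (1 : ℝ)) (g := φ) (v := e) (by simp)
    (by simpa using hc.integrable_of_hasCompactSupport hcs)
    (by simpa using hφ.continuous.integrable_of_hasCompactSupport hs)
    (fun x _ => by fun_prop) (fun x _ => (hφ.differentiable one_ne_zero) x)
  simpa using h

end CompactSupport

/-! ### Pairs of a function and its gradient -/

theorem continuous_gradient {φ : Euc m → ℝ} (hφ : ContDiff ℝ 1 φ) : Continuous (gradient φ) :=
  (LinearIsometryEquiv.continuous _).comp (hφ.continuous_fderiv one_ne_zero)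

theorem hasCompactSupport_gradient {φ : Euc m → ℝ} (hs : HasCompactSupport φ) :
    HasCompactSupport (gradient φ) := by
  refine (hs.fderiv ℝ).mono fun x hx => ?_
  contrapose! hx
  simp only [Function.mem_support, not_not] at hx ⊢
  simp [gradient, hx]

theorem memLp_gradient {φ : Euc m → ℝ} (hφ : ContDiff ℝ 1 φ) (hs : HasCompactSupport φ)
    (p : ℝ≥0∞) : MemLp (gradient φ) p volume :=
  (continuous_gradient hφ).memLp_of_hasCompactSupport (hasCompactSupport_gradient hs)

theorem isH1Pair_gradient {φ : Euc m → ℝ} (hφ : ContDiff ℝ 1 φ) (hs : HasCompactSupport φ) :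
    IsH1Pair φ (gradient φ) where
  continuous := hφ.continuous
  hasCompactSupport := hs
  memLp := memLp_gradient hφ hs 2
  integral_eq ψ hψ hψs e := by
    simp_rw [inner_gradient_eq_fderiv]
    have hψ1 : ContDiff ℝ 1 ψ := hψ.of_le (by simp)
    have h := integral_fderiv_eq_zero (hφ.mul hψ1) (hs.mul_right) e
    have e1 : ∀ x, fderiv ℝ (φ * ψ) x e = φ x * fderiv ℝ ψ x e + ψ x * fderiv ℝ φ x e := fun x => by
      rw [fderiv_mul (hφ.differentiable one_ne_zero x) (hψ1.differentiable one_ne_zero x)]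
      simp
    have h' : ∫ x, (φ x * fderiv ℝ ψ x e + ψ x * fderiv ℝ φ x e) = 0 := by
      rw [← h]
      exact integral_congr_ae (Eventually.of_forall fun x => (e1 x).symm)
    rw [integral_add] at h'
    · linarith
    · exact (hφ.continuous.mul ((hψ1.continuous_fderiv one_ne_zero).clm_apply
        continuous_const)).integrable_of_hasCompactSupport hs.mul_right
    · exact (hψ.continuous.mul ((hφ.continuous_fderiv one_ne_zero).clm_apply
        continuous_const)).integrable_of_hasCompactSupport hψs.mul_right

theorem IsH1Pair.translate {U : Euc m → ℝ} {G : Euc m → Euc m} (h : IsH1Pair U G) (y : Euc m) :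
    IsH1Pair (fun x => U (x + y)) (fun x => G (x + y)) where
  continuous := h.continuous.comp (continuous_add_const y)
  hasCompactSupport := h.hasCompactSupport.comp_homeomorph (Homeomorph.addRight y)
  memLp := h.memLp.comp_measurePreserving (measurePreserving_add_right volume y)
  integral_eq ψ hψ hψs e := by
    have h1 := h.integral_eq (fun x => ψ (x + -y)) (hψ.comp (contDiff_id.add contDiff_const))
      (hψs.comp_homeomorph (Homeomorph.addRight (-y))) e
    simp only [fderiv_comp_add_right] at h1
    rw [← integral_add_right_eq_self (fun x => ψ (x + -y) * ⟪G x, e⟫_ℝ) y] at h1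
    rw [← integral_add_right_eq_self _ (-y)]
    simpa only [add_neg_cancel_right, neg_add_cancel_right] using h1

theorem IsH1Pair.sub {U W : Euc m → ℝ} {G K : Euc m → Euc m} (h : IsH1Pair U G)
    (h' : IsH1Pair W K) : IsH1Pair (fun x => U x - W x) (fun x => G x - K x) where
  continuous := h.continuous.sub h'.continuous
  hasCompactSupport := h.hasCompactSupport.sub h'.hasCompactSupport
  memLp := h.memLp.sub h'.memLp
  integral_eq ψ hψ hψs e := by
    have hc : Continuous fun x => fderiv ℝ ψ x e :=
      (hψ.continuous_fderiv (by simp)).clm_apply continuous_const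
    have i1 : ∀ {U : Euc m → ℝ} {G : Euc m → Euc m}, IsH1Pair U G →
        Integrable fun x => U x * fderiv ℝ ψ x e := fun h =>
      (h.continuous.mul hc).integrable_of_hasCompactSupport h.hasCompactSupport.mul_right
    have i2 : ∀ {U : Euc m → ℝ} {G : Euc m → Euc m}, IsH1Pair U G →
        Integrable fun x => ψ x * ⟪G x, e⟫_ℝ := fun h =>
      integrable_of_memLp_of_hasCompactSupport (memLp_smul_of_hasCompactSupport hψ.continuous hψs
        (h.memLp.inner_const e)) hψs.mul_right
    simp_rw [sub_mul, inner_sub_left, mul_sub]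
    rw [integral_sub (i1 h) (i1 h'), integral_sub (i2 h) (i2 h'), h.integral_eq ψ hψ hψs e,
      h'.integral_eq ψ hψ hψs e]
    ring

/-! ### Weak equations tested with functions of class `C¹` and with Sobolev functions -/

/-- Mollify the test function; the supports of the mollified functions eventually lie in a
thickening of the compact support of `φ` that is still contained in `V`. -/
theorem weakEquation_of_contDiff_one {P : Euc m → Euc m} {g : Euc m → ℝ} (hP : MemLp P 2 volume)
    (hg : Continuous g) (hgs : HasCompactSupport g) {V : Set (Euc m)} (hV : IsOpen V)
    (hw : ∀ φ : Euc m → ℝ, ContDiff ℝ ∞ φ → HasCompactSupport φ → tsupport φ ⊆ V →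
      ∫ x, fderiv ℝ φ x (P x) = ∫ x, g x * φ x)
    {φ : Euc m → ℝ} (hφ : ContDiff ℝ 1 φ) (hs : HasCompactSupport φ) (hφV : tsupport φ ⊆ V) :
    ∫ x, fderiv ℝ φ x (P x) = ∫ x, g x * φ x := by
  obtain ⟨ψ, hψ, hψs, hψu, hψg, hψt⟩ := (isH1Pair_gradient hφ hs).exists_approx
  obtain ⟨δ, hδ, hδV⟩ := hs.isCompact.exists_cthickening_subset_open hV hφV
  have h1 : Tendsto (fun n => ∫ x, fderiv ℝ (ψ n) x (P x)) atTop
      (𝓝 (∫ x, fderiv ℝ φ x (P x))) := by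
    simp_rw [← inner_gradient_eq_fderiv]
    refine tendsto_integral_inner (fun n => memLp_gradient ((hψ n).of_le (by simp)) (hψs n) 2)
      (fun _ => hP) (memLp_gradient hφ hs 2) hP hψg ?_
    simp
  have h2 : Tendsto (fun n => ∫ x, g x * ψ n x) atTop (𝓝 (∫ x, g x * φ x)) := by
    simp_rw [mul_comm (g _)]
    refine tendsto_integral_mul_of_tendstoUniformly (hg.integrable_of_hasCompactSupport hgs) hψu
      (fun n => (hψ n).continuous.aestronglyMeasurable) hφ.continuous.aestronglyMeasurable
      ((hφ.continuous.mul hg).integrable_of_hasCompactSupport hs.mul_right)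
  refine tendsto_nhds_unique_of_eventuallyEq h1 h2 ?_
  filter_upwards [hψt δ hδ] with n hn
  exact hw _ (hψ n) (hψs n) (hn.trans hδV)

/-- The equation tested with `η W`. For smooth approximations of `W` the product rule splits the
derivative into a term with the gradient, which converges in `L²`, and a term with the function,
which converges uniformly. It is applied to differences of translates and to the solution itself. -/
theorem weakEquation_mul_h1Pair {P : Euc m → Euc m} {g : Euc m → ℝ} (hP : MemLp P 2 volume)
    (hg : Continuous g) (hgs : HasCompactSupport g) {V : Set (Euc m)} (hV : IsOpen V)
    (hw : ∀ φ : Euc m → ℝ, ContDiff ℝ ∞ φ → HasCompactSupport φ → tsupport φ ⊆ V →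
      ∫ x, fderiv ℝ φ x (P x) = ∫ x, g x * φ x)
    {W : Euc m → ℝ} {K : Euc m → Euc m} (hW : IsH1Pair W K)
    {η : Euc m → ℝ} (hη : ContDiff ℝ 1 η) (hs : HasCompactSupport η) (hηV : tsupport η ⊆ V) :
    (∫ x, ⟪K x, η x • P x⟫_ℝ) + ∫ x, W x * fderiv ℝ η x (P x) = ∫ x, W x * (g x * η x) := by
  obtain ⟨ψ, hψ, hψs, hψu, hψg, -⟩ := hW.exists_approx
  have hηP : MemLp (fun x => η x • P x) 2 volume :=
    memLp_smul_of_hasCompactSupport hη.continuous hs hP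
  have hdP : Integrable fun x => fderiv ℝ η x (P x) :=
    integrable_of_memLp_of_hasCompactSupport (memLp_clm_apply_of_hasCompactSupport
      (hη.continuous_fderiv one_ne_zero) (hs.fderiv ℝ) hP) (hasCompactSupport_clm_apply
      (hs.fderiv ℝ) _)
  have hbd : ∀ {c k : Euc m → ℝ}, Continuous c → HasCompactSupport c → Integrable k →
      Integrable fun x => c x * k x := fun {c k} hc hcs hk => by
    obtain ⟨C, hC⟩ := hcs.exists_bound_of_continuous hc
    exact hk.bdd_mul (c := C) hc.aestronglyMeasurable (Eventually.of_forall hC)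
  have h1 : Tendsto (fun n => ∫ x, ⟪gradient (ψ n) x, η x • P x⟫_ℝ) atTop
      (𝓝 (∫ x, ⟪K x, η x • P x⟫_ℝ)) :=
    tendsto_integral_inner (fun n => memLp_gradient ((hψ n).of_le (by simp)) (hψs n) 2)
      (fun _ => hηP) hW.memLp hηP hψg (by simp)
  have h2 : Tendsto (fun n => ∫ x, ψ n x * fderiv ℝ η x (P x)) atTop
      (𝓝 (∫ x, W x * fderiv ℝ η x (P x))) :=
    tendsto_integral_mul_of_tendstoUniformly hdP hψu
      (fun n => (hψ n).continuous.aestronglyMeasurable) hW.continuous.aestronglyMeasurable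
      (hbd hW.continuous hW.hasCompactSupport hdP)
  have hgη : Integrable fun x => g x * η x :=
    (hg.mul hη.continuous).integrable_of_hasCompactSupport hgs.mul_right
  have h3 : Tendsto (fun n => ∫ x, ψ n x * (g x * η x)) atTop
      (𝓝 (∫ x, W x * (g x * η x))) :=
    tendsto_integral_mul_of_tendstoUniformly hgη hψu
      (fun n => (hψ n).continuous.aestronglyMeasurable) hW.continuous.aestronglyMeasurable
      (hbd hW.continuous hW.hasCompactSupport hgη)
  refine tendsto_nhds_unique_of_eventuallyEq (h1.add h2) h3 (Eventually.of_forall fun n => ?_)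
  have hψ1 : ContDiff ℝ 1 (ψ n) := (hψ n).of_le (by simp)
  have key := weakEquation_of_contDiff_one hP hg hgs hV hw (φ := ψ n * η) (hψ1.mul hη)
    hs.mul_left ((tsupport_mul_subset_right).trans hηV)
  beta_reduce
  rw [← integral_add]
  · calc _ = ∫ x, fderiv ℝ (ψ n * η) x (P x) := by
          refine integral_congr_ae (Eventually.of_forall fun x => ?_)
          simp only [inner_smul_right, inner_gradient_eq_fderiv]
          rw [fderiv_mul (hψ1.differentiable one_ne_zero x) (hη.differentiable one_ne_zero x)]
          simp [add_comm]
      _ = _ := key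
      _ = _ := by
          refine integral_congr_ae (Eventually.of_forall fun x => ?_)
          simp only [Pi.mul_apply]; ring
  · exact integrable_inner_of_memLp (memLp_gradient hψ1 (hψs n) 2) hηP
  · exact hbd (hψ n).continuous (hψs n) hdP

/-- Since the limit is bounded, eventually all the values lie in one compact ball, on which `Ψ` is
uniformly continuous. -/
theorem tendstoUniformly_comp_of_bounded {α ι X Y : Type*} {l : Filter ι} [NormedAddCommGroup X]
    [ProperSpace X] [PseudoMetricSpace Y] {c : ι → α → X} {c₀ : α → X}
    (hc : TendstoUniformly c c₀ l) {R : ℝ} (hR : ∀ x, ‖c₀ x‖ ≤ R) {Ψ : X → Y}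
    (hΨ : Continuous Ψ) :
    TendstoUniformly (fun n x => Ψ (c n x)) (fun x => Ψ (c₀ x)) l := by
  have huc : UniformContinuousOn Ψ (closedBall 0 (R + 1)) :=
    (isCompact_closedBall 0 (R + 1)).uniformContinuousOn_of_continuous hΨ.continuousOn
  rw [Metric.tendstoUniformly_iff] at hc ⊢
  intro ε hε
  obtain ⟨δ, hδ, hd⟩ := Metric.uniformContinuousOn_iff.mp huc ε hε
  filter_upwards [hc (min δ 1) (by positivity)] with n hn x
  have h1 := hn x
  refine hd _ ?_ _ ?_ (h1.trans_le (min_le_left _ _))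
  · rw [mem_closedBall_zero_iff]; linarith [hR x]
  · rw [mem_closedBall_zero_iff]
    have h2 := h1.trans_le (min_le_right _ _)
    rw [dist_eq_norm, norm_sub_rev] at h2
    have := norm_le_norm_add_norm_sub' (c n x) (c₀ x)
    linarith [hR x]

theorem abs_integral_inner_le {α F : Type*} [MeasurableSpace α] {μ : Measure α}
    [NormedAddCommGroup F] [InnerProductSpace ℝ F] {a b : α → F} (ha : MemLp a 2 μ)
    (hb : MemLp b 2 μ) :
    |∫ x, ⟪a x, b x⟫_ℝ ∂μ| ≤ (eLpNorm a 2 μ).toReal * (eLpNorm b 2 μ).toReal := by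
  have e : ⟪ha.toLp a, hb.toLp b⟫_ℝ = ∫ x, ⟪a x, b x⟫_ℝ ∂μ := by
    rw [L2.inner_def]
    refine integral_congr_ae ?_
    filter_upwards [ha.coeFn_toLp, hb.coeFn_toLp] with x h1 h2
    rw [h1, h2]
  rw [← e, ← Lp.norm_toLp a ha, ← Lp.norm_toLp b hb]
  exact abs_real_inner_le_norm _ _

/-- Integration by parts for a function of class `C¹` of two Sobolev functions. -/
theorem integral_comp_h1Pair {U₁ U₂ : Euc m → ℝ} {G₁ G₂ : Euc m → Euc m} (h₁ : IsH1Pair U₁ G₁)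
    (h₂ : IsH1Pair U₂ G₂) {Ψ : ℝ × ℝ → ℝ} (hΨ : ContDiff ℝ 1 Ψ) {η : Euc m → ℝ}
    (hη : ContDiff ℝ 1 η) (hs : HasCompactSupport η) (e : Euc m) :
    (∫ x, Ψ (U₁ x, U₂ x) * fderiv ℝ η x e)
      + (∫ x, ⟪G₁ x, fderiv ℝ Ψ (U₁ x, U₂ x) (1, 0) • (η x • e)⟫_ℝ)
      + (∫ x, ⟪G₂ x, fderiv ℝ Ψ (U₁ x, U₂ x) (0, 1) • (η x • e)⟫_ℝ) = 0 := by
  obtain ⟨ψ₁, s₁, c₁, u₁, g₁, -⟩ := h₁.exists_approx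
  obtain ⟨ψ₂, s₂, c₂, u₂, g₂, -⟩ := h₂.exists_approx
  obtain ⟨R₁, hR₁⟩ := h₁.hasCompactSupport.exists_bound_of_continuous h₁.continuous
  obtain ⟨R₂, hR₂⟩ := h₂.hasCompactSupport.exists_bound_of_continuous h₂.continuous
  have hu : TendstoUniformly (fun n x => (ψ₁ n x, ψ₂ n x)) (fun x => (U₁ x, U₂ x)) atTop := by
    have := u₁.prodMk u₂
    rw [Metric.tendstoUniformly_iff] at u₁ u₂ ⊢
    intro ε hε
    filter_upwards [u₁ ε hε, u₂ ε hε] with n h1 h2 x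
    rw [Prod.dist_eq]
    exact max_lt (h1 x) (h2 x)
  have hb : ∀ x, ‖(U₁ x, U₂ x)‖ ≤ max R₁ R₂ := fun x => by
    rw [Prod.norm_def]
    exact max_le_max (hR₁ x) (hR₂ x)
  have hdc : ∀ q, Continuous fun p => fderiv ℝ Ψ p q := fun q =>
    (hΨ.continuous_fderiv one_ne_zero).clm_apply continuous_const
  have hUc : Continuous fun x => (U₁ x, U₂ x) := h₁.continuous.prodMk h₂.continuous
  have hψc : ∀ n, Continuous fun x => (ψ₁ n x, ψ₂ n x) := fun n =>
    (s₁ n).continuous.prodMk (s₂ n).continuous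
  have hηe : Continuous fun x => η x • e := hη.continuous.smul continuous_const
  have hηes : HasCompactSupport fun x => η x • e := hs.smul_right
  have hmem : ∀ {c : Euc m → ℝ}, Continuous c → MemLp (fun x => c x • (η x • e)) 2 volume :=
    fun hc => (hc.smul hηe).memLp_of_hasCompactSupport hηes.smul_left
  have hη1 : Continuous fun x => fderiv ℝ η x e :=
    (hη.continuous_fderiv one_ne_zero).clm_apply continuous_const
  have hη2 : HasCompactSupport fun x => fderiv ℝ η x e :=
    hasCompactSupport_clm_apply (hs.fderiv ℝ) _
  have t0 : Tendsto (fun n => ∫ x, Ψ (ψ₁ n x, ψ₂ n x) * fderiv ℝ η x e) atTop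
      (𝓝 (∫ x, Ψ (U₁ x, U₂ x) * fderiv ℝ η x e)) :=
    tendsto_integral_mul_of_tendstoUniformly (hη1.integrable_of_hasCompactSupport hη2)
      (tendstoUniformly_comp_of_bounded hu hb hΨ.continuous)
      (fun n => (hΨ.continuous.comp (hψc n)).aestronglyMeasurable)
      (hΨ.continuous.comp hUc).aestronglyMeasurable
      (((hΨ.continuous.comp hUc).mul hη1).integrable_of_hasCompactSupport hη2.mul_left)
  -- The partial derivatives of `Ψ` along the approximations converge uniformly and the gradients in
  -- `L²`; one statement serves both variables of `Ψ`.
  have tq : ∀ (q : ℝ × ℝ) {ψ : ℕ → Euc m → ℝ} {G : Euc m → Euc m}, (∀ n, ContDiff ℝ ∞ (ψ n)) →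
      (∀ n, HasCompactSupport (ψ n)) → MemLp G 2 volume →
      Tendsto (fun n => eLpNorm (fun x => gradient (ψ n) x - G x) 2 volume) atTop (𝓝 0) →
      Tendsto (fun n => ∫ x, ⟪gradient (ψ n) x, fderiv ℝ Ψ (ψ₁ n x, ψ₂ n x) q • (η x • e)⟫_ℝ) atTop
        (𝓝 (∫ x, ⟪G x, fderiv ℝ Ψ (U₁ x, U₂ x) q • (η x • e)⟫_ℝ)) := fun q ψ G s c hG hg =>
    tendsto_integral_inner (fun n => memLp_gradient ((s n).of_le (by simp)) (c n) 2)
      (fun n => hmem ((hdc q).comp (hψc n))) hG (hmem ((hdc q).comp hUc)) hg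
      (tendsto_eLpNorm_of_tendstoUniformly (hηe.memLp_of_hasCompactSupport hηes)
        (tendstoUniformly_comp_of_bounded hu hb (hdc q)))
  have t1 := tq (1, 0) s₁ c₁ h₁.memLp g₁
  have t2 := tq (0, 1) s₂ c₂ h₂.memLp g₂
  refine tendsto_nhds_unique_of_eventuallyEq ((t0.add t1).add t2) (tendsto_const_nhds (x := (0 : ℝ)))
    (Eventually.of_forall fun n => ?_)
  beta_reduce
  have s1' : ContDiff ℝ 1 (ψ₁ n) := (s₁ n).of_le (by simp)
  have s2' : ContDiff ℝ 1 (ψ₂ n) := (s₂ n).of_le (by simp)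
  have hφ : ContDiff ℝ 1 fun x => Ψ (ψ₁ n x, ψ₂ n x) := hΨ.comp (s1'.prodMk s2')
  have hz := integral_fderiv_eq_zero (hφ.mul hη) hs.mul_left e
  rw [← integral_add, ← integral_add]
  · refine Eq.trans ?_ hz
    refine integral_congr_ae (Eventually.of_forall fun x => ?_)
    have d1 := (s1'.differentiable one_ne_zero x).hasFDerivAt
    have d2 := (s2'.differentiable one_ne_zero x).hasFDerivAt
    have d := ((hΨ.differentiable one_ne_zero (ψ₁ n x, ψ₂ n x)).hasFDerivAt).comp x (d1.prodMk d2)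
    have dm := (d.mul (hη.differentiable one_ne_zero x).hasFDerivAt).fderiv
    have hlin : fderiv ℝ Ψ (ψ₁ n x, ψ₂ n x) (fderiv ℝ (ψ₁ n) x e, fderiv ℝ (ψ₂ n) x e)
        = fderiv ℝ (ψ₁ n) x e * fderiv ℝ Ψ (ψ₁ n x, ψ₂ n x) (1, 0)
          + fderiv ℝ (ψ₂ n) x e * fderiv ℝ Ψ (ψ₁ n x, ψ₂ n x) (0, 1) := by
      rw [← smul_eq_mul, ← smul_eq_mul, ← map_smul, ← map_smul, ← map_add]
      simp
    have dm' := congrArg (fun L => L e) dm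
    simp only [add_apply, smul_apply,
      ContinuousLinearMap.comp_apply, ContinuousLinearMap.prod_apply, smul_eq_mul, hlin] at dm'
    simp only [inner_smul_right, inner_gradient_eq_fderiv]
    refine Eq.trans ?_ dm'.symm
    simp only [Function.comp_apply]
    ring
  · exact (((hΨ.continuous.comp (hψc n)).mul hη1).integrable_of_hasCompactSupport
      hη2.mul_left).add
      (integrable_inner_of_memLp (memLp_gradient s1' (c₁ n) 2) (hmem ((hdc (1, 0)).comp (hψc n))))
  · exact integrable_inner_of_memLp (memLp_gradient s2' (c₂ n) 2) (hmem ((hdc _).comp (hψc n)))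
  · exact (((hΨ.continuous.comp (hψc n)).mul hη1).integrable_of_hasCompactSupport hη2.mul_left)
  · exact integrable_inner_of_memLp (memLp_gradient s1' (c₁ n) 2) (hmem ((hdc _).comp (hψc n)))

theorem hasDerivAt_add_smul (x e : Euc m) (t : ℝ) : HasDerivAt (fun t : ℝ => x + t • e) e t := by
  simpa using (((hasDerivAt_id t).smul_const e).const_add x)

/-- The derivative of `t ↦ ∫ k U(· + t e)` at `0`, for `k ∈ L²` and `U ∈ H¹`. -/
theorem hasDerivAt_integral_translate {k : Euc m → ℝ} (hk : MemLp k 2 volume) (hki : Integrable k)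
    {U : Euc m → ℝ} {G : Euc m → Euc m} (h : IsH1Pair U G) (e : Euc m) :
    HasDerivAt (fun t : ℝ => ∫ x, k x * U (x + t • e)) (∫ x, k x * ⟪G x, e⟫_ℝ) 0 := by
  obtain ⟨ψ, hψ, hψs, hψu, hψg, -⟩ := h.exists_approx
  have hψ1 : ∀ n, ContDiff ℝ 1 (ψ n) := fun n => (hψ n).of_le (by simp)
  have htr : ∀ {K : Euc m → Euc m}, MemLp K 2 volume → ∀ t : ℝ,
      MemLp (fun x => K (x + t • e)) 2 volume := fun hK t =>
    hK.comp_measurePreserving (measurePreserving_add_right volume (t • e))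
  have hbd : ∀ {c : Euc m → ℝ}, Continuous c → HasCompactSupport c → ∀ t : ℝ,
      Integrable fun x => k x * c (x + t • e) := fun {c} hc hcs t => by
    obtain ⟨C, hC⟩ := hcs.exists_bound_of_continuous hc
    exact hki.mul_bdd (c := C) (hc.comp (continuous_add_const _)).aestronglyMeasurable
      (Eventually.of_forall fun x => hC _)
  have hke : MemLp (fun x => k x • e) 2 volume :=
    hk.of_le_mul (c := ‖e‖) (hk.1.smul aestronglyMeasurable_const)
      (Eventually.of_forall fun x => by rw [norm_smul, mul_comm])
  have hke_int : ∀ {K : Euc m → Euc m}, MemLp K 2 volume → ∀ t : ℝ,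
      Integrable fun x => ⟪k x • e, K (x + t • e)⟫_ℝ := fun hK t =>
    integrable_inner_of_memLp hke (htr hK t)
  have key : HasDerivAt (fun t : ℝ => ∫ x, k x * U (x + t • e))
      (∫ x, ⟪k x • e, G (x + (0 : ℝ) • e)⟫_ℝ) 0 := by
    -- The derivatives have to converge uniformly in `t`. They do, because translations preserve the
    -- `L²` norm of `gradient (ψ n) - G`.
    refine hasDerivAt_of_tendstoUniformly (l := atTop)
      (f := fun n t => ∫ x, k x * ψ n (x + t • e))
      (f' := fun n t => ∫ x, ⟪k x • e, gradient (ψ n) (x + t • e)⟫_ℝ)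
      (g' := fun t => ∫ x, ⟪k x • e, G (x + t • e)⟫_ℝ) ?_ ?_ ?_ 0
    · have hz : Tendsto (fun n => (eLpNorm (fun x => k x • e) 2 volume).toReal *
          (eLpNorm (fun x => gradient (ψ n) x - G x) 2 volume).toReal) atTop (𝓝 0) := by
        simpa using ((ENNReal.tendsto_toReal ENNReal.zero_ne_top).comp hψg).const_mul
          (eLpNorm (fun x => k x • e) 2 volume).toReal
      rw [Metric.tendstoUniformly_iff]
      intro ε hε
      filter_upwards [hz.eventually (gt_mem_nhds hε)] with n hn t
      have hD : MemLp (fun x => gradient (ψ n) x - G x) 2 volume :=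
        (memLp_gradient (hψ1 n) (hψs n) 2).sub h.memLp
      rw [dist_comm, Real.dist_eq, ← integral_sub
        (hke_int (memLp_gradient (hψ1 n) (hψs n) 2) t) (hke_int h.memLp t)]
      simp_rw [← inner_sub_right]
      refine (abs_integral_inner_le hke (htr hD t)).trans_lt ?_
      have : eLpNorm (fun x => gradient (ψ n) (x + t • e) - G (x + t • e)) 2 volume
          = eLpNorm (fun x => gradient (ψ n) x - G x) 2 volume :=
        eLpNorm_comp_measurePreserving (g := fun x => gradient (ψ n) x - G x) hD.1
          (measurePreserving_add_right volume (t • e))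
      rw [this]
      exact hn
    · refine Eventually.of_forall fun n t => ?_
      obtain ⟨C, hC⟩ := (hasCompactSupport_gradient (hψs n)).exists_bound_of_continuous
        (continuous_gradient (hψ1 n))
      refine (hasDerivAt_integral_of_dominated_loc_of_deriv_le (μ := volume)
        (F := fun t x => k x * ψ n (x + t • e)) (bound := fun x => |k x| * (‖e‖ * C))
        (F' := fun t x => ⟪k x • e, gradient (ψ n) (x + t • e)⟫_ℝ)
        (s := univ) univ_mem (Eventually.of_forall fun t => ?_) ?_ ?_ ?_ ?_ ?_).2
      · exact (hbd (hψ n).continuous (hψs n) t).1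
      · exact hbd (hψ n).continuous (hψs n) t
      · exact (hke_int (memLp_gradient (hψ1 n) (hψs n) 2) t).1
      · refine Eventually.of_forall fun x t _ => ?_
        rw [Real.norm_eq_abs]
        refine (abs_real_inner_le_norm _ _).trans ?_
        rw [norm_smul, Real.norm_eq_abs, mul_assoc]
        have := hC (x + t • e)
        gcongr
      · exact hki.abs.mul_const _
      · refine Eventually.of_forall fun x t _ => ?_
        have d := (((hψ1 n).differentiable one_ne_zero (x + t • e)).hasFDerivAt).comp_hasDerivAt t
          (hasDerivAt_add_smul x e t)
        have d2 := d.const_mul (k x)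
        rw [inner_smul_left, real_inner_comm, inner_gradient_eq_fderiv]
        exact d2
    · intro t
      have hut : TendstoUniformly (fun n x => ψ n (x + t • e)) (fun x => U (x + t • e)) atTop :=
        hψu.comp (fun x => x + t • e)
      have := tendsto_integral_mul_of_tendstoUniformly hki hut
        (fun n => ((hψ n).continuous.comp (continuous_add_const _)).aestronglyMeasurable)
        (h.continuous.comp (continuous_add_const _)).aestronglyMeasurable
        (by simpa only [mul_comm] using hbd h.continuous h.hasCompactSupport t)
      simpa only [mul_comm (k _)] using this
  simpa [inner_smul_left, real_inner_comm e] using key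

theorem exists_bound_fderiv {X F : Type*} [NormedAddCommGroup X] [NormedSpace ℝ X]
    [NormedAddCommGroup F] [NormedSpace ℝ F] {B : X → F} (hB : ContDiff ℝ 1 B)
    (hs : HasCompactSupport B) : ∃ C, ∀ x e, ‖fderiv ℝ B x e‖ ≤ C * ‖e‖ := by
  obtain ⟨C, hC⟩ := (hs.fderiv ℝ).exists_bound_of_continuous (hB.continuous_fderiv one_ne_zero)
  exact ⟨C, fun x e => (fderiv ℝ B x).le_of_opNorm_le (hC x) e⟩

theorem hasDerivAt_quadratic_translate {B : Euc m → Euc m →L[ℝ] Euc m}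
    (hB : ContDiff ℝ 1 B) (x e ξ : Euc m) (t : ℝ) :
    HasDerivAt (fun t : ℝ => ⟪B (x + (-t) • e) ξ, ξ⟫_ℝ)
      (-⟪fderiv ℝ B (x + (-t) • e) e ξ, ξ⟫_ℝ) t := by
  have d0 : HasDerivAt (fun t : ℝ => x + (-t) • e) (-e) t := by
    simpa using (((hasDerivAt_id t).neg.smul_const e).const_add x)
  have d : HasDerivAt (fun t : ℝ => B (x + (-t) • e)) (fderiv ℝ B (x + (-t) • e) (-e)) t :=
    ((hB.differentiable one_ne_zero (x + (-t) • e)).hasFDerivAt).comp_hasDerivAt t d0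
  have d1 : HasDerivAt (fun t : ℝ => B (x + (-t) • e) ξ) (fderiv ℝ B (x + (-t) • e) (-e) ξ) t :=
    ((ContinuousLinearMap.apply ℝ (Euc m) ξ).hasFDerivAt).comp_hasDerivAt t d
  have d2 := ((innerSL ℝ ξ).hasFDerivAt).comp_hasDerivAt t d1
  have e2 : (innerSL ℝ ξ) (fderiv ℝ B (x + (-t) • e) (-e) ξ)
      = -⟪fderiv ℝ B (x + (-t) • e) e ξ, ξ⟫_ℝ := by
    rw [map_neg, innerSL_apply_apply, real_inner_comm, neg_apply, inner_neg_left]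
  rw [e2] at d2
  refine d2.congr_of_eventuallyEq (Eventually.of_forall fun s => ?_)
  simp [real_inner_comm]

/-- The derivative of `t ↦ ∫ ⟨B(· - t e) G, G⟩`, for a field `B` of class `C¹`. -/
theorem hasDerivAt_integral_quadratic_translate {B : Euc m → Euc m →L[ℝ] Euc m}
    (hB : ContDiff ℝ 1 B) (hs : HasCompactSupport B) {G : Euc m → Euc m} (hG : MemLp G 2 volume)
    (e : Euc m) :
    HasDerivAt (fun t : ℝ => ∫ x, ⟪B (x + (-t) • e) (G x), G x⟫_ℝ)
      (-∫ x, ⟪fderiv ℝ B x e (G x), G x⟫_ℝ) 0 := by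
  obtain ⟨C, hC⟩ := hs.exists_bound_of_continuous hB.continuous
  obtain ⟨C', hC'⟩ := exists_bound_fderiv hB hs
  have hdB : Continuous fun x => fderiv ℝ B x e :=
    (hB.continuous_fderiv one_ne_zero).clm_apply continuous_const
  have h1 : ∀ t : ℝ, MemLp (fun x => B (x + (-t) • e) (G x)) 2 volume := fun t =>
    memLp_clm_apply (hB.continuous.comp (continuous_add_const _)).aestronglyMeasurable
      (Eventually.of_forall fun x => hC _) hG
  have h2 : ∀ t : ℝ, MemLp (fun x => (fderiv ℝ B (x + (-t) • e) e) (G x)) 2 volume := fun t =>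
    memLp_clm_apply (C := C' * ‖e‖) (hdB.comp (continuous_add_const _)).aestronglyMeasurable
      (Eventually.of_forall fun x => hC' _ _) hG
  have hm : ∀ t : ℝ, Integrable (fun x => ⟪B (x + (-t) • e) (G x), G x⟫_ℝ) := fun t =>
    integrable_inner_of_memLp (h1 t) hG
  have hm' : ∀ t : ℝ, Integrable (fun x => -⟪fderiv ℝ B (x + (-t) • e) e (G x), G x⟫_ℝ) :=
    fun t => (integrable_inner_of_memLp (h2 t) hG).neg
  have hbound : ∀ (x : Euc m) (t : ℝ), ‖-⟪fderiv ℝ B (x + (-t) • e) e (G x), G x⟫_ℝ‖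
      ≤ C' * ‖e‖ * ‖G x‖ ^ 2 := fun x t => by
    rw [norm_neg, Real.norm_eq_abs]
    refine (abs_real_inner_le_norm _ _).trans ?_
    have a1 : ‖fderiv ℝ B (x + (-t) • e) e‖ ≤ C' * ‖e‖ := hC' _ _
    have a2 := ContinuousLinearMap.le_opNorm (fderiv ℝ B (x + (-t) • e) e) (G x)
    calc _ ≤ (C' * ‖e‖ * ‖G x‖) * ‖G x‖ := by gcongr; exact a2.trans (by gcongr)
      _ = _ := by ring
  -- The translation acts on the `C¹` field and not on `G`, so differentiation under the integral
  -- sign is dominated by a multiple of `‖G‖ ^ 2`.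
  have key : HasDerivAt (fun t : ℝ => ∫ x, ⟪B (x + (-t) • e) (G x), G x⟫_ℝ)
      (∫ x, -⟪fderiv ℝ B (x + (-(0 : ℝ)) • e) e (G x), G x⟫_ℝ) 0 :=
    (hasDerivAt_integral_of_dominated_loc_of_deriv_le (μ := volume) (x₀ := (0 : ℝ))
        (F := fun t x => ⟪B (x + (-t) • e) (G x), G x⟫_ℝ) (bound := fun x => C' * ‖e‖ * ‖G x‖ ^ 2)
        (F' := fun t x => -⟪fderiv ℝ B (x + (-t) • e) e (G x), G x⟫_ℝ)
        (s := univ) univ_mem (Eventually.of_forall fun t => (hm t).1) (hm 0) (hm' 0).1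
        (Eventually.of_forall fun x t _ => hbound x t)
        (((memLp_two_iff_integrable_sq_norm hG.1).mp hG).const_mul _)
        (Eventually.of_forall fun x t _ => hasDerivAt_quadratic_translate hB x e (G x) t)).2
  simp only [integral_neg, neg_zero, zero_smul, add_zero] at key
  exact key

/-- The cutoff equals one on an open neighbourhood of `k` and not just on `k`, so that
multiplication by it leaves derivatives on `k` unchanged. -/
theorem exists_cutoff {k Ω : Set (Euc m)} (hk : IsCompact k) (hΩ : IsOpen Ω) (hkΩ : k ⊆ Ω) :
    ∃ χ : Euc m → ℝ, ContDiff ℝ ∞ χ ∧ HasCompactSupport χ ∧ tsupport χ ⊆ Ω ∧ (∀ x, 0 ≤ χ x) ∧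
      ∃ V, IsOpen V ∧ k ⊆ V ∧ V ⊆ Ω ∧ ∀ x ∈ V, χ x = 1 := by
  obtain ⟨K, hK, hkK, hKΩ⟩ := exists_compact_between hk hΩ hkΩ
  obtain ⟨f, hf1, hf0, hf⟩ := exists_contMDiffMap_one_nhds_of_subset_interior (n := (⊤ : ℕ∞)) 𝓘(ℝ, Euc m)
    hk.isClosed hkK
  have hsupp : tsupport f ⊆ K := by
    refine closure_minimal (fun x hx => ?_) hK.isClosed
    by_contra h
    exact hx (hf0 x h)
  obtain ⟨V, hV, hkV, hV1⟩ := mem_nhdsSet_iff_exists.mp hf1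
  refine ⟨f, f.contMDiff.contDiff, hK.of_isClosed_subset (isClosed_tsupport _) hsupp,
    hsupp.trans hKΩ, fun x => (hf x).1, V ∩ Ω, hV.inter hΩ, subset_inter hkV hkΩ,
    inter_subset_right, fun x hx => hV1 hx.1⟩

/-! ### The inner variation of the Dirichlet energy -/

section InnerVariation

variable {U : Euc m → ℝ} {G : Euc m → Euc m} {B : Euc m → Euc m →L[ℝ] Euc m} {g : Euc m → ℝ}
  {V : Set (Euc m)}

theorem fderiv_smul_clm {η : Euc m → ℝ} (hη : ContDiff ℝ 1 η) (hB : ContDiff ℝ 1 B) (x e : Euc m) :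
    fderiv ℝ (fun x => η x • B x) x e = η x • fderiv ℝ B x e + fderiv ℝ η x e • B x := by
  rw [fderiv_fun_smul (hη.differentiable one_ne_zero x) (hB.differentiable one_ne_zero x)]
  simp

theorem hasCompactSupport_fderiv_clm {X F : Type*} [NormedAddCommGroup X] [NormedSpace ℝ X]
    [NormedAddCommGroup F] [NormedSpace ℝ F] {B : X → F} (hs : HasCompactSupport B) (e : X) :
    HasCompactSupport fun x => fderiv ℝ B x e := by
  refine (hs.fderiv ℝ).mono fun x hx => ?_
  contrapose! hx
  simp only [Function.mem_support, not_not] at hx ⊢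
  simp [hx]

theorem hasCompactSupport_smul {X F : Type*} [NormedAddCommGroup X]
    [NormedAddCommGroup F] [NormedSpace ℝ F] {η : X → ℝ} (hs : HasCompactSupport η) (B : X → F) :
    HasCompactSupport fun x => η x • B x := hs.smul_right

/-- The integrand of the inner variation in the direction `η e`. -/
def variationDensity (G : Euc m → Euc m) (B : Euc m → Euc m →L[ℝ] Euc m) (g η : Euc m → ℝ)
    (e x : Euc m) : ℝ :=
  η x * ⟪fderiv ℝ B x e (G x), G x⟫_ℝ + fderiv ℝ η x e * ⟪B x (G x), G x⟫_ℝ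
    + 2 * (g x * η x - fderiv ℝ η x (B x (G x))) * ⟪G x, e⟫_ℝ

/-- A weak solution is stationary even though it need not be twice differentiable. The integral of
`η ⟨B (G_t - G), G_t - G⟩`, with `G_t` a translate of `G`, is minimal at `t = 0`; after the weak
equation is used, it is visibly differentiable there, and the vanishing derivative is the claim.
Only nonnegativity of `B` is needed, but the sign of `η` is essential. -/
theorem integral_variationDensity_of_nonneg (hU : IsH1Pair U G) (hB : ContDiff ℝ 1 B)
    (hBs : HasCompactSupport B) (hsym : ∀ x ξ ζ, ⟪B x ξ, ζ⟫_ℝ = ⟪ξ, B x ζ⟫_ℝ)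
    (hpos : ∀ x ξ, 0 ≤ ⟪B x ξ, ξ⟫_ℝ) (hg : Continuous g) (hgs : HasCompactSupport g)
    (hV : IsOpen V)
    (hw : ∀ φ : Euc m → ℝ, ContDiff ℝ ∞ φ → HasCompactSupport φ → tsupport φ ⊆ V →
      ∫ x, fderiv ℝ φ x (B x (G x)) = ∫ x, g x * φ x)
    {η : Euc m → ℝ} (hη : ContDiff ℝ 1 η) (hs : HasCompactSupport η) (hηV : tsupport η ⊆ V)
    (h0 : ∀ x, 0 ≤ η x) (e : Euc m) :
    Integrable (variationDensity G B g η e) ∧ ∫ x, variationDensity G B g η e x = 0 := by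
  have hP : MemLp (fun x => B x (G x)) 2 volume :=
    memLp_clm_apply_of_hasCompactSupport hB.continuous hBs hU.memLp
  -- By the equation tested with `η (U_t - U)`, the pairing of `k` with `U_t - U` equals the
  -- integral of `η ⟨B G, G_t - G⟩`. Thus the cross term needs no derivative of `G`.
  set k : Euc m → ℝ := fun x => g x * η x - fderiv ℝ η x (B x (G x)) with hk
  have hk1 : MemLp (fun x => g x * η x) 2 volume :=
    (hg.mul hη.continuous).memLp_of_hasCompactSupport hgs.mul_right
  have hk2 : MemLp (fun x => fderiv ℝ η x (B x (G x))) 2 volume :=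
    memLp_clm_apply_of_hasCompactSupport (hη.continuous_fderiv one_ne_zero) (hs.fderiv ℝ) hP
  have hk2s : HasCompactSupport fun x => fderiv ℝ η x (B x (G x)) :=
    hasCompactSupport_clm_apply (hs.fderiv ℝ) _
  have hkL : MemLp k 2 volume := hk1.sub hk2
  have hki : Integrable k :=
    integrable_of_memLp_of_hasCompactSupport hkL ((hs.mul_left).sub hk2s)
  have hB' : ContDiff ℝ 1 fun x => η x • B x := hη.smul hB
  have hB's : HasCompactSupport fun x => η x • B x := hasCompactSupport_smul hs B
  have hdk : Continuous fun x => fderiv ℝ (fun x => η x • B x) x e :=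
    (hB'.continuous_fderiv one_ne_zero).clm_apply continuous_const
  have d1 := hasDerivAt_integral_translate hkL hki hU e
  have d2 := hasDerivAt_integral_quadratic_translate hB' hB's hU.memLp e
  have hGe : MemLp (fun x => ⟪G x, e⟫_ℝ) 2 volume := hU.memLp.inner_const e
  have i1 : Integrable fun x => k x * ⟪G x, e⟫_ℝ := hkL.integrable_mul hGe
  have i2 : Integrable fun x => ⟪fderiv ℝ (fun x => η x • B x) x e (G x), G x⟫_ℝ :=
    integrable_inner_of_memLp (memLp_clm_apply_of_hasCompactSupport hdk
      (hasCompactSupport_fderiv_clm hB's e) hU.memLp) hU.memLp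
  have hη' : ∀ {L K : Euc m → Euc m}, MemLp L 2 volume → MemLp K 2 volume →
      Integrable fun x => η x * ⟪B x (L x), K x⟫_ℝ := fun {L K} hL hK => by
    have := integrable_inner_of_memLp
      (memLp_clm_apply_of_hasCompactSupport hB'.continuous hB's hL) hK
    refine this.congr (Eventually.of_forall fun x => ?_)
    simp [inner_smul_left]
  have htr : ∀ {K : Euc m → Euc m}, MemLp K 2 volume → ∀ t : ℝ,
      MemLp (fun x => K (x + t • e)) 2 volume := fun hK t =>
    hK.comp_measurePreserving (measurePreserving_add_right volume (t • e))
  -- This is the integral of `η ⟨B (G_t - G), G_t - G⟩`, expanded: in the term quadratic in `G_t` a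
  -- change of variables puts the translation on `η B`, and the cross term is expressed through `k`.
  have hmin : ∀ t : ℝ, 0 ≤ (∫ x, ⟪(η (x + (-t) • e) • B (x + (-t) • e)) (G x), G x⟫_ℝ)
      - (∫ x, η x * ⟪B x (G x), G x⟫_ℝ)
      - 2 * ((∫ x, k x * U (x + t • e)) - ∫ x, k x * U x) := fun t => by
    have ht := (hU.translate (t • e)).sub hU
    have key := weakEquation_mul_h1Pair hP hg hgs hV hw ht hη hs hηV
    have hUt : ∀ y : Euc m, Integrable fun x => k x * U (x + y) := fun y => by
      obtain ⟨C, hC⟩ := hU.hasCompactSupport.exists_bound_of_continuous hU.continuous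
      exact hki.mul_bdd (c := C) (hU.continuous.comp (continuous_add_const _)).aestronglyMeasurable
        (Eventually.of_forall fun x => hC _)
    have hUi : Integrable fun x => k x * U x := by simpa using hUt 0
    have e1 : (∫ x, k x * U (x + t • e)) - ∫ x, k x * U x
        = ∫ x, η x * ⟪B x (G x), G (x + t • e) - G x⟫_ℝ := by
      have ib : ∀ {c : Euc m → ℝ}, Integrable c →
          Integrable fun x => (U (x + t • e) - U x) * c x := fun {c} hc => by
        obtain ⟨C, hC⟩ := ht.hasCompactSupport.exists_bound_of_continuous ht.continuous
        exact hc.bdd_mul (c := C) ht.continuous.aestronglyMeasurable (Eventually.of_forall hC)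
      have hsub : ∫ x, (U (x + t • e) - U x) * k x
          = (∫ x, (U (x + t • e) - U x) * (g x * η x))
            - ∫ x, (U (x + t • e) - U x) * fderiv ℝ η x (B x (G x)) := by
        rw [← integral_sub (ib (integrable_of_memLp_of_hasCompactSupport hk1 hgs.mul_right))
          (ib (integrable_of_memLp_of_hasCompactSupport hk2 hk2s))]
        simp only [hk, mul_sub]
      rw [← integral_sub (hUt _) hUi]
      calc ∫ x, (k x * U (x + t • e) - k x * U x) = ∫ x, (U (x + t • e) - U x) * k x :=
            integral_congr_ae (Eventually.of_forall fun x => by ring)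
        _ = ∫ x, ⟪G (x + t • e) - G x, η x • B x (G x)⟫_ℝ := by rw [hsub, ← key]; ring
        _ = _ := integral_congr_ae (Eventually.of_forall fun x => by
            simp only [inner_smul_right]; rw [real_inner_comm])
    have e2 : ∫ x, ⟪(η (x + (-t) • e) • B (x + (-t) • e)) (G x), G x⟫_ℝ
        = ∫ x, η x * ⟪B x (G (x + t • e)), G (x + t • e)⟫_ℝ := by
      rw [← integral_add_right_eq_self _ (t • e)]
      refine integral_congr_ae (Eventually.of_forall fun x => ?_)
      simp [inner_smul_left]
    rw [e1, e2, ← integral_const_mul, ← integral_sub, ← integral_sub]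
    · refine integral_nonneg fun x => ?_
      have hq := hpos x (G (x + t • e) - G x)
      have hs1 : ⟪B x (G (x + t • e)), G x⟫_ℝ = ⟪B x (G x), G (x + t • e)⟫_ℝ := by
        rw [hsym, real_inner_comm]
      simp only [map_sub, inner_sub_left, inner_sub_right] at hq ⊢
      have : 0 ≤ η x * (⟪B x (G (x + t • e)), G (x + t • e)⟫_ℝ - ⟪B x (G x), G x⟫_ℝ
          - 2 * (⟪B x (G x), G (x + t • e)⟫_ℝ - ⟪B x (G x), G x⟫_ℝ)) := by
        refine mul_nonneg (h0 x) ?_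
        linarith
      simp only [Pi.zero_apply]
      linarith
    · exact (hη' (htr hU.memLp t) (htr hU.memLp t)).sub (hη' hU.memLp hU.memLp)
    · exact (hη' hU.memLp ((htr hU.memLp t).sub hU.memLp)).const_mul 2
    · exact hη' (htr hU.memLp t) (htr hU.memLp t)
    · exact hη' hU.memLp hU.memLp
  have hloc : IsLocalMin (fun t : ℝ => (∫ x, ⟪(η (x + (-t) • e) • B (x + (-t) • e)) (G x), G x⟫_ℝ)
      - (∫ x, η x * ⟪B x (G x), G x⟫_ℝ)
      - 2 * ((∫ x, k x * U (x + t • e)) - ∫ x, k x * U x)) 0 := by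
    refine Eventually.of_forall fun t => ?_
    refine le_trans (le_of_eq ?_) (hmin t)
    simp [inner_smul_left]
  have hz := hloc.hasDerivAt_eq_zero ((d2.sub_const _).sub ((d1.sub_const _).const_mul 2))
  have hpt : ∀ x, variationDensity G B g η e x
      = ⟪fderiv ℝ (fun x => η x • B x) x e (G x), G x⟫_ℝ + 2 * (k x * ⟪G x, e⟫_ℝ) := fun x => by
    rw [fderiv_smul_clm hη hB, add_apply, smul_apply, smul_apply, inner_add_left, inner_smul_left,
      inner_smul_left]
    simp only [variationDensity, hk, conj_trivial]
    ring
  constructor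
  · exact (i2.add (i1.const_mul 2)).congr (Eventually.of_forall fun x => (hpt x).symm)
  · simp_rw [hpt]
    rw [integral_add i2 (i1.const_mul 2), integral_const_mul]
    linarith

/-- The sign of `η` is removed by polarization: with `ζ = 1` near the support of `η`, one has `4 η =
(η + ζ)² - (η - ζ)²`, both squares are admissible cutoffs, and the density is linear in the cutoff.
-/
theorem integral_variationDensity (hU : IsH1Pair U G) (hB : ContDiff ℝ 1 B)
    (hBs : HasCompactSupport B) (hsym : ∀ x ξ ζ, ⟪B x ξ, ζ⟫_ℝ = ⟪ξ, B x ζ⟫_ℝ)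
    (hpos : ∀ x ξ, 0 ≤ ⟪B x ξ, ξ⟫_ℝ) (hg : Continuous g) (hgs : HasCompactSupport g)
    (hV : IsOpen V)
    (hw : ∀ φ : Euc m → ℝ, ContDiff ℝ ∞ φ → HasCompactSupport φ → tsupport φ ⊆ V →
      ∫ x, fderiv ℝ φ x (B x (G x)) = ∫ x, g x * φ x)
    {η : Euc m → ℝ} (hη : ContDiff ℝ 1 η) (hs : HasCompactSupport η) (hηV : tsupport η ⊆ V)
    (e : Euc m) :
    ∫ x, variationDensity G B g η e x = 0 := by
  obtain ⟨ζ, hζ, hζs, hζV, -, W, -, hηW, -, hW⟩ := exists_cutoff hs.isCompact hV hηV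
  have hζ1 : ContDiff ℝ 1 ζ := hζ.of_le (by simp)
  have main : ∀ {a : Euc m → ℝ}, ContDiff ℝ 1 a → HasCompactSupport a → tsupport a ⊆ V →
      Integrable (variationDensity G B g (fun x => a x * a x) e) ∧
        ∫ x, variationDensity G B g (fun x => a x * a x) e x = 0 := fun ha has haV =>
    integral_variationDensity_of_nonneg hU hB hBs hsym hpos hg hgs hV hw (ha.mul ha)
      has.mul_right ((tsupport_mul_subset_left).trans haV) (fun x => mul_self_nonneg _) e
  have ha : tsupport (η + ζ) ⊆ V := (tsupport_add _ _).trans (union_subset hηV hζV)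
  have hb : tsupport (η - ζ) ⊆ V := (tsupport_sub _ _).trans (union_subset hηV hζV)
  have h1 := main (a := η + ζ) (hη.add hζ1) (hs.add hζs) ha
  have h2 := main (a := η - ζ) (hη.sub hζ1) (hs.sub hζs) hb
  have hfun : η = fun x => (1 / 4 : ℝ) * ((η x + ζ x) * (η x + ζ x) - (η x - ζ x) * (η x - ζ x)) := by
    funext x
    by_cases hx : x ∈ tsupport η
    · rw [hW x (hηW hx)]; ring
    · rw [image_eq_zero_of_notMem_tsupport hx]; ring
  have hpt : ∀ x, variationDensity G B g η e x
      = (1 / 4) * (variationDensity G B g (fun x => (η + ζ) x * (η + ζ) x) e x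
        - variationDensity G B g (fun x => (η - ζ) x * (η - ζ) x) e x) := fun x => by
    have da : DifferentiableAt ℝ (fun x => (η + ζ) x * (η + ζ) x) x :=
      ((hη.add hζ1).mul (hη.add hζ1)).differentiable one_ne_zero x
    have db : DifferentiableAt ℝ (fun x => (η - ζ) x * (η - ζ) x) x :=
      ((hη.sub hζ1).mul (hη.sub hζ1)).differentiable one_ne_zero x
    have hfd : fderiv ℝ η x = (1 / 4 : ℝ) • (fderiv ℝ (fun x => (η + ζ) x * (η + ζ) x) x
        - fderiv ℝ (fun x => (η - ζ) x * (η - ζ) x) x) := by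
      conv_lhs => rw [hfun]
      exact ((da.hasFDerivAt.sub db.hasFDerivAt).const_mul (1 / 4 : ℝ)).fderiv
    have hx := congrFun hfun x
    simp only [variationDensity, hfd, smul_apply, sub_apply, smul_eq_mul]
    simp only [Pi.add_apply, Pi.sub_apply]
    linear_combination (⟪fderiv ℝ B x e (G x), G x⟫_ℝ + 2 * g x * ⟪G x, e⟫_ℝ) * hx
  simp_rw [hpt]
  rw [integral_const_mul, integral_sub h1.1 h2.1, h1.2, h2.2]
  simp

end InnerVariation

/-! ### Weak gradients on open sets -/

section WeakGradient

variable {F : Type*} [NormedAddCommGroup F] [NormedSpace ℝ F]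

theorem integrable_smul_of_locallyIntegrableOn {U : Set (Euc m)} {φ : Euc m → ℝ}
    (hφ : Continuous φ) (hs : HasCompactSupport φ) (hU : tsupport φ ⊆ U) {G : Euc m → F}
    (hG : LocallyIntegrableOn G U) : Integrable fun x => φ x • G x := by
  obtain ⟨C, hC⟩ := hs.exists_bound_of_continuous hφ
  have h1 : IntegrableOn G (tsupport φ) := hG.integrableOn_compact_subset hU hs.isCompact
  have h2 : IntegrableOn (fun x => φ x • G x) (tsupport φ) :=
    h1.bdd_smul C hφ.aestronglyMeasurable (Eventually.of_forall hC)
  rwa [integrableOn_iff_integrable_of_support_subset] at h2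
  intro x hx
  by_contra h
  exact hx (by simp [image_eq_zero_of_notMem_tsupport h])

theorem setIntegral_eq_of_tsupport_subset {U : Set (Euc m)} {φ : Euc m → ℝ} (hU : tsupport φ ⊆ U)
    {f : Euc m → F} (hf : ∀ x ∉ tsupport φ, f x = 0) : ∫ x in U, f x = ∫ x, f x :=
  setIntegral_eq_integral_of_forall_compl_eq_zero fun x hx => hf x fun h => hx (hU h)

/-- The fundamental lemma of the calculus of variations. It makes the choice in `weakGrad` harmless:
the chosen gradient agrees almost everywhere with any other. -/
theorem IsWeakGradient.ae_eq {U : Set (Euc m)} (hU : IsOpen U) {w : Euc m → ℝ}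
    {G K : Euc m → Euc m} (h : IsWeakGradient U w G) (h' : IsWeakGradient U w K) :
    G =ᵐ[volume.restrict U] K := by
  have key := hU.ae_eq_zero_of_integral_contDiff_smul_eq_zero (μ := volume) (h.2.1.sub h'.2.1)
    fun φ hφ hs hφU => by
      have e1 := h.2.2 φ ⟨hφ, hs, hφU⟩
      rw [h'.2.2 φ ⟨hφ, hs, hφU⟩, neg_inj] at e1
      rw [setIntegral_eq_of_tsupport_subset hφU (fun x hx => by
        simp [image_eq_zero_of_notMem_tsupport hx]), setIntegral_eq_of_tsupport_subset hφU
        (fun x hx => by simp [image_eq_zero_of_notMem_tsupport hx])] at e1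
      simp only [Pi.sub_apply, smul_sub]
      rw [integral_sub (integrable_smul_of_locallyIntegrableOn hφ.continuous hs hφU h.2.1)
        (integrable_smul_of_locallyIntegrableOn hφ.continuous hs hφU h'.2.1), e1, sub_self]
  rw [EventuallyEq, ae_restrict_iff' hU.measurableSet]
  filter_upwards [key] with x hx hxU
  exact sub_eq_zero.mp (hx hxU)

theorem MemH1.isWeakGradient {U : Set (Euc m)} {w : Euc m → ℝ} (h : MemH1 U w) :
    IsWeakGradient U w (weakGrad U w) := by
  have hex : ∃ G, IsWeakGradient U w G := ⟨_, h.2.choose_spec.1⟩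
  rw [weakGrad, dif_pos hex]
  exact hex.choose_spec

theorem MemH1.memLp_weakGrad {U : Set (Euc m)} (hU : IsOpen U) {w : Euc m → ℝ} (h : MemH1 U w) :
    MemLp (weakGrad U w) 2 (volume.restrict U) := by
  obtain ⟨G, hG, hG2⟩ := h.2
  exact hG2.ae_eq (hG.ae_eq hU h.isWeakGradient)

end WeakGradient

/-! ### Localization -/

theorem continuous_smul_of_continuousOn {F : Type*} [NormedAddCommGroup F] [NormedSpace ℝ F]
    {Ω : Set (Euc m)} (hΩ : IsOpen Ω) {χ : Euc m → ℝ} (hχ : Continuous χ) (hχΩ : tsupport χ ⊆ Ω)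
    {f : Euc m → F} (hf : ContinuousOn f Ω) : Continuous fun x => χ x • f x := by
  refine continuous_of_tsupport fun x hx => ?_
  have hx' : x ∈ Ω := hχΩ (closure_mono (Function.support_smul_subset_left χ f) hx)
  exact hχ.continuousAt.smul (hf.continuousAt (hΩ.mem_nhds hx'))

theorem contDiff_smul_of_contDiffOn {F : Type*} [NormedAddCommGroup F] [NormedSpace ℝ F]
    {Ω : Set (Euc m)} (hΩ : IsOpen Ω) {χ : Euc m → ℝ} (hχ : ContDiff ℝ 1 χ) (hχΩ : tsupport χ ⊆ Ω)
    {f : Euc m → F} (hf : ContDiffOn ℝ 1 f Ω) : ContDiff ℝ 1 fun x => χ x • f x := by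
  refine contDiff_iff_contDiffAt.mpr fun x => ?_
  by_cases hx : x ∈ tsupport χ
  · exact hχ.contDiffAt.smul (hf.contDiffAt (hΩ.mem_nhds (hχΩ hx)))
  · have h0 : (fun x => χ x • f x) =ᶠ[𝓝 x] fun _ => 0 := by
      filter_upwards [notMem_tsupport_iff_eventuallyEq.mp hx] with y hy
      rw [hy, Pi.zero_apply, zero_smul]
    exact contDiffAt_const.congr_of_eventuallyEq h0

theorem hasCompactSupport_smul_right {X F : Type*} [TopologicalSpace X] [NormedAddCommGroup F]
    [NormedSpace ℝ F] {f : X → F} (hf : HasCompactSupport f) (w : X → ℝ) :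
    HasCompactSupport fun x => w x • f x :=
  hf.mono' (closure_mono (Function.support_smul_subset_right w f) |>.trans' subset_closure)

theorem gradient_eq_zero_of_notMem_tsupport {χ : Euc m → ℝ} {x : Euc m} (hx : x ∉ tsupport χ) :
    gradient χ x = 0 := by
  have : fderiv ℝ χ x = 0 := by
    by_contra h
    exact hx (support_fderiv_subset ℝ h)
  simp [gradient, this]

/-- The Leibniz rule, read off from the weak gradient of `w` tested with `χ φ`. It reduces local
statements on `Ω` to the global pairs treated above. -/
theorem IsWeakGradient.isH1Pair_cutoff {Ω : Set (Euc m)} (hΩ : IsOpen Ω) {w : Euc m → ℝ}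
    {G : Euc m → Euc m} (hw : ContinuousOn w Ω) (h : IsWeakGradient Ω w G)
    (hG : MemLp G 2 (volume.restrict Ω)) {χ : Euc m → ℝ} (hχ : ContDiff ℝ ∞ χ)
    (hs : HasCompactSupport χ) (hχΩ : tsupport χ ⊆ Ω) :
    IsH1Pair (fun x => χ x * w x) (fun x => χ x • G x + w x • gradient χ x) := by
  have hχ1 : ContDiff ℝ 1 χ := hχ.of_le (by simp)
  have hgs : tsupport (gradient χ) ⊆ tsupport χ :=
    closure_minimal (fun x hx => by
      by_contra h
      exact hx (gradient_eq_zero_of_notMem_tsupport h)) (isClosed_tsupport _)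
  have hwg : Continuous fun x => w x • gradient χ x := by
    refine continuous_of_tsupport fun x hx => ?_
    have hx' : x ∈ Ω :=
      hχΩ (hgs (closure_mono (Function.support_smul_subset_right w (gradient χ)) hx))
    exact (hw.continuousAt (hΩ.mem_nhds hx')).smul (continuous_gradient hχ1).continuousAt
  refine ⟨continuous_smul_of_continuousOn hΩ hχ.continuous hχΩ hw, hs.mul_right, ?_, ?_⟩
  · refine MemLp.add ?_ (hwg.memLp_of_hasCompactSupport (hasCompactSupport_smul_right (hasCompactSupport_gradient hs) w))
    obtain ⟨C, hC⟩ := hs.exists_bound_of_continuous hχ.continuous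
    have h1 : MemLp (fun x => χ x • G x) 2 (volume.restrict Ω) :=
      hG.of_le_mul (c := C) (hχ.continuous.aestronglyMeasurable.smul hG.1)
        (Eventually.of_forall fun x => by rw [norm_smul]; gcongr; exact hC x)
    rw [← memLp_indicator_iff_restrict hΩ.measurableSet] at h1
    refine (memLp_congr_ae (Eventually.of_forall fun x => ?_)).mp h1
    by_cases hx : x ∈ Ω
    · simp [hx]
    · simp [hx, image_eq_zero_of_notMem_tsupport fun h => hx (hχΩ h)]
  · intro φ hφ hφs e
    have hφ1 : ContDiff ℝ 1 φ := hφ.of_le (by simp)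
    have ht : IsTestFunction Ω (fun x => χ x * φ x) :=
      ⟨hχ.mul hφ, hs.mul_right, (tsupport_mul_subset_left).trans hχΩ⟩
    have key := h.2.2 _ ht
    have hz : ∀ x ∉ tsupport χ, gradient (fun x => χ x * φ x) x = 0 := fun x hx =>
      gradient_eq_zero_of_notMem_tsupport fun h => hx (tsupport_mul_subset_left h)
    rw [setIntegral_eq_of_tsupport_subset hχΩ (fun x hx => by rw [hz x hx, smul_zero]),
      setIntegral_eq_of_tsupport_subset hχΩ (fun x hx => by
        simp [image_eq_zero_of_notMem_tsupport hx])] at key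
    have ig : Integrable fun x => w x • gradient (fun x => χ x * φ x) x := by
      have hc : Continuous fun x => w x • gradient (fun x => χ x * φ x) x := by
        refine continuous_of_tsupport fun x hx => ?_
        have hx' : x ∈ Ω := hχΩ (closure_minimal (fun y hy => by
          by_contra h
          exact hy (by simp [hz y h])) (isClosed_tsupport χ) hx)
        exact (hw.continuousAt (hΩ.mem_nhds hx')).smul
          (continuous_gradient (hχ1.mul hφ1)).continuousAt
      exact hc.integrable_of_hasCompactSupport
        (hasCompactSupport_smul_right (hasCompactSupport_gradient hs.mul_right) w)
    have iG : Integrable fun x => (χ x * φ x) • G x :=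
      integrable_smul_of_locallyIntegrableOn (hχ.mul hφ).continuous ht.2.1 ht.2.2 h.2.1
    have iw : Integrable fun x => φ x * ⟪w x • gradient χ x, e⟫_ℝ :=
      (hφ.continuous.mul (hwg.inner continuous_const)).integrable_of_hasCompactSupport hφs.mul_right
    have key2 := congrArg (fun v => ⟪v, e⟫_ℝ) key
    simp only [inner_neg_left] at key2
    rw [real_inner_comm, ← integral_inner ig, real_inner_comm, ← integral_inner iG] at key2
    have e1 : ∀ x, ⟪e, w x • gradient (fun x => χ x * φ x) x⟫_ℝ
        = χ x * w x * fderiv ℝ φ x e + φ x * ⟪w x • gradient χ x, e⟫_ℝ := fun x => by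
      rw [real_inner_comm, inner_smul_left, inner_smul_left, inner_gradient_eq_fderiv,
        inner_gradient_eq_fderiv, fderiv_fun_mul (hχ1.differentiable one_ne_zero x)
        (hφ1.differentiable one_ne_zero x)]
      simp; ring
    simp_rw [e1] at key2
    have iwφ : Integrable fun x => χ x * w x * fderiv ℝ φ x e :=
      ((continuous_smul_of_continuousOn hΩ hχ.continuous hχΩ hw).mul
        ((hφ1.continuous_fderiv one_ne_zero).clm_apply
          continuous_const)).integrable_of_hasCompactSupport (hs.mul_right).mul_right
    rw [integral_add iwφ iw] at key2
    have e2 : ∀ x, φ x * ⟪χ x • G x + w x • gradient χ x, e⟫_ℝ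
        = ⟪e, (χ x * φ x) • G x⟫_ℝ + φ x * ⟪w x • gradient χ x, e⟫_ℝ := fun x => by
      rw [inner_add_left, inner_smul_right, inner_smul_left, real_inner_comm]
      simp; ring
    simp_rw [e2]
    rw [integral_add (iG.const_inner e) iw]
    linarith

/-! ### The coefficient matrix as a field of operators -/

/-- The field of operators `x ↦ (ξ ↦ A(x) ξ)`. -/
def opField (A : Euc m → Matrix (Fin m) (Fin m) ℝ) (x : Euc m) : Euc m →L[ℝ] Euc m :=
  LinearMap.toContinuousLinearMap (Matrix.toEuclideanLin (A x))

theorem opField_apply (A : Euc m → Matrix (Fin m) (Fin m) ℝ) (x ξ : Euc m) :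
    opField A x ξ = matAct (A x) ξ := rfl

theorem matForm_eq (A : Euc m → Matrix (Fin m) (Fin m) ℝ) (x ξ ζ : Euc m) :
    matForm (A x) ξ ζ = ⟪opField A x ξ, ζ⟫_ℝ := rfl

theorem opField_apply_apply (A : Euc m → Matrix (Fin m) (Fin m) ℝ) (x ξ : Euc m) (h : Fin m) :
    opField A x ξ h = ∑ l, A x h l * ξ l := by
  simp [opField_apply, matAct, Matrix.toEuclideanLin, Matrix.toLpLin_apply, Matrix.mulVec,
    dotProduct]

/-- The operator of the elementary matrix with entry `1` at `(i, j)`. -/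
def elemOp (i j : Fin m) : Euc m →L[ℝ] Euc m :=
  (EuclideanSpace.proj j : Euc m →L[ℝ] ℝ).smulRight (stdVec i)

/-- With constant operators as a basis, regularity and derivative bounds of the field reduce to
those of the matrix entries. -/
theorem opField_eq_sum (A : Euc m → Matrix (Fin m) (Fin m) ℝ) (x : Euc m) :
    opField A x = ∑ i, ∑ j, A x i j • elemOp i j := by
  ext ξ h
  rw [opField_apply_apply]
  simp only [elemOp, sum_apply, smul_apply,
    ContinuousLinearMap.smulRight_apply, PiLp.proj_apply, PiLp.smul_apply, smul_eq_mul,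
    WithLp.ofLp_sum, Finset.sum_apply, stdVec, PiLp.single_apply, mul_ite, mul_one,
    mul_zero]
  rw [Finset.sum_comm]
  simp

theorem IsEllipticC1.contDiffOn_opField {U : Set (Euc m)} {θ : ℝ}
    {A : Euc m → Matrix (Fin m) (Fin m) ℝ} (hA : IsEllipticC1 U θ A) :
    ContDiffOn ℝ 1 (opField A) U := by
  have : opField A = fun x => ∑ i, ∑ j, A x i j • elemOp i j := funext (opField_eq_sum A)
  rw [this]
  exact ContDiffOn.sum fun i _ => ContDiffOn.sum fun j _ => (hA.1 i j).smul contDiffOn_const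

theorem opField_symm {A : Euc m → Matrix (Fin m) (Fin m) ℝ} {x : Euc m} (h : (A x).IsSymm)
    (ξ ζ : Euc m) : ⟪opField A x ξ, ζ⟫_ℝ = ⟪ξ, opField A x ζ⟫_ℝ := by
  simp only [PiLp.inner_apply, opField_apply_apply, RCLike.inner_apply, conj_trivial,
    Finset.mul_sum, Finset.sum_mul]
  rw [Finset.sum_comm]
  refine Finset.sum_congr rfl fun i _ => Finset.sum_congr rfl fun j _ => ?_
  rw [← h.apply i j]; ring

/-! ### Local identities for weak solutions -/

section Local

variable {Ω : Set (Euc m)}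

theorem fderiv_eq_zero_of_notMem_tsupport {η : Euc m → ℝ} {x : Euc m} (hx : x ∉ tsupport η) :
    fderiv ℝ η x = 0 := by
  by_contra h
  exact hx (support_fderiv_subset ℝ h)

theorem MemH1.exists_h1Pair (hΩ : IsOpen Ω) {w : Euc m → ℝ} (h : MemH1 Ω w)
    (hw : ContinuousOn w Ω) {k : Set (Euc m)} (hk : IsCompact k) (hkΩ : k ⊆ Ω) :
    ∃ U K, IsH1Pair U K ∧ ∃ V, IsOpen V ∧ k ⊆ V ∧ V ⊆ Ω ∧
      ∀ x ∈ V, U x = w x ∧ K x = weakGrad Ω w x := by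
  obtain ⟨χ, hχ, hs, hχΩ, -, V, hV, hkV, hVΩ, h1⟩ := exists_cutoff hk hΩ hkΩ
  refine ⟨_, _, h.isWeakGradient.isH1Pair_cutoff hΩ hw (h.memLp_weakGrad hΩ) hχ hs hχΩ,
    V, hV, hkV, hVΩ, fun x hx => ?_⟩
  have hg : gradient χ x = 0 := by
    have : χ =ᶠ[𝓝 x] fun _ => 1 := by
      filter_upwards [hV.mem_nhds hx] with y hy using h1 y hy
    simp [gradient, this.fderiv_eq]
  simp [h1 x hx, hg]

theorem integral_comp_weakGrad (hΩ : IsOpen Ω) {w₁ w₂ : Euc m → ℝ} (h₁ : MemH1 Ω w₁)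
    (h₂ : MemH1 Ω w₂) (c₁ : ContinuousOn w₁ Ω) (c₂ : ContinuousOn w₂ Ω) {Ψ : ℝ × ℝ → ℝ}
    (hΨ : ContDiff ℝ 1 Ψ) {η : Euc m → ℝ} (hη : ContDiff ℝ 1 η) (hs : HasCompactSupport η)
    (hηΩ : tsupport η ⊆ Ω) (e : Euc m) :
    (∫ x, Ψ (w₁ x, w₂ x) * fderiv ℝ η x e)
      + (∫ x, (η x * fderiv ℝ Ψ (w₁ x, w₂ x) (1, 0)) * ⟪weakGrad Ω w₁ x, e⟫_ℝ)
      + (∫ x, (η x * fderiv ℝ Ψ (w₁ x, w₂ x) (0, 1)) * ⟪weakGrad Ω w₂ x, e⟫_ℝ) = 0 := by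
  obtain ⟨U₁, K₁, p₁, V₁, -, k₁, -, e₁⟩ := h₁.exists_h1Pair hΩ c₁ hs.isCompact hηΩ
  obtain ⟨U₂, K₂, p₂, V₂, -, k₂, -, e₂⟩ := h₂.exists_h1Pair hΩ c₂ hs.isCompact hηΩ
  refine Eq.trans ?_ (integral_comp_h1Pair p₁ p₂ hΨ hη hs e)
  congr 1
  · congr 1
    · refine integral_congr_ae (Eventually.of_forall fun x => ?_)
      by_cases hx : x ∈ tsupport η
      · simp [(e₁ x (k₁ hx)).1, (e₂ x (k₂ hx)).1]
      · simp [fderiv_eq_zero_of_notMem_tsupport hx]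
    · refine integral_congr_ae (Eventually.of_forall fun x => ?_)
      by_cases hx : x ∈ tsupport η
      · simp only [(e₁ x (k₁ hx)).1, (e₂ x (k₂ hx)).1, (e₁ x (k₁ hx)).2, inner_smul_right]; ring
      · simp [image_eq_zero_of_notMem_tsupport hx]
  · refine integral_congr_ae (Eventually.of_forall fun x => ?_)
    by_cases hx : x ∈ tsupport η
    · simp only [(e₁ x (k₁ hx)).1, (e₂ x (k₂ hx)).1, (e₂ x (k₂ hx)).2, inner_smul_right]; ring
    · simp [image_eq_zero_of_notMem_tsupport hx]

theorem integral_sq_weakGrad (hΩ : IsOpen Ω) {w : Euc m → ℝ} (h : MemH1 Ω w)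
    (c : ContinuousOn w Ω) {η : Euc m → ℝ} (hη : ContDiff ℝ 1 η) (hs : HasCompactSupport η)
    (hηΩ : tsupport η ⊆ Ω) (e : Euc m) :
    (∫ x, w x ^ 2 * fderiv ℝ η x e) + (∫ x, (η x * (2 * w x)) * ⟪weakGrad Ω w x, e⟫_ℝ) = 0 := by
  have hd : ∀ p : ℝ × ℝ, HasFDerivAt (fun p : ℝ × ℝ => p.1 ^ 2)
      ((2 * p.1) • ContinuousLinearMap.fst ℝ ℝ ℝ) p := fun p => by
    have := (hasFDerivAt_fst (𝕜 := ℝ) (p := p)).pow 2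
    simpa using this
  have := integral_comp_weakGrad hΩ h h c c (Ψ := fun p => p.1 ^ 2) (by fun_prop) hη hs hηΩ e
  simpa [(hd _).fderiv] using this

/-- The chain rule for `w₁ ^ (γ + 1) * w₂ ^ (γ + 1)`, where `γ > 0` makes the power function of
class `C¹` on the whole line. It exhibits the interaction forces as the derivative of a potential.
-/
theorem integral_rpow_weakGrad (hΩ : IsOpen Ω) {w₁ w₂ : Euc m → ℝ} (h₁ : MemH1 Ω w₁)
    (h₂ : MemH1 Ω w₂) (c₁ : ContinuousOn w₁ Ω) (c₂ : ContinuousOn w₂ Ω) {γ : ℝ} (hγ : 0 < γ)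
    {η : Euc m → ℝ} (hη : ContDiff ℝ 1 η) (hs : HasCompactSupport η)
    (hηΩ : tsupport η ⊆ Ω) (e : Euc m) :
    (∫ x, w₁ x ^ (γ + 1) * w₂ x ^ (γ + 1) * fderiv ℝ η x e)
      + (γ + 1) * (∫ x, (η x * (w₂ x ^ (γ + 1) * w₁ x ^ γ)) * ⟪weakGrad Ω w₁ x, e⟫_ℝ)
      + (γ + 1) * (∫ x, (η x * (w₁ x ^ (γ + 1) * w₂ x ^ γ)) * ⟪weakGrad Ω w₂ x, e⟫_ℝ) = 0 := by
  have h1 : (1 : ℝ) ≤ γ + 1 := by linarith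
  have hr : ContDiff ℝ 1 fun s : ℝ => s ^ (γ + 1) := Real.contDiff_rpow_const_of_le (by simpa using hγ.le)
  have hd : ∀ s : ℝ, HasDerivAt (fun s : ℝ => s ^ (γ + 1)) ((γ + 1) * s ^ γ) s := fun s => by
    simpa using Real.hasDerivAt_rpow_const (x := s) (Or.inr h1)
  have hfd : ∀ p : ℝ × ℝ, HasFDerivAt (fun p : ℝ × ℝ => p.1 ^ (γ + 1) * p.2 ^ (γ + 1))
      (p.1 ^ (γ + 1) • (((γ + 1) * p.2 ^ γ) • ContinuousLinearMap.snd ℝ ℝ ℝ)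
        + p.2 ^ (γ + 1) • (((γ + 1) * p.1 ^ γ) • ContinuousLinearMap.fst ℝ ℝ ℝ)) p := fun p =>
    ((hd p.1).comp_hasFDerivAt p hasFDerivAt_fst).mul
      ((hd p.2).comp_hasFDerivAt p hasFDerivAt_snd)
  have := integral_comp_weakGrad hΩ h₁ h₂ c₁ c₂ (Ψ := fun p => p.1 ^ (γ + 1) * p.2 ^ (γ + 1))
    ((hr.comp contDiff_fst).mul (hr.comp contDiff_snd)) hη hs hηΩ e
  simp only [(hfd _).fderiv] at this
  refine Eq.trans ?_ this
  rw [← integral_const_mul, ← integral_const_mul]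
  congr 1
  · congr 1
    refine integral_congr_ae (Eventually.of_forall fun x => ?_)
    simp; ring
  · refine integral_congr_ae (Eventually.of_forall fun x => ?_)
    simp; ring

/-- Multiplication by a nonnegative cutoff keeps symmetry and nonnegativity and loses uniform
ellipticity, which the inner variation argument does not use. -/
theorem exists_localized_coefficients (hΩ : IsOpen Ω) {θ : ℝ} (hθ : 0 < θ)
    {A : Euc m → Matrix (Fin m) (Fin m) ℝ} (hA : IsEllipticC1 Ω θ A) {g : Euc m → ℝ}
    (hg : ContinuousOn g Ω) {k : Set (Euc m)} (hk : IsCompact k) (hkΩ : k ⊆ Ω) :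
    ∃ (B : Euc m → Euc m →L[ℝ] Euc m) (b : Euc m → ℝ), ContDiff ℝ 1 B ∧ HasCompactSupport B ∧
      (∀ x ξ ζ, ⟪B x ξ, ζ⟫_ℝ = ⟪ξ, B x ζ⟫_ℝ) ∧ (∀ x ξ, 0 ≤ ⟪B x ξ, ξ⟫_ℝ) ∧ Continuous b ∧
      HasCompactSupport b ∧ ∃ V, IsOpen V ∧ k ⊆ V ∧ V ⊆ Ω ∧
      ∀ x ∈ V, B x = opField A x ∧ b x = g x := by
  obtain ⟨χ, hχ, hs, hχΩ, hχ0, V, hV, hkV, hVΩ, h1⟩ := exists_cutoff hk hΩ hkΩ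
  have hχ1 : ContDiff ℝ 1 χ := hχ.of_le (by simp)
  have hB := contDiff_smul_of_contDiffOn hΩ hχ1 hχΩ hA.contDiffOn_opField
  have hBs := hasCompactSupport_smul hs (opField A)
  refine ⟨fun x => χ x • opField A x, fun x => χ x • g x, hB, hBs, fun x ξ ζ => ?_,
    fun x ξ => ?_, continuous_smul_of_continuousOn hΩ hχ.continuous hχΩ hg,
    hasCompactSupport_smul hs _, V, hV, hkV, hVΩ, fun x hx => by simp [h1 x hx]⟩
  · rw [smul_apply, smul_apply, inner_smul_left, inner_smul_right]
    by_cases hx : x ∈ tsupport χ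
    · rw [opField_symm (hA.2.1 x (hχΩ hx))]; simp
    · simp [image_eq_zero_of_notMem_tsupport hx]
  · rw [smul_apply, inner_smul_left]
    by_cases hx : x ∈ tsupport χ
    · have := hA.2.2 x (hχΩ hx) ξ
      rw [matForm_eq] at this
      exact mul_nonneg (hχ0 x) ((by positivity : (0 : ℝ) ≤ θ * ‖ξ‖ ^ 2).trans this)
    · simp [image_eq_zero_of_notMem_tsupport hx]

/-- Near the support of `η` the solution and the coefficients coincide with compactly supported
ones, to which `integral_variationDensity` applies; the second identity is the equation tested with
`η w`. -/
theorem IsWeakSolution.integral_variationDensity_eq_zero (hΩ : IsOpen Ω) {θ : ℝ} (hθ : 0 < θ)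
    {A : Euc m → Matrix (Fin m) (Fin m) ℝ} (hA : IsEllipticC1 Ω θ A) {w g : Euc m → ℝ}
    (h : IsWeakSolution Ω A w g) (hw : ContinuousOn w Ω) (hg : ContinuousOn g Ω)
    {η : Euc m → ℝ} (hη : ContDiff ℝ 1 η) (hs : HasCompactSupport η) (hηΩ : tsupport η ⊆ Ω) :
    (∀ e, ∫ x, variationDensity (weakGrad Ω w) (opField A) g η e x = 0) ∧
      (∫ x, η x * ⟪opField A x (weakGrad Ω w x), weakGrad Ω w x⟫_ℝ)
        + (∫ x, w x * fderiv ℝ η x (opField A x (weakGrad Ω w x)))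
        = ∫ x, η x * (g x * w x) := by
  obtain ⟨U, K, p, V₁, o₁, k₁, s₁, e₁⟩ := h.1.exists_h1Pair hΩ hw hs.isCompact hηΩ
  obtain ⟨B, b, hB, hBs, hsym, hpos, hb, hbs, V₂, o₂, k₂, s₂, e₂⟩ :=
    exists_localized_coefficients hΩ hθ hA hg hs.isCompact hηΩ
  have hV : IsOpen (V₁ ∩ V₂) := o₁.inter o₂
  have heq : ∀ φ : Euc m → ℝ, ContDiff ℝ ∞ φ → HasCompactSupport φ → tsupport φ ⊆ V₁ ∩ V₂ →
      ∫ x, fderiv ℝ φ x (B x (K x)) = ∫ x, b x * φ x := fun φ hφ hφs hφV => by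
    have hφΩ : tsupport φ ⊆ Ω := hφV.trans (inter_subset_left.trans s₁)
    have := h.2 φ ⟨hφ, hφs, hφΩ⟩
    rw [setIntegral_eq_of_tsupport_subset hφΩ (fun x hx => by
        simp [matForm, gradient_eq_zero_of_notMem_tsupport hx]),
      setIntegral_eq_of_tsupport_subset hφΩ (fun x hx => by
        simp [image_eq_zero_of_notMem_tsupport hx])] at this
    convert this using 1
    · refine integral_congr_ae (Eventually.of_forall fun x => ?_)
      by_cases hx : x ∈ tsupport φ
      · simp only [(e₁ x (hφV hx).1).2, (e₂ x (hφV hx).2).1, matForm_eq]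
        rw [real_inner_comm, inner_gradient_eq_fderiv]
      · simp [matForm, gradient_eq_zero_of_notMem_tsupport hx, fderiv_eq_zero_of_notMem_tsupport hx]
    · refine integral_congr_ae (Eventually.of_forall fun x => ?_)
      by_cases hx : x ∈ tsupport φ
      · simp only [(e₂ x (hφV hx).2).2]
      · simp [image_eq_zero_of_notMem_tsupport hx]
  have hηV : tsupport η ⊆ V₁ ∩ V₂ := subset_inter k₁ k₂
  refine ⟨fun e => ?_, ?_⟩
  · rw [← integral_variationDensity p hB hBs hsym hpos hb hbs hV heq hη hs hηV e]
    refine integral_congr_ae (Eventually.of_forall fun x => ?_)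
    by_cases hx : x ∈ tsupport η
    · have hfd : fderiv ℝ B x = fderiv ℝ (opField A) x := by
        refine Filter.EventuallyEq.fderiv_eq ?_
        filter_upwards [o₂.mem_nhds (k₂ hx)] with y hy using (e₂ y hy).1
      simp only [variationDensity, hfd, (e₁ x (k₁ hx)).2, (e₂ x (k₂ hx)).1, (e₂ x (k₂ hx)).2]
    · simp [variationDensity, image_eq_zero_of_notMem_tsupport hx,
        fderiv_eq_zero_of_notMem_tsupport hx]
  · have key := weakEquation_mul_h1Pair (memLp_clm_apply_of_hasCompactSupport hB.continuous hBs
      p.memLp) hb hbs hV heq p hη hs hηV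
    convert key using 1
    · congr 1
      · refine integral_congr_ae (Eventually.of_forall fun x => ?_)
        by_cases hx : x ∈ tsupport η
        · simp only [(e₁ x (k₁ hx)).2, (e₂ x (k₂ hx)).1, inner_smul_right]
          rw [real_inner_comm]
        · simp [image_eq_zero_of_notMem_tsupport hx]
      · refine integral_congr_ae (Eventually.of_forall fun x => ?_)
        by_cases hx : x ∈ tsupport η
        · simp only [(e₁ x (k₁ hx)).2, (e₁ x (k₁ hx)).1, (e₂ x (k₂ hx)).1]
        · simp [fderiv_eq_zero_of_notMem_tsupport hx]
    · refine integral_congr_ae (Eventually.of_forall fun x => ?_)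
      by_cases hx : x ∈ tsupport η
      · simp only [(e₁ x (k₁ hx)).1, (e₂ x (k₂ hx)).2]; ring
      · simp [image_eq_zero_of_notMem_tsupport hx]

end Local

/-! ### The stationarity conditions of the limit profile -/

/-- Stationarity of `v` with gradients `G` for the operators `B` and the reactions `F`, with respect
to inner variations and to multiplications by cutoff functions. -/
structure IsCritical {ℓ : ℕ} (Ω : Set (Euc m)) (B : Euc m → Euc m →L[ℝ] Euc m)
    (F v : Fin ℓ → Euc m → ℝ) (G : Fin ℓ → Euc m → Euc m) : Prop where
  memLp : ∀ i, MemLp (G i) 2 (volume.restrict Ω)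
  continuousOn : ∀ i, ContinuousOn (v i) Ω
  continuousOn_reaction : ∀ i, ContinuousOn (F i) Ω
  contDiffOn : ContDiffOn ℝ 1 B Ω
  symm : ∀ x ∈ Ω, ∀ ξ ζ, ⟪B x ξ, ζ⟫_ℝ = ⟪ξ, B x ζ⟫_ℝ
  variation : ∀ η : Euc m → ℝ, ContDiff ℝ 1 η → HasCompactSupport η → tsupport η ⊆ Ω → ∀ e,
    ∑ i, ∫ x, variationDensity (G i) B (F i) η e x = 0
  energy : ∀ i, ∀ η : Euc m → ℝ, ContDiff ℝ 1 η → HasCompactSupport η → tsupport η ⊆ Ω →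
    ∫ x, (⟪G i x, η x • B x (G i x) + v i x • B x (gradient η x)⟫_ℝ - η x * (F i x * v i x)) = 0
  square : ∀ i, ∀ η : Euc m → ℝ, ContDiff ℝ 1 η → HasCompactSupport η → tsupport η ⊆ Ω → ∀ e,
    ∫ x, (v i x ^ 2 * fderiv ℝ η x e + (η x * (2 * v i x)) * ⟪G i x, e⟫_ℝ) = 0

/-! ### Passage to the limit in quadratic integrals -/

section Limit

theorem memLp_of_continuousOn_compact {F : Type*} [NormedAddCommGroup F] {k : Set (Euc m)}
    (hk : IsCompact k) {f : Euc m → F} (hf : ContinuousOn f k) (p : ℝ≥0∞) :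
    MemLp f p (volume.restrict k) := by
  have : IsFiniteMeasure (volume.restrict k : Measure (Euc m)) := ⟨by
    rw [Measure.restrict_apply_univ]; exact hk.measure_lt_top⟩
  obtain ⟨C, hC⟩ := hk.exists_bound_of_continuousOn hf
  have h : AEStronglyMeasurable f (volume.restrict k) := by
    obtain ⟨g, hg⟩ : ∃ g, g = f := ⟨f, rfl⟩
    exact hf.aestronglyMeasurable_of_isCompact hk hk.measurableSet
  exact MemLp.of_bound h C ((ae_restrict_iff' hk.measurableSet).mpr (Eventually.of_forall hC))

theorem memLp_clm_apply_of_continuousOn {F₁ F₂ : Type*} [NormedAddCommGroup F₁] [NormedSpace ℝ F₁]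
    [NormedAddCommGroup F₂] [NormedSpace ℝ F₂] {k : Set (Euc m)}
    (hk : IsCompact k) {K : Euc m → F₁ →L[ℝ] F₂} (hK : ContinuousOn K k) {G : Euc m → F₁}
    {p : ℝ≥0∞} (hG : MemLp G p (volume.restrict k)) :
    MemLp (fun x => K x (G x)) p (volume.restrict k) := by
  obtain ⟨C, hC⟩ := hk.exists_bound_of_continuousOn hK
  exact memLp_clm_apply (hK.aestronglyMeasurable_of_isCompact hk hk.measurableSet)
    ((ae_restrict_iff' hk.measurableSet).mpr (Eventually.of_forall hC)) hG

theorem memLp_smul_of_continuousOn {F : Type*} [NormedAddCommGroup F] [NormedSpace ℝ F]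
    {k : Set (Euc m)} (hk : IsCompact k) {c : Euc m → ℝ} (hc : ContinuousOn c k) {q : Euc m → F}
    {p : ℝ≥0∞} (hq : MemLp q p (volume.restrict k)) :
    MemLp (fun x => c x • q x) p (volume.restrict k) := by
  obtain ⟨C, hC⟩ := hk.exists_bound_of_continuousOn hc
  refine hq.of_le_mul (c := C)
    ((hc.aestronglyMeasurable_of_isCompact hk hk.measurableSet).smul hq.1)
    ((ae_restrict_iff' hk.measurableSet).mpr (Eventually.of_forall fun x hx => ?_))
  rw [norm_smul]
  gcongr
  exact hC x hx

theorem tendsto_eLpNorm_of_tendstoUniformlyOn {ι F : Type*} [NormedAddCommGroup F]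
    [NormedSpace ℝ F] {l : Filter ι} {k : Set (Euc m)} (hk : MeasurableSet k)
    {c : ι → Euc m → ℝ} {c₀ : Euc m → ℝ} {q : Euc m → F} {p : ℝ≥0∞}
    (hq : MemLp q p (volume.restrict k)) (hc : TendstoUniformlyOn c c₀ l k) :
    Tendsto (fun n => eLpNorm ((fun x => c n x • q x) - fun x => c₀ x • q x) p
      (volume.restrict k)) l (𝓝 0) := by
  have h : TendstoUniformly (fun n => k.indicator (c n)) (k.indicator c₀) l := by
    rw [Metric.tendstoUniformly_iff]
    rw [Metric.tendstoUniformlyOn_iff] at hc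
    intro ε hε
    filter_upwards [hc ε hε] with n hn x
    by_cases hx : x ∈ k
    · simpa [hx] using hn x hx
    · simpa [hx] using hε
  refine (tendsto_eLpNorm_of_tendstoUniformly hq h).congr fun n => eLpNorm_congr_ae ?_
  refine (ae_restrict_iff' hk).mpr (Eventually.of_forall fun x hx => ?_)
  simp [hx]

/-- The integrand, quadratic in the gradient plus a linear term, covers both the inner variation and
the gradient part of the energy identity. The quadratic part passes to the limit because the
gradients converge strongly. -/
theorem tendsto_integral_density {F : Type*} [NormedAddCommGroup F] [InnerProductSpace ℝ F]
    {k : Set (Euc m)} (hk : IsCompact k)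
    {K : Euc m → F →L[ℝ] F} (hK : ContinuousOn K k) {q : Euc m → F}
    (hq : ContinuousOn q k) {G : ℕ → Euc m → F} {G₀ : Euc m → F}
    (hG : ∀ n, MemLp (G n) 2 (volume.restrict k)) (hG₀ : MemLp G₀ 2 (volume.restrict k))
    (hGt : Tendsto (fun n => eLpNorm (G n - G₀) 2 (volume.restrict k)) atTop (𝓝 0))
    {c : ℕ → Euc m → ℝ} {c₀ : Euc m → ℝ} (hc : ∀ n, ContinuousOn (c n) k)
    (hct : TendstoUniformlyOn c c₀ atTop k) :
    Tendsto (fun n => ∫ x in k, ⟪G n x, K x (G n x) + c n x • q x⟫_ℝ) atTop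
      (𝓝 (∫ x in k, ⟪G₀ x, K x (G₀ x) + c₀ x • q x⟫_ℝ)) := by
  have hc₀ : ContinuousOn c₀ k := hct.continuousOn (Frequently.of_forall hc)
  have hq2 : MemLp q 2 (volume.restrict k) := memLp_of_continuousOn_compact hk hq 2
  have m1 : ∀ n, MemLp (fun x => K x (G n x) + c n x • q x) 2 (volume.restrict k) := fun n =>
    (memLp_clm_apply_of_continuousOn hk hK (hG n)).add (memLp_smul_of_continuousOn hk (hc n) hq2)
  have m0 : MemLp (fun x => K x (G₀ x) + c₀ x • q x) 2 (volume.restrict k) :=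
    (memLp_clm_apply_of_continuousOn hk hK hG₀).add (memLp_smul_of_continuousOn hk hc₀ hq2)
  refine tendsto_integral_inner hG m1 hG₀ m0 hGt ?_
  obtain ⟨C, hC⟩ := hk.exists_bound_of_continuousOn hK
  have t1 : Tendsto (fun n => eLpNorm (fun x => K x ((G n - G₀) x)) 2 (volume.restrict k)) atTop
      (𝓝 0) := by
    refine tendsto_eLpNorm_of_le_mul C (fun n => ?_) hGt
    refine (ae_restrict_iff' hk.measurableSet).mpr (Eventually.of_forall fun x hx => ?_)
    exact ((K x).le_opNorm _).trans (by gcongr; exact hC x hx)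
  have t2 := tendsto_eLpNorm_of_tendstoUniformlyOn hk.measurableSet hq2 hct
  have t3 := t1.add t2
  rw [add_zero] at t3
  have hle : ∀ n, eLpNorm ((fun x => K x (G n x) + c n x • q x) - fun x => K x (G₀ x) + c₀ x • q x)
      2 (volume.restrict k) ≤ eLpNorm (fun x => K x ((G n - G₀) x)) 2 (volume.restrict k)
      + eLpNorm ((fun x => c n x • q x) - fun x => c₀ x • q x) 2 (volume.restrict k) := fun n => by
    have e : ((fun x => K x (G n x) + c n x • q x) - fun x => K x (G₀ x) + c₀ x • q x)
        = (fun x => K x ((G n - G₀) x)) + ((fun x => c n x • q x) - fun x => c₀ x • q x) := by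
      ext x : 1
      simp only [Pi.sub_apply, Pi.add_apply, map_sub]
      abel
    rw [e]
    exact eLpNorm_add_le (memLp_clm_apply_of_continuousOn hk hK ((hG n).sub hG₀)).1
      ((memLp_smul_of_continuousOn hk (hc n) hq2).sub (memLp_smul_of_continuousOn hk hc₀ hq2)).1
      one_le_two
  exact tendsto_of_tendsto_of_tendsto_of_le_of_le tendsto_const_nhds t3 (fun _ => zero_le) hle

/-- Eventually the pairs `(x, w n x)` stay in the compact set `k ×ˢ closedBall 0 (R + 1)`, where `φ`
is uniformly continuous. -/
theorem tendstoUniformlyOn_comp {ι : Type*} {l : Filter ι} {Ω k : Set (Euc m)} (hk : IsCompact k)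
    (hkΩ : k ⊆ Ω) {φ : Euc m → ℝ → ℝ}
    (hφ : ContinuousOn (fun p : Euc m × ℝ => φ p.1 p.2) (Ω ×ˢ univ)) {w : ι → Euc m → ℝ}
    {u : Euc m → ℝ} (hu : ContinuousOn u k) (hw : TendstoUniformlyOn w u l k) :
    TendstoUniformlyOn (fun n x => φ x (w n x)) (fun x => φ x (u x)) l k := by
  obtain ⟨R, hR⟩ := hk.exists_bound_of_continuousOn hu
  have huc : UniformContinuousOn (fun p : Euc m × ℝ => φ p.1 p.2) (k ×ˢ closedBall 0 (R + 1)) :=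
    (hk.prod (isCompact_closedBall 0 (R + 1))).uniformContinuousOn_of_continuous
      (hφ.mono (prod_mono hkΩ (subset_univ _)))
  have hp : TendstoUniformlyOn (fun n x => (x, w n x)) (fun x => (x, u x)) l k := by
    rw [Metric.tendstoUniformlyOn_iff] at hw ⊢
    intro ε hε
    filter_upwards [hw ε hε] with n hn x hx
    simpa [Prod.dist_eq, hε] using hn x hx
  refine UniformContinuousOn.comp_tendstoUniformlyOn_eventually
    (F := fun n x => (x, w n x)) (f := fun x => (x, u x)) ?_ ?_ huc hp
  · filter_upwards [Metric.tendstoUniformlyOn_iff.mp hw 1 one_pos] with n hn x hx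
    refine ⟨hx, ?_⟩
    rw [mem_closedBall_zero_iff]
    have h2 := hn x hx
    rw [dist_eq_norm, norm_sub_rev] at h2
    have := norm_le_norm_add_norm_sub' (w n x) (u x)
    linarith [hR x hx]
  · intro x hx
    refine ⟨hx, ?_⟩
    rw [mem_closedBall_zero_iff]
    linarith [hR x hx]

/-- The operators of the quadratic part of `variationDensity`. -/
def variationOp (B : Euc m → Euc m →L[ℝ] Euc m) (η : Euc m → ℝ) (e x : Euc m) :
    Euc m →L[ℝ] Euc m :=
  η x • fderiv ℝ B x e + fderiv ℝ η x e • B x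
    - (2 : ℝ) • (ContinuousLinearMap.toSpanSingleton ℝ e ∘L (fderiv ℝ η x ∘L B x))

theorem variationDensity_eq (G : Euc m → Euc m) (B : Euc m → Euc m →L[ℝ] Euc m) (g η : Euc m → ℝ)
    (e x : Euc m) : variationDensity G B g η e x
      = ⟪G x, variationOp B η e x (G x) + (2 * (η x * g x)) • e⟫_ℝ := by
  simp only [variationDensity, variationOp, sub_apply, add_apply, smul_apply,
    ContinuousLinearMap.comp_apply, ContinuousLinearMap.toSpanSingleton_apply, inner_add_right,
    inner_sub_right, inner_smul_right, smul_smul, real_inner_comm (G x)]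
  ring

theorem continuousOn_variationOp {Ω : Set (Euc m)} (hΩ : IsOpen Ω)
    {B : Euc m → Euc m →L[ℝ] Euc m} (hB : ContDiffOn ℝ 1 B Ω) {η : Euc m → ℝ}
    (hη : ContDiff ℝ 1 η) (e : Euc m) : ContinuousOn (variationOp B η e) Ω := by
  have h1 : ContinuousOn (fun x => fderiv ℝ B x e) Ω :=
    (hB.continuousOn_fderiv_of_isOpen hΩ le_rfl).clm_apply continuousOn_const
  have h2 := hη.continuous_fderiv one_ne_zero
  have h3 : ContinuousOn (fun x => fderiv ℝ η x e • B x) Ω :=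
    (h2.clm_apply continuous_const).continuousOn.smul hB.continuousOn
  exact ((hη.continuous.continuousOn.smul h1).add h3).sub
    ((continuousOn_const.clm_comp (h2.continuousOn.clm_comp hB.continuousOn)).const_smul (2 : ℝ))

end Limit

/-! ### Identities for the competitive system at a fixed parameter -/

section System

variable {ℓ : ℕ} {Ω : Set (Euc m)} {A : Euc m → Matrix (Fin m) (Fin m) ℝ}
  {f : Fin ℓ → Euc m → ℝ → ℝ} {a : Euc m → ℝ} {γ θ : ℝ}

theorem systemRHS_eq (hγ : 0 < γ) (lam : ℝ) {w : Fin ℓ → Euc m → ℝ} {x : Euc m}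
    (h0 : ∀ i, 0 ≤ w i x) (i : Fin ℓ) :
    systemRHS f a γ lam w i x = f i x (w i x)
      + lam * (a x * ∑ j ∈ Finset.univ.erase i, w j x ^ (γ + 1) * w i x ^ γ) := by
  have hsum : ∀ j ∈ Finset.univ.erase i, lam * |w j x| ^ (γ + 1) * |w i x| ^ (γ - 1) * w i x
      = lam * (w j x ^ (γ + 1) * w i x ^ γ) := ?_
  · rw [systemRHS, Finset.sum_congr rfl hsum, ← Finset.mul_sum]
    ring
  intro j _
  -- The exponent `γ - 1` may be negative. At a zero of `w i` the factor `w i x` annihilates the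
  -- left side, and `γ > 0` the right side.
  have : w i x ^ (γ - 1) * w i x = w i x ^ γ := by
    rcases (h0 i).eq_or_lt with h | h
    · rw [← h, mul_zero, Real.zero_rpow hγ.ne']
    · rw [Real.rpow_sub_one h.ne', div_mul_cancel₀ _ h.ne']
  rw [abs_of_nonneg (h0 i), abs_of_nonneg (h0 j), mul_assoc, this]
  ring

theorem continuousOn_reaction (hf : IsAdmissibleReaction Ω f) {i : Fin ℓ} {w : Euc m → ℝ}
    (hw : ContinuousOn w Ω) : ContinuousOn (fun x => f i x (w x)) Ω :=
  (hf.1 i).comp (continuousOn_id.prodMk hw) fun _ hx => ⟨hx, mem_univ _⟩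

theorem continuousOn_rpow_mul_rpow (hγ : 0 < γ) {v w : Euc m → ℝ} (hv : ContinuousOn v Ω)
    (hw : ContinuousOn w Ω) : ContinuousOn (fun x => v x ^ (γ + 1) * w x ^ γ) Ω :=
  (hv.rpow_const fun _ _ => Or.inr (by linarith)).mul (hw.rpow_const fun _ _ => Or.inr hγ.le)

theorem continuousOn_systemRHS (hγ : 0 < γ) (hf : IsAdmissibleReaction Ω f)
    (ha : ContinuousOn a Ω) {lam : ℝ} {w : Fin ℓ → Euc m → ℝ} (hw : ∀ i, ContinuousOn (w i) Ω)
    (h0 : ∀ i, ∀ x ∈ Ω, 0 ≤ w i x) (i : Fin ℓ) :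
    ContinuousOn (systemRHS f a γ lam w i) Ω := by
  refine ContinuousOn.congr ?_ fun x hx => systemRHS_eq hγ lam (fun i => h0 i x hx) i
  exact (continuousOn_reaction hf (hw i)).add (continuousOn_const.mul
    (ha.mul (continuousOn_finsetSum _ fun j _ => continuousOn_rpow_mul_rpow hγ (hw j) (hw i))))

variable (hΩ : IsOpen Ω) (hθ : 0 < θ) (hA : IsEllipticC1 Ω θ A) (hf : IsAdmissibleReaction Ω f)
  (ha : ContDiffOn ℝ 1 a Ω) (hγ : 0 < γ)
  {lam : ℝ} {w : Fin ℓ → Euc m → ℝ} (hw : ∀ i, ContinuousOn (w i) Ω)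
  (h0 : ∀ i, ∀ x ∈ Ω, 0 ≤ w i x) (hsol : ∀ i, IsWeakSolution Ω A (w i) (systemRHS f a γ lam w i))
  {η : Euc m → ℝ} (hη : ContDiff ℝ 1 η) (hs : HasCompactSupport η) (hηΩ : tsupport η ⊆ Ω)

include hΩ hA hf hw hsol hη hs hηΩ in
theorem integrableOn_variation (e : Euc m) (i : Fin ℓ) :
    IntegrableOn (fun x => ⟪weakGrad Ω (w i) x, variationOp (opField A) η e x (weakGrad Ω (w i) x)
      + (2 * (η x * f i x (w i x))) • e⟫_ℝ) (tsupport η) := by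
  have hk := hs.isCompact
  have hG : MemLp (weakGrad Ω (w i)) 2 (volume.restrict (tsupport η)) :=
    ((hsol i).1.memLp_weakGrad hΩ).mono_measure (Measure.restrict_mono hηΩ le_rfl)
  have hc : ContinuousOn (fun x => 2 * (η x * f i x (w i x))) (tsupport η) :=
    continuousOn_const.mul (hη.continuous.continuousOn.mul
      ((continuousOn_reaction hf (hw i)).mono hηΩ))
  exact integrable_inner_of_memLp hG ((memLp_clm_apply_of_continuousOn hk
    ((continuousOn_variationOp hΩ hA.contDiffOn_opField hη e).mono hηΩ) hG).add
    (memLp_smul_of_continuousOn hk hc (memLp_of_continuousOn_compact hk continuousOn_const 2)))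

include hΩ hθ hA hf ha hγ hw h0 hsol hη hs hηΩ in
-- The forces `w_j ^ (γ + 1) * w_i ^ γ * ∂_e w_i`, paired over `(i, j)` and `(j, i)`, add up to the
-- derivative of `w_i ^ (γ + 1) * w_j ^ (γ + 1)` divided by `γ + 1`. Integration by parts transfers
-- this derivative to `η a`, and no gradient of a solution multiplies the large parameter any more.
-- This is why only the sum over the components is stationary in the limit.
theorem sum_integral_variation_system (e : Euc m) :
    (γ + 1) * ∑ i, ∫ x in tsupport η, ⟪weakGrad Ω (w i) x,
        variationOp (opField A) η e x (weakGrad Ω (w i) x) + (2 * (η x * f i x (w i x))) • e⟫_ℝ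
      = ∑ i, ∑ j ∈ Finset.univ.erase i, lam * ∫ x, w i x ^ (γ + 1) * w j x ^ (γ + 1)
          * fderiv ℝ (fun x => η x * a x) x e := by
  set ζ : Euc m → ℝ := fun x => η x * a x with hζ
  have hζ1 : ContDiff ℝ 1 ζ := contDiff_smul_of_contDiffOn hΩ hη hηΩ ha
  have hζs : HasCompactSupport ζ := hs.mul_right
  have hζΩ : tsupport ζ ⊆ Ω := tsupport_mul_subset_left.trans hηΩ
  set X : Fin ℓ → Fin ℓ → ℝ := fun i j =>
    ∫ x, (ζ x * (w j x ^ (γ + 1) * w i x ^ γ)) * ⟪weakGrad Ω (w i) x, e⟫_ℝ with hX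
  have iX : ∀ i j, Integrable fun x =>
      (ζ x * (w j x ^ (γ + 1) * w i x ^ γ)) * ⟪weakGrad Ω (w i) x, e⟫_ℝ := fun i j => by
    have hc : Continuous fun x => ζ x * (w j x ^ (γ + 1) * w i x ^ γ) :=
      continuous_smul_of_continuousOn hΩ hζ1.continuous hζΩ
        (continuousOn_rpow_mul_rpow hγ (hw j) (hw i))
    have := integrable_smul_of_locallyIntegrableOn hc hζs.mul_right
      (tsupport_mul_subset_left.trans hζΩ) (hsol i).1.isWeakGradient.2.1
    refine (this.inner_const e).congr (Eventually.of_forall fun x => ?_)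
    simp only [inner_smul_left]; simp
  have h1 : ∀ i, (∫ x in tsupport η, ⟪weakGrad Ω (w i) x,
      variationOp (opField A) η e x (weakGrad Ω (w i) x) + (2 * (η x * f i x (w i x))) • e⟫_ℝ)
      = -(2 * (lam * ∑ j ∈ Finset.univ.erase i, X i j)) := fun i => by
    have key := ((hsol i).integral_variationDensity_eq_zero hΩ hθ hA (hw i)
      (continuousOn_systemRHS hγ hf ha.continuousOn hw h0 i) hη hs hηΩ).1 e
    have hz : ∀ x ∉ tsupport η, variationDensity (weakGrad Ω (w i)) (opField A)
        (systemRHS f a γ lam w i) η e x = 0 := fun x hx => by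
      simp [variationDensity, image_eq_zero_of_notMem_tsupport hx,
        fderiv_eq_zero_of_notMem_tsupport hx]
    rw [← setIntegral_eq_integral_of_forall_compl_eq_zero hz] at key
    have hpt : EqOn (variationDensity (weakGrad Ω (w i)) (opField A)
        (systemRHS f a γ lam w i) η e) (fun x => ⟪weakGrad Ω (w i) x,
      variationOp (opField A) η e x (weakGrad Ω (w i) x) + (2 * (η x * f i x (w i x))) • e⟫_ℝ
      + 2 * (lam * ∑ j ∈ Finset.univ.erase i,
        (ζ x * (w j x ^ (γ + 1) * w i x ^ γ)) * ⟪weakGrad Ω (w i) x, e⟫_ℝ)) (tsupport η) := by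
      intro x hx
      rw [variationDensity_eq, systemRHS_eq hγ lam (fun i => h0 i x (hηΩ hx))]
      simp only [inner_add_right, inner_smul_right, hζ, ← Finset.sum_mul, ← Finset.mul_sum]
      ring
    rw [setIntegral_congr_fun (isClosed_tsupport η).measurableSet hpt, integral_add
      (integrableOn_variation hΩ hA hf hw hsol hη hs hηΩ e i)
      (((integrable_finsetSum _ fun j _ => (iX i j)).const_mul lam).const_mul 2).integrableOn,
      integral_const_mul, integral_const_mul,
      integral_finsetSum _ fun j _ => (iX i j).integrableOn] at key
    have hXk : ∀ j, (∫ x in tsupport η,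
        (ζ x * (w j x ^ (γ + 1) * w i x ^ γ)) * ⟪weakGrad Ω (w i) x, e⟫_ℝ) = X i j := fun j =>
      setIntegral_eq_integral_of_forall_compl_eq_zero fun x hx => by
        simp [hζ, image_eq_zero_of_notMem_tsupport hx]
    simp_rw [hXk] at key
    linarith
  have h2 : ∀ i j, (∫ x, w i x ^ (γ + 1) * w j x ^ (γ + 1) * fderiv ℝ ζ x e)
      = -((γ + 1) * (X i j + X j i)) := fun i j => by
    have := integral_rpow_weakGrad hΩ (hsol i).1 (hsol j).1 (hw i) (hw j) hγ hζ1 hζs hζΩ e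
    simp only [hX]
    linarith
  -- The set of ordered pairs of distinct indices is symmetric; the resulting factor two cancels the
  -- one in `variationDensity`.
  have h3 : ∑ i, ∑ j ∈ Finset.univ.erase i, X j i = ∑ i, ∑ j ∈ Finset.univ.erase i, X i j :=
    Finset.sum_comm' fun i j => by simp [ne_comm]
  simp_rw [h1, h2, mul_neg, mul_add, Finset.sum_neg_distrib, Finset.sum_add_distrib,
    ← Finset.mul_sum]
  rw [h3]
  ring

include hΩ hθ hA hf ha hγ hw h0 hsol hη hs hηΩ in
-- Testing with `η w_i` raises the exponent `γ` of `w_i` to `γ + 1`, so the interaction is already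
-- in its symmetric form and no summation over `i` is necessary.
theorem integral_energy_system (i : Fin ℓ) :
    (∫ x in tsupport η, ⟪weakGrad Ω (w i) x, (η x • opField A x) (weakGrad Ω (w i) x)
        + w i x • opField A x (gradient η x)⟫_ℝ) - (∫ x in tsupport η, η x * (f i x (w i x) * w i x))
      = ∑ j ∈ Finset.univ.erase i, lam * ∫ x, w i x ^ (γ + 1) * w j x ^ (γ + 1) * (η x * a x) := by
  have hk := hs.isCompact
  have hAc := hA.contDiffOn_opField.continuousOn.mono hηΩ
  have hwk := (hw i).mono hηΩ
  have hG : MemLp (weakGrad Ω (w i)) 2 (volume.restrict (tsupport η)) :=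
    ((hsol i).1.memLp_weakGrad hΩ).mono_measure (Measure.restrict_mono hηΩ le_rfl)
  have key := ((hsol i).integral_variationDensity_eq_zero hΩ hθ hA (hw i)
    (continuousOn_systemRHS hγ hf ha.continuousOn hw h0 i) hη hs hηΩ).2
  rw [← setIntegral_eq_integral_of_forall_compl_eq_zero (s := tsupport η)
      (f := fun x => η x * ⟪opField A x (weakGrad Ω (w i) x), weakGrad Ω (w i) x⟫_ℝ) fun x hx => by
      simp [image_eq_zero_of_notMem_tsupport hx],
    ← setIntegral_eq_integral_of_forall_compl_eq_zero (s := tsupport η)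
      (f := fun x => w i x * fderiv ℝ η x (opField A x (weakGrad Ω (w i) x))) fun x hx => by
      simp [fderiv_eq_zero_of_notMem_tsupport hx],
    ← setIntegral_eq_integral_of_forall_compl_eq_zero (s := tsupport η)
      (f := fun x => η x * (systemRHS f a γ lam w i x * w i x)) fun x hx => by
      simp [image_eq_zero_of_notMem_tsupport hx]] at key
  have hgc : ContinuousOn (gradient η) (tsupport η) := (continuous_gradient hη).continuousOn
  have i1 : IntegrableOn (fun x => η x * ⟪opField A x (weakGrad Ω (w i) x), weakGrad Ω (w i) x⟫_ℝ)
      (tsupport η) := by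
    refine (integrable_inner_of_memLp (memLp_smul_of_continuousOn hk hη.continuous.continuousOn
      (memLp_clm_apply_of_continuousOn hk hAc hG)) hG).congr (Eventually.of_forall fun x => ?_)
    simp only [inner_smul_left]; simp
  have hsymm : ∀ x ∈ tsupport η, fderiv ℝ η x (opField A x (weakGrad Ω (w i) x))
      = ⟪weakGrad Ω (w i) x, opField A x (gradient η x)⟫_ℝ := fun x hx => by
    rw [← opField_symm (hA.2.1 x (hηΩ hx)), real_inner_comm, inner_gradient_eq_fderiv]
  have i2 : IntegrableOn (fun x => w i x * fderiv ℝ η x (opField A x (weakGrad Ω (w i) x)))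
      (tsupport η) := by
    refine IntegrableOn.congr_fun (integrable_inner_of_memLp hG (memLp_smul_of_continuousOn hk hwk
      (memLp_of_continuousOn_compact hk (hAc.clm_apply hgc) 2))) (fun x hx => ?_)
      (isClosed_tsupport η).measurableSet
    simp only [inner_smul_right, hsymm x hx]
  have i3 : IntegrableOn (fun x => η x * (f i x (w i x) * w i x)) (tsupport η) :=
    (hη.continuous.continuousOn.mul (((continuousOn_reaction hf (hw i)).mul (hw i)).mono
      hηΩ)).integrableOn_compact hk
  have i4 : ∀ j ∈ Finset.univ.erase i, IntegrableOn (fun x => w i x ^ (γ + 1) * w j x ^ (γ + 1)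
      * (η x * a x)) (tsupport η) := fun j _ =>
    ((((hw i).rpow_const fun _ _ => Or.inr (by linarith)).mul
      ((hw j).rpow_const fun _ _ => Or.inr (by linarith))).mul
      (hη.continuous.continuousOn.mul ha.continuousOn)).mono hηΩ |>.integrableOn_compact hk
  have e1 : (∫ x in tsupport η, ⟪weakGrad Ω (w i) x, (η x • opField A x) (weakGrad Ω (w i) x)
        + w i x • opField A x (gradient η x)⟫_ℝ)
      = (∫ x in tsupport η, η x * ⟪opField A x (weakGrad Ω (w i) x), weakGrad Ω (w i) x⟫_ℝ)
        + ∫ x in tsupport η, w i x * fderiv ℝ η x (opField A x (weakGrad Ω (w i) x)) := by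
    rw [← integral_add i1 i2]
    refine setIntegral_congr_fun (isClosed_tsupport η).measurableSet fun x hx => ?_
    simp only [inner_add_right, smul_apply, inner_smul_right, hsymm x hx]
    rw [real_inner_comm]
  have e2 : (∫ x in tsupport η, η x * (systemRHS f a γ lam w i x * w i x))
      = (∫ x in tsupport η, η x * (f i x (w i x) * w i x)) + lam * ∑ j ∈ Finset.univ.erase i,
        ∫ x in tsupport η, w i x ^ (γ + 1) * w j x ^ (γ + 1) * (η x * a x) := by
    rw [← integral_finsetSum _ i4, ← integral_const_mul,
      ← integral_add i3 ((integrable_finsetSum _ i4).const_mul lam)]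
    refine setIntegral_congr_fun (isClosed_tsupport η).measurableSet fun x hx => ?_
    have hp : w i x ^ (γ + 1) = w i x ^ γ * w i x := by
      rw [Real.rpow_add_one' (h0 i x (hηΩ hx)) (by linarith)]
    simp only [systemRHS_eq hγ lam (fun i => h0 i x (hηΩ hx)), hp, Finset.mul_sum, add_mul, mul_add,
      Finset.sum_mul]
    congr 1
    exact Finset.sum_congr rfl fun j _ => by ring
  rw [e1, key, e2, add_sub_cancel_left, Finset.mul_sum]
  refine Finset.sum_congr rfl fun j _ => ?_
  rw [setIntegral_eq_integral_of_forall_compl_eq_zero fun x hx => by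
    simp [image_eq_zero_of_notMem_tsupport hx]]

end System

/-- As `W n ≥ 0` and the parameter does not depend on `x`, the absolute value of `∫ lam n * W n` is
`|lam n| * ∫ W n`; a bounded weight therefore costs only its bound. -/
theorem tendsto_interaction {Ω : Set (Euc m)} (hΩ : IsOpen Ω) {W : ℕ → Euc m → ℝ} {lam : ℕ → ℝ}
    (hi : ∀ n, IntegrableOn (W n) Ω) (h0 : ∀ n, ∀ x ∈ Ω, 0 ≤ W n x)
    (ht : Tendsto (fun n => ∫ x in Ω, lam n * W n x) atTop (𝓝 0)) {ζ : Euc m → ℝ} {C : ℝ}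
    (hC : ∀ x, |ζ x| ≤ C) (hz : ∀ x ∉ Ω, ζ x = 0) :
    Tendsto (fun n => lam n * ∫ x, W n x * ζ x) atTop (𝓝 0) := by
  refine squeeze_zero_norm (a := fun n => C * ‖∫ x in Ω, lam n * W n x‖) (fun n => ?_) (by
    simpa using ht.norm.const_mul C)
  rw [← setIntegral_eq_integral_of_forall_compl_eq_zero (s := Ω) (fun x hx => by simp [hz x hx]),
    integral_const_mul, norm_mul, norm_mul, mul_left_comm]
  refine mul_le_mul_of_nonneg_left ?_ (norm_nonneg _)
  have hb : ∀ᵐ x ∂volume.restrict Ω, ‖W n x * ζ x‖ ≤ C * W n x :=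
    (ae_restrict_iff' hΩ.measurableSet).mpr (Eventually.of_forall fun x hx => by
      rw [norm_mul, Real.norm_of_nonneg (h0 n x hx), mul_comm]
      exact mul_le_mul_of_nonneg_right (hC x) (h0 n x hx))
  refine (norm_integral_le_of_norm_le ((hi n).const_mul C) hb).trans ?_
  rw [integral_const_mul]
  exact mul_le_mul_of_nonneg_left (le_abs_self _) ((abs_nonneg _).trans (hC 0))

/-! ### Stationarity of the segregated limit -/

section Profile

variable {ℓ : ℕ} {Ω : Set (Euc m)} {A : Euc m → Matrix (Fin m) (Fin m) ℝ}
  {f : Fin ℓ → Euc m → ℝ → ℝ} {a : Euc m → ℝ} {γ θ : ℝ} {w : ℝ → Fin ℓ → Euc m → ℝ}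
  {u : Fin ℓ → Euc m → ℝ}

theorem IsSegregatedLimit.tendstoUniformlyOn (h : IsSegregatedLimit Ω A f a γ w u) (i : Fin ℓ) :
    TendstoUniformlyOn (fun lam => w lam i) (u i) atBot Ω := by
  -- Only the supremum part of the Hölder norm is used, so any exponent in `(0, 1)` would do.
  have h1 := h.tendsto_holder i (1 / 2) (by norm_num) (by rw [← NNReal.coe_lt_coe]; norm_num)
  rw [EMetric.tendstoUniformlyOn_iff]
  intro ε hε
  filter_upwards [h1.eventually (gt_mem_nhds hε)] with lam hlam x hx
  rw [edist_comm, edist_eq_enorm_sub]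
  refine lt_of_le_of_lt ?_ hlam
  refine le_trans ?_ le_self_add
  exact le_iSup₂_of_le (f := fun x (_ : x ∈ Ω) => ‖(w lam i - u i) x‖ₑ) x hx le_rfl

theorem IsSegregatedLimit.continuousOn_profile (h : IsSegregatedLimit Ω A f a γ w u) (i : Fin ℓ) :
    ContinuousOn (u i) Ω :=
  (h.tendstoUniformlyOn i).continuousOn
    ((eventually_lt_atBot 0).mono fun lam hlam => h.continuousOn lam hlam i).frequently

/-- Strong `H^1` and uniform convergence carry the left sides of the identities of the system to the
limit, while the interaction terms on the right vanish by `tendsto_interaction`. The chain rule for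
the squares belongs to the limit itself. -/
theorem IsSegregatedLimit.isCritical (h : IsSegregatedLimit Ω A f a γ w u) (hΩ : IsOpen Ω)
    (hθ : 0 < θ) (hA : IsEllipticC1 Ω θ A) (hf : IsAdmissibleReaction Ω f)
    (ha : ContDiffOn ℝ 1 a Ω) (hγ : 0 < γ) :
    IsCritical Ω (opField A) (fun i x => f i x (u i x)) u (fun i => weakGrad Ω (u i)) := by
  -- A sequence of parameters, all of them negative so that the hypotheses apply to every term.
  set lam : ℕ → ℝ := fun n => -((n : ℝ) + 1) with hlam
  have hneg : ∀ n, lam n < 0 := fun n => by simp only [hlam]; linarith [n.cast_nonneg (α := ℝ)]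
  have hbot : Tendsto lam atTop atBot :=
    tendsto_neg_atTop_atBot.comp (tendsto_atTop_add_const_right _ 1 tendsto_natCast_atTop_atTop)
  have hu : ∀ i, ContinuousOn (u i) Ω := h.continuousOn_profile
  have hG0 : ∀ i, MemLp (weakGrad Ω (u i)) 2 (volume.restrict Ω) := fun i =>
    (h.memH1 i).memLp_weakGrad hΩ
  have hG : ∀ n i, MemLp (weakGrad Ω (w (lam n) i)) 2 (volume.restrict Ω) := fun n i =>
    (h.solution _ (hneg n) i).1.memLp_weakGrad hΩ
  have hunif : ∀ i {k : Set (Euc m)}, k ⊆ Ω →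
      TendstoUniformlyOn (fun n => w (lam n) i) (u i) atTop k := fun i k hk ε hε =>
    hbot.eventually ((h.tendstoUniformlyOn i).mono hk ε hε)
  have hfu : ∀ i {k : Set (Euc m)}, IsCompact k → k ⊆ Ω → TendstoUniformlyOn
      (fun n x => f i x (w (lam n) i x)) (fun x => f i x (u i x)) atTop k := fun i k hk hkΩ =>
    tendstoUniformlyOn_comp hk hkΩ (hf.1 i) ((hu i).mono hkΩ) (hunif i hkΩ)
  have hgt : ∀ i {k : Set (Euc m)}, k ⊆ Ω → Tendsto (fun n =>
      eLpNorm (weakGrad Ω (w (lam n) i) - weakGrad Ω (u i)) 2 (volume.restrict k)) atTop (𝓝 0) :=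
    fun i k hk => tendsto_of_tendsto_of_tendsto_of_le_of_le tendsto_const_nhds
      ((h.tendsto_grad i).comp hbot) (fun _ => zero_le)
      fun n => eLpNorm_mono_measure _ (Measure.restrict_mono hk le_rfl)
  have hinter : ∀ i j, i ≠ j → ∀ {ζ : Euc m → ℝ}, Continuous ζ → HasCompactSupport ζ →
      (∀ x ∉ Ω, ζ x = 0) → Tendsto (fun n => lam n * ∫ x, w (lam n) i x ^ (γ + 1)
        * w (lam n) j x ^ (γ + 1) * ζ x) atTop (𝓝 0) := fun i j hij ζ hζ hζs hz => by
    obtain ⟨C, hC⟩ := hζs.exists_bound_of_continuous hζ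
    exact tendsto_interaction hΩ (fun n => h.interaction_integrable _ (hneg n) i j hij)
      (fun n x hx => mul_nonneg (Real.rpow_nonneg (h.nonneg _ (hneg n) i x hx) _)
        (Real.rpow_nonneg (h.nonneg _ (hneg n) j x hx) _))
      ((h.interaction_tendsto i j hij).comp hbot) hC hz
  have hBc := hA.contDiffOn_opField
  refine ⟨hG0, hu, fun i => continuousOn_reaction hf (hu i), hBc,
    fun x hx => opField_symm (hA.2.1 x hx), ?_, ?_, ?_⟩
  · intro η hη hs hηΩ e
    have hk := hs.isCompact
    have lim : Tendsto (fun n => (γ + 1) * ∑ i, ∫ x in tsupport η, ⟪weakGrad Ω (w (lam n) i) x,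
        variationOp (opField A) η e x (weakGrad Ω (w (lam n) i) x)
          + (2 * (η x * f i x (w (lam n) i x))) • e⟫_ℝ) atTop
        (𝓝 ((γ + 1) * ∑ i, ∫ x in tsupport η, ⟪weakGrad Ω (u i) x,
        variationOp (opField A) η e x (weakGrad Ω (u i) x)
          + (2 * (η x * f i x (u i x))) • e⟫_ℝ)) := by
      refine Tendsto.const_mul _ (tendsto_finsetSum _ fun i _ => ?_)
      refine tendsto_integral_density hk ((continuousOn_variationOp hΩ hBc hη e).mono hηΩ)
        continuousOn_const (fun n => (hG n i).mono_measure (Measure.restrict_mono hηΩ le_rfl))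
        ((hG0 i).mono_measure (Measure.restrict_mono hηΩ le_rfl)) (hgt i hηΩ)
        (c := fun n x => 2 * (η x * f i x (w (lam n) i x)))
        (fun n => ?_) ?_
      · exact continuousOn_const.mul (hη.continuous.continuousOn.mul
          ((continuousOn_reaction hf (h.continuousOn _ (hneg n) i)).mono hηΩ))
      · have := tendstoUniformlyOn_comp (φ := fun x s => 2 * (η x * f i x s)) hk hηΩ
          (continuousOn_const.mul ((hη.continuous.comp continuous_fst).continuousOn.mul (hf.1 i)))
          ((hu i).mono hηΩ) (hunif i hηΩ)
        exact this
    have lim0 : Tendsto (fun n => ∑ i, ∑ j ∈ Finset.univ.erase i, lam n * ∫ x,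
        w (lam n) i x ^ (γ + 1) * w (lam n) j x ^ (γ + 1)
          * fderiv ℝ (fun x => η x * a x) x e) atTop (𝓝 0) := by
      have hζ1 : ContDiff ℝ 1 fun x => η x * a x := contDiff_smul_of_contDiffOn hΩ hη hηΩ ha
      have hζs : HasCompactSupport fun x => η x * a x := hs.mul_right
      rw [show (0 : ℝ) = ∑ i : Fin ℓ, ∑ j ∈ Finset.univ.erase i, 0 by simp]
      refine tendsto_finsetSum _ fun i _ => tendsto_finsetSum _ fun j hj =>
        hinter i j (Finset.ne_of_mem_erase hj).symm
        ((hζ1.continuous_fderiv one_ne_zero).clm_apply continuous_const)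
        (hasCompactSupport_fderiv_clm hζs e) fun x hx => ?_
      rw [fderiv_eq_zero_of_notMem_tsupport fun hx' =>
        hx (hηΩ (tsupport_mul_subset_left hx')), zero_apply]
    have := tendsto_nhds_unique (lim.congr fun n => sum_integral_variation_system hΩ hθ hA hf ha hγ
      (h.continuousOn _ (hneg n)) (h.nonneg _ (hneg n)) (h.solution _ (hneg n)) hη hs hηΩ e) lim0
    rw [mul_eq_zero, or_iff_right (by linarith)] at this
    rw [← this]
    refine Finset.sum_congr rfl fun i _ => ?_
    rw [setIntegral_eq_integral_of_forall_compl_eq_zero fun x hx => ?_]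
    · simp_rw [variationDensity_eq]
    · rw [← variationDensity_eq (g := fun x => f i x (u i x))]
      simp [variationDensity, image_eq_zero_of_notMem_tsupport hx,
        fderiv_eq_zero_of_notMem_tsupport hx]
  · intro i η hη hs hηΩ
    have hk := hs.isCompact
    have hBk := hBc.continuousOn.mono hηΩ
    have hgc : ContinuousOn (gradient η) (tsupport η) := (continuous_gradient hη).continuousOn
    have hKc : ContinuousOn (fun x => η x • opField A x) (tsupport η) :=
      hη.continuous.continuousOn.smul hBk
    have hqc : ContinuousOn (fun x => opField A x (gradient η x)) (tsupport η) := hBk.clm_apply hgc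
    have hGk : MemLp (weakGrad Ω (u i)) 2 (volume.restrict (tsupport η)) :=
      (hG0 i).mono_measure (Measure.restrict_mono hηΩ le_rfl)
    have lim1 := tendsto_integral_density hk hKc hqc
        (fun n => (hG n i).mono_measure (Measure.restrict_mono hηΩ le_rfl)) hGk (hgt i hηΩ)
        (c := fun n => w (lam n) i) (fun n => (h.continuousOn _ (hneg n) i).mono hηΩ) (hunif i hηΩ)
    have hφ : ContinuousOn (fun p : Euc m × ℝ => η p.1 * (f i p.1 p.2 * p.2)) (Ω ×ˢ univ) :=
      (hη.continuous.comp continuous_fst).continuousOn.mul ((hf.1 i).mul continuousOn_snd)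
    have i3 : ∀ {v : Euc m → ℝ}, ContinuousOn v Ω →
        IntegrableOn (fun x => η x * (f i x (v x) * v x)) (tsupport η) := fun hv =>
      (hη.continuous.continuousOn.mul (((continuousOn_reaction hf hv).mul hv).mono
        hηΩ)).integrableOn_compact hk
    have lim2 : Tendsto (fun n => ∫ x in tsupport η, η x * (f i x (w (lam n) i x) * w (lam n) i x))
        atTop (𝓝 (∫ x in tsupport η, η x * (f i x (u i x) * u i x))) := by
      have h1 : MemLp (fun _ => (1 : ℝ)) 1 (volume.restrict (tsupport η)) :=
        memLp_of_continuousOn_compact hk continuousOn_const 1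
      have h2 := tendsto_eLpNorm_of_tendstoUniformlyOn hk.measurableSet h1
        (tendstoUniformlyOn_comp (φ := fun x s => η x * (f i x s * s)) hk hηΩ hφ
          ((hu i).mono hηΩ) (hunif i hηΩ))
      simp only [smul_eq_mul, mul_one] at h2
      exact tendsto_integral_of_L1' _ (i3 (hu i)).1
        (Eventually.of_forall fun n => i3 (h.continuousOn _ (hneg n) i)) h2
    have lim0 : Tendsto (fun n => ∑ j ∈ Finset.univ.erase i, lam n * ∫ x,
        w (lam n) i x ^ (γ + 1) * w (lam n) j x ^ (γ + 1) * (η x * a x)) atTop (𝓝 0) := by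
      rw [show (0 : ℝ) = ∑ j ∈ Finset.univ.erase i, 0 by simp]
      refine tendsto_finsetSum _ fun j hj => hinter i j (Finset.ne_of_mem_erase hj).symm
        (continuous_smul_of_continuousOn hΩ hη.continuous hηΩ ha.continuousOn)
        hs.mul_right fun x hx => ?_
      rw [image_eq_zero_of_notMem_tsupport fun hx' => hx (hηΩ hx'), zero_mul]
    have := tendsto_nhds_unique ((lim1.sub lim2).congr fun n => integral_energy_system hΩ hθ hA hf ha
      hγ (h.continuousOn _ (hneg n)) (h.nonneg _ (hneg n)) (h.solution _ (hneg n)) hη hs hηΩ i) lim0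
    rw [← this, ← integral_sub _ (i3 (hu i)),
      setIntegral_eq_integral_of_forall_compl_eq_zero fun x hx => ?_]
    · rfl
    · simp [image_eq_zero_of_notMem_tsupport hx, gradient_eq_zero_of_notMem_tsupport hx]
    · exact integrable_inner_of_memLp hGk ((memLp_clm_apply_of_continuousOn hk hKc hGk).add
        (memLp_smul_of_continuousOn hk ((hu i).mono hηΩ) (memLp_of_continuousOn_compact hk hqc 2)))
  · intro i η hη hs hηΩ e
    have key := integral_sq_weakGrad hΩ (h.memH1 i) (hu i) hη hs hηΩ e
    rw [← key, integral_add]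
    · have hc := (hη.continuous_fderiv one_ne_zero).clm_apply (continuous_const (y := e))
      have hds := hasCompactSupport_fderiv_clm hs e
      have hdΩ : tsupport (fun x => fderiv ℝ η x e) ⊆ Ω := fun x hx =>
        hηΩ (closure_minimal (fun y hy => by
          by_contra h
          exact hy (by simp [fderiv_eq_zero_of_notMem_tsupport h])) (isClosed_tsupport η) hx)
      refine ((continuous_smul_of_continuousOn hΩ hc hdΩ
        ((hu i).pow 2)).integrable_of_hasCompactSupport hds.mul_right).congr
        (Eventually.of_forall fun x => ?_)
      simp [mul_comm]
    · have hc : Continuous fun x => η x * (2 * u i x) :=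
        continuous_smul_of_continuousOn hΩ hη.continuous hηΩ (continuousOn_const.mul (hu i))
      refine ((integrable_smul_of_locallyIntegrableOn hc hs.mul_right
        (tsupport_mul_subset_left.trans hηΩ) (h.memH1 i).isWeakGradient.2.1).inner_const e).congr
        (Eventually.of_forall fun x => ?_)
      simp only [inner_smul_left]; simp

end Profile

/-! ### Affine changes of variables -/

section Affine

/-- The affine homeomorphism `x ↦ x₀ + S x`. -/
def affineHomeo (S : Euc m ≃L[ℝ] Euc m) (x₀ : Euc m) : Euc m ≃ₜ Euc m :=
  S.toHomeomorph.trans (Homeomorph.addLeft x₀)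

theorem affineHomeo_apply (S : Euc m ≃L[ℝ] Euc m) (x₀ x : Euc m) :
    affineHomeo S x₀ x = x₀ + S x := rfl

theorem contDiff_affineHomeo (S : Euc m ≃L[ℝ] Euc m) (x₀ : Euc m) {n : WithTop ℕ∞} :
    ContDiff ℝ n (affineHomeo S x₀) := contDiff_const.add S.contDiff

theorem contDiff_affineHomeo_symm (S : Euc m ≃L[ℝ] Euc m) (x₀ : Euc m) {n : WithTop ℕ∞} :
    ContDiff ℝ n (affineHomeo S x₀).symm := S.symm.contDiff.comp (contDiff_const.add contDiff_id)

theorem hasFDerivAt_affineHomeo (S : Euc m ≃L[ℝ] Euc m) (x₀ x : Euc m) :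
    HasFDerivAt (affineHomeo S x₀) (S : Euc m →L[ℝ] Euc m) x :=
  (S.hasFDerivAt).const_add x₀

theorem fderiv_comp_affineHomeo {F : Type*} [NormedAddCommGroup F] [NormedSpace ℝ F]
    (S : Euc m ≃L[ℝ] Euc m) (x₀ : Euc m) {φ : Euc m → F} {x : Euc m}
    (hφ : DifferentiableAt ℝ φ (affineHomeo S x₀ x)) (e : Euc m) :
    fderiv ℝ (fun x => φ (affineHomeo S x₀ x)) x e = fderiv ℝ φ (affineHomeo S x₀ x) (S e) := by
  have h : HasFDerivAt (fun x => φ (affineHomeo S x₀ x)) _ x :=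
    hφ.hasFDerivAt.comp x (hasFDerivAt_affineHomeo S x₀ x)
  rw [h.fderiv]
  rfl

/-- The constant is the inverse of `|det S|`. It is common to all sets and integrands, so identities
between integrals are transported without knowing its value. -/
theorem exists_map_affineHomeo (S : Euc m ≃L[ℝ] Euc m) (x₀ : Euc m) :
    ∃ c : ℝ≥0∞, c ≠ 0 ∧ c ≠ ⊤ ∧ Measure.map (affineHomeo S x₀) volume = c • volume := by
  have hdet : LinearMap.det ((S : Euc m →L[ℝ] Euc m) : Euc m →ₗ[ℝ] Euc m) ≠ 0 :=
    (LinearEquiv.isUnit_det' S.toLinearEquiv).ne_zero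
  refine ⟨ENNReal.ofReal |(LinearMap.det ((S : Euc m →L[ℝ] Euc m) : Euc m →ₗ[ℝ] Euc m))⁻¹|, ?_,
    ENNReal.ofReal_ne_top, ?_⟩
  · rw [Ne, ENNReal.ofReal_eq_zero, not_le]
    positivity
  · have h1 := Measure.map_linearMap_addHaar_eq_smul_addHaar (volume : Measure (Euc m)) hdet
    have h2 : Measure.map (fun x => x₀ + x) (Measure.map S (volume : Measure (Euc m)))
        = Measure.map (affineHomeo S x₀) volume :=
      Measure.map_map (measurable_const_add x₀) S.continuous.measurable
    rw [← h2]
    have h3 : Measure.map S (volume : Measure (Euc m)) = ENNReal.ofReal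
      |(LinearMap.det ((S : Euc m →L[ℝ] Euc m) : Euc m →ₗ[ℝ] Euc m))⁻¹| • volume := h1
    rw [h3, Measure.map_smul, map_add_left_eq_self]

theorem exists_integral_comp_affineHomeo (S : Euc m ≃L[ℝ] Euc m) (x₀ : Euc m) (F : Type*)
    [NormedAddCommGroup F] [NormedSpace ℝ F] :
    ∃ c : ℝ, ∀ (U : Set (Euc m)) (f : Euc m → F),
      ∫ x in affineHomeo S x₀ ⁻¹' U, f (affineHomeo S x₀ x) = c • ∫ x in U, f x := by
  obtain ⟨c, -, -, h⟩ := exists_map_affineHomeo S x₀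
  refine ⟨c.toReal, fun U f => ?_⟩
  rw [← (affineHomeo S x₀).measurableEmbedding.setIntegral_map f U, h, Measure.restrict_smul,
    integral_smul_measure]

theorem integral_comp_affineHomeo_eq_zero (S : Euc m ≃L[ℝ] Euc m) (x₀ : Euc m)
    {f : Euc m → ℝ} (h : ∫ x, f x = 0) : ∫ x, f (affineHomeo S x₀ x) = 0 := by
  obtain ⟨c, hc⟩ := exists_integral_comp_affineHomeo S x₀ ℝ
  have := hc univ f
  rwa [preimage_univ, setIntegral_univ, setIntegral_univ, h, smul_zero] at this

theorem memLp_comp_affineHomeo {F : Type*} [NormedAddCommGroup F] (S : Euc m ≃L[ℝ] Euc m)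
    (x₀ : Euc m) {U : Set (Euc m)} {f : Euc m → F} {p : ℝ≥0∞}
    (hf : MemLp f p (volume.restrict U)) :
    MemLp (fun x => f (affineHomeo S x₀ x)) p (volume.restrict (affineHomeo S x₀ ⁻¹' U)) := by
  obtain ⟨c, -, hc, h⟩ := exists_map_affineHomeo S x₀
  have e : Measure.map (affineHomeo S x₀) (volume.restrict (affineHomeo S x₀ ⁻¹' U))
      = c • volume.restrict U := by
    rw [← (affineHomeo S x₀).measurableEmbedding.restrict_map, h, Measure.restrict_smul]
  exact ((affineHomeo S x₀).measurableEmbedding.memLp_map_measure_iff).mp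
    (e ▸ hf.smul_measure hc)

theorem locallyIntegrableOn_comp_affineHomeo {F : Type*} [NormedAddCommGroup F]
    (S : Euc m ≃L[ℝ] Euc m) (x₀ : Euc m) {U : Set (Euc m)} (hU : IsOpen U) {f : Euc m → F}
    (hf : LocallyIntegrableOn f U) :
    LocallyIntegrableOn (fun x => f (affineHomeo S x₀ x)) (affineHomeo S x₀ ⁻¹' U) := by
  rw [locallyIntegrableOn_iff (hU.preimage (affineHomeo S x₀).continuous).isLocallyClosed]
  intro k hk hkc
  have h1 : IntegrableOn f (affineHomeo S x₀ '' k) :=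
    hf.integrableOn_compact_subset (image_subset_iff.mpr hk)
      (hkc.image (affineHomeo S x₀).continuous)
  have := memLp_comp_affineHomeo S x₀ (memLp_one_iff_integrable.mpr h1)
  rwa [preimage_image_eq _ (affineHomeo S x₀).injective, memLp_one_iff_integrable] at this

variable {S : Euc m ≃L[ℝ] Euc m} (hS : ∀ ξ ζ, ⟪S ξ, ζ⟫_ℝ = ⟪ξ, S ζ⟫_ℝ) (x₀ : Euc m)

include hS in
theorem gradient_comp_affineHomeo {φ : Euc m → ℝ} {x : Euc m}
    (hφ : DifferentiableAt ℝ φ (affineHomeo S x₀ x)) :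
    gradient (fun x => φ (affineHomeo S x₀ x)) x = S (gradient φ (affineHomeo S x₀ x)) := by
  refine ext_inner_right ℝ fun e => ?_
  rw [inner_gradient_eq_fderiv, fderiv_comp_affineHomeo S x₀ hφ, hS, inner_gradient_eq_fderiv]

/-- Every test function on the preimage is a composition with the affine map, so the transported
identities need only be checked on such compositions. -/
theorem exists_comp_affineHomeo_eq {n : WithTop ℕ∞} {U : Set (Euc m)} {φ : Euc m → ℝ}
    (hφ : ContDiff ℝ n φ) (hs : HasCompactSupport φ) (hU : tsupport φ ⊆ affineHomeo S x₀ ⁻¹' U) :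
    ∃ ψ : Euc m → ℝ, ContDiff ℝ n ψ ∧ HasCompactSupport ψ ∧ tsupport ψ ⊆ U ∧
      φ = fun x => ψ (affineHomeo S x₀ x) := by
  have hsub : tsupport (fun y => φ ((affineHomeo S x₀).symm y)) ⊆ affineHomeo S x₀ '' tsupport φ :=
    closure_minimal (fun y hy => ⟨(affineHomeo S x₀).symm y, subset_tsupport _ hy, by simp⟩)
      ((affineHomeo S x₀).isClosedMap _ (isClosed_tsupport φ))
  refine ⟨fun y => φ ((affineHomeo S x₀).symm y), hφ.comp (contDiff_affineHomeo_symm S x₀),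
    (hs.isCompact.image (affineHomeo S x₀).continuous).of_isClosed_subset (isClosed_tsupport _) hsub,
    hsub.trans (image_subset_iff.mpr hU), by simp⟩

include hS in
-- By the symmetry of `S`, the gradients of the test function and of `w` both transform by the
-- application of `S`, and the Jacobian factor is the same on the two sides.
theorem IsWeakGradient.comp_affineHomeo {U : Set (Euc m)} (hU : IsOpen U) {w : Euc m → ℝ}
    {G : Euc m → Euc m} (h : IsWeakGradient U w G) :
    IsWeakGradient (affineHomeo S x₀ ⁻¹' U) (fun x => w (affineHomeo S x₀ x))
      (fun x => S (G (affineHomeo S x₀ x))) := by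
  refine ⟨locallyIntegrableOn_comp_affineHomeo S x₀ hU h.1, ?_, ?_⟩
  · have h2 := locallyIntegrableOn_comp_affineHomeo S x₀ hU h.2.1
    intro x hx
    obtain ⟨t, ht, hi⟩ := h2 x hx
    exact ⟨t, ht, (S : Euc m →L[ℝ] Euc m).integrable_comp hi⟩
  · rintro φ ⟨hφ, hs, hφU⟩
    obtain ⟨ψ, hψ, hψs, hψU, rfl⟩ := exists_comp_affineHomeo_eq x₀ hφ hs hφU
    obtain ⟨c, hc⟩ := exists_integral_comp_affineHomeo S x₀ (Euc m)
    have hd : ∀ x, gradient (fun x => ψ (affineHomeo S x₀ x)) x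
        = S (gradient ψ (affineHomeo S x₀ x)) := fun x => gradient_comp_affineHomeo hS x₀
      (hψ.differentiable (by simp) _)
    have key := h.2.2 ψ ⟨hψ, hψs, hψU⟩
    simp_rw [hd, ← map_smul]
    rw [S.integral_comp_comm, S.integral_comp_comm, hc U fun y => w y • gradient ψ y,
      hc U fun y => ψ y • G y, key, smul_neg, map_neg]

include hS in
theorem MemH1.comp_affineHomeo {U : Set (Euc m)} (hU : IsOpen U) {w : Euc m → ℝ}
    (h : MemH1 U w) :
    MemH1 (affineHomeo S x₀ ⁻¹' U) (fun x => w (affineHomeo S x₀ x)) ∧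
      weakGrad (affineHomeo S x₀ ⁻¹' U) (fun x => w (affineHomeo S x₀ x))
        =ᵐ[volume.restrict (affineHomeo S x₀ ⁻¹' U)]
          fun x => S (weakGrad U w (affineHomeo S x₀ x)) := by
  have hg := h.isWeakGradient.comp_affineHomeo hS x₀ hU
  have hm : MemH1 (affineHomeo S x₀ ⁻¹' U) (fun x => w (affineHomeo S x₀ x)) :=
    ⟨memLp_comp_affineHomeo S x₀ h.1, _, hg,
      (S : Euc m →L[ℝ] Euc m).comp_memLp' (memLp_comp_affineHomeo S x₀ (h.memLp_weakGrad hU))⟩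
  exact ⟨hm, hm.isWeakGradient.ae_eq (hU.preimage (affineHomeo S x₀).continuous) hg⟩

/-- The operators `S⁻¹ B(T x) S⁻¹`. -/
def affineOp (S : Euc m ≃L[ℝ] Euc m) (x₀ : Euc m) (B : Euc m → Euc m →L[ℝ] Euc m) (x : Euc m) :
    Euc m →L[ℝ] Euc m :=
  (S.symm : Euc m →L[ℝ] Euc m) ∘L (B (affineHomeo S x₀ x) ∘L (S.symm : Euc m →L[ℝ] Euc m))

include hS in
theorem inner_symm_comm (ξ ζ : Euc m) : ⟪S.symm ξ, ζ⟫_ℝ = ⟪ξ, S.symm ζ⟫_ℝ := by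
  have := hS (S.symm ξ) (S.symm ζ)
  simpa using this.symm

theorem contDiffOn_affineOp {U : Set (Euc m)} {B : Euc m → Euc m →L[ℝ] Euc m}
    (hB : ContDiffOn ℝ 1 B U) : ContDiffOn ℝ 1 (affineOp S x₀ B) (affineHomeo S x₀ ⁻¹' U) :=
  contDiffOn_const.clm_comp ((hB.comp (contDiff_affineHomeo S x₀).contDiffOn
    fun _ hx => hx).clm_comp contDiffOn_const)

theorem fderiv_affineOp {B : Euc m → Euc m →L[ℝ] Euc m} {x : Euc m}
    (hB : DifferentiableAt ℝ B (affineHomeo S x₀ x)) (e ξ : Euc m) :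
    fderiv ℝ (affineOp S x₀ B) x e ξ
      = S.symm (fderiv ℝ B (affineHomeo S x₀ x) (S e) (S.symm ξ)) := by
  have h1 : HasFDerivAt (fun x => B (affineHomeo S x₀ x))
      (fderiv ℝ B (affineHomeo S x₀ x) ∘L (S : Euc m →L[ℝ] Euc m)) x :=
    hB.hasFDerivAt.comp x (hasFDerivAt_affineHomeo S x₀ x)
  have h2 := ((hasFDerivAt_const (S.symm : Euc m →L[ℝ] Euc m) x).clm_comp
    (h1.clm_comp (hasFDerivAt_const (S.symm : Euc m →L[ℝ] Euc m) x)))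
  have h3 : HasFDerivAt (affineOp S x₀ B) _ x := h2
  rw [h3.fderiv]
  simp

include hS in
-- The densities are pointwise invariant: the factors `S⁻¹` of the new operator cancel the factors
-- `S` of the new gradients, and a variation in the direction `e` becomes one in the direction `S
-- e`.
theorem IsCritical.comp_affineHomeo {ℓ : ℕ} {Ω : Set (Euc m)} (hΩ : IsOpen Ω)
    {B : Euc m → Euc m →L[ℝ] Euc m} {F v : Fin ℓ → Euc m → ℝ} {G : Fin ℓ → Euc m → Euc m}
    (h : IsCritical Ω B F v G) :
    IsCritical (affineHomeo S x₀ ⁻¹' Ω) (affineOp S x₀ B) (fun i x => F i (affineHomeo S x₀ x))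
      (fun i x => v i (affineHomeo S x₀ x)) (fun i x => S (G i (affineHomeo S x₀ x))) := by
  have hT : MapsTo (affineHomeo S x₀) (affineHomeo S x₀ ⁻¹' Ω) Ω := fun _ hx => hx
  have hTc := (affineHomeo S x₀).continuous.continuousOn (s := affineHomeo S x₀ ⁻¹' Ω)
  refine ⟨fun i => (S : Euc m →L[ℝ] Euc m).comp_memLp' (memLp_comp_affineHomeo S x₀ (h.memLp i)),
    fun i => (h.continuousOn i).comp hTc hT, fun i => (h.continuousOn_reaction i).comp hTc hT,
    contDiffOn_affineOp x₀ h.contDiffOn, fun x hx ξ ζ => ?_, ?_, ?_, ?_⟩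
  · have := h.symm _ hx (S.symm ξ) (S.symm ζ)
    simp only [affineOp, ContinuousLinearMap.comp_apply, ContinuousLinearEquiv.coe_coe]
    rw [inner_symm_comm hS, this, inner_symm_comm hS]
  · intro η hη hs hηU e
    obtain ⟨ψ, hψ, hψs, hψU, rfl⟩ := exists_comp_affineHomeo_eq x₀ hη hs hηU
    have key := h.variation ψ hψ hψs hψU (S e)
    obtain ⟨c, hc⟩ := exists_integral_comp_affineHomeo S x₀ ℝ
    have hpt : ∀ i x, variationDensity (fun x => S (G i (affineHomeo S x₀ x))) (affineOp S x₀ B)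
        (fun x => F i (affineHomeo S x₀ x)) (fun x => ψ (affineHomeo S x₀ x)) e x
        = variationDensity (G i) B (F i) ψ (S e) (affineHomeo S x₀ x) := fun i x => by
      by_cases hx : affineHomeo S x₀ x ∈ tsupport ψ
      · have hB : DifferentiableAt ℝ B (affineHomeo S x₀ x) :=
          (h.contDiffOn.contDiffAt (hΩ.mem_nhds (hψU hx))).differentiableAt one_ne_zero
        simp only [variationDensity, fderiv_affineOp x₀ hB,
          fderiv_comp_affineHomeo S x₀ (hψ.differentiable one_ne_zero _), affineOp,
          ContinuousLinearMap.comp_apply, ContinuousLinearEquiv.coe_coe,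
          ContinuousLinearEquiv.symm_apply_apply, ContinuousLinearEquiv.apply_symm_apply,
          inner_symm_comm hS, hS]
      · simp [variationDensity, fderiv_comp_affineHomeo S x₀ (hψ.differentiable one_ne_zero _),
          image_eq_zero_of_notMem_tsupport hx, fderiv_eq_zero_of_notMem_tsupport hx]
    simp_rw [hpt]
    have h2 : ∀ i, (∫ x, variationDensity (G i) B (F i) ψ (S e) (affineHomeo S x₀ x))
        = c • ∫ x, variationDensity (G i) B (F i) ψ (S e) x := fun i => by
      simpa using hc univ (variationDensity (G i) B (F i) ψ (S e))
    simp_rw [h2, ← Finset.smul_sum, key, smul_zero]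
  · intro i η hη hs hηU
    obtain ⟨ψ, hψ, hψs, hψU, rfl⟩ := exists_comp_affineHomeo_eq x₀ hη hs hηU
    rw [← integral_comp_affineHomeo_eq_zero S x₀ (h.energy i ψ hψ hψs hψU)]
    refine integral_congr_ae (Eventually.of_forall fun x => ?_)
    simp only [gradient_comp_affineHomeo hS x₀ (hψ.differentiable one_ne_zero _), affineOp,
      ContinuousLinearMap.comp_apply, ContinuousLinearEquiv.coe_coe,
      ContinuousLinearEquiv.symm_apply_apply, hS, ← map_smul, ← map_add,
      ContinuousLinearEquiv.apply_symm_apply]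
  · intro i η hη hs hηU e
    obtain ⟨ψ, hψ, hψs, hψU, rfl⟩ := exists_comp_affineHomeo_eq x₀ hη hs hηU
    rw [← integral_comp_affineHomeo_eq_zero S x₀ (h.square i ψ hψ hψs hψU (S e))]
    refine integral_congr_ae (Eventually.of_forall fun x => ?_)
    simp only [fderiv_comp_affineHomeo S x₀ (hψ.differentiable one_ne_zero _), hS]

end Affine

/-! ### Polar coordinates -/

section Polar

theorem sphereIntegral_eq (hm : 1 ≤ m) (r : ℝ) (g : Euc m → ℝ) : sphereIntegral r g
    = r ^ (m - 1) * ∫ s : sphere (0 : Euc m) 1, g (r • (s : Euc m))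
        ∂(volume : Measure (Euc m)).toSphere := by
  rw [sphereIntegral, ← zpow_natCast, Nat.cast_sub hm, Nat.cast_one]

/-- Fubini on sphere times half-line. The radial measure has the density `r ^ (m - 1)`, which is
positive on the half-line; hence its null sets are those of Lebesgue measure, and it supplies the
factor in `sphereIntegral`. -/
theorem polar_coordinates (hm : 1 ≤ m) {g : Euc m → ℝ} (hg : Integrable g) :
    (∀ᵐ r ∂volume.restrict (Ioi (0 : ℝ)), Integrable (fun s : sphere (0 : Euc m) 1 =>
      g (r • (s : Euc m))) (volume : Measure (Euc m)).toSphere) ∧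
    IntegrableOn (fun r => sphereIntegral r g) (Ioi 0) ∧
    ∫ x, g x = ∫ r in Ioi (0 : ℝ), sphereIntegral r g := by
  have hdim : Module.finrank ℝ (Euc m) = m := finrank_euclideanSpace_fin
  have : Nontrivial (Euc m) := Module.nontrivial_of_finrank_pos (R := ℝ) (by rw [hdim]; omega)
  set σ := (volume : Measure (Euc m)).toSphere
  have hmp := (volume : Measure (Euc m)).measurePreserving_homeomorphUnitSphereProd
  have hemb := (homeomorphUnitSphereProd (Euc m)).measurableEmbedding
  rw [hdim] at hmp
  set G : sphere (0 : Euc m) 1 × Ioi (0 : ℝ) → ℝ := fun p => g ((p.2 : ℝ) • (p.1 : Euc m)) with hG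
  have hGh : ∀ x : ({0}ᶜ : Set (Euc m)), G (homeomorphUnitSphereProd (Euc m) x) = g x := fun x => by
    have := congrArg Subtype.val ((homeomorphUnitSphereProd (Euc m)).symm_apply_apply x)
    rw [homeomorphUnitSphereProd_symm_apply_coe] at this
    simp only [hG, this]
  have h1 : Integrable G (σ.prod (Measure.volumeIoiPow (m - 1))) := by
    rw [← hmp.integrable_comp_emb hemb]
    have h0 : Integrable (g ∘ Subtype.val) (Measure.comap (Subtype.val : ({0}ᶜ : Set (Euc m)) → _)
        volume) := by
      rw [← integrableOn_iff_comap_subtypeVal (measurableSet_singleton _).compl]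
      exact hg.integrableOn
    exact h0.congr (Eventually.of_forall fun x => (hGh x).symm)
  have hmeas : Measurable fun r : Ioi (0 : ℝ) => (r.1 ^ (m - 1)).toNNReal := by fun_prop
  have hvol : Measure.volumeIoiPow (m - 1) = (Measure.comap (Subtype.val : Ioi (0 : ℝ) → ℝ)
      volume).withDensity fun r => ((r.1 ^ (m - 1)).toNNReal : ℝ≥0∞) := rfl
  have hsm : ∀ r : Ioi (0 : ℝ), (r.1 ^ (m - 1)).toNNReal • (∫ s, G (s, r) ∂σ)
      = sphereIntegral r.1 g := fun r => by
    rw [sphereIntegral_eq hm, NNReal.smul_def, Real.coe_toNNReal _ (by have := r.2.out; positivity),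
      smul_eq_mul]
  refine ⟨?_, ?_, ?_⟩
  · have h2 := h1.prod_left_ae
    rw [hvol, ae_withDensity_iff hmeas.coe_nnreal_ennreal] at h2
    rw [ae_restrict_iff_subtype measurableSet_Ioi]
    filter_upwards [h2] with r hr
    refine hr ?_
    have := r.2.out
    simp only [ne_eq, ENNReal.coe_eq_zero, Real.toNNReal_eq_zero, not_le]
    positivity
  · have h2 := h1.integral_prod_right
    rw [hvol, integrable_withDensity_iff_integrable_smul hmeas] at h2
    rw [integrableOn_iff_comap_subtypeVal measurableSet_Ioi]
    exact h2.congr (Eventually.of_forall hsm)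
  · have e1 : ∫ x, g x = ∫ x : ({0}ᶜ : Set (Euc m)), g x ∂(Measure.comap Subtype.val volume) := by
      rw [integral_subtype_comap (measurableSet_singleton _).compl, restrict_compl_singleton]
    have e2 := hmp.integral_comp hemb G
    simp_rw [hGh] at e2
    rw [e1, e2, integral_prod_symm _ h1, hvol, integral_withDensity_eq_integral_smul hmeas]
    simp_rw [hsm]
    exact integral_subtype_comap measurableSet_Ioi fun r => sphereIntegral r g

theorem sphereIntegral_congr {r : ℝ} {g h : Euc m → ℝ} (hr : 0 ≤ r)
    (H : ∀ x : Euc m, ‖x‖ = r → g x = h x) : sphereIntegral r g = sphereIntegral r h := by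
  rw [sphereIntegral, sphereIntegral]
  congr 1
  refine integral_congr_ae (Eventually.of_forall fun s => H _ ?_)
  rw [norm_smul, Real.norm_of_nonneg hr, norm_eq_of_mem_sphere s, mul_one]

theorem sphereIntegral_const_mul (r c : ℝ) (g : Euc m → ℝ) :
    sphereIntegral r (fun x => c * g x) = c * sphereIntegral r g := by
  rw [sphereIntegral, sphereIntegral, integral_const_mul]
  ring

/-- Integrability over the sphere of radius `r`. -/
def SphereIntegrable (r : ℝ) (g : Euc m → ℝ) : Prop :=
  Integrable (fun s : sphere (0 : Euc m) 1 => g (r • (s : Euc m)))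
    (volume : Measure (Euc m)).toSphere

theorem SphereIntegrable.sphereIntegral_add {r : ℝ} {g h : Euc m → ℝ} (hg : SphereIntegrable r g)
    (hh : SphereIntegrable r h) :
    sphereIntegral r (fun x => g x + h x) = sphereIntegral r g + sphereIntegral r h := by
  simp only [sphereIntegral]
  rw [integral_add hg hh]
  ring

theorem SphereIntegrable.sphereIntegral_sub {r : ℝ} {g h : Euc m → ℝ} (hg : SphereIntegrable r g)
    (hh : SphereIntegrable r h) :
    sphereIntegral r (fun x => g x - h x) = sphereIntegral r g - sphereIntegral r h := by
  simp only [sphereIntegral]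
  rw [integral_sub hg hh]
  ring

theorem sphereIntegral_sum {ι : Type*} {t : Finset ι} {r : ℝ} {g : ι → Euc m → ℝ}
    (hg : ∀ i ∈ t, SphereIntegrable r (g i)) :
    sphereIntegral r (fun x => ∑ i ∈ t, g i x) = ∑ i ∈ t, sphereIntegral r (g i) := by
  simp only [sphereIntegral]
  rw [integral_finsetSum _ hg, Finset.mul_sum]

theorem sphereIntegral_mono {r : ℝ} (hr : 0 < r) {g h : Euc m → ℝ} (hg : SphereIntegrable r g)
    (hh : SphereIntegrable r h) (H : ∀ x : Euc m, ‖x‖ = r → g x ≤ h x) :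
    sphereIntegral r g ≤ sphereIntegral r h := by
  rw [sphereIntegral, sphereIntegral]
  refine mul_le_mul_of_nonneg_left (integral_mono hg hh fun s => H _ ?_) (by positivity)
  rw [norm_smul, Real.norm_of_nonneg hr.le, norm_eq_of_mem_sphere s, mul_one]

theorem SphereIntegrable.congr {r : ℝ} (hr : 0 ≤ r) {g h : Euc m → ℝ} (hg : SphereIntegrable r g)
    (H : ∀ x : Euc m, ‖x‖ = r → g x = h x) : SphereIntegrable r h := by
  refine Integrable.congr hg (Eventually.of_forall fun s => H _ ?_)
  rw [norm_smul, Real.norm_of_nonneg hr, norm_eq_of_mem_sphere s, mul_one]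

theorem sphereIntegrable_of_continuousOn {R r : ℝ} (hr : 0 ≤ r) (hrR : r < R) {g : Euc m → ℝ}
    (hg : ContinuousOn g (ball 0 R)) : SphereIntegrable r g := by
  have hc : Continuous fun s : sphere (0 : Euc m) 1 => g (r • (s : Euc m)) := by
    refine hg.comp_continuous (by fun_prop) fun s => ?_
    rw [mem_ball_zero_iff, norm_smul, Real.norm_of_nonneg hr, norm_eq_of_mem_sphere s, mul_one]
    exact hrR
  exact hc.integrable_of_hasCompactSupport (HasCompactSupport.of_compactSpace _)

theorem continuousOn_sphereIntegral {R : ℝ} {g : Euc m → ℝ}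
    (hg : ContinuousOn g (ball 0 R)) : ContinuousOn (fun r => sphereIntegral r g) (Ioo 0 R) := by
  have h1 : ContinuousOn (fun r : ℝ => ∫ s : sphere (0 : Euc m) 1, g (r • (s : Euc m))
      ∂(volume : Measure (Euc m)).toSphere) (Ioo 0 R) := by
    have hc : ContinuousOn (Function.uncurry fun (r : ℝ) (s : sphere (0 : Euc m) 1) =>
        g (r • (s : Euc m))) (Ioo 0 R ×ˢ univ) := by
      refine hg.comp (Continuous.continuousOn (by fun_prop)) fun p hp => ?_
      rw [mem_ball_zero_iff, norm_smul, norm_eq_of_mem_sphere p.2, mul_one,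
        Real.norm_of_nonneg hp.1.1.le]
      exact hp.1.2
    have := continuousOn_integral_of_compact_support (μ := (volume : Measure (Euc m)).toSphere)
      isCompact_univ hc (fun p x _ hx => absurd (mem_univ _) hx)
    exact this
  exact (continuousOn_id.zpow₀ _ fun r hr => Or.inl hr.1.ne').mul h1

section Ball

variable (hm : 1 ≤ m) {R : ℝ} {g : Euc m → ℝ} (hg : IntegrableOn g (ball 0 R))

theorem sphereIntegral_indicator_ball {r : ℝ} (hr : 0 ≤ r) (g : Euc m → ℝ) :
    sphereIntegral r ((ball (0 : Euc m) R).indicator g) = (Iio R).indicator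
      (fun r => sphereIntegral r g) r := by
  by_cases h : r < R
  · rw [indicator_of_mem (show r ∈ Iio R from h)]
    exact sphereIntegral_congr hr fun x hx => indicator_of_mem (by simpa [hx] using h) _
  · rw [indicator_of_notMem (show r ∉ Iio R from h)]
    rw [sphereIntegral_congr (h := fun _ => 0) hr fun x hx =>
      indicator_of_notMem (by simpa [hx] using h) _]
    simp [sphereIntegral]

include hm hg in
theorem ae_sphereIntegrable : ∀ᵐ r ∂volume.restrict (Ioo 0 R), SphereIntegrable r g := by
  have h := (polar_coordinates hm ((integrable_indicator_iff measurableSet_ball).mpr hg)).1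
  rw [ae_restrict_iff' measurableSet_Ioi] at h
  rw [ae_restrict_iff' measurableSet_Ioo]
  filter_upwards [h] with r hr hrR
  exact SphereIntegrable.congr hrR.1.le (hr hrR.1) fun x hx =>
    indicator_of_mem (by simpa [hx] using hrR.2) _

include hm hg in
theorem integrableOn_sphereIntegral : IntegrableOn (fun r => sphereIntegral r g) (Ioo 0 R) := by
  have h := (polar_coordinates hm ((integrable_indicator_iff measurableSet_ball).mpr hg)).2.1
  refine (h.mono_set Ioo_subset_Ioi_self).congr_fun (fun r hr => ?_) measurableSet_Ioo
  beta_reduce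
  rw [sphereIntegral_indicator_ball hr.1.le, indicator_of_mem (show r ∈ Iio R from hr.2)]

include hm hg in
theorem integral_ball_eq : ∫ x in ball 0 R, g x = ∫ r in Ioo 0 R, sphereIntegral r g := by
  have h := (polar_coordinates hm ((integrable_indicator_iff measurableSet_ball).mpr hg)).2.2
  rw [integral_indicator measurableSet_ball] at h
  rw [h, setIntegral_congr_fun measurableSet_Ioi fun r hr =>
    sphereIntegral_indicator_ball (show (0:ℝ) < r from hr).le g, setIntegral_indicator measurableSet_Iio]
  rfl

include hm hg in
theorem integral_ball_eq_intervalIntegral {r : ℝ} (hr : r ∈ Icc 0 R) :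
    ∫ x in ball 0 r, g x = ∫ t in 0..r, sphereIntegral t g := by
  rw [integral_ball_eq hm (hg.mono_set (ball_subset_ball hr.2)), intervalIntegral.integral_of_le hr.1,
    integral_Ioc_eq_integral_Ioo]

include hm hg in
theorem intervalIntegrable_sphereIntegral (hR : 0 ≤ R) :
    IntervalIntegrable (fun r => sphereIntegral r g) volume 0 R := by
  rw [intervalIntegrable_iff_integrableOn_Ioo_of_le hR]
  exact integrableOn_sphereIntegral hm hg

include hm hg in
-- The integral over the ball is a primitive of an integrable function of the radius, so Lebesgue's
-- differentiation theorem applies.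
theorem ae_hasDerivAt_integral_ball :
    ∀ᵐ r ∂volume.restrict (Ioo 0 R), HasDerivAt (fun r => ∫ x in ball 0 r, g x)
      (sphereIntegral r g) r := by
  rcases le_or_gt R 0 with hR | hR
  · simp [Ioo_eq_empty_of_le hR]
  have h := (intervalIntegrable_sphereIntegral hm hg hR.le).ae_hasDerivAt_integral
  rw [ae_restrict_iff' measurableSet_Ioo]
  filter_upwards [h] with r hr hrR
  have h1 := hr (by rw [uIcc_of_le hR.le]; exact Ioo_subset_Icc_self hrR) 0 left_mem_uIcc
  refine h1.congr_of_eventuallyEq ?_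
  filter_upwards [Ioo_mem_nhds hrR.1 hrR.2] with t ht
  exact integral_ball_eq_intervalIntegral hm hg (Ioo_subset_Icc_self ht)

include hm hg in
theorem absolutelyContinuous_integral_ball (hR : 0 ≤ R) :
    AbsolutelyContinuousOnInterval (fun r => ∫ t in 0..r, sphereIntegral t g) 0 R :=
  (intervalIntegrable_sphereIntegral hm hg hR).absolutelyContinuousOnInterval_intervalIntegral
    left_mem_uIcc

include hm hg in
/-- Passage from radial test functions to an identity on almost every sphere. -/
theorem ae_sphereIntegral_eq {P : Euc m → ℝ} (hP : IntegrableOn P (ball 0 R))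
    (H : ∀ ψ : ℝ → ℝ, ContDiff ℝ ∞ ψ → HasCompactSupport ψ → tsupport ψ ⊆ Ioo 0 R →
      ∫ x in ball 0 R, (∫ t in ‖x‖..R, ψ t) * P x = ∫ x in ball 0 R, ψ ‖x‖ * g x) :
    ∀ᵐ r ∂volume.restrict (Ioo 0 R), sphereIntegral r g = ∫ x in ball 0 r, P x := by
  rcases le_or_gt R 0 with hR | hR
  · simp [Ioo_eq_empty_of_le hR]
  have hI : ContinuousOn (fun r => ∫ x in ball 0 r, P x) (Icc 0 R) := by
    have := (absolutelyContinuous_integral_ball hm hP hR.le).continuousOn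
    rw [uIcc_of_le hR.le] at this
    exact this.congr fun r hr => integral_ball_eq_intervalIntegral hm hP hr
  have hIi : IntegrableOn (fun r => ∫ x in ball 0 r, P x) (Ioo 0 R) :=
    (hI.integrableOn_compact isCompact_Icc).mono_set Ioo_subset_Icc_self
  have hSi := integrableOn_sphereIntegral hm hg
  -- The fundamental lemma of the calculus of variations, in the radial variable.
  have key := (isOpen_Ioo (a := (0:ℝ)) (b := R)).ae_eq_zero_of_integral_contDiff_smul_eq_zero
    (μ := volume) (f := fun r => sphereIntegral r g - ∫ x in ball 0 r, P x)
    (hSi.sub hIi).locallyIntegrableOn fun ψ hψ hs hψR => by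
      obtain ⟨C, hC⟩ := hs.exists_bound_of_continuous hψ.continuous
      have hz : ∀ r ∉ Ioo 0 R, ψ r = 0 := fun r hr =>
        image_eq_zero_of_notMem_tsupport fun h => hr (hψR h)
      rw [← setIntegral_eq_integral_of_forall_compl_eq_zero (s := Ioo 0 R)
        fun r hr => by rw [hz r hr, zero_smul]]
      simp only [smul_eq_mul, mul_sub]
      have i1 : IntegrableOn (fun r => ψ r * sphereIntegral r g) (Ioo 0 R) :=
        hSi.bdd_mul hψ.continuous.aestronglyMeasurable (Eventually.of_forall hC)
      have i2 : IntegrableOn (fun r => ψ r * ∫ x in ball 0 r, P x) (Ioo 0 R) :=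
        hIi.bdd_mul hψ.continuous.aestronglyMeasurable (Eventually.of_forall hC)
      rw [integral_sub i1 i2, sub_eq_zero]
      have hψg : IntegrableOn (fun x : Euc m => ψ ‖x‖ * g x) (ball 0 R) :=
        Integrable.bdd_mul hg (hψ.continuous.comp continuous_norm).aestronglyMeasurable
          (Eventually.of_forall fun x => hC ‖x‖)
      have e1 : ∫ x in ball 0 R, ψ ‖x‖ * g x = ∫ r in Ioo 0 R, ψ r * sphereIntegral r g := by
        rw [integral_ball_eq hm hψg]
        refine setIntegral_congr_fun measurableSet_Ioo fun r hr => ?_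
        rw [← sphereIntegral_const_mul]
        exact sphereIntegral_congr hr.1.le fun x hx => by rw [hx]
      rw [← e1, ← H ψ hψ hs hψR]
      -- Fubini over the region `‖x‖ < t`: integrating in `t` first gives the radial cutoff,
      -- integrating in `x` first gives the integral of `P` over the ball of radius `t`.
      have hprod : Integrable (Function.uncurry fun (x : Euc m) (t : ℝ) =>
          (if ‖x‖ < t then (1 : ℝ) else 0) * (ψ t * P x))
          ((volume.restrict (ball 0 R)).prod (volume.restrict (Ioo 0 R))) := by
        have h0 : Integrable (fun p : Euc m × ℝ => P p.1 * ψ p.2)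
            ((volume.restrict (ball 0 R)).prod (volume.restrict (Ioo 0 R))) :=
          Integrable.mul_prod hP (hψ.continuous.integrable_of_hasCompactSupport hs).integrableOn
        have hms : Measurable fun p : Euc m × ℝ => if ‖p.1‖ < p.2 then (1 : ℝ) else 0 :=
          Measurable.ite (measurableSet_lt (by fun_prop) (by fun_prop)) measurable_const
            measurable_const
        refine (h0.bdd_mul (c := 1) hms.aestronglyMeasurable (Eventually.of_forall fun p => ?_)).congr
          (Eventually.of_forall fun p => ?_)
        · split_ifs <;> simp
        · simp only [Function.uncurry]; ring
      have e2 := integral_integral_swap hprod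
      have e3 : ∀ x ∈ ball (0 : Euc m) R, (∫ t in Ioo 0 R, (if ‖x‖ < t then (1 : ℝ) else 0)
          * (ψ t * P x)) = (∫ t in ‖x‖..R, ψ t) * P x := fun x hx => by
        rw [mem_ball_zero_iff] at hx
        rw [intervalIntegral.integral_of_le hx.le, integral_Ioc_eq_integral_Ioo,
          ← integral_mul_const]
        have : Ioo ‖x‖ R = Ioo 0 R ∩ Ioi ‖x‖ := by
          ext t
          simp only [mem_Ioo, mem_inter_iff, mem_Ioi]
          constructor
          · rintro ⟨h1, h2⟩; exact ⟨⟨(norm_nonneg x).trans_lt h1, h2⟩, h1⟩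
          · rintro ⟨⟨-, h2⟩, h1⟩; exact ⟨h1, h2⟩
        rw [this, ← setIntegral_indicator measurableSet_Ioi]
        refine integral_congr_ae (Eventually.of_forall fun t => ?_)
        by_cases h : ‖x‖ < t <;> simp [h]
      have e4 : ∀ t ∈ Ioo 0 R, (∫ x in ball (0 : Euc m) R, (if ‖x‖ < t then (1 : ℝ) else 0)
          * (ψ t * P x)) = ψ t * ∫ x in ball 0 t, P x := fun t ht => by
        have : ball (0 : Euc m) t = ball 0 R ∩ ball 0 t := by
          rw [inter_eq_right.mpr (ball_subset_ball ht.2.le)]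
        rw [this, ← setIntegral_indicator measurableSet_ball, ← integral_const_mul]
        refine integral_congr_ae (Eventually.of_forall fun x => ?_)
        by_cases h : ‖x‖ < t <;> simp [h, indicator]
      rw [setIntegral_congr_fun measurableSet_ball e3, setIntegral_congr_fun measurableSet_Ioo e4]
        at e2
      exact e2
  rw [ae_restrict_iff' measurableSet_Ioo]
  filter_upwards [key] with r hr hrR
  exact sub_eq_zero.mp (hr hrR)

end Ball

end Polar

/-! ### Radial test functions -/

section RadialCutoff

theorem hasFDerivAt_norm_euc {x : Euc m} (hx : x ≠ 0) :
    HasFDerivAt (fun x : Euc m => ‖x‖) (innerSL ℝ (unitVec x)) x := by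
  have h := (hasStrictFDerivAt_norm_sq x).hasFDerivAt.sqrt (by positivity)
  simp only [Real.sqrt_sq (norm_nonneg _)] at h
  refine h.congr_fderiv ?_
  ext ξ
  have : ‖x‖ ≠ 0 := norm_ne_zero_iff.mpr hx
  simp [unitVec]
  field_simp

variable {R : ℝ} {ψ : ℝ → ℝ}

theorem exists_Icc_of_tsupport_subset_Ioo (hs : HasCompactSupport ψ) (hψR : tsupport ψ ⊆ Ioo 0 R)
    (hR : 0 < R) : ∃ a b, 0 < a ∧ b < R ∧ 0 < b ∧ (∀ t < a, ψ t = 0) ∧ ∀ t > b, ψ t = 0 := by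
  rcases (tsupport ψ).eq_empty_or_nonempty with h | h
  · have : ∀ t, ψ t = 0 := fun t => image_eq_zero_of_notMem_tsupport (by simp [h])
    exact ⟨1, R / 2, one_pos, by linarith, by linarith, fun t _ => this t, fun t _ => this t⟩
  · obtain ⟨a, ha, ha'⟩ := hs.isCompact.exists_isLeast h
    obtain ⟨b, hb, hb'⟩ := hs.isCompact.exists_isGreatest h
    exact ⟨a, b, (hψR ha).1, (hψR hb).2, (hψR hb).1,
      fun t ht => image_eq_zero_of_notMem_tsupport fun h => absurd (ha' h) (not_le.mpr ht),
      fun t ht => image_eq_zero_of_notMem_tsupport fun h => absurd (hb' h) (not_le.mpr ht)⟩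

/-- The radial cutoff `x ↦ ∫_{|x|}^R ψ`. -/
def radialCutoff (R : ℝ) (ψ : ℝ → ℝ) (x : Euc m) : ℝ := ∫ t in ‖x‖..R, ψ t

theorem radialCutoff_spec (hψ : Continuous ψ) (hs : HasCompactSupport ψ)
    (hψR : tsupport ψ ⊆ Ioo 0 R) (hR : 0 < R) :
    ContDiff ℝ 1 (radialCutoff R ψ : Euc m → ℝ) ∧ HasCompactSupport (radialCutoff R ψ : Euc m → ℝ) ∧
      tsupport (radialCutoff R ψ : Euc m → ℝ) ⊆ ball 0 R ∧
      (∀ x : Euc m, gradient (radialCutoff R ψ) x = (-ψ ‖x‖) • unitVec x) := by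
  obtain ⟨a, b, ha, hbR, hb, hψa, hψb⟩ := exists_Icc_of_tsupport_subset_Ioo hs hψR hR
  have hd : ∀ t, HasDerivAt (fun t => ∫ s in t..R, ψ s) (-ψ t) t := fun t =>
    intervalIntegral.integral_hasDerivAt_left (hψ.intervalIntegrable _ _)
      hψ.stronglyMeasurable.stronglyMeasurableAtFilter hψ.continuousAt
  have hC1 : ContDiff ℝ 1 fun t => ∫ s in t..R, ψ s := by
    rw [contDiff_one_iff_deriv]
    refine ⟨fun t => (hd t).differentiableAt, ?_⟩
    rw [funext fun t => (hd t).deriv]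
    exact hψ.neg
  -- As `ψ` vanishes near `0`, the cutoff is constant near the origin, where the norm is not
  -- differentiable. The gradient formula remains true there since `unitVec 0 = 0`.
  have h0 : (radialCutoff R ψ : Euc m → ℝ) =ᶠ[𝓝 0] fun _ => ∫ s in (0:ℝ)..R, ψ s := by
    filter_upwards [ball_mem_nhds (0 : Euc m) ha] with x hx
    rw [mem_ball_zero_iff] at hx
    have hz : ∫ t in (0:ℝ)..‖x‖, ψ t = 0 := by
      rw [intervalIntegral.integral_congr (g := fun _ => (0:ℝ)), intervalIntegral.integral_zero]
      intro t ht
      rw [uIcc_of_le (norm_nonneg x)] at ht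
      exact hψa t (ht.2.trans_lt hx)
    rw [radialCutoff, ← intervalIntegral.integral_add_adjacent_intervals
      (hψ.intervalIntegrable 0 ‖x‖) (hψ.intervalIntegrable ‖x‖ R), hz, zero_add]
  have hsupp : tsupport (radialCutoff R ψ : Euc m → ℝ) ⊆ closedBall 0 b := by
    refine closure_minimal (fun x hx => ?_) isClosed_closedBall
    by_contra h
    rw [mem_closedBall_zero_iff, not_le] at h
    refine hx ?_
    rw [radialCutoff, intervalIntegral.integral_congr (g := fun _ => (0:ℝ)),
      intervalIntegral.integral_zero]
    intro t ht
    refine hψb t ?_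
    rw [mem_uIcc] at ht
    rcases ht with ht | ht <;> linarith [ht.1]
  have hCx : ∀ x : Euc m, ContDiffAt ℝ 1 (radialCutoff R ψ) x := fun x => by
    by_cases hx : x = 0
    · subst hx
      exact contDiffAt_const.congr_of_eventuallyEq h0
    · exact (hC1.contDiffAt (x := ‖x‖)).comp x (contDiffAt_norm ℝ hx)
  refine ⟨contDiff_iff_contDiffAt.mpr hCx, (isCompact_closedBall 0 b).of_isClosed_subset
    (isClosed_tsupport _) hsupp, hsupp.trans (closedBall_subset_ball hbR), fun x => ?_⟩
  refine ext_inner_right ℝ fun ξ => ?_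
  rw [inner_gradient_eq_fderiv]
  by_cases hx : x = 0
  · subst hx
    rw [h0.fderiv_eq]
    simp [unitVec]
  · have h1 : HasFDerivAt (radialCutoff R ψ : Euc m → ℝ) _ x :=
      (hd ‖x‖).comp_hasFDerivAt x (hasFDerivAt_norm_euc hx)
    rw [h1.fderiv, inner_smul_left]
    simp

theorem fderiv_radialCutoff (hψ : Continuous ψ) (hs : HasCompactSupport ψ)
    (hψR : tsupport ψ ⊆ Ioo 0 R) (hR : 0 < R) (x ξ : Euc m) :
    fderiv ℝ (radialCutoff R ψ) x ξ = -ψ ‖x‖ * ⟪unitVec x, ξ⟫_ℝ := by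
  rw [← inner_gradient_eq_fderiv, (radialCutoff_spec hψ hs hψR hR).2.2.2, inner_smul_left]
  simp

theorem norm_unitVec_le (x : Euc m) : ‖unitVec x‖ ≤ 1 := by
  by_cases hx : x = 0
  · simp [unitVec, hx]
  · rw [unitVec, norm_smul, norm_inv, norm_norm, inv_mul_cancel₀ (norm_ne_zero_iff.mpr hx)]

theorem measurable_unitVec : Measurable (unitVec : Euc m → Euc m) := by
  unfold unitVec
  fun_prop

end RadialCutoff

/-! ### Identities on spheres -/

section Identities

theorem sum_smul_stdVec (x : Euc m) : ∑ k, x k • stdVec k = x := by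
  ext j
  simp [stdVec, Pi.single_apply]

/-- The divergence, as the trace of the derivative. -/
def divTrace (W : Euc m → Euc m) (x : Euc m) : ℝ := ∑ k, fderiv ℝ W x (stdVec k) k

theorem IsCritical.mono {ℓ : ℕ} {Ω U : Set (Euc m)} {B : Euc m → Euc m →L[ℝ] Euc m}
    {F v : Fin ℓ → Euc m → ℝ} {G : Fin ℓ → Euc m → Euc m} (h : IsCritical Ω B F v G)
    (hU : U ⊆ Ω) : IsCritical U B F v G :=
  ⟨fun i => (h.memLp i).mono_measure (Measure.restrict_mono hU le_rfl),
    fun i => (h.continuousOn i).mono hU, fun i => (h.continuousOn_reaction i).mono hU,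
    h.contDiffOn.mono hU, fun x hx => h.symm x (hU hx),
    fun η hη hs hηU => h.variation η hη hs (hηU.trans hU),
    fun i η hη hs hηU => h.energy i η hη hs (hηU.trans hU),
    fun i η hη hs hηU => h.square i η hη hs (hηU.trans hU)⟩

/-- The gradients enter only through integrals. This permits replacing the transformed gradient by
the `weakGrad` of the composed function. -/
theorem IsCritical.congr_ae {ℓ : ℕ} {Ω : Set (Euc m)} (hΩ : IsOpen Ω)
    {B : Euc m → Euc m →L[ℝ] Euc m}
    {F v : Fin ℓ → Euc m → ℝ} {G K : Fin ℓ → Euc m → Euc m} (h : IsCritical Ω B F v G)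
    (hK : ∀ i, G i =ᵐ[volume.restrict Ω] K i) : IsCritical Ω B F v K := by
  have key : ∀ i, ∀ᵐ x, x ∈ Ω → G i x = K i x := fun i =>
    (ae_restrict_iff' hΩ.measurableSet).mp (hK i)
  refine ⟨fun i => (memLp_congr_ae (hK i)).mp (h.memLp i), h.continuousOn, h.continuousOn_reaction,
    h.contDiffOn, h.symm, fun η hη hs hηΩ e => ?_, fun i η hη hs hηΩ => ?_,
    fun i η hη hs hηΩ e => ?_⟩
  · rw [← h.variation η hη hs hηΩ e]
    refine Finset.sum_congr rfl fun i _ => integral_congr_ae ?_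
    filter_upwards [key i] with x hx
    by_cases hx' : x ∈ tsupport η
    · simp only [variationDensity, hx (hηΩ hx')]
    · simp [variationDensity, image_eq_zero_of_notMem_tsupport hx',
        fderiv_eq_zero_of_notMem_tsupport hx']
  · rw [← h.energy i η hη hs hηΩ]
    refine integral_congr_ae ?_
    filter_upwards [key i] with x hx
    by_cases hx' : x ∈ tsupport η
    · simp only [hx (hηΩ hx')]
    · simp [image_eq_zero_of_notMem_tsupport hx', gradient_eq_zero_of_notMem_tsupport hx']
  · rw [← h.square i η hη hs hηΩ e]
    refine integral_congr_ae ?_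
    filter_upwards [key i] with x hx
    by_cases hx' : x ∈ tsupport η
    · simp only [hx (hηΩ hx')]
    · simp [image_eq_zero_of_notMem_tsupport hx', fderiv_eq_zero_of_notMem_tsupport hx']

theorem IsCritical.integrable_variationDensity {ℓ : ℕ} {Ω : Set (Euc m)} (hΩ : IsOpen Ω)
    {B : Euc m → Euc m →L[ℝ] Euc m} {F v : Fin ℓ → Euc m → ℝ} {G : Fin ℓ → Euc m → Euc m}
    (h : IsCritical Ω B F v G) {η : Euc m → ℝ} (hη : ContDiff ℝ 1 η) (hs : HasCompactSupport η)
    (hηΩ : tsupport η ⊆ Ω) (e : Euc m) (i : Fin ℓ) :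
    Integrable (variationDensity (G i) B (F i) η e) := by
  have hk := hs.isCompact
  have hG : MemLp (G i) 2 (volume.restrict (tsupport η)) :=
    (h.memLp i).mono_measure (Measure.restrict_mono hηΩ le_rfl)
  have hc : ContinuousOn (fun x => 2 * (η x * F i x)) (tsupport η) :=
    continuousOn_const.mul (hη.continuous.continuousOn.mul ((h.continuousOn_reaction i).mono hηΩ))
  have h1 : IntegrableOn (variationDensity (G i) B (F i) η e) (tsupport η) := by
    refine (integrable_inner_of_memLp hG ((memLp_clm_apply_of_continuousOn hk
      ((continuousOn_variationOp hΩ h.contDiffOn hη e).mono hηΩ) hG).add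
      (memLp_smul_of_continuousOn hk hc (memLp_of_continuousOn_compact hk
        (continuousOn_const (c := e)) 2)))).congr (Eventually.of_forall fun x => ?_)
    rw [variationDensity_eq]
    rfl
  rwa [integrableOn_iff_integrable_of_support_subset] at h1
  intro x hx
  by_contra hx'
  exact hx (by simp [variationDensity, image_eq_zero_of_notMem_tsupport hx',
        fderiv_eq_zero_of_notMem_tsupport hx'])

theorem ae_sphereIntegral_eq_of_radialCutoff (hm : 1 ≤ m) {R : ℝ} {q P : Euc m → ℝ}
    (hq : IntegrableOn q (ball 0 R)) (hP : IntegrableOn P (ball 0 R))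
    (H : ∀ ψ : ℝ → ℝ, ContDiff ℝ ∞ ψ → HasCompactSupport ψ → tsupport ψ ⊆ Ioo 0 R →
      ∫ x in ball 0 R, (radialCutoff R ψ x * P x - ψ ‖x‖ * q x) = 0) :
    ∀ᵐ r ∂volume.restrict (Ioo 0 R), sphereIntegral r q = ∫ x in ball 0 r, P x := by
  rcases le_or_gt R 0 with hR | hR
  · simp [Ioo_eq_empty_of_le hR]
  refine ae_sphereIntegral_eq hm hq hP fun ψ hψ hs hψR => ?_
  have spec := radialCutoff_spec (m := m) hψ.continuous hs hψR hR
  obtain ⟨C, hC⟩ := hs.exists_bound_of_continuous hψ.continuous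
  obtain ⟨C', hC'⟩ := spec.2.1.exists_bound_of_continuous spec.1.continuous
  have h1 : IntegrableOn (fun x => radialCutoff R ψ x * P x) (ball 0 R) :=
    Integrable.bdd_mul hP spec.1.continuous.aestronglyMeasurable (Eventually.of_forall hC')
  have h2 : IntegrableOn (fun x => ψ ‖x‖ * q x) (ball 0 R) :=
    Integrable.bdd_mul hq (hψ.continuous.comp continuous_norm).aestronglyMeasurable
      (Eventually.of_forall fun x => hC _)
  have := H ψ hψ hs hψR
  rw [integral_sub h1 h2, sub_eq_zero] at this
  exact this

/-- The bulk density of the Pohozaev identity for the field `W`. -/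
def pohozaevDensity (G : Euc m → Euc m) (B : Euc m → Euc m →L[ℝ] Euc m) (F : Euc m → ℝ)
    (W : Euc m → Euc m) (x : Euc m) : ℝ :=
  ⟪fderiv ℝ B x (W x) (G x), G x⟫_ℝ + divTrace W x * ⟪B x (G x), G x⟫_ℝ
    + 2 * (F x * ⟪G x, W x⟫_ℝ) - 2 * ⟪fderiv ℝ W x (B x (G x)), G x⟫_ℝ

/-- The surface density of the Pohozaev identity for the field `W`. -/
def pohozaevFlux (G : Euc m → Euc m) (B : Euc m → Euc m →L[ℝ] Euc m)
    (W : Euc m → Euc m) (x : Euc m) : ℝ :=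
  ⟪unitVec x, W x⟫_ℝ * ⟪B x (G x), G x⟫_ℝ - 2 * (⟪W x, G x⟫_ℝ * ⟪B x (G x), unitVec x⟫_ℝ)

theorem fderiv_mul_component {η : Euc m → ℝ} {W : Euc m → Euc m} {x : Euc m}
    (hη : DifferentiableAt ℝ η x) (hW : DifferentiableAt ℝ W x) (k : Fin m) (ξ : Euc m) :
    fderiv ℝ (fun x => η x * W x k) x ξ = η x * fderiv ℝ W x ξ k + fderiv ℝ η x ξ * W x k := by
  have hk : HasFDerivAt (fun x => W x k)
      ((EuclideanSpace.proj k : Euc m →L[ℝ] ℝ) ∘L fderiv ℝ W x) x :=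
    (EuclideanSpace.proj k : Euc m →L[ℝ] ℝ).hasFDerivAt.comp x hW.hasFDerivAt
  have h : HasFDerivAt (fun x => η x * W x k) _ x := hη.hasFDerivAt.mul hk
  rw [h.fderiv]
  simp
  ring

/-- A variation along the field `η W` is the sum over `k` of variations along `e_k` with cutoff `η
W_k`. The terms with `η` form the bulk density; those with its derivative become the flux when `η`
is radial. -/
theorem sum_variationDensity {η : Euc m → ℝ} {W G : Euc m → Euc m} {x : Euc m}
    {B : Euc m → Euc m →L[ℝ] Euc m} {F : Euc m → ℝ}
    (hη : DifferentiableAt ℝ η x) (hW : DifferentiableAt ℝ W x) :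
    ∑ k, variationDensity G B F (fun x => η x * W x k) (stdVec k) x
      = η x * pohozaevDensity G B F W x + fderiv ℝ η x (W x) * ⟪B x (G x), G x⟫_ℝ
        - 2 * (fderiv ℝ η x (B x (G x)) * ⟪W x, G x⟫_ℝ) := by
  have e1 : ∑ k, W x k * ⟪fderiv ℝ B x (stdVec k) (G x), G x⟫_ℝ
      = ⟪fderiv ℝ B x (W x) (G x), G x⟫_ℝ := by
    conv_rhs => rw [← sum_smul_stdVec (W x)]
    simp only [map_sum, map_smul, sum_apply, smul_apply, sum_inner, inner_smul_left]
    simp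
  have e2 : ∑ k, fderiv ℝ η x (stdVec k) * W x k = fderiv ℝ η x (W x) := by
    conv_rhs => rw [← sum_smul_stdVec (W x)]
    simp only [map_sum, map_smul, smul_eq_mul, mul_comm]
  have e3 : ∀ ζ : Euc m, ∑ k, ζ k * ⟪G x, stdVec k⟫_ℝ = ⟪ζ, G x⟫_ℝ := fun ζ => by
    conv_rhs => rw [← sum_smul_stdVec ζ, sum_inner]
    refine Finset.sum_congr rfl fun k _ => ?_
    rw [inner_smul_left, real_inner_comm]
    simp
  have hterm : ∀ k, variationDensity G B F (fun x => η x * W x k) (stdVec k) x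
      = η x * (W x k * ⟪fderiv ℝ B x (stdVec k) (G x), G x⟫_ℝ)
        + (η x * fderiv ℝ W x (stdVec k) k + fderiv ℝ η x (stdVec k) * W x k)
          * ⟪B x (G x), G x⟫_ℝ
        + 2 * (F x * η x - fderiv ℝ η x (B x (G x))) * (W x k * ⟪G x, stdVec k⟫_ℝ)
        - 2 * η x * (fderiv ℝ W x (B x (G x)) k * ⟪G x, stdVec k⟫_ℝ) := fun k => by
    rw [variationDensity, fderiv_mul_component hη hW, fderiv_mul_component hη hW]
    ring
  simp_rw [hterm]
  rw [Finset.sum_sub_distrib, Finset.sum_add_distrib, Finset.sum_add_distrib, ← Finset.mul_sum,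
    ← Finset.sum_mul, ← Finset.mul_sum, ← Finset.mul_sum, Finset.sum_add_distrib, ← Finset.mul_sum,
    e1, e2, e3, e3, pohozaevDensity, divTrace, real_inner_comm (W x) (G x)]
  ring

variable {ℓ : ℕ} {U : Set (Euc m)} {B : Euc m → Euc m →L[ℝ] Euc m}
  {F v : Fin ℓ → Euc m → ℝ} {G : Fin ℓ → Euc m → Euc m}

section Integrability

variable (hU : IsOpen U) (h : IsCritical U B F v G) {R : ℝ} (hRU : closedBall 0 R ⊆ U)

include h hRU in
theorem IsCritical.memLp_closedBall (i : Fin ℓ) :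
    MemLp (G i) 2 (volume.restrict (closedBall 0 R)) :=
  (h.memLp i).mono_measure (Measure.restrict_mono hRU le_rfl)

include h hRU in
theorem IsCritical.integrableOn_quadratic {K : Euc m → Euc m →L[ℝ] Euc m} (hK : ContinuousOn K U)
    (i : Fin ℓ) : IntegrableOn (fun x => ⟪K x (G i x), G i x⟫_ℝ) (ball 0 R) :=
  IntegrableOn.mono_set (integrable_inner_of_memLp (memLp_clm_apply_of_continuousOn
    (isCompact_closedBall 0 R) (hK.mono hRU) (h.memLp_closedBall hRU i))
    (h.memLp_closedBall hRU i)) ball_subset_closedBall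

include h hRU in
theorem IsCritical.integrableOn_linear {W : Euc m → Euc m} (hW : ContinuousOn W U)
    (i : Fin ℓ) : IntegrableOn (fun x => ⟪G i x, W x⟫_ℝ) (ball 0 R) :=
  IntegrableOn.mono_set (integrable_inner_of_memLp (h.memLp_closedBall hRU i)
    (memLp_of_continuousOn_compact (isCompact_closedBall 0 R) (hW.mono hRU) 2))
    ball_subset_closedBall

theorem continuousOn_divTrace (hU : IsOpen U) {W : Euc m → Euc m} (hW : ContDiffOn ℝ 1 W U) :
    ContinuousOn (divTrace W) U := by
  have h1 := hW.continuousOn_fderiv_of_isOpen hU le_rfl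
  refine continuousOn_finsetSum _ fun k _ => ?_
  exact (EuclideanSpace.proj k : Euc m →L[ℝ] ℝ).continuous.comp_continuousOn
    (h1.clm_apply continuousOn_const)

include hU h hRU in
theorem IsCritical.integrableOn_pohozaevDensity {W : Euc m → Euc m} (hW : ContDiffOn ℝ 1 W U)
    (i : Fin ℓ) : IntegrableOn (pohozaevDensity (G i) B (F i) W) (ball 0 R) := by
  have hB' := h.contDiffOn.continuousOn_fderiv_of_isOpen hU le_rfl
  have hW' := hW.continuousOn_fderiv_of_isOpen hU le_rfl
  have i1 := h.integrableOn_quadratic hRU (hB'.clm_apply hW.continuousOn) i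
  have i2 := h.integrableOn_quadratic hRU
    ((continuousOn_divTrace hU hW).smul h.contDiffOn.continuousOn) i
  have i3 := h.integrableOn_linear hRU ((h.continuousOn_reaction i).smul hW.continuousOn) i
  have i4 := h.integrableOn_quadratic hRU (hW'.clm_comp h.contDiffOn.continuousOn) i
  refine IntegrableOn.congr_fun (((i1.add i2).add (i3.const_mul 2)).sub (i4.const_mul 2))
    (fun x _ => ?_) measurableSet_ball
  simp [pohozaevDensity, inner_smul_left, inner_smul_right]

include h hRU in
theorem IsCritical.integrableOn_flux {W : Euc m → Euc m} (hW : ContinuousOn W U) (i : Fin ℓ) :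
    IntegrableOn (fun x => ⟪W x, G i x⟫_ℝ * ⟪B x (G i x), unitVec x⟫_ℝ) (ball 0 R) := by
  have hk := isCompact_closedBall (0 : Euc m) R
  have hG := h.memLp_closedBall hRU i
  have m1 : MemLp (fun x => ⟪W x, G i x⟫_ℝ) 2 (volume.restrict (closedBall 0 R)) := by
    have hc : ContinuousOn (fun x => innerSL ℝ (W x)) (closedBall 0 R) :=
      (innerSL ℝ).continuous.comp_continuousOn (hW.mono hRU)
    exact memLp_clm_apply_of_continuousOn hk hc hG
  have m2 : MemLp (fun x => ⟪B x (G i x), unitVec x⟫_ℝ) 2 (volume.restrict (closedBall 0 R)) := by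
    have hBG := memLp_clm_apply_of_continuousOn hk (h.contDiffOn.continuousOn.mono hRU) hG
    refine hBG.of_le_mul (c := 1) (hBG.1.inner measurable_unitVec.aestronglyMeasurable)
      (Eventually.of_forall fun x => ?_)
    refine (norm_inner_le_norm _ _).trans ?_
    rw [one_mul]
    exact mul_le_of_le_one_right (norm_nonneg _) (norm_unitVec_le x)
  exact IntegrableOn.mono_set (m1.integrable_mul m2) ball_subset_closedBall

include h hRU in
theorem IsCritical.integrableOn_unitVec_mul {W : Euc m → Euc m} (hW : ContinuousOn W U)
    (i : Fin ℓ) :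
    IntegrableOn (fun x => ⟪unitVec x, W x⟫_ℝ * ⟪B x (G i x), G i x⟫_ℝ) (ball 0 R) := by
  obtain ⟨C, hC⟩ := (isCompact_closedBall (0 : Euc m) R).exists_bound_of_continuousOn (hW.mono hRU)
  have h1 := h.integrableOn_quadratic hRU h.contDiffOn.continuousOn i
  have hWm : AEStronglyMeasurable W (volume.restrict (ball 0 R)) :=
    (hW.mono (ball_subset_closedBall.trans hRU)).aestronglyMeasurable measurableSet_ball
  refine Integrable.bdd_mul (c := C) h1 (measurable_unitVec.aestronglyMeasurable.inner hWm) ?_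
  refine (ae_restrict_iff' measurableSet_ball).mpr (Eventually.of_forall fun x hx => ?_)
  refine (norm_inner_le_norm _ _).trans ?_
  exact (mul_le_of_le_one_left (norm_nonneg _) (norm_unitVec_le x)).trans
    (hC x (ball_subset_closedBall hx))

end Integrability

end Identities

/-! ### Pohozaev, energy and divergence identities on spheres -/

section SphereIdentities

variable {ℓ : ℕ} {U : Set (Euc m)} {B : Euc m → Euc m →L[ℝ] Euc m}
  {F v : Fin ℓ → Euc m → ℝ} {G : Fin ℓ → Euc m → Euc m}
  (hm : 1 ≤ m) (hU : IsOpen U) (h : IsCritical U B F v G) {R : ℝ} (hRU : closedBall 0 R ⊆ U)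

include hRU in
theorem contDiff_radialCutoff_mul (hU : IsOpen U) {ψ : ℝ → ℝ} (hψ : Continuous ψ)
    (hs : HasCompactSupport ψ) (hψR : tsupport ψ ⊆ Ioo 0 R) (hR : 0 < R) {W : Euc m → Euc m}
    (hW : ContDiffOn ℝ 1 W U) (k : Fin m) :
    ContDiff ℝ 1 (fun x => radialCutoff R ψ x * W x k) ∧
    HasCompactSupport (fun x => radialCutoff R ψ x * W x k) ∧
    tsupport (fun x => radialCutoff R ψ x * W x k) ⊆ U := by
  have spec := radialCutoff_spec (m := m) hψ hs hψR hR
  have hWk : ContDiffOn ℝ 1 (fun x => W x k) U :=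
    (EuclideanSpace.proj k : Euc m →L[ℝ] ℝ).contDiff.comp_contDiffOn hW
  have hsub : tsupport (radialCutoff R ψ : Euc m → ℝ) ⊆ U :=
    spec.2.2.1.trans (ball_subset_closedBall.trans hRU)
  exact ⟨contDiff_smul_of_contDiffOn hU spec.1 hsub hWk, spec.2.1.mul_right,
    tsupport_mul_subset_left.trans hsub⟩

include hm hU h hRU in
/-- The Pohozaev identity on almost every sphere, for a general vector field. -/
theorem IsCritical.ae_sphereIntegral_pohozaevFlux {W : Euc m → Euc m} (hW : ContDiffOn ℝ 1 W U) :
    ∀ᵐ r ∂volume.restrict (Ioo 0 R), sphereIntegral r (fun x => ∑ i, pohozaevFlux (G i) B W x)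
      = ∫ x in ball 0 r, ∑ i, pohozaevDensity (G i) B (F i) W x := by
  rcases le_or_gt R 0 with hR | hR
  · simp [Ioo_eq_empty_of_le hR]
  have hq : IntegrableOn (fun x => ∑ i, pohozaevFlux (G i) B W x) (ball 0 R) :=
    integrable_finsetSum _ fun i _ => (h.integrableOn_unitVec_mul hRU hW.continuousOn i).sub
      ((h.integrableOn_flux hRU hW.continuousOn i).const_mul 2)
  have hP : IntegrableOn (fun x => ∑ i, pohozaevDensity (G i) B (F i) W x) (ball 0 R) :=
    integrable_finsetSum _ fun i _ => h.integrableOn_pohozaevDensity hU hRU hW i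
  refine ae_sphereIntegral_eq_of_radialCutoff hm hq hP fun ψ hψ hs hψR => ?_
  have spec := radialCutoff_spec (m := m) hψ.continuous hs hψR hR
  have htest := contDiff_radialCutoff_mul hRU hU hψ.continuous hs hψR hR hW
  have hint : ∀ i k, Integrable (variationDensity (G i) B (F i)
      (fun x => radialCutoff R ψ x * W x k) (stdVec k)) := fun i k =>
    h.integrable_variationDensity hU (htest k).1 (htest k).2.1 (htest k).2.2 _ i
  have key : ∫ x, ∑ i, ∑ k, variationDensity (G i) B (F i)
      (fun x => radialCutoff R ψ x * W x k) (stdVec k) x = 0 := by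
    rw [integral_finsetSum _ fun i _ => integrable_finsetSum _ fun k _ => hint i k]
    simp_rw [integral_finsetSum _ fun k _ => hint _ k]
    rw [Finset.sum_comm]
    exact Finset.sum_eq_zero fun k _ =>
      h.variation _ (htest k).1 (htest k).2.1 (htest k).2.2 (stdVec k)
  rw [← setIntegral_eq_integral_of_forall_compl_eq_zero (s := ball 0 R)] at key
  · rw [← key]
    refine setIntegral_congr_fun measurableSet_ball fun x hx => ?_
    have hxU : x ∈ U := hRU (ball_subset_closedBall hx)
    have hWd := (hW.contDiffAt (hU.mem_nhds hxU)).differentiableAt one_ne_zero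
    simp only [sum_variationDensity (spec.1.differentiable one_ne_zero x) hWd,
      fderiv_radialCutoff hψ.continuous hs hψR hR, Finset.mul_sum, ← Finset.sum_sub_distrib,
      pohozaevFlux]
    refine Finset.sum_congr rfl fun i _ => ?_
    rw [real_inner_comm (unitVec x) (B x (G i x))]
    ring
  · intro x hx
    refine Finset.sum_eq_zero fun i _ => Finset.sum_eq_zero fun k _ => ?_
    have hx' : x ∉ tsupport (fun x => radialCutoff R ψ x * W x k) := fun hx' =>
      hx (spec.2.2.1 (tsupport_mul_subset_left hx'))
    have h0 := image_eq_zero_of_notMem_tsupport hx'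
    simp only [variationDensity, h0, fderiv_eq_zero_of_notMem_tsupport hx']
    simp

include hm h hRU in
-- The energy identity with a radial cutoff, whose gradient `-ψ(|x|) x / |x|` concentrates on
-- spheres.
theorem IsCritical.ae_sphereIntegral_energy (i : Fin ℓ) :
    ∀ᵐ r ∂volume.restrict (Ioo 0 R),
      sphereIntegral r (fun x => v i x * ⟪B x (G i x), unitVec x⟫_ℝ)
      = ∫ x in ball 0 r, (⟪B x (G i x), G i x⟫_ℝ - F i x * v i x) := by
  rcases le_or_gt R 0 with hR | hR
  · simp [Ioo_eq_empty_of_le hR]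
  have hk := isCompact_closedBall (0 : Euc m) R
  have hq : IntegrableOn (fun x => v i x * ⟪B x (G i x), unitVec x⟫_ℝ) (ball 0 R) := by
    have hG := h.memLp_closedBall hRU i
    have m1 : MemLp (v i) 2 (volume.restrict (closedBall 0 R)) :=
      memLp_of_continuousOn_compact hk ((h.continuousOn i).mono hRU) 2
    have m2 : MemLp (fun x => ⟪B x (G i x), unitVec x⟫_ℝ) 2 (volume.restrict (closedBall 0 R)) := by
      have hBG := memLp_clm_apply_of_continuousOn hk (h.contDiffOn.continuousOn.mono hRU) hG
      refine hBG.of_le_mul (c := 1) (hBG.1.inner measurable_unitVec.aestronglyMeasurable)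
        (Eventually.of_forall fun x => ?_)
      refine (norm_inner_le_norm _ _).trans ?_
      rw [one_mul]
      exact mul_le_of_le_one_right (norm_nonneg _) (norm_unitVec_le x)
    exact IntegrableOn.mono_set (m1.integrable_mul m2) ball_subset_closedBall
  have hFv : IntegrableOn (fun x => F i x * v i x) (ball 0 R) :=
    (((h.continuousOn_reaction i).mul (h.continuousOn i)).mono hRU |>.integrableOn_compact
      hk).mono_set ball_subset_closedBall
  have hP := (h.integrableOn_quadratic hRU h.contDiffOn.continuousOn i).sub hFv
  refine ae_sphereIntegral_eq_of_radialCutoff hm hq hP fun ψ hψ hs hψR => ?_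
  have spec := radialCutoff_spec (m := m) hψ.continuous hs hψR hR
  have hsub : tsupport (radialCutoff R ψ : Euc m → ℝ) ⊆ U :=
    spec.2.2.1.trans (ball_subset_closedBall.trans hRU)
  have key := h.energy i _ spec.1 spec.2.1 hsub
  rw [← setIntegral_eq_integral_of_forall_compl_eq_zero (s := ball 0 R)] at key
  · rw [← key]
    refine setIntegral_congr_fun measurableSet_ball fun x hx => ?_
    have hxU : x ∈ U := hRU (ball_subset_closedBall hx)
    simp only [spec.2.2.2, map_smul, inner_add_right, inner_smul_right]
    rw [← h.symm x hxU (G i x) (G i x), ← h.symm x hxU (G i x) (unitVec x)]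
    ring
  · intro x hx
    have hx' : x ∉ tsupport (radialCutoff R ψ : Euc m → ℝ) := fun hx' => hx (spec.2.2.1 hx')
    simp [image_eq_zero_of_notMem_tsupport hx', gradient_eq_zero_of_notMem_tsupport hx']

include h hRU in
theorem IsCritical.integrableOn_square (hU : IsOpen U) {W : Euc m → Euc m}
    (hW : ContDiffOn ℝ 1 W U) (i : Fin ℓ) :
    IntegrableOn (fun x => divTrace W x * v i x ^ 2 + 2 * (v i x * ⟪G i x, W x⟫_ℝ)) (ball 0 R) := by
  have hk := isCompact_closedBall (0 : Euc m) R
  have i1 : IntegrableOn (fun x => divTrace W x * v i x ^ 2) (ball 0 R) :=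
    (((continuousOn_divTrace hU hW).mul ((h.continuousOn i).pow 2)).mono hRU
      |>.integrableOn_compact hk).mono_set ball_subset_closedBall
  have i2 := h.integrableOn_linear hRU ((h.continuousOn i).smul hW.continuousOn) i
  refine IntegrableOn.congr_fun (i1.add (i2.const_mul 2)) (fun x _ => ?_) measurableSet_ball
  simp [inner_smul_right]

include hm hU h hRU in
-- The divergence theorem for `v² W`. Radial cutoffs yield almost every radius; since no gradient
-- occurs on the sphere and `v` is continuous, both sides are continuous in `r` and every radius
-- follows. The height can thus be handled at each `r`, unlike the energy.
theorem IsCritical.sphereIntegral_square {W : Euc m → Euc m} (hW : ContDiffOn ℝ 1 W U)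
    (i : Fin ℓ) : ∀ r ∈ Ioo 0 R, sphereIntegral r (fun x => ⟪x, W x⟫_ℝ * v i x ^ 2)
      = r * ∫ x in ball 0 r, (divTrace W x * v i x ^ 2 + 2 * (v i x * ⟪G i x, W x⟫_ℝ)) := by
  rcases le_or_gt R 0 with hR | hR
  · simp [Ioo_eq_empty_of_le hR]
  have hk := isCompact_closedBall (0 : Euc m) R
  have hP := h.integrableOn_square hRU hU hW i
  have hq : IntegrableOn (fun x => ⟪unitVec x, W x⟫_ℝ * v i x ^ 2) (ball 0 R) := by
    have h1 : IntegrableOn (fun x => v i x ^ 2) (ball 0 R) :=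
      (((h.continuousOn i).pow 2).mono hRU |>.integrableOn_compact hk).mono_set
        ball_subset_closedBall
    obtain ⟨C, hC⟩ := hk.exists_bound_of_continuousOn (hW.continuousOn.mono hRU)
    have hWm : AEStronglyMeasurable W (volume.restrict (ball 0 R)) :=
      (hW.continuousOn.mono (ball_subset_closedBall.trans hRU)).aestronglyMeasurable
        measurableSet_ball
    refine Integrable.bdd_mul (c := C) h1 (measurable_unitVec.aestronglyMeasurable.inner hWm) ?_
    refine (ae_restrict_iff' measurableSet_ball).mpr (Eventually.of_forall fun x hx => ?_)
    refine (norm_inner_le_norm _ _).trans ?_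
    exact (mul_le_of_le_one_left (norm_nonneg _) (norm_unitVec_le x)).trans
      (hC x (ball_subset_closedBall hx))
  have hae : ∀ᵐ r ∂volume.restrict (Ioo 0 R),
      sphereIntegral r (fun x => ⟪unitVec x, W x⟫_ℝ * v i x ^ 2)
        = ∫ x in ball 0 r, (divTrace W x * v i x ^ 2 + 2 * (v i x * ⟪G i x, W x⟫_ℝ)) := by
    refine ae_sphereIntegral_eq_of_radialCutoff hm hq hP fun ψ hψ hs hψR => ?_
    have spec := radialCutoff_spec (m := m) hψ.continuous hs hψR hR
    have htest := contDiff_radialCutoff_mul hRU hU hψ.continuous hs hψR hR hW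
    have hsub : tsupport (radialCutoff R ψ : Euc m → ℝ) ⊆ U :=
      spec.2.2.1.trans (ball_subset_closedBall.trans hRU)
    have hint : ∀ k, Integrable fun x => v i x ^ 2 * fderiv ℝ (fun x => radialCutoff R ψ x * W x k)
        x (stdVec k) + (radialCutoff R ψ x * W x k * (2 * v i x)) * ⟪G i x, stdVec k⟫_ℝ := fun k => by
      have ht : tsupport (fun x => fderiv ℝ (fun x => radialCutoff R ψ x * W x k) x (stdVec k))
          ⊆ U := fun x hx => (htest k).2.2 (closure_minimal (fun y hy => by
            by_contra h
            exact hy (by simp [fderiv_eq_zero_of_notMem_tsupport h])) (isClosed_tsupport _) hx)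
      refine Integrable.add ?_ ?_
      · refine ((continuous_smul_of_continuousOn hU (((htest k).1.continuous_fderiv
          one_ne_zero).clm_apply continuous_const) ht
          ((h.continuousOn i).pow 2)).integrable_of_hasCompactSupport
          (hasCompactSupport_fderiv_clm (htest k).2.1 (stdVec k)).mul_right).congr
          (Eventually.of_forall fun x => ?_)
        simp [mul_comm]
      · have hc : Continuous fun x => radialCutoff R ψ x * W x k * (2 * v i x) :=
          continuous_smul_of_continuousOn hU (htest k).1.continuous (htest k).2.2
            (continuousOn_const.mul (h.continuousOn i))
        have hGl : LocallyIntegrableOn (G i) U :=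
          locallyIntegrableOn_of_locallyIntegrable_restrict ((h.memLp i).locallyIntegrable one_le_two)
        refine ((integrable_smul_of_locallyIntegrableOn hc (htest k).2.1.mul_right
          (tsupport_mul_subset_left.trans (htest k).2.2) hGl).inner_const (stdVec k)).congr
          (Eventually.of_forall fun x => ?_)
        simp only [inner_smul_left]; simp
    have key : ∫ x, ∑ k, (v i x ^ 2 * fderiv ℝ (fun x => radialCutoff R ψ x * W x k) x (stdVec k)
        + (radialCutoff R ψ x * W x k * (2 * v i x)) * ⟪G i x, stdVec k⟫_ℝ) = 0 := by
      rw [integral_finsetSum _ fun k _ => hint k]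
      exact Finset.sum_eq_zero fun k _ =>
        h.square i _ (htest k).1 (htest k).2.1 (htest k).2.2 (stdVec k)
    rw [← setIntegral_eq_integral_of_forall_compl_eq_zero (s := ball 0 R)] at key
    · rw [← key]
      refine setIntegral_congr_fun measurableSet_ball fun x hx => ?_
      have hxU : x ∈ U := hRU (ball_subset_closedBall hx)
      have hWd := (hW.contDiffAt (hU.mem_nhds hxU)).differentiableAt one_ne_zero
      have e2 : ∑ k, W x k * ⟪unitVec x, stdVec k⟫_ℝ = ⟪unitVec x, W x⟫_ℝ := by
        conv_rhs => rw [← sum_smul_stdVec (W x)]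
        simp only [inner_sum, inner_smul_right]
      have e3 : ∑ k, W x k * ⟪G i x, stdVec k⟫_ℝ = ⟪G i x, W x⟫_ℝ := by
        conv_rhs => rw [← sum_smul_stdVec (W x)]
        simp only [inner_sum, inner_smul_right]
      have hterm : ∀ k, v i x ^ 2 * fderiv ℝ (fun x => radialCutoff R ψ x * W x k) x (stdVec k)
          + (radialCutoff R ψ x * W x k * (2 * v i x)) * ⟪G i x, stdVec k⟫_ℝ
          = v i x ^ 2 * radialCutoff R ψ x * fderiv ℝ W x (stdVec k) k
          - v i x ^ 2 * ψ ‖x‖ * (W x k * ⟪unitVec x, stdVec k⟫_ℝ)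
          + radialCutoff R ψ x * (2 * v i x) * (W x k * ⟪G i x, stdVec k⟫_ℝ) := fun k => by
        rw [fderiv_mul_component (spec.1.differentiable one_ne_zero x) hWd,
          fderiv_radialCutoff hψ.continuous hs hψR hR]
        ring
      simp_rw [hterm]
      rw [Finset.sum_add_distrib, Finset.sum_sub_distrib, ← Finset.mul_sum, ← Finset.mul_sum,
        ← Finset.mul_sum, e2, e3, divTrace]
      ring
    · intro x hx
      refine Finset.sum_eq_zero fun k _ => ?_
      have hx' : x ∉ tsupport (fun x => radialCutoff R ψ x * W x k) := fun hx' =>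
        hx (spec.2.2.1 (tsupport_mul_subset_left hx'))
      have h0 := image_eq_zero_of_notMem_tsupport hx'
      simp only [h0, fderiv_eq_zero_of_notMem_tsupport hx']
      simp
  have hae' : (fun r => sphereIntegral r (fun x => ⟪x, W x⟫_ℝ * v i x ^ 2))
      =ᵐ[volume.restrict (Ioo 0 R)] fun r => r * ∫ x in ball 0 r, (divTrace W x * v i x ^ 2
        + 2 * (v i x * ⟪G i x, W x⟫_ℝ)) := by
    filter_upwards [hae, ae_restrict_mem measurableSet_Ioo] with r hr hrR
    rw [← hr, ← sphereIntegral_const_mul]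
    refine sphereIntegral_congr hrR.1.le fun x hx => ?_
    rw [unitVec, inner_smul_left, hx]
    have := hrR.1.ne'
    simp
    field_simp
  refine Measure.eqOn_open_of_ae_eq hae' isOpen_Ioo ?_ ?_
  · refine continuousOn_sphereIntegral ?_
    exact ((continuousOn_id.inner hW.continuousOn).mul ((h.continuousOn i).pow 2)).mono
      (ball_subset_closedBall.trans hRU)
  · refine continuousOn_id.mul ?_
    have := (absolutelyContinuous_integral_ball hm hP hR.le).continuousOn
    rw [uIcc_of_le hR.le] at this
    exact (this.congr fun r hr => integral_ball_eq_intervalIntegral hm hP hr).mono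
      Ioo_subset_Icc_self

end SphereIdentities

/-! ### Operators close to the identity -/

section NearIdentity

variable {E : Type*} [NormedAddCommGroup E] [InnerProductSpace ℝ E]

/-- The vector field `|x|² B(x) x / ⟨B(x) x, x⟩`. -/
def opZ (B : E → E →L[ℝ] E) (x : E) : E := (‖x‖ ^ 2 / ⟪B x x, x⟫_ℝ) • B x x

variable {B : E → E →L[ℝ] E} {R M : ℝ} (hB : ContDiffOn ℝ 1 B (ball 0 R))
  (hB0 : B 0 = ContinuousLinearMap.id ℝ E) (hM : ∀ x ∈ ball (0 : E) R, ‖fderiv ℝ B x‖ ≤ M)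
  (hMR : M * R ≤ 1 / 2) (hsym : ∀ x ∈ ball (0 : E) R, ∀ ξ ζ, ⟪B x ξ, ζ⟫_ℝ = ⟪ξ, B x ζ⟫_ℝ)

include hB hB0 hM in
-- The mean value inequality on the ball, starting from `B 0 = id`.
theorem norm_sub_self_le {x : E} (hx : x ∈ ball 0 R) (ξ : E) :
    ‖B x ξ - ξ‖ ≤ M * ‖x‖ * ‖ξ‖ := by
  have hR : 0 < R := pos_of_mem_ball hx
  have h := (convex_ball (0 : E) R).norm_image_sub_le_of_norm_fderiv_le (𝕜 := ℝ)
    (fun y hy => (hB.contDiffAt (isOpen_ball.mem_nhds hy)).differentiableAt one_ne_zero) hM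
    (mem_ball_self hR) hx
  rw [sub_zero, hB0] at h
  exact (B x - ContinuousLinearMap.id ℝ E).le_of_opNorm_le h ξ

include hM hMR in
theorem mul_norm_le_half {x : E} (hx : x ∈ ball 0 R) : 0 ≤ M ∧ M * ‖x‖ ≤ 1 / 2 := by
  have hM0 : 0 ≤ M := (ContinuousLinearMap.opNorm_nonneg _).trans (hM x hx)
  rw [mem_ball_zero_iff] at hx
  exact ⟨hM0, (mul_le_mul_of_nonneg_left hx.le hM0).trans hMR⟩

include hB hB0 hM in
theorem abs_inner_sub_le {x : E} (hx : x ∈ ball 0 R) (ξ : E) :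
    |⟪B x ξ, ξ⟫_ℝ - ‖ξ‖ ^ 2| ≤ M * ‖x‖ * ‖ξ‖ ^ 2 := by
  have : ⟪B x ξ, ξ⟫_ℝ - ‖ξ‖ ^ 2 = ⟪B x ξ - ξ, ξ⟫_ℝ := by
    rw [inner_sub_left, real_inner_self_eq_norm_sq]
  rw [this]
  refine (abs_real_inner_le_norm _ _).trans ?_
  calc _ ≤ M * ‖x‖ * ‖ξ‖ * ‖ξ‖ := by gcongr; exact norm_sub_self_le hB hB0 hM hx ξ
    _ = _ := by ring

include hB hB0 hM hMR in
theorem half_le_inner {x : E} (hx : x ∈ ball 0 R) (ξ : E) :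
    ‖ξ‖ ^ 2 / 2 ≤ ⟪B x ξ, ξ⟫_ℝ := by
  have h1 := abs_le.mp (abs_inner_sub_le hB hB0 hM hx ξ)
  have h2 := (mul_norm_le_half hM hMR hx).2
  nlinarith [sq_nonneg ‖ξ‖, mul_le_mul_of_nonneg_right h2 (sq_nonneg ‖ξ‖)]

include hB hB0 hM hMR in
theorem norm_apply_le {x : E} (hx : x ∈ ball 0 R) (ξ : E) : ‖B x ξ‖ ≤ 3 / 2 * ‖ξ‖ := by
  have h1 := norm_sub_self_le hB hB0 hM hx ξ
  have h2 := (mul_norm_le_half hM hMR hx).2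
  have h3 := norm_le_norm_add_norm_sub' (B x ξ) ξ
  nlinarith [norm_nonneg ξ, mul_le_mul_of_nonneg_right h2 (norm_nonneg ξ)]

include hB hB0 hM hMR in
-- The scalar factor differs from one by at most `2 M |x|` and multiplies a vector of norm at most
-- `3 |x| / 2`; adding `|B x x - x| ≤ M |x|²` gives the constant `3 + 1 = 4`.
theorem norm_opZ_sub_le {x : E} (hx : x ∈ ball 0 R) :
    ‖opZ B x - x‖ ≤ 4 * M * ‖x‖ ^ 2 := by
  by_cases hx0 : x = 0
  · simp [hx0, opZ]
  have hn : 0 < ‖x‖ := norm_pos_iff.mpr hx0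
  have hM' := mul_norm_le_half hM hMR hx
  have hN := half_le_inner hB hB0 hM hMR hx x
  have hN0 : 0 < ⟪B x x, x⟫_ℝ := lt_of_lt_of_le (by positivity) hN
  have e : opZ B x - x = (‖x‖ ^ 2 / ⟪B x x, x⟫_ℝ - 1) • B x x + (B x x - x) := by
    rw [opZ, sub_smul, one_smul]; abel
  have hκ : |‖x‖ ^ 2 / ⟪B x x, x⟫_ℝ - 1| ≤ 2 * (M * ‖x‖) := by
    rw [div_sub_one hN0.ne', abs_div, abs_of_pos hN0, div_le_iff₀ hN0, abs_sub_comm]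
    refine (abs_inner_sub_le hB hB0 hM hx x).trans ?_
    have : 0 ≤ M * ‖x‖ := mul_nonneg hM'.1 hn.le
    nlinarith
  rw [e]
  refine (norm_add_le _ _).trans ?_
  rw [norm_smul, Real.norm_eq_abs]
  have h1 := norm_sub_self_le hB hB0 hM hx x
  have h2 := norm_apply_le hB hB0 hM hMR hx x
  have h3 : |‖x‖ ^ 2 / ⟪B x x, x⟫_ℝ - 1| * ‖B x x‖ ≤ 2 * (M * ‖x‖) * (3 / 2 * ‖x‖) :=
    mul_le_mul hκ h2 (norm_nonneg _) (by have := hM'.1; positivity)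
  nlinarith

include hB hB0 hM hMR in
theorem norm_opZ_le {x : E} (hx : x ∈ ball 0 R) : ‖opZ B x‖ ≤ 3 * ‖x‖ := by
  have h1 := norm_opZ_sub_le hB hB0 hM hMR hx
  have h2 := (mul_norm_le_half hM hMR hx).2
  have h3 := norm_le_norm_add_norm_sub' (opZ B x) x
  nlinarith [norm_nonneg x, mul_le_mul_of_nonneg_right h2 (norm_nonneg x)]

include hB in
theorem hasFDerivAt_apply_self {x : E} (hx : x ∈ ball 0 R) :
    HasFDerivAt (fun x => B x x) ((fderiv ℝ B x).flip x + B x) x := by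
  have h1 := (hB.contDiffAt (isOpen_ball.mem_nhds hx)).differentiableAt one_ne_zero
  refine (h1.hasFDerivAt.clm_apply (hasFDerivAt_id x)).congr_fderiv ?_
  ext ξ
  simp
  abel

theorem contDiffOn_apply_self (hB : ContDiffOn ℝ 1 B (ball 0 R)) :
    ContDiffOn ℝ 1 (fun x => B x x) (ball 0 R) := hB.clm_apply contDiffOn_id

include hB hB0 hM in
theorem norm_fderiv_apply_self_sub_le {x : E} (hx : x ∈ ball 0 R) (ξ : E) :
    ‖fderiv ℝ (fun x => B x x) x ξ - ξ‖ ≤ 2 * M * ‖x‖ * ‖ξ‖ := by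
  rw [(hasFDerivAt_apply_self hB hx).fderiv]
  have e : ((fderiv ℝ B x).flip x + B x) ξ - ξ = fderiv ℝ B x ξ x + (B x ξ - ξ) := by
    simp; abel
  rw [e]
  refine (norm_add_le _ _).trans ?_
  have h1 := norm_sub_self_le hB hB0 hM hx ξ
  have h2 : ‖fderiv ℝ B x ξ x‖ ≤ M * ‖ξ‖ * ‖x‖ :=
    (fderiv ℝ B x ξ).le_of_opNorm_le ((fderiv ℝ B x).le_of_opNorm_le (hM x hx) ξ) x
  nlinarith

include hB hB0 hM hMR in
theorem contDiffAt_opZ {x : E} (hx : x ∈ ball 0 R) (hx0 : x ≠ 0) : ContDiffAt ℝ 1 (opZ B) x := by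
  have hn : 0 < ‖x‖ := norm_pos_iff.mpr hx0
  have hN := half_le_inner hB hB0 hM hMR hx x
  have hN0 : 0 < ⟪B x x, x⟫_ℝ := lt_of_lt_of_le (by positivity) hN
  have h1 := (contDiffOn_apply_self hB).contDiffAt (isOpen_ball.mem_nhds hx)
  exact ((contDiff_norm_sq ℝ).contDiffAt.div (h1.inner ℝ contDiffAt_id) hN0.ne').smul h1

include hB hB0 hM hMR hsym in
-- Instead of the quotient, the product relation `⟨B x, x⟩ Z = |x|² B x` is differentiated. The
-- leading terms cancel, and each remaining one is at most cubic in `|x|`, against the factor `⟨B x,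
-- x⟩ ≥ |x|² / 2`.
theorem norm_fderiv_opZ_sub_le {x : E} (hx : x ∈ ball 0 R) (hx0 : x ≠ 0) (ξ : E) :
    ‖fderiv ℝ (opZ B) x ξ - ξ‖ ≤ 44 * M * ‖x‖ * ‖ξ‖ := by
  have hn : 0 < ‖x‖ := norm_pos_iff.mpr hx0
  have hN := half_le_inner hB hB0 hM hMR hx x
  have hM' := mul_norm_le_half hM hMR hx
  have hZ := ((contDiffAt_opZ hB hB0 hM hMR hx hx0).differentiableAt one_ne_zero).hasFDerivAt
  have hW := hasFDerivAt_apply_self hB hx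
  have hNd := hW.inner ℝ (hasFDerivAt_id x)
  have ha := (hasStrictFDerivAt_norm_sq x).hasFDerivAt
  have heq : (fun y => ⟪B y y, y⟫_ℝ • opZ B y) =ᶠ[𝓝 x] fun y => ‖y‖ ^ 2 • B y y := by
    filter_upwards [isOpen_ball.mem_nhds hx] with y hy
    by_cases hy0 : y = 0
    · simp [hy0]
    have h2 : 0 < ‖y‖ := norm_pos_iff.mpr hy0
    have h3 : 0 < ⟪B y y, y⟫_ℝ :=
      lt_of_lt_of_le (by positivity) (half_le_inner hB hB0 hM hMR hy y)
    rw [opZ, smul_smul, mul_div_cancel₀ _ h3.ne']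
  have hd := ((ha.smul hW).congr_of_eventuallyEq heq).unique (hNd.smul hZ)
  have key := congrArg (fun L : E →L[ℝ] E => L ξ) hd
  simp only [add_apply, smul_apply, ContinuousLinearMap.smulRight_apply,
    ContinuousLinearMap.comp_apply, ContinuousLinearMap.prod_apply, fderivInnerCLM_apply,
    innerSL_apply_apply, ContinuousLinearMap.flip_apply, id_eq, ContinuousLinearMap.id_apply,
    inner_add_left, nsmul_eq_mul, Nat.cast_ofNat] at key
  set N := ⟪B x x, x⟫_ℝ with hNdef
  set z := opZ B x - x with hz
  set b := B x x - x with hb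
  set D := fderiv ℝ B x ξ x with hD
  have hZe : opZ B x = x + z := by rw [hz]; abel
  have hBe : B x x = x + b := by rw [hb]; abel
  have hBξ : ⟪B x ξ, x⟫_ℝ = ⟪x, ξ⟫_ℝ + ⟪b, ξ⟫_ℝ := by
    rw [hsym x hx, hBe, inner_add_right, real_inner_comm, real_inner_comm b]
  -- Every summand contains one of the small quantities `b`, `z`, `D`, `B x ξ - ξ`, `‖x‖ ^ 2 - N`.
  -- The symmetry of `B x` was used to write `⟪B x ξ, x⟫` through `b`.
  have main : N • (fderiv ℝ (opZ B) x ξ - ξ) = (2 * ⟪x, ξ⟫_ℝ) • (b - z) + ‖x‖ ^ 2 • D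
      + ‖x‖ ^ 2 • (B x ξ - ξ) + (‖x‖ ^ 2 - N) • ξ - ⟪D, x⟫_ℝ • opZ B x
      - (2 * ⟪b, ξ⟫_ℝ) • opZ B x := by
    have k2 : N • fderiv ℝ (opZ B) x ξ = ‖x‖ ^ 2 • (D + B x ξ) + (2 * ⟪x, ξ⟫_ℝ) • B x x
        - (⟪B x x, ξ⟫_ℝ + (⟪D, x⟫_ℝ + ⟪B x ξ, x⟫_ℝ)) • opZ B x := by
      rw [eq_sub_iff_add_eq, ← key]
    rw [smul_sub, k2, hBξ, hBe, inner_add_left, hZe]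
    module
  have hM0 := hM'.1
  have n1 : ‖b‖ ≤ M * ‖x‖ * ‖x‖ := norm_sub_self_le hB hB0 hM hx x
  have n2 : ‖z‖ ≤ 4 * M * ‖x‖ ^ 2 := norm_opZ_sub_le hB hB0 hM hMR hx
  have n3 : ‖D‖ ≤ M * ‖ξ‖ * ‖x‖ :=
    (fderiv ℝ B x ξ).le_of_opNorm_le ((fderiv ℝ B x).le_of_opNorm_le (hM x hx) ξ) x
  have n4 : ‖B x ξ - ξ‖ ≤ M * ‖x‖ * ‖ξ‖ := norm_sub_self_le hB hB0 hM hx ξ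
  have n5 : |‖x‖ ^ 2 - N| ≤ M * ‖x‖ * ‖x‖ ^ 2 := by
    rw [abs_sub_comm]; exact abs_inner_sub_le hB hB0 hM hx x
  have n6 : ‖opZ B x‖ ≤ 3 * ‖x‖ := norm_opZ_le hB hB0 hM hMR hx
  have t1 : ‖(2 * ⟪x, ξ⟫_ℝ) • (b - z)‖ ≤ (2 * (‖x‖ * ‖ξ‖)) * (M * ‖x‖ * ‖x‖ + 4 * M * ‖x‖ ^ 2) := by
    rw [norm_smul, norm_mul, Real.norm_two, Real.norm_eq_abs]
    gcongr
    · exact abs_real_inner_le_norm _ _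
    · exact (norm_sub_le _ _).trans (add_le_add n1 n2)
  have t2 : ‖‖x‖ ^ 2 • D‖ ≤ ‖x‖ ^ 2 * (M * ‖ξ‖ * ‖x‖) := by
    rw [norm_smul, norm_pow, norm_norm]; gcongr
  have t3 : ‖‖x‖ ^ 2 • (B x ξ - ξ)‖ ≤ ‖x‖ ^ 2 * (M * ‖x‖ * ‖ξ‖) := by
    rw [norm_smul, norm_pow, norm_norm]; gcongr
  have t4 : ‖(‖x‖ ^ 2 - N) • ξ‖ ≤ M * ‖x‖ * ‖x‖ ^ 2 * ‖ξ‖ := by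
    rw [norm_smul, Real.norm_eq_abs]; gcongr
  have t5 : ‖⟪D, x⟫_ℝ • opZ B x‖ ≤ M * ‖ξ‖ * ‖x‖ * ‖x‖ * (3 * ‖x‖) := by
    rw [norm_smul, Real.norm_eq_abs]
    gcongr
    exact (abs_real_inner_le_norm _ _).trans (mul_le_mul_of_nonneg_right n3 (norm_nonneg _))
  have t6 : ‖(2 * ⟪b, ξ⟫_ℝ) • opZ B x‖ ≤ 2 * (M * ‖x‖ * ‖x‖ * ‖ξ‖) * (3 * ‖x‖) := by
    rw [norm_smul, norm_mul, Real.norm_two, Real.norm_eq_abs]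
    gcongr
    exact (abs_real_inner_le_norm _ _).trans (mul_le_mul_of_nonneg_right n1 (norm_nonneg _))
  have hN0 : 0 < N := lt_of_lt_of_le (by positivity) hN
  -- The six terms contribute `10 + 1 + 1 + 1 + 3 + 6 = 22`; dividing by `N ≥ ‖x‖ ^ 2 / 2` doubles
  -- this to `44`.
  have hbound : N * ‖fderiv ℝ (opZ B) x ξ - ξ‖ ≤ 22 * M * ‖x‖ ^ 3 * ‖ξ‖ := by
    have : N * ‖fderiv ℝ (opZ B) x ξ - ξ‖ = ‖N • (fderiv ℝ (opZ B) x ξ - ξ)‖ := by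
      rw [norm_smul, Real.norm_of_nonneg hN0.le]
    rw [this, main]
    refine (norm_sub_le _ _).trans ((add_le_add ((norm_sub_le _ _).trans (add_le_add
      ((norm_add_le _ _).trans (add_le_add ((norm_add_le _ _).trans (add_le_add
      ((norm_add_le _ _).trans (add_le_add t1 t2)) t3)) t4)) t5)) t6).trans (le_of_eq ?_))
    ring
  have h1 : ‖x‖ ^ 2 / 2 * ‖fderiv ℝ (opZ B) x ξ - ξ‖ ≤ ‖x‖ ^ 2 / 2 * (44 * M * ‖x‖ * ‖ξ‖) :=
    (mul_le_mul_of_nonneg_right hN (norm_nonneg _)).trans (hbound.trans (le_of_eq (by ring)))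
  exact le_of_mul_le_mul_left h1 (by positivity)

include hB hB0 hM hMR in
theorem hasFDerivAt_opZ_zero (hR : 0 < R) :
    HasFDerivAt (opZ B) (ContinuousLinearMap.id ℝ E) 0 := by
  rw [hasFDerivAt_iff_isLittleO_nhds_zero]
  have h0 : opZ B 0 = 0 := by simp [opZ]
  have hO : (fun x => opZ B x - x) =O[𝓝 0] fun x => ‖x‖ ^ 2 := by
    refine Asymptotics.IsBigO.of_bound (4 * M) ?_
    filter_upwards [ball_mem_nhds (0 : E) hR] with x hx
    rw [Real.norm_of_nonneg (sq_nonneg _)]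
    exact norm_opZ_sub_le hB hB0 hM hMR hx
  have ho : (fun x : E => ‖x‖ ^ 2) =o[𝓝 0] fun x => x := by
    have := (Asymptotics.isLittleO_pow_id (𝕜 := ℝ) one_lt_two).comp_tendsto
      (tendsto_norm_zero (E := E))
    exact Asymptotics.isLittleO_norm_right.mp this
  simpa [h0] using hO.trans_isLittleO ho

include hB hB0 hM hMR hsym in
theorem norm_fderiv_opZ_sub_le' {x : E} (hx : x ∈ ball 0 R) (ξ : E) :
    ‖fderiv ℝ (opZ B) x ξ - ξ‖ ≤ 44 * M * ‖x‖ * ‖ξ‖ := by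
  by_cases hx0 : x = 0
  · rw [hx0, (hasFDerivAt_opZ_zero hB hB0 hM hMR (pos_of_mem_ball hx)).fderiv]
    simp
  · exact norm_fderiv_opZ_sub_le hB hB0 hM hMR hsym hx hx0 ξ

include hB hB0 hM hMR hsym in
-- Only the origin needs care, since the quotient is `0 / 0` there: the derivative is the identity
-- by the quadratic bound, and it is continuous there by the linear bound on `DZ - I`.
theorem contDiffOn_opZ : ContDiffOn ℝ 1 (opZ B) (ball 0 R) := by
  rcases le_or_gt R 0 with hR | hR
  · rw [ball_eq_empty.mpr hR]; exact contDiffOn_empty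
  have h0 := hasFDerivAt_opZ_zero hB hB0 hM hMR hR
  rw [show (1 : WithTop ℕ∞) = 0 + 1 by simp, contDiffOn_succ_iff_fderiv_of_isOpen isOpen_ball]
  refine ⟨fun x hx => ?_, by simp, ?_⟩
  · by_cases hx0 : x = 0
    · rw [hx0]; exact h0.differentiableAt.differentiableWithinAt
    · exact ((contDiffAt_opZ hB hB0 hM hMR hx hx0).differentiableAt
        one_ne_zero).differentiableWithinAt
  · rw [contDiffOn_zero]
    intro x hx
    refine ContinuousAt.continuousWithinAt ?_
    by_cases hx0 : x = 0
    · rw [hx0, ContinuousAt, h0.fderiv, tendsto_iff_norm_sub_tendsto_zero]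
      refine squeeze_zero' (Eventually.of_forall fun _ => norm_nonneg _)
        (g := fun x => 44 * M * ‖x‖) ?_ ?_
      · filter_upwards [ball_mem_nhds (0 : E) hR] with y hy
        have hM0 := (mul_norm_le_half hM hMR hy).1
        refine ContinuousLinearMap.opNorm_le_bound _ (by positivity) fun ξ => ?_
        exact norm_fderiv_opZ_sub_le' hB hB0 hM hMR hsym hy ξ
      · have : Tendsto (fun x : E => 44 * M * ‖x‖) (𝓝 0) (𝓝 (44 * M * ‖(0 : E)‖)) :=
          (continuous_const.mul continuous_norm).tendsto 0
        simpa using this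
    · exact (contDiffAt_opZ hB hB0 hM hMR hx hx0).continuousAt_fderiv one_ne_zero

end NearIdentity

theorem abs_divTrace_sub_le {m : ℕ} {W : Euc m → Euc m} {x : Euc m} {c : ℝ}
    (h : ∀ ξ, ‖fderiv ℝ W x ξ - ξ‖ ≤ c * ‖ξ‖) : |divTrace W x - m| ≤ m * c := by
  have e : divTrace W x - m = ∑ k : Fin m, (fderiv ℝ W x (stdVec k) - stdVec k) k := by
    simp [divTrace, stdVec]
  rw [e]
  refine (Finset.abs_sum_le_sum_abs _ _).trans ?_
  have hk : ∀ k : Fin m, |(fderiv ℝ W x (stdVec k) - stdVec k) k| ≤ c := fun k => by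
    refine (PiLp.norm_apply_le _ k).trans ((h (stdVec k)).trans (by simp [stdVec]))
  exact (Finset.sum_le_sum fun k _ => hk k).trans (by simp)

/-! ### Monotonicity of a frequency function -/

theorem absolutelyContinuous_congr {f g : ℝ → ℝ} {a b : ℝ}
    (hf : AbsolutelyContinuousOnInterval f a b) (h : EqOn f g (uIcc a b)) :
    AbsolutelyContinuousOnInterval g a b := by
  rw [absolutelyContinuousOnInterval_iff] at hf ⊢
  intro ε hε
  obtain ⟨δ, hδ, hd⟩ := hf ε hε
  refine ⟨δ, hδ, fun I hI hI2 => ?_⟩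
  have := hd I hI hI2
  rwa [Finset.sum_congr rfl fun i hi => by rw [h (hI.1 i hi).1, h (hI.1 i hi).2]] at this

/-- The differential inequalities satisfied by the energy `E` and the height `H`. -/
structure FrequencyEstimates (E H ρ : ℝ → ℝ) (c R : ℝ) : Prop where
  pos : 0 < c
  absolutelyContinuous : ∀ a b, 0 < a → a ≤ b → b < R → AbsolutelyContinuousOnInterval E a b
  height_nonneg : ∀ r ∈ Ioo 0 R, 0 ≤ H r
  hasDerivAt_height : ∀ r ∈ Ioo 0 R, HasDerivAt H (2 / r * E r + ρ r) r
  abs_remainder_le : ∀ r ∈ Ioo 0 R, |ρ r| ≤ c * H r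
  ae_hasDerivAt_energy : ∀ᵐ r ∂volume.restrict (Ioo 0 R), ∃ e b, HasDerivAt E e r ∧
    b - c * (E r + H r) ≤ e ∧ 2 / r * E r ^ 2 ≤ b * H r
  half_height_le : ∀ r ∈ Ioo 0 R, H r / 2 ≤ E r + H r
  height_eq_zero : ∀ r ∈ Ioo 0 R, H r = 0 → E r = 0 → ∀ s ∈ Ioo 0 r, H s = 0

namespace FrequencyEstimates

variable {E H ρ : ℝ → ℝ} {c R : ℝ} (h : FrequencyEstimates E H ρ c R)

include h

theorem continuousOn_height : ContinuousOn H (Ioo 0 R) := fun r hr =>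
  (h.hasDerivAt_height r hr).continuousAt.continuousWithinAt

/-- On a compact interval away from zero `H` is bounded below and has a bounded derivative, so `1 /
H` is Lipschitz and the product with `E` is absolutely continuous. -/
theorem absolutelyContinuous_quotient {a b : ℝ} (ha : 0 < a) (hab : a ≤ b) (hb : b < R)
    (hpos : ∀ r ∈ Icc a b, 0 < H r) : AbsolutelyContinuousOnInterval (fun r => E r / H r) a b := by
  have hsub : Icc a b ⊆ Ioo 0 R := fun r hr => ⟨ha.trans_le hr.1, hr.2.trans_lt hb⟩
  have hE := h.absolutelyContinuous a b ha hab hb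
  have hEc := hE.continuousOn
  rw [uIcc_of_le hab] at hEc
  have hHc := h.continuousOn_height.mono hsub
  obtain ⟨C₁, hC₁⟩ := isCompact_Icc.exists_bound_of_continuousOn hEc
  obtain ⟨C₂, hC₂⟩ := isCompact_Icc.exists_bound_of_continuousOn hHc
  obtain ⟨C₃, hC₃⟩ := isCompact_Icc.exists_bound_of_continuousOn
    (hHc.inv₀ fun r hr => (hpos r hr).ne')
  have hLip : LipschitzOnWith (Real.toNNReal ((2 / a * C₁ + c * C₂) * C₃ ^ 2)) (fun r => (H r)⁻¹)
      (Icc a b) := by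
    refine (convex_Icc a b).lipschitzOnWith_of_nnnorm_hasDerivWithin_le
      (f' := fun r => -(2 / r * E r + ρ r) / H r ^ 2) (fun r hr =>
      ((h.hasDerivAt_height r (hsub hr)).inv (hpos r hr).ne').hasDerivWithinAt) fun r hr => ?_
    rw [← norm_toNNReal]
    refine Real.toNNReal_le_toNNReal ?_
    have hr0 : 0 < r := ha.trans_le hr.1
    have h1 : |E r| ≤ C₁ := hC₁ r hr
    have h2 : H r ≤ C₂ := (le_abs_self _).trans (hC₂ r hr)
    have h3 : (H r)⁻¹ ≤ C₃ := (le_abs_self _).trans (hC₃ r hr)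
    have hp := hpos r hr
    have hC1 : 0 ≤ C₁ := (abs_nonneg _).trans h1
    have hc := h.pos
    have h4 : |2 / r * E r + ρ r| ≤ 2 / a * C₁ + c * C₂ := by
      refine (abs_add_le _ _).trans (add_le_add ?_ ((h.abs_remainder_le r (hsub hr)).trans (by gcongr)))
      rw [abs_mul, abs_of_pos (by positivity : 0 < 2 / r)]
      have : 2 / r ≤ 2 / a := by gcongr; exact hr.1
      gcongr
    rw [Real.norm_eq_abs, abs_div, abs_neg, abs_of_pos (by positivity : 0 < H r ^ 2),
      div_eq_mul_inv, ← inv_pow]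
    have h5 : 0 ≤ 2 / a * C₁ + c * C₂ := (abs_nonneg _).trans h4
    gcongr
  have hinv : AbsolutelyContinuousOnInterval (fun r => (H r)⁻¹) a b :=
    LipschitzOnWith.absolutelyContinuousOnInterval (by rw [uIcc_of_le hab]; exact hLip)
  exact absolutelyContinuous_congr (hE.mul hinv) fun r _ => by simp [div_eq_mul_inv]

/-- In `E' H - E H'` the flux `b H` dominates `2 E² / r`. What remains is at least `-c (E + H) H -
|E| |ρ|`, and `|E| ≤ E + H` by the coercivity; the two errors explain the factor `2 c`. -/
theorem hasDerivAt_quotient {r : ℝ} (hr : r ∈ Ioo 0 R) (hp : 0 < H r) {e b : ℝ}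
    (he : HasDerivAt E e r) (hb : b - c * (E r + H r) ≤ e) (hbH : 2 / r * E r ^ 2 ≤ b * H r) :
    ∃ n, HasDerivAt (fun r => E r / H r) n r ∧ -(2 * c) * (E r / H r + 1) ≤ n := by
  refine ⟨_, he.div (h.hasDerivAt_height r hr) hp.ne', ?_⟩
  rw [le_div_iff₀ (by positivity)]
  have h1 := h.abs_remainder_le r hr
  have h2 := h.half_height_le r hr
  have hc := h.pos
  have e1 : -(2 * c) * (E r / H r + 1) * H r ^ 2 = -(2 * c) * (E r + H r) * H r := by
    field_simp
  rw [e1]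
  have h3 : |E r * ρ r| ≤ (E r + H r) * (c * H r) := by
    rw [abs_mul]
    refine mul_le_mul ?_ h1 (abs_nonneg _) (by linarith)
    rw [abs_le]
    constructor <;> linarith
  have h4 := (abs_le.mp h3).2
  have h5 := mul_le_mul_of_nonneg_right hb hp.le
  nlinarith

theorem exp_mul_le {a b : ℝ} (ha : 0 < a) (hab : a ≤ b) (hb : b < R)
    (hpos : ∀ r ∈ Icc a b, 0 < H r) :
    Real.exp (2 * c * a) * (E a / H a + 1) ≤ Real.exp (2 * c * b) * (E b / H b + 1) := by
  have hN := h.absolutelyContinuous_quotient ha hab hb hpos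
  have hexp : ∀ r : ℝ, HasDerivAt (fun r => Real.exp (2 * c * r)) (Real.exp (2 * c * r) * (2 * c)) r :=
    fun r => by simpa using ((hasDerivAt_id r).const_mul (2 * c)).exp
  have hF : AbsolutelyContinuousOnInterval
      (fun r => Real.exp (2 * c * r) * (E r / H r + 1)) a b := by
    have h1 : AbsolutelyContinuousOnInterval (fun r : ℝ => Real.exp (2 * c * r)) a b :=
      ContDiffOn.absolutelyContinuousOnInterval
        (Real.contDiff_exp.comp (contDiff_const.mul contDiff_id)).contDiffOn
    have h2 : AbsolutelyContinuousOnInterval (fun _ : ℝ => (1 : ℝ)) a b :=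
      ContDiffOn.absolutelyContinuousOnInterval contDiffOn_const
    exact absolutelyContinuous_congr (h1.mul (hN.add h2)) fun r _ => by simp
  have hint := hF.integral_deriv_eq_sub
  have h0 : 0 ≤ ∫ r in a..b, deriv (fun r => Real.exp (2 * c * r) * (E r / H r + 1)) r := by
    refine intervalIntegral.integral_nonneg_of_ae_restrict hab ?_
    have hsub : Icc a b ⊆ Ioo 0 R := fun r hr => ⟨ha.trans_le hr.1, hr.2.trans_lt hb⟩
    have hae := ae_restrict_of_ae_restrict_of_subset hsub h.ae_hasDerivAt_energy
    filter_upwards [hae, ae_restrict_mem measurableSet_Icc] with r ⟨e, b, he, hb, hbH⟩ hr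
    obtain ⟨n, hn, hn2⟩ := h.hasDerivAt_quotient (hsub hr) (hpos r hr) he hb hbH
    have hd := (hexp r).mul (hn.add_const 1)
    have hd' : HasDerivAt (fun r => Real.exp (2 * c * r) * (E r / H r + 1)) _ r := hd
    rw [Pi.zero_apply, hd'.deriv]
    have : 0 ≤ Real.exp (2 * c * r) * (2 * c * (E r / H r + 1) + n) :=
      mul_nonneg (Real.exp_pos _).le (by linarith)
    linarith
  linarith

/-- A zero of `H ≥ 0` is a minimum, so `H' = 0` there; the remainder vanishes with `H`, which leaves
only the energy term. -/
theorem energy_eq_zero {r : ℝ} (hr : r ∈ Ioo 0 R) (h0 : H r = 0) : E r = 0 := by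
  have hmin : IsLocalMin H r := by
    filter_upwards [Ioo_mem_nhds hr.1 hr.2] with s hs
    rw [h0]
    exact h.height_nonneg s hs
  have h1 := hmin.hasDerivAt_eq_zero (h.hasDerivAt_height r hr)
  have h2 := h.abs_remainder_le r hr
  rw [h0, mul_zero] at h2
  rw [abs_nonpos_iff.mp h2, add_zero] at h1
  have : 2 / r ≠ 0 := by have := hr.1; positivity
  exact (mul_eq_zero.mp h1).resolve_left this

/-- Zeros of `H` propagate inwards by `height_eq_zero`. Outwards, just beyond the largest zero the
monotone quotient bounds `E` by a multiple of `H`, so the logarithmic derivative of `H` is bounded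
above and `H` cannot leave zero. -/
theorem height_eq_zero_or_pos :
    (∀ r ∈ Ioo 0 R, H r = 0) ∨ ∀ r ∈ Ioo 0 R, 0 < H r := by
  by_contra! hcon
  obtain ⟨⟨r₁, hr₁, hne⟩, r₀, hr₀, hle⟩ := hcon
  have hp₁ : 0 < H r₁ := lt_of_le_of_ne (h.height_nonneg r₁ hr₁) hne.symm
  have hz₀ : H r₀ = 0 := le_antisymm hle (h.height_nonneg r₀ hr₀)
  have hlt : r₀ < r₁ := by
    by_contra! hcon
    rcases hcon.eq_or_lt with rfl | hcon
    · exact hne hz₀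
    · exact hne (h.height_eq_zero r₀ hr₀ hz₀ (h.energy_eq_zero hr₀ hz₀) r₁ ⟨hr₁.1, hcon⟩)
  have hsub : Icc r₀ r₁ ⊆ Ioo 0 R := fun r hr => ⟨hr₀.1.trans_le hr.1, hr.2.trans_lt hr₁.2⟩
  have hHc := h.continuousOn_height.mono hsub
  have hclosed : IsCompact (Icc r₀ r₁ ∩ H ⁻¹' {0}) :=
    isCompact_Icc.of_isClosed_subset (hHc.preimage_isClosed_of_isClosed isClosed_Icc
      isClosed_singleton) inter_subset_left
  -- The largest zero below `r₁`: to its right `H > 0`, and the monotonicity formula holds.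
  obtain ⟨s, ⟨hs, hs0⟩, hmax⟩ := hclosed.exists_isGreatest ⟨r₀, left_mem_Icc.mpr hlt.le, hz₀⟩
  have hs0' : H s = 0 := hs0
  have hss : s < r₁ := lt_of_le_of_ne hs.2 fun heq => hne (heq ▸ hs0')
  have hspos : 0 < s := (hsub hs).1
  have hpos : ∀ r ∈ Ioc s r₁, 0 < H r := fun r hr => by
    have hr' : r ∈ Icc r₀ r₁ := ⟨hs.1.trans hr.1.le, hr.2⟩
    refine lt_of_le_of_ne (h.height_nonneg r (hsub hr')) fun h0 => ?_
    exact absurd (hmax ⟨hr', h0.symm⟩) (not_le.mpr hr.1)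
  set K := Real.exp (2 * c * r₁) * (E r₁ / H r₁ + 1) with hK
  have hc := h.pos
  have hN : ∀ r ∈ Ioc s r₁, E r ≤ K * H r := fun r hr => by
    have h1 := h.exp_mul_le (hspos.trans hr.1) hr.2 hr₁.2
      fun t ht => hpos t ⟨hr.1.trans_le ht.1, ht.2⟩
    have hp := hpos r hr
    have hr' : r ∈ Icc r₀ r₁ := ⟨hs.1.trans hr.1.le, hr.2⟩
    have h2 := h.half_height_le r (hsub hr')
    have h3 : 0 ≤ E r / H r + 1 := by
      rw [div_add_one hp.ne']; exact div_nonneg (by linarith) hp.le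
    have h4 : 1 ≤ Real.exp (2 * c * r) := Real.one_le_exp (by have := hspos.trans hr.1; positivity)
    have h5 : E r / H r ≤ K := by nlinarith
    rwa [div_le_iff₀ hp] at h5
  have hK0 : 0 ≤ K := by
    have h2 := h.half_height_le r₁ hr₁
    refine mul_nonneg (Real.exp_pos _).le ?_
    rw [div_add_one hp₁.ne']; exact div_nonneg (by linarith) hp₁.le
  -- An upper bound for `H' / H` on the interval from `s` to `r₁`, where `1 / r ≤ 1 / s`.
  set K' := 2 / s * K + c with hK'
  have hanti : AntitoneOn (fun r => H r * Real.exp (-K' * r)) (Icc s r₁) := by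
    have hd : ∀ r ∈ Ioo s r₁, HasDerivAt (fun r => H r * Real.exp (-K' * r))
        ((2 / r * E r + ρ r) * Real.exp (-K' * r) + H r * (Real.exp (-K' * r) * -K')) r :=
      fun r hr => (h.hasDerivAt_height r (hsub ⟨hs.1.trans hr.1.le, hr.2.le⟩)).mul
        (by simpa using ((hasDerivAt_id r).const_mul (-K')).exp)
    refine antitoneOn_of_deriv_nonpos (convex_Icc _ _) ?_ ?_ ?_
    · exact (hHc.mono (Icc_subset_Icc_left hs.1)).mul (Continuous.continuousOn (by fun_prop))
    · rw [interior_Icc]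
      exact fun r hr => (hd r hr).differentiableAt.differentiableWithinAt
    · rw [interior_Icc]
      intro r hr
      rw [(hd r hr).deriv]
      have hrI : r ∈ Ioc s r₁ := ⟨hr.1, hr.2.le⟩
      have hp := hpos r hrI
      have h1 := (abs_le.mp (h.abs_remainder_le r (hsub ⟨hs.1.trans hr.1.le, hr.2.le⟩))).2
      have hr0 : 0 < r := hspos.trans hr.1
      have h2 : 2 / r * E r ≤ 2 / s * (K * H r) := by
        calc 2 / r * E r ≤ 2 / r * (K * H r) := by gcongr; exact hN r hrI
          _ ≤ _ := by gcongr; exact hr.1.le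
      have : (2 / r * E r + ρ r - H r * K') ≤ 0 := by rw [hK']; nlinarith
      have := mul_nonpos_of_nonpos_of_nonneg this (Real.exp_pos (-K' * r)).le
      linarith
  have := hanti (left_mem_Icc.mpr hss.le) (right_mem_Icc.mpr hss.le) hss.le
  simp only [hs0', zero_mul] at this
  exact absurd this (not_le.mpr (mul_pos hp₁ (Real.exp_pos _)))

section Positive

variable (hpos : ∀ r ∈ Ioo 0 R, 0 < H r)

include hpos

theorem monotoneOn_quotient :
    MonotoneOn (fun r => Real.exp (2 * c * r) * (E r / H r + 1)) (Ioo 0 R) :=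
  fun _ ha _ hb hab => h.exp_mul_le ha.1 hab hb.2
    fun r hr => hpos r ⟨ha.1.trans_le hr.1, hr.2.trans_lt hb.2⟩

theorem ae_deriv_quotient : ∀ᵐ r ∂volume.restrict (Ioo 0 R),
    DifferentiableAt ℝ (fun r => E r / H r) r ∧
      -(2 * c) * (E r / H r + 1) ≤ deriv (fun r => E r / H r) r := by
  filter_upwards [h.ae_hasDerivAt_energy, ae_restrict_mem measurableSet_Ioo]
    with r ⟨e, b, he, hb, hbH⟩ hr
  obtain ⟨n, hn, hn2⟩ := h.hasDerivAt_quotient hr (hpos r hr) he hb hbH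
  exact ⟨hn.differentiableAt, by rwa [hn.deriv]⟩

theorem hasDerivAt_log_height {r : ℝ} (hr : r ∈ Ioo 0 R) :
    DifferentiableAt ℝ (fun t => Real.log (H t)) r ∧
      |deriv (fun t => Real.log (H t)) r - 2 / r * (E r / H r)| ≤ c := by
  have hp := hpos r hr
  have hd := (h.hasDerivAt_height r hr).log hp.ne'
  refine ⟨hd.differentiableAt, ?_⟩
  rw [hd.deriv]
  have : (2 / r * E r + ρ r) / H r - 2 / r * (E r / H r) = ρ r / H r := by ring
  rw [this, abs_div, abs_of_pos hp, div_le_iff₀ hp]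
  exact h.abs_remainder_le r hr

/-- The monotone function `F` is bounded below by zero, hence has a limit `L` at zero. A monotone
function has an integrable derivative, and letting the left endpoint tend to zero in the fundamental
theorem represents the extension of `F` as `L` plus an integral. Multiplication by a smooth
exponential recovers the quotient. -/
theorem exists_limit {r₁ : ℝ} (hr₁ : 0 < r₁) (hr₁R : r₁ < R) :
    ∃ N₀ : ℝ, Tendsto (fun r => E r / H r) (𝓝[>] 0) (𝓝 N₀) ∧
      AbsolutelyContinuousOnInterval (Function.update (fun r => E r / H r) 0 N₀) 0 r₁ := by
  set F : ℝ → ℝ := fun r => Real.exp (2 * c * r) * (E r / H r + 1) with hF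
  have hmono := h.monotoneOn_quotient hpos
  have hR : 0 < R := hr₁.trans hr₁R
  have hF0 : ∀ r ∈ Ioo 0 R, 0 ≤ F r := fun r hr => by
    have hp := hpos r hr
    have h2 := h.half_height_le r hr
    refine mul_nonneg (Real.exp_pos _).le ?_
    rw [div_add_one hp.ne']; exact div_nonneg (by linarith) hp.le
  have hbdd : BddBelow (F '' Ioo 0 R) := ⟨0, by rintro _ ⟨r, hr, rfl⟩; exact hF0 r hr⟩
  set L := sInf (F '' Ioo 0 R) with hL
  have hlim : Tendsto F (𝓝[>] 0) (𝓝 L) := by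
    have := hmono.tendsto_nhdsWithin_Ioo_right (nonempty_Ioo.mpr hR) hbdd
    exact this
  have hexp0 : Tendsto (fun r : ℝ => Real.exp (-(2 * c) * r)) (𝓝[>] 0) (𝓝 1) := by
    have : Tendsto (fun r : ℝ => Real.exp (-(2 * c) * r)) (𝓝 0) (𝓝 (Real.exp (-(2 * c) * 0))) :=
      Continuous.tendsto (by fun_prop) 0
    rw [mul_zero, Real.exp_zero] at this
    exact this.mono_left nhdsWithin_le_nhds
  have hrec : ∀ r, E r / H r = Real.exp (-(2 * c) * r) * F r - 1 := fun r => by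
    rw [hF]
    simp only
    rw [← mul_assoc, ← Real.exp_add, neg_mul, neg_add_cancel, Real.exp_zero, one_mul,
      add_sub_cancel_right]
  refine ⟨L - 1, ?_, ?_⟩
  · have := (hexp0.mul hlim).sub_const 1
    rw [one_mul] at this
    exact this.congr fun r => (hrec r).symm
  · set F₀ : ℝ → ℝ := Function.update F 0 L with hF₀
    have hF₀r : ∀ r, 0 < r → F₀ r = F r := fun r hr => Function.update_of_ne hr.ne' _ _
    have hmono₀ : MonotoneOn F₀ (uIcc 0 r₁) := by
      rw [uIcc_of_le hr₁.le]
      intro a ha b hb hab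
      rcases ha.1.eq_or_lt with rfl | ha0
      · rcases hb.1.eq_or_lt with rfl | hb0
        · exact le_rfl
        · rw [hF₀r b hb0, hF₀, Function.update_self]
          exact csInf_le hbdd ⟨b, ⟨hb0, hb.2.trans_lt hr₁R⟩, rfl⟩
      · rw [hF₀r a ha0, hF₀r b (ha0.trans_le hab)]
        exact hmono ⟨ha0, ha.2.trans_lt hr₁R⟩ ⟨ha0.trans_le hab, hb.2.trans_lt hr₁R⟩ hab
    -- Monotonicity up to `0` gives integrability of the derivative up to `0`, which absolute
    -- continuity on each `[a, r]` with `a > 0` would not.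
    have hii := hmono₀.intervalIntegrable_deriv
    have hac := hii.absolutelyContinuousOnInterval_intervalIntegral (c := 0) left_mem_uIcc
    have hFTC : ∀ r ∈ Icc 0 r₁, F₀ r = L + ∫ t in (0:ℝ)..r, deriv F₀ t := by
      intro r hr
      rcases hr.1.eq_or_lt with rfl | hr0
      · simp [hF₀]
      have hrR : r < R := hr.2.trans_lt hr₁R
      have hcongr : ∀ a, 0 < a → a ≤ r → F r - F a = ∫ t in a..r, deriv F₀ t := by
        intro a ha har
        have hN := h.absolutelyContinuous_quotient ha har hrR
          fun t ht => hpos t ⟨ha.trans_le ht.1, ht.2.trans_lt hrR⟩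
        have h1 : AbsolutelyContinuousOnInterval (fun r : ℝ => Real.exp (2 * c * r)) a r :=
          ContDiffOn.absolutelyContinuousOnInterval
            (Real.contDiff_exp.comp (contDiff_const.mul contDiff_id)).contDiffOn
        have h2 : AbsolutelyContinuousOnInterval (fun _ : ℝ => (1 : ℝ)) a r :=
          ContDiffOn.absolutelyContinuousOnInterval contDiffOn_const
        have h3 : AbsolutelyContinuousOnInterval F₀ a r :=
          absolutelyContinuous_congr (h1.mul (hN.add h2)) fun t ht => by
            rw [uIcc_of_le har] at ht
            rw [hF₀r t (ha.trans_le ht.1)]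
            simp [hF]
        rw [h3.integral_deriv_eq_sub, hF₀r r hr0, hF₀r a ha]
      have hc1 : Tendsto (fun a => ∫ t in a..r, deriv F₀ t) (𝓝[>] 0)
          (𝓝 (∫ t in (0:ℝ)..r, deriv F₀ t)) := by
        have hcont := hac.continuousOn
        rw [uIcc_of_le hr₁.le] at hcont
        have h0 : Tendsto (fun a => ∫ t in (0:ℝ)..a, deriv F₀ t) (𝓝[>] 0) (𝓝 0) := by
          have := (hcont 0 (left_mem_Icc.mpr hr₁.le)).tendsto
          rw [intervalIntegral.integral_same] at this
          have h4 := this.mono_left (nhdsWithin_mono 0 (Ioc_subset_Icc_self : Ioc 0 r₁ ⊆ _))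
          rwa [nhdsWithin_Ioc_eq_nhdsGT hr₁] at h4
        have h5 := h0.const_sub (∫ t in (0:ℝ)..r, deriv F₀ t)
        rw [sub_zero] at h5
        refine h5.congr' ?_
        filter_upwards [Ioc_mem_nhdsGT hr₁] with a ha
        rw [sub_eq_iff_eq_add, add_comm, intervalIntegral.integral_add_adjacent_intervals]
        · exact hii.mono_set (by
            rw [uIcc_of_le ha.1.le, uIcc_of_le hr₁.le]; exact Icc_subset_Icc_right ha.2)
        · refine hii.mono_set ?_
          rw [uIcc_of_le hr₁.le]
          exact uIcc_subset_Icc (Ioc_subset_Icc_self ha) hr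
      have hc2 : Tendsto (fun a => ∫ t in a..r, deriv F₀ t) (𝓝[>] 0) (𝓝 (F r - L)) := by
        refine (hlim.const_sub (F r)).congr' ?_
        filter_upwards [Ioc_mem_nhdsGT hr0] with a ha using hcongr a ha.1 ha.2
      rw [tendsto_nhds_unique hc1 hc2, hF₀r r hr0]
      ring
    have h1 : AbsolutelyContinuousOnInterval (fun r : ℝ => Real.exp (-(2 * c) * r)) 0 r₁ :=
      ContDiffOn.absolutelyContinuousOnInterval
        (Real.contDiff_exp.comp (contDiff_const.mul contDiff_id)).contDiffOn
    have h2 : ∀ x : ℝ, AbsolutelyContinuousOnInterval (fun _ : ℝ => x) 0 r₁ := fun x =>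
      ContDiffOn.absolutelyContinuousOnInterval contDiffOn_const
    refine absolutelyContinuous_congr ((h1.mul ((h2 L).add hac)).sub (h2 1)) fun r hr => ?_
    rw [uIcc_of_le hr₁.le] at hr
    simp only [Pi.sub_apply, Pi.mul_apply, Pi.add_apply]
    rw [← hFTC r hr]
    rcases hr.1.eq_or_lt with rfl | hr0
    · simp [hF₀]
    · rw [hF₀r r hr0, Function.update_of_ne hr0.ne', hrec r]

end Positive

end FrequencyEstimates

/-! ### Energy and height of a normalized critical tuple -/

/-- A critical tuple on a small ball, for operators close to the identity. -/
structure IsNormalizedCritical {ℓ : ℕ} (B : Euc m → Euc m →L[ℝ] Euc m)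
    (F v : Fin ℓ → Euc m → ℝ) (G : Fin ℓ → Euc m → Euc m) (R M c : ℝ) : Prop where
  one_le : 1 ≤ m
  critical : IsCritical (ball 0 R) B F v G
  apply_zero : B 0 = ContinuousLinearMap.id ℝ (Euc m)
  norm_fderiv_le : ∀ x ∈ ball (0 : Euc m) R, ‖fderiv ℝ B x‖ ≤ M
  le_one : R ≤ 1
  small : M * R ≤ 1 / 4
  nonneg : 0 ≤ c
  abs_reaction_le : ∀ i, ∀ x ∈ ball (0 : Euc m) R, |F i x| ≤ c * |v i x|
  reaction_small : 144 * c * R ^ 2 ≤ 1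

section Densities

variable {ℓ : ℕ} (B : Euc m → Euc m →L[ℝ] Euc m) (F v : Fin ℓ → Euc m → ℝ)
  (G : Fin ℓ → Euc m → Euc m)

/-- `∑ ⟨B ∇v, ∇v⟩`. -/
def dirichletDensity (x : Euc m) : ℝ := ∑ i, ⟪B x (G i x), G i x⟫_ℝ

/-- `∑ F v`. -/
def reactionDensity (x : Euc m) : ℝ := ∑ i, F i x * v i x

/-- `∑ v²`. -/
def squareDensity (x : Euc m) : ℝ := ∑ i, v i x ^ 2

/-- `div (|v|² B(x) x)`. -/
def heightDensity (x : Euc m) : ℝ :=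
  ∑ i, (divTrace (fun x => B x x) x * v i x ^ 2 + 2 * (v i x * ⟪G i x, B x x⟫_ℝ))

/-- The energy at radius `r`. -/
def opEnergy (r : ℝ) : ℝ :=
  r ^ 2 / r ^ m * ((∫ x in ball 0 r, dirichletDensity B G x) - ∫ x in ball 0 r, reactionDensity F v x)

/-- The height at radius `r`. -/
def opHeight (r : ℝ) : ℝ := (∫ x in ball 0 r, heightDensity B v G x) / r ^ m

end Densities

theorem SphereIntegrable.const_mul {r : ℝ} {g : Euc m → ℝ} (hg : SphereIntegrable r g) (c : ℝ) :
    SphereIntegrable r (fun x => c * g x) := Integrable.const_mul hg c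

theorem SphereIntegrable.add {r : ℝ} {g h : Euc m → ℝ} (hg : SphereIntegrable r g)
    (hh : SphereIntegrable r h) : SphereIntegrable r (fun x => g x + h x) := Integrable.add hg hh

namespace IsNormalizedCritical

variable {ℓ : ℕ} {B : Euc m → Euc m →L[ℝ] Euc m} {F v : Fin ℓ → Euc m → ℝ}
  {G : Fin ℓ → Euc m → Euc m} {R M c : ℝ} (h : IsNormalizedCritical B F v G R M c)

include h

theorem small' : M * R ≤ 1 / 2 := h.small.trans (by norm_num)

theorem abs_divTrace_le {x : Euc m} (hx : x ∈ ball 0 R) :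
    |divTrace (fun x => B x x) x - m| ≤ m * (2 * M * ‖x‖) :=
  abs_divTrace_sub_le fun ξ => norm_fderiv_apply_self_sub_le h.critical.contDiffOn h.apply_zero
    h.norm_fderiv_le hx ξ

theorem constant_nonneg {x : Euc m} (hx : x ∈ ball 0 R) : 0 ≤ M :=
  (mul_norm_le_half h.norm_fderiv_le h.small' hx).1

theorem mul_norm_le {x : Euc m} (hx : x ∈ ball 0 R) : M * ‖x‖ ≤ 1 / 4 := by
  have := h.constant_nonneg hx
  have hx' : ‖x‖ ≤ R := by simpa using (mem_ball_zero_iff.mp hx).le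
  exact (by gcongr : M * ‖x‖ ≤ M * R).trans h.small

theorem sq_norm_le {x : Euc m} (hx : x ∈ ball 0 R) (ξ : Euc m) : ‖ξ‖ ^ 2 ≤ 2 * ⟪B x ξ, ξ⟫_ℝ := by
  have := half_le_inner h.critical.contDiffOn h.apply_zero h.norm_fderiv_le h.small' hx ξ
  linarith

theorem norm_apply_le' {x : Euc m} (hx : x ∈ ball 0 R) (ξ : Euc m) : ‖B x ξ‖ ≤ 3 / 2 * ‖ξ‖ :=
  norm_apply_le h.critical.contDiffOn h.apply_zero h.norm_fderiv_le h.small' hx ξ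

theorem dirichletDensity_nonneg {x : Euc m} (hx : x ∈ ball 0 R) : 0 ≤ dirichletDensity B G x :=
  Finset.sum_nonneg fun i _ => by
    have := h.sq_norm_le hx (G i x)
    have := sq_nonneg ‖G i x‖
    linarith

theorem abs_reactionDensity_le {x : Euc m} (hx : x ∈ ball 0 R) :
    |reactionDensity F v x| ≤ c * squareDensity v x := by
  rw [reactionDensity, squareDensity, Finset.mul_sum]
  refine (Finset.abs_sum_le_sum_abs _ _).trans (Finset.sum_le_sum fun i _ => ?_)
  rw [abs_mul, ← sq_abs, sq, ← mul_assoc]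
  exact mul_le_mul_of_nonneg_right (h.abs_reaction_le i x hx) (abs_nonneg _)

/-- A pointwise Poincaré inequality. The bound `M |x| ≤ 1 / 4` keeps the divergence of `B x x` above
`m / 2 ≥ 1 / 2`, and Young's inequality absorbs the mixed term into a quarter of `v²`, leaving `9
|x|² |G|²`. -/
theorem squareDensity_le {x : Euc m} (hx : x ∈ ball 0 R) :
    squareDensity v x ≤ 4 * heightDensity B v G x + 72 * ‖x‖ ^ 2 * dirichletDensity B G x := by
  rw [squareDensity, heightDensity, dirichletDensity, Finset.mul_sum, Finset.mul_sum,
    ← Finset.sum_add_distrib]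
  refine Finset.sum_le_sum fun i _ => ?_
  have h1 := (abs_le.mp (h.abs_divTrace_le hx)).1
  have h2 := h.mul_norm_le hx
  have hm : (1 : ℝ) ≤ m := by exact_mod_cast h.one_le
  have h3 : 1 / 2 ≤ divTrace (fun x => B x x) x := by nlinarith
  have h4 := mul_le_mul_of_nonneg_right h3 (sq_nonneg (v i x))
  have h5 : |⟪G i x, B x x⟫_ℝ| ≤ 3 / 2 * ‖x‖ * ‖G i x‖ := by
    refine (abs_real_inner_le_norm _ _).trans ?_
    have := h.norm_apply_le' hx x
    calc ‖G i x‖ * ‖B x x‖ ≤ ‖G i x‖ * (3 / 2 * ‖x‖) := by gcongr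
      _ = _ := by ring
  have h6 : |v i x * ⟪G i x, B x x⟫_ℝ| ≤ |v i x| * (3 / 2 * ‖x‖ * ‖G i x‖) := by
    rw [abs_mul]; gcongr
  have h7 := (abs_le.mp h6).1
  have h8 := h.sq_norm_le hx (G i x)
  have h9 := mul_le_mul_of_nonneg_left h8 (sq_nonneg ‖x‖)
  have h10 : 2 * (|v i x| * (3 / 2 * ‖x‖ * ‖G i x‖)) ≤ v i x ^ 2 / 4 + 9 * (‖x‖ ^ 2 * ‖G i x‖ ^ 2) := by
    have := sq_nonneg (|v i x| / 2 - 3 * (‖x‖ * ‖G i x‖))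
    have e := sq_abs (v i x)
    nlinarith
  linarith

section Integrability

variable {r : ℝ} (hr : r < R)

omit h in
theorem closedBall_subset (hr : r < R) : closedBall (0 : Euc m) r ⊆ ball 0 R :=
  closedBall_subset_ball hr

include hr

theorem integrableOn_dirichletDensity : IntegrableOn (dirichletDensity B G) (ball 0 r) :=
  integrable_finsetSum _ fun i _ => h.critical.integrableOn_quadratic (closedBall_subset_ball hr)
    h.critical.contDiffOn.continuousOn i

theorem integrableOn_heightDensity : IntegrableOn (heightDensity B v G) (ball 0 r) :=
  integrable_finsetSum _ fun i _ => h.critical.integrableOn_square (closedBall_subset_ball hr)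
    isOpen_ball (contDiffOn_apply_self h.critical.contDiffOn) i

omit hr in
theorem continuousOn_squareDensity : ContinuousOn (squareDensity v) (ball 0 R) :=
  continuousOn_finsetSum _ fun i _ => (h.critical.continuousOn i).pow 2

omit hr in
theorem continuousOn_reactionDensity : ContinuousOn (reactionDensity F v) (ball 0 R) :=
  continuousOn_finsetSum _ fun i _ =>
    (h.critical.continuousOn_reaction i).mul (h.critical.continuousOn i)

omit h in
theorem integrableOn_of_continuousOn {g : Euc m → ℝ} (hg : ContinuousOn g (ball 0 R)) :
    IntegrableOn g (ball 0 r) :=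
  ((hg.mono (closedBall_subset_ball hr)).integrableOn_compact
    (isCompact_closedBall _ _)).mono_set ball_subset_closedBall

theorem integral_dirichletDensity_nonneg : 0 ≤ ∫ x in ball 0 r, dirichletDensity B G x :=
  setIntegral_nonneg measurableSet_ball fun _ hx =>
    h.dirichletDensity_nonneg (ball_subset_ball hr.le hx)

theorem integral_squareDensity_le : ∫ x in ball 0 r, squareDensity v x ≤
    4 * (∫ x in ball 0 r, heightDensity B v G x)
      + 72 * r ^ 2 * ∫ x in ball 0 r, dirichletDensity B G x := by
  rw [← integral_const_mul, ← integral_const_mul, ← integral_add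
    ((h.integrableOn_heightDensity hr).const_mul _) ((h.integrableOn_dirichletDensity hr).const_mul _)]
  refine setIntegral_mono_on (integrableOn_of_continuousOn hr h.continuousOn_squareDensity)
    (((h.integrableOn_heightDensity hr).const_mul _).add
      ((h.integrableOn_dirichletDensity hr).const_mul _)) measurableSet_ball fun x hx => ?_
  have hx' := ball_subset_ball hr.le hx
  refine (h.squareDensity_le hx').trans ?_
  have hn : ‖x‖ ≤ r := (mem_ball_zero_iff.mp hx).le
  have := h.dirichletDensity_nonneg hx'
  gcongr

theorem abs_integral_reactionDensity_le : |∫ x in ball 0 r, reactionDensity F v x| ≤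
    c * ∫ x in ball 0 r, squareDensity v x := by
  rw [← integral_const_mul]
  refine (abs_integral_le_integral_abs).trans (setIntegral_mono_on
    (integrableOn_of_continuousOn hr h.continuousOn_reactionDensity).abs
    ((integrableOn_of_continuousOn hr h.continuousOn_squareDensity).const_mul _)
    measurableSet_ball fun x hx => h.abs_reactionDensity_le (ball_subset_ball hr.le hx))

end Integrability

section Radius

variable {r : ℝ} (hr : r ∈ Ioo 0 R)

include hr

/-- The divergence theorem for `|v|² B x x`. Writing the height as an integral over a ball makes it
differentiable in `r`, although `v` is only of class `H^1`. -/
theorem sphereIntegral_height : sphereIntegral r (fun x => ⟪x, B x x⟫_ℝ * squareDensity v x)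
    = r * ∫ x in ball 0 r, heightDensity B v G x := by
  obtain ⟨R', hrR', hR'⟩ := exists_between hr.2
  have hW := contDiffOn_apply_self h.critical.contDiffOn
  have hc : ContinuousOn (fun x => ⟪x, B x x⟫_ℝ) (ball 0 R) := continuousOn_id.inner hW.continuousOn
  simp only [squareDensity, Finset.mul_sum]
  rw [sphereIntegral_sum (g := fun i x => ⟪x, B x x⟫_ℝ * v i x ^ 2) fun i _ =>
    sphereIntegrable_of_continuousOn hr.1.le hr.2
    (hc.mul ((h.critical.continuousOn i).pow 2))]
  simp only [heightDensity]
  rw [integral_finsetSum _ fun i _ => h.critical.integrableOn_square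
    (closedBall_subset_ball hr.2) isOpen_ball hW i, Finset.mul_sum]
  exact Finset.sum_congr rfl fun i _ => h.critical.sphereIntegral_square h.one_le isOpen_ball
    (closedBall_subset_ball hR') hW i r ⟨hr.1, hrR'⟩

theorem inner_pos {x : Euc m} (hx : ‖x‖ = r) : 0 < ⟪x, B x x⟫_ℝ ∧ r ^ 2 ≤ 2 * ⟪x, B x x⟫_ℝ := by
  have hxR : x ∈ ball 0 R := by rw [mem_ball_zero_iff, hx]; exact hr.2
  have := h.sq_norm_le hxR x
  rw [hx, real_inner_comm] at this
  have h2 : 0 < r ^ 2 := pow_pos hr.1 2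
  exact ⟨by linarith, this⟩

theorem integral_heightDensity_nonneg : 0 ≤ ∫ x in ball 0 r, heightDensity B v G x := by
  have h1 : 0 ≤ sphereIntegral r (fun x => ⟪x, B x x⟫_ℝ * squareDensity v x) := by
    have h0 : sphereIntegral (m := m) r (fun _ => 0) = 0 := by simp [sphereIntegral]
    rw [← h0]
    refine sphereIntegral_mono hr.1 (integrable_zero _ _ _) (sphereIntegrable_of_continuousOn
      hr.1.le hr.2 ((continuousOn_id.inner
        (contDiffOn_apply_self h.critical.contDiffOn).continuousOn).mul
        h.continuousOn_squareDensity)) fun x hx => ?_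
    exact mul_nonneg (h.inner_pos hr hx).1.le (Finset.sum_nonneg fun i _ => sq_nonneg _)
  rw [h.sphereIntegral_height hr] at h1
  exact nonneg_of_mul_nonneg_right h1 hr.1

/-- Coercivity of the energy, before rescaling. -/
theorem sq_mul_add_le : r ^ 2 * (∫ x in ball 0 r, dirichletDensity B G x)
    + ∫ x in ball 0 r, heightDensity B v G x ≤
    2 * (r ^ 2 * ((∫ x in ball 0 r, dirichletDensity B G x)
      - ∫ x in ball 0 r, reactionDensity F v x) + ∫ x in ball 0 r, heightDensity B v G x) := by
  have h1 := h.integral_squareDensity_le hr.2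
  have h2 := (abs_le.mp (h.abs_integral_reactionDensity_le hr.2)).2
  have h3 := h.integral_dirichletDensity_nonneg hr.2
  have h4 := h.integral_heightDensity_nonneg hr
  set D := ∫ x in ball 0 r, dirichletDensity B G x
  set Q := ∫ x in ball 0 r, heightDensity B v G x
  set J := ∫ x in ball 0 r, reactionDensity F v x
  have hc := h.nonneg
  have hr0 := hr.1
  -- With this, `r ^ 2 * J` is at most `Q / 36 + r ^ 2 * D / 2`, and is absorbed at the cost of the
  -- factor two.
  have h5 : 144 * (c * r ^ 2) ≤ 1 := by
    have : c * r ^ 2 ≤ c * R ^ 2 := by have := hr.2.le; gcongr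
    linarith [h.reaction_small]
  have h6 : J ≤ c * (4 * Q + 72 * r ^ 2 * D) := h2.trans (by gcongr)
  have h7 : r ^ 2 * J ≤ r ^ 2 * (c * (4 * Q + 72 * r ^ 2 * D)) := by gcongr
  have h8 : r ^ 2 * (c * (4 * Q + 72 * r ^ 2 * D))
      = 4 * (c * r ^ 2) * Q + 72 * (c * r ^ 2) * (r ^ 2 * D) := by ring
  have h9 : 0 ≤ r ^ 2 * D := by positivity
  nlinarith

theorem opHeight_nonneg : 0 ≤ opHeight B v G r :=
  div_nonneg (h.integral_heightDensity_nonneg hr) (pow_nonneg hr.1.le _)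

theorem rescaled_dirichlet_add_le :
    r ^ 2 / r ^ m * (∫ x in ball 0 r, dirichletDensity B G x) + opHeight B v G r
      ≤ 2 * (opEnergy B F v G r + opHeight B v G r) := by
  have hp : 0 < r ^ m := pow_pos hr.1 m
  have := div_le_div_of_nonneg_right (h.sq_mul_add_le hr) hp.le
  rw [opEnergy, opHeight]
  exact le_of_eq_of_le (by ring) (this.trans_eq (by ring))

theorem rescaled_dirichlet_nonneg :
    0 ≤ r ^ 2 / r ^ m * (∫ x in ball 0 r, dirichletDensity B G x) := by
  have := h.integral_dirichletDensity_nonneg hr.2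
  have := hr.1
  positivity

theorem half_opHeight_le : opHeight B v G r / 2 ≤ opEnergy B F v G r + opHeight B v G r := by
  have h1 := h.rescaled_dirichlet_add_le hr
  have h2 := h.rescaled_dirichlet_nonneg hr
  linarith

/-- The rescaled Poincaré inequality. -/
theorem integral_squareDensity_le_energy : ∫ x in ball 0 r, squareDensity v x ≤
    r ^ m * (152 * (opEnergy B F v G r + opHeight B v G r)) := by
  have hp : 0 < r ^ m := pow_pos hr.1 m
  have h1 := h.integral_squareDensity_le hr.2
  have h2 := h.rescaled_dirichlet_add_le hr
  have h3 := h.rescaled_dirichlet_nonneg hr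
  have h4 := h.opHeight_nonneg hr
  have e1 : 4 * (∫ x in ball 0 r, heightDensity B v G x)
      + 72 * r ^ 2 * ∫ x in ball 0 r, dirichletDensity B G x
      = r ^ m * (4 * opHeight B v G r
        + 72 * (r ^ 2 / r ^ m * (∫ x in ball 0 r, dirichletDensity B G x))) := by
    rw [opHeight]; field_simp
  rw [e1] at h1
  refine h1.trans (mul_le_mul_of_nonneg_left ?_ hp.le)
  linarith

/-- The rescaled Poincaré inequality makes the integral of `|v|²` over the ball vanish, and `v` is
continuous. -/
theorem eq_zero_of_opHeight_eq_zero (hH : opHeight B v G r = 0) (hE : opEnergy B F v G r = 0) :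
    ∀ x ∈ ball 0 r, ∀ i, v i x = 0 := by
  have h1 := h.integral_squareDensity_le_energy hr
  rw [hH, hE] at h1
  have hcont : ContinuousOn (squareDensity v) (ball 0 r) :=
    h.continuousOn_squareDensity.mono (ball_subset_ball hr.2.le)
  have hnn : ∀ x, 0 ≤ squareDensity v x := fun x => Finset.sum_nonneg fun i _ => sq_nonneg _
  have h2 : ∫ x in ball 0 r, squareDensity v x = 0 :=
    le_antisymm (by simpa using h1) (integral_nonneg hnn)
  rw [setIntegral_eq_zero_iff_of_nonneg_ae (Eventually.of_forall hnn)
    (integrableOn_of_continuousOn hr.2 h.continuousOn_squareDensity)] at h2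
  have h3 : EqOn (squareDensity v) (fun _ => 0) (ball 0 r) :=
    Measure.eqOn_open_of_ae_eq h2 isOpen_ball hcont continuousOn_const
  intro x hx i
  have := (Finset.sum_eq_zero_iff_of_nonneg fun i _ => sq_nonneg (v i x)).mp (h3 hx) i
    (Finset.mem_univ i)
  exact pow_eq_zero_iff two_ne_zero |>.mp this

theorem opHeight_eq_zero (h0 : ∀ x : Euc m, ‖x‖ = r → ∀ i, v i x = 0) : opHeight B v G r = 0 := by
  have h1 := h.sphereIntegral_height hr
  rw [sphereIntegral_congr (h := fun _ => 0) hr.1.le fun x hx => by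
    simp [squareDensity, h0 x hx]] at h1
  have : r * (∫ x in ball 0 r, heightDensity B v G x) = 0 := by
    rw [← h1]; simp [sphereIntegral]
  rw [opHeight, (mul_eq_zero.mp this).resolve_left hr.1.ne', zero_div]

end Radius

end IsNormalizedCritical

theorem absolutelyContinuousOn_integral_ball (hm : 1 ≤ m) {g : Euc m → ℝ} {R a b : ℝ}
    (hg : IntegrableOn g (ball 0 R)) (ha : 0 ≤ a) (hab : a ≤ b) (hb : b ≤ R) :
    AbsolutelyContinuousOnInterval (fun r => ∫ x in ball 0 r, g x) a b := by
  have h0 : (0 : ℝ) ≤ b := ha.trans hab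
  have h1 : a ∈ uIcc 0 b := by rw [uIcc_of_le h0]; exact ⟨ha, hab⟩
  have hi := (intervalIntegrable_sphereIntegral hm (hg.mono_set (ball_subset_ball hb)) h0)
  have h2 := (hi.absolutelyContinuousOnInterval_intervalIntegral (c := 0) left_mem_uIcc)
  have h3 : AbsolutelyContinuousOnInterval (fun r => ∫ t in 0..r, sphereIntegral t g) a b := by
    rw [absolutelyContinuousOnInterval_iff] at h2 ⊢
    intro ε hε
    obtain ⟨δ, hδ, hd⟩ := h2 ε hε
    refine ⟨δ, hδ, fun I hI hI2 => hd I ⟨fun i hi => ?_, hI.2⟩ hI2⟩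
    have hsub : uIcc a b ⊆ uIcc 0 b := uIcc_subset_uIcc h1 right_mem_uIcc
    exact ⟨hsub (hI.1 i hi).1, hsub (hI.1 i hi).2⟩
  refine absolutelyContinuous_congr h3 fun r hr => ?_
  rw [uIcc_of_le hab] at hr
  exact (integral_ball_eq_intervalIntegral hm hg ⟨ha.trans hr.1, hr.2.trans hb⟩).symm

theorem continuousOn_integral_ball (hm : 1 ≤ m) {g : Euc m → ℝ} {R : ℝ}
    (hg : IntegrableOn g (ball 0 R)) : ContinuousOn (fun r => ∫ x in ball 0 r, g x) (Ioo 0 R) := by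
  rcases le_or_gt R 0 with hR | hR
  · simp [Ioo_eq_empty_of_le hR]
  have := (absolutelyContinuousOn_integral_ball hm hg le_rfl hR.le le_rfl).continuousOn
  rw [uIcc_of_le hR.le] at this
  exact this.mono Ioo_subset_Icc_self

namespace IsNormalizedCritical

variable {ℓ : ℕ} {B : Euc m → Euc m →L[ℝ] Euc m} {F v : Fin ℓ → Euc m → ℝ}
  {G : Fin ℓ → Euc m → Euc m} {R M c : ℝ} (h : IsNormalizedCritical B F v G R M c)

include h

/-! #### The height -/

/-- The energy identity on the sphere, summed over the components and multiplied by `r`, because `x`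
is `r` times the unit normal. -/
theorem ae_sphereIntegral_normal {R' : ℝ} (hR' : R' < R) :
    ∀ᵐ r ∂volume.restrict (Ioo 0 R'),
      SphereIntegrable r (fun x => ∑ i, v i x * ⟪G i x, B x x⟫_ℝ) ∧
      sphereIntegral r (fun x => ∑ i, v i x * ⟪G i x, B x x⟫_ℝ)
        = r * ((∫ x in ball 0 r, dirichletDensity B G x)
          - ∫ x in ball 0 r, reactionDensity F v x) := by
  have hW := (contDiffOn_apply_self h.critical.contDiffOn).continuousOn
  have hsub := closedBall_subset (m := m) hR'
  have hi : ∀ i, IntegrableOn (fun x => v i x * ⟪G i x, B x x⟫_ℝ) (ball 0 R') := fun i => by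
    have := h.critical.integrableOn_linear hsub ((h.critical.continuousOn i).smul hW) i
    refine IntegrableOn.congr_fun this (fun x _ => ?_) measurableSet_ball
    simp [inner_smul_right]
  have hs : ∀ᵐ r ∂volume.restrict (Ioo 0 R'), ∀ i,
      SphereIntegrable r (fun x => v i x * ⟪G i x, B x x⟫_ℝ) :=
    ae_all_iff.mpr fun i => ae_sphereIntegrable h.one_le (hi i)
  have he : ∀ᵐ r ∂volume.restrict (Ioo 0 R'), ∀ i,
      sphereIntegral r (fun x => v i x * ⟪B x (G i x), unitVec x⟫_ℝ)
      = ∫ x in ball 0 r, (⟪B x (G i x), G i x⟫_ℝ - F i x * v i x) :=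
    ae_all_iff.mpr fun i => h.critical.ae_sphereIntegral_energy h.one_le hsub i
  filter_upwards [hs, he, ae_restrict_mem measurableSet_Ioo] with r h1 h2 hr
  have hrR : r < R := hr.2.trans hR'
  refine ⟨integrable_finsetSum _ fun i _ => h1 i, ?_⟩
  rw [sphereIntegral_sum (g := fun i x => v i x * ⟪G i x, B x x⟫_ℝ) fun i _ => h1 i]
  have e1 : ∀ i, sphereIntegral r (fun x => v i x * ⟪G i x, B x x⟫_ℝ)
      = r * ∫ x in ball 0 r, (⟪B x (G i x), G i x⟫_ℝ - F i x * v i x) := fun i => by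
    rw [← h2 i, ← sphereIntegral_const_mul]
    refine sphereIntegral_congr hr.1.le fun x hx => ?_
    have hxR : x ∈ ball 0 R := by rw [mem_ball_zero_iff, hx]; exact hrR
    rw [← h.critical.symm x hxR, unitVec, inner_smul_right, hx]
    have := hr.1.ne'
    field_simp
  simp only [e1]
  rw [← Finset.mul_sum]
  congr 1
  have i1 := fun i => h.critical.integrableOn_quadratic (closedBall_subset hrR)
    h.critical.contDiffOn.continuousOn i
  have i2 : ∀ i, IntegrableOn (fun x => F i x * v i x) (ball 0 r) := fun i => integrableOn_of_continuousOn hrR ((h.critical.continuousOn_reaction i).mul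
    (h.critical.continuousOn i))
  simp only [dirichletDensity, reactionDensity]
  rw [integral_finsetSum _ fun i _ => i1 i, integral_finsetSum _ fun i _ => i2 i,
    ← Finset.sum_sub_distrib]
  exact Finset.sum_congr rfl fun i _ => integral_sub (i1 i) (i2 i)

/-- The error term in the derivative of the height. -/
def heightRemainder (B : Euc m → Euc m →L[ℝ] Euc m) (v : Fin ℓ → Euc m → ℝ) (r : ℝ) : ℝ :=
  sphereIntegral r (fun x => (divTrace (fun x => B x x) x - m * (⟪x, B x x⟫_ℝ / r ^ 2))
    * squareDensity v x) / r ^ m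

theorem continuousOn_div_mul : ContinuousOn
    (fun x => divTrace (fun x => B x x) x * squareDensity v x) (ball 0 R) :=
  (continuousOn_divTrace isOpen_ball (contDiffOn_apply_self h.critical.contDiffOn)).mul
    h.continuousOn_squareDensity

theorem continuousOn_inner_mul : ContinuousOn
    (fun x => ⟪x, B x x⟫_ℝ * squareDensity v x) (ball 0 R) :=
  (continuousOn_id.inner (contDiffOn_apply_self h.critical.contDiffOn).continuousOn).mul
    h.continuousOn_squareDensity

/-- For almost every radius the sphere integral of the density equals the asserted derivative, which
is continuous in `r`: its gradient part has been converted into integrals over balls. A primitive of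
a continuous function is differentiable everywhere. -/
theorem hasDerivAt_integral_heightDensity {r : ℝ} (hr : r ∈ Ioo 0 R) :
    HasDerivAt (fun r => ∫ x in ball 0 r, heightDensity B v G x)
      (sphereIntegral r (fun x => divTrace (fun x => B x x) x * squareDensity v x)
        + 2 * (r * ((∫ x in ball 0 r, dirichletDensity B G x)
          - ∫ x in ball 0 r, reactionDensity F v x))) r := by
  obtain ⟨R', hrR', hR'⟩ := exists_between hr.2
  have hi := h.integrableOn_heightDensity hR'
  set ψ : ℝ → ℝ := fun r =>
    sphereIntegral r (fun x => divTrace (fun x => B x x) x * squareDensity v x)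
        + 2 * (r * ((∫ x in ball 0 r, dirichletDensity B G x)
          - ∫ x in ball 0 r, reactionDensity F v x)) with hψ
  have hψc : ContinuousOn ψ (Ioo 0 R') := by
    have h1 := (continuousOn_sphereIntegral h.continuousOn_div_mul).mono
      (Ioo_subset_Ioo_right hR'.le)
    have h2 := continuousOn_integral_ball h.one_le (h.integrableOn_dirichletDensity hR')
    have h3 := continuousOn_integral_ball h.one_le
      (integrableOn_of_continuousOn hR' h.continuousOn_reactionDensity)
    exact h1.add (continuousOn_const.mul (continuousOn_id.mul (h2.sub h3)))
  have hae : ∀ᵐ t ∂volume.restrict (Ioo 0 R'), sphereIntegral t (heightDensity B v G) = ψ t := by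
    filter_upwards [h.ae_sphereIntegral_normal hR', ae_restrict_mem measurableSet_Ioo] with t ht htR
    rw [hψ]
    beta_reduce
    rw [← ht.2, ← sphereIntegral_const_mul, ← SphereIntegrable.sphereIntegral_add
      (sphereIntegrable_of_continuousOn htR.1.le (htR.2.trans hR') h.continuousOn_div_mul)
      (ht.1.const_mul 2)]
    congr 1
    funext x
    rw [heightDensity, squareDensity, Finset.mul_sum, Finset.mul_sum, ← Finset.sum_add_distrib]
  have hint : IntervalIntegrable ψ volume 0 r := by
    rw [intervalIntegrable_iff_integrableOn_Ioo_of_le hr.1.le]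
    have : IntegrableOn ψ (Ioo 0 R') := (integrableOn_sphereIntegral h.one_le hi).congr hae
    exact this.mono_set (Ioo_subset_Ioo_right hrR'.le)
  have hd := intervalIntegral.integral_hasDerivAt_right hint
    (hψc.stronglyMeasurableAtFilter isOpen_Ioo r ⟨hr.1, hrR'⟩)
    (hψc.continuousAt (Ioo_mem_nhds hr.1 hrR'))
  refine hd.congr_of_eventuallyEq ?_
  filter_upwards [Ioo_mem_nhds hr.1 hrR'] with t ht
  rw [integral_ball_eq_intervalIntegral h.one_le hi (Ioo_subset_Icc_self ht),
    intervalIntegral.integral_of_le ht.1.le, intervalIntegral.integral_of_le ht.1.le,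
    integral_Ioc_eq_integral_Ioo, integral_Ioc_eq_integral_Ioo]
  exact integral_congr_ae (ae_restrict_of_ae_restrict_of_subset (Ioo_subset_Ioo_right ht.2.le) hae)

theorem hasDerivAt_opHeight {r : ℝ} (hr : r ∈ Ioo 0 R) :
    HasDerivAt (opHeight B v G) (2 / r * opEnergy B F v G r + heightRemainder B v r) r := by
  have hr0 := hr.1
  have hp : r ^ m ≠ 0 := (pow_pos hr0 m).ne'
  have hd := (h.hasDerivAt_integral_heightDensity hr).div (hasDerivAt_pow m r) hp
  refine HasDerivAt.congr_deriv hd ?_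
  have hs := h.sphereIntegral_height hr
  have e1 : sphereIntegral r (fun x => (divTrace (fun x => B x x) x - m * (⟪x, B x x⟫_ℝ / r ^ 2))
      * squareDensity v x)
      = sphereIntegral r (fun x => divTrace (fun x => B x x) x * squareDensity v x)
        - m / r ^ 2 * (r * ∫ x in ball 0 r, heightDensity B v G x) := by
    rw [← hs, ← sphereIntegral_const_mul, ← SphereIntegrable.sphereIntegral_sub
      (sphereIntegrable_of_continuousOn hr.1.le hr.2 h.continuousOn_div_mul)
      ((sphereIntegrable_of_continuousOn hr.1.le hr.2 h.continuousOn_inner_mul).const_mul _)]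
    congr 1
    funext x
    ring
  -- Removes the truncated subtraction `m - 1` in the derivative of `r ^ m`.
  obtain ⟨k, rfl⟩ : ∃ k, m = k + 1 := ⟨m - 1, by have := h.one_le; omega⟩
  rw [heightRemainder, e1, opEnergy, Nat.add_sub_cancel]
  generalize (∫ x in ball 0 r, heightDensity B v G x) = q
  field_simp
  ring

/-- The divergence of `B x x` deviates from `m` by `2 m M r`, and `⟪x, B x x⟫ / r ^ 2` deviates from
one by `M r`, together `3 m M r`. The passage from `r ^ 2` to `2 ⟪x, B x x⟫` doubles the constant.
-/
theorem abs_heightRemainder_le {r : ℝ} (hr : r ∈ Ioo 0 R) :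
    |heightRemainder B v r| ≤ 6 * m * M * opHeight B v G r := by
  have hr0 := hr.1
  have hp : 0 < r ^ m := pow_pos hr0 m
  have hM : 0 ≤ M := h.constant_nonneg (mem_ball_self (hr0.trans hr.2))
  rw [heightRemainder, opHeight, abs_div, abs_of_pos hp, mul_div_assoc']
  refine div_le_div_of_nonneg_right ?_ hp.le
  have hsi1 : SphereIntegrable r (fun x => (divTrace (fun x => B x x) x
      - m * (⟪x, B x x⟫_ℝ / r ^ 2)) * squareDensity v x) := by
    have := (sphereIntegrable_of_continuousOn hr.1.le hr.2 h.continuousOn_div_mul).add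
      ((sphereIntegrable_of_continuousOn hr.1.le hr.2 h.continuousOn_inner_mul).const_mul
        (-(m / r ^ 2)))
    exact this.congr hr.1.le fun x _ => by ring
  have hsi2 := (sphereIntegrable_of_continuousOn hr.1.le hr.2 h.continuousOn_inner_mul).const_mul
    (6 * m * M / r)
  have hbound : ∀ x : Euc m, ‖x‖ = r → |(divTrace (fun x => B x x) x
      - m * (⟪x, B x x⟫_ℝ / r ^ 2)) * squareDensity v x|
      ≤ 6 * m * M / r * (⟪x, B x x⟫_ℝ * squareDensity v x) := by
    intro x hx
    have hxR : x ∈ ball 0 R := by rw [mem_ball_zero_iff, hx]; exact hr.2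
    have hsq : 0 ≤ squareDensity v x := Finset.sum_nonneg fun i _ => sq_nonneg _
    have h1 := h.abs_divTrace_le hxR
    have h2 := abs_inner_sub_le h.critical.contDiffOn h.apply_zero h.norm_fderiv_le hxR x
    have h3 := (h.inner_pos hr hx).2
    rw [real_inner_comm, hx] at h2
    rw [hx] at h1
    have h4 : |⟪x, B x x⟫_ℝ / r ^ 2 - 1| ≤ M * r := by
      rw [div_sub_one (by positivity), abs_div, abs_of_pos (by positivity : 0 < r ^ 2),
        div_le_iff₀ (by positivity)]
      exact h2
    have h5 : |divTrace (fun x => B x x) x - m * (⟪x, B x x⟫_ℝ / r ^ 2)| ≤ 3 * m * M * r := by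
      have e : divTrace (fun x => B x x) x - m * (⟪x, B x x⟫_ℝ / r ^ 2)
        = (divTrace (fun x => B x x) x - m) - m * (⟪x, B x x⟫_ℝ / r ^ 2 - 1) := by ring
      rw [e]
      refine (abs_sub _ _).trans ?_
      rw [abs_mul, Nat.abs_cast]
      have := mul_le_mul_of_nonneg_left h4 (Nat.cast_nonneg (α := ℝ) m)
      linarith
    rw [abs_mul, abs_of_nonneg hsq, ← mul_assoc]
    refine mul_le_mul_of_nonneg_right (h5.trans ?_) hsq
    rw [div_mul_eq_mul_div, le_div_iff₀ hr0]
    calc 3 * m * M * r * r = 3 * m * M * r ^ 2 := by ring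
      _ ≤ 3 * m * M * (2 * ⟪x, B x x⟫_ℝ) := by gcongr
      _ = _ := by ring
  have e2 : sphereIntegral r (fun x => 6 * m * M / r * (⟪x, B x x⟫_ℝ * squareDensity v x))
      = 6 * m * M * ∫ x in ball 0 r, heightDensity B v G x := by
    rw [sphereIntegral_const_mul, h.sphereIntegral_height hr]
    field_simp
  rw [← e2, abs_le, ← neg_one_mul, ← sphereIntegral_const_mul]
  refine ⟨sphereIntegral_mono hr.1 (hsi2.const_mul _) hsi1 fun x hx => ?_,
    sphereIntegral_mono hr.1 hsi1 hsi2 fun x hx => (abs_le.mp (hbound x hx)).2⟩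
  rw [neg_one_mul]
  exact (abs_le.mp (hbound x hx)).1

end IsNormalizedCritical

theorem sphereIntegrable_sum {ι : Type*} [Fintype ι] {r : ℝ} {g : ι → Euc m → ℝ}
    (hg : ∀ i, SphereIntegrable r (g i)) : SphereIntegrable r (fun x => ∑ i, g i x) :=
  integrable_finsetSum _ fun i _ => hg i

namespace IsNormalizedCritical

variable {ℓ : ℕ} {B : Euc m → Euc m →L[ℝ] Euc m} {F v : Fin ℓ → Euc m → ℝ}
  {G : Fin ℓ → Euc m → Euc m} {R M c : ℝ} (h : IsNormalizedCritical B F v G R M c)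

include h

/-! #### The derivative of the energy -/

theorem contDiffOn_field : ContDiffOn ℝ 1 (opZ B) (ball 0 R) :=
  contDiffOn_opZ h.critical.contDiffOn h.apply_zero h.norm_fderiv_le h.small' h.critical.symm

/-- The normal component of the field is constant on each sphere, and the field is proportional to
`B x x`. The first makes the Dirichlet term on the sphere a full derivative; the second makes the
flux term a square. -/
theorem field_eq {r : ℝ} (hr : r ∈ Ioo 0 R) {x : Euc m} (hx : ‖x‖ = r) :
    opZ B x = (r ^ 2 / ⟪x, B x x⟫_ℝ) • B x x ∧ ⟪unitVec x, opZ B x⟫_ℝ = r := by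
  have hp := (h.inner_pos hr hx).1
  have e : opZ B x = (r ^ 2 / ⟪x, B x x⟫_ℝ) • B x x := by rw [opZ, hx, real_inner_comm]
  refine ⟨e, ?_⟩
  have hr0 := hr.1.ne'
  rw [e, unitVec, hx, inner_smul_left, inner_smul_right]
  simp only [conj_trivial]
  field_simp

/-- For the identity operator and the field `x`, the gradient terms would be exactly `(m - 2) |G|²`.
The errors are `6` from the derivative of `B`, `264` from `DZ - I`, `44 m` from the divergence of
`Z`; the reaction term is an error as a whole. -/
theorem abs_pohozaevDensity_sub_le {x : Euc m} (hx : x ∈ ball 0 R) :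
    |∑ i, pohozaevDensity (G i) B (F i) (opZ B) x - (m - 2) * dirichletDensity B G x|
      ≤ ‖x‖ * ((270 + 44 * m) * M * dirichletDensity B G x
        + 3 * c * (squareDensity v x + 2 * dirichletDensity B G x)) := by
  rw [dirichletDensity, squareDensity]
  simp only [Finset.mul_sum]
  rw [← Finset.sum_sub_distrib, ← Finset.sum_add_distrib, Finset.mul_sum, ← Finset.sum_add_distrib,
    Finset.mul_sum]
  refine (Finset.abs_sum_le_sum_abs _ _).trans (Finset.sum_le_sum fun i _ => ?_)
  have hM := h.constant_nonneg hx
  have hc := h.nonneg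
  have hB := h.critical.contDiffOn
  have hg := h.sq_norm_le hx (G i x)
  set q := ⟪B x (G i x), G i x⟫_ℝ with hq
  have hZ := norm_opZ_le hB h.apply_zero h.norm_fderiv_le h.small' hx
  have h1 : |⟪fderiv ℝ B x (opZ B x) (G i x), G i x⟫_ℝ| ≤ 6 * M * ‖x‖ * q := by
    refine (abs_real_inner_le_norm _ _).trans ?_
    have a1 : ‖fderiv ℝ B x (opZ B x)‖ ≤ M * (3 * ‖x‖) :=
      (ContinuousLinearMap.le_opNorm _ _).trans
        (mul_le_mul (h.norm_fderiv_le x hx) hZ (norm_nonneg _) hM)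
    have a2 : ‖fderiv ℝ B x (opZ B x) (G i x)‖ ≤ M * (3 * ‖x‖) * ‖G i x‖ :=
      (ContinuousLinearMap.le_opNorm _ _).trans (by gcongr)
    calc _ ≤ M * (3 * ‖x‖) * ‖G i x‖ * ‖G i x‖ := by gcongr
      _ = 3 * M * ‖x‖ * ‖G i x‖ ^ 2 := by ring
      _ ≤ 3 * M * ‖x‖ * (2 * q) := by gcongr
      _ = _ := by ring
  have hq0 : 0 ≤ q := by have := sq_nonneg ‖G i x‖; linarith
  have hD : ∀ ξ, ‖fderiv ℝ (opZ B) x ξ - ξ‖ ≤ 44 * M * ‖x‖ * ‖ξ‖ :=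
    norm_fderiv_opZ_sub_le' hB h.apply_zero h.norm_fderiv_le h.small' h.critical.symm hx
  have h2 : |(divTrace (opZ B) x - m) * q| ≤ 44 * m * M * ‖x‖ * q := by
    rw [abs_mul, abs_of_nonneg hq0]
    have := abs_divTrace_sub_le hD
    calc _ ≤ m * (44 * M * ‖x‖) * q := by gcongr
      _ = _ := by ring
  have h3 : |2 * (F i x * ⟪G i x, opZ B x⟫_ℝ)| ≤ 3 * c * ‖x‖ * (v i x ^ 2 + 2 * q) := by
    rw [abs_mul, abs_mul, abs_two]
    have a1 : |⟪G i x, opZ B x⟫_ℝ| ≤ ‖G i x‖ * (3 * ‖x‖) :=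
      (abs_real_inner_le_norm _ _).trans (by gcongr)
    have a2 := h.abs_reaction_le i x hx
    have a3 : 2 * (|v i x| * ‖G i x‖) ≤ v i x ^ 2 + 2 * q := by
      have := sq_nonneg (|v i x| - ‖G i x‖)
      have := sq_abs (v i x)
      nlinarith
    calc 2 * (|F i x| * |⟪G i x, opZ B x⟫_ℝ|)
        ≤ 2 * ((c * |v i x|) * (‖G i x‖ * (3 * ‖x‖))) := by gcongr
      _ = 3 * c * ‖x‖ * (2 * (|v i x| * ‖G i x‖)) := by ring
      _ ≤ _ := by gcongr
  have h4 : |2 * ⟪fderiv ℝ (opZ B) x (B x (G i x)) - B x (G i x), G i x⟫_ℝ|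
      ≤ 264 * M * ‖x‖ * q := by
    rw [abs_mul, abs_two]
    have a1 : |⟪fderiv ℝ (opZ B) x (B x (G i x)) - B x (G i x), G i x⟫_ℝ|
        ≤ 44 * M * ‖x‖ * (3 / 2 * ‖G i x‖) * ‖G i x‖ := by
      refine (abs_real_inner_le_norm _ _).trans ?_
      have := h.norm_apply_le' hx (G i x)
      gcongr
      exact (hD _).trans (by gcongr)
    calc _ ≤ 2 * (44 * M * ‖x‖ * (3 / 2 * ‖G i x‖) * ‖G i x‖) := by gcongr
      _ = 132 * M * ‖x‖ * ‖G i x‖ ^ 2 := by ring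
      _ ≤ 132 * M * ‖x‖ * (2 * q) := by gcongr
      _ = _ := by ring
  have e : pohozaevDensity (G i) B (F i) (opZ B) x - (m - 2) * q
      = ⟪fderiv ℝ B x (opZ B x) (G i x), G i x⟫_ℝ + (divTrace (opZ B) x - m) * q
        + 2 * (F i x * ⟪G i x, opZ B x⟫_ℝ)
        - 2 * ⟪fderiv ℝ (opZ B) x (B x (G i x)) - B x (G i x), G i x⟫_ℝ := by
    rw [pohozaevDensity, inner_sub_left, hq]
    ring
  rw [e]
  refine (abs_sub _ _).trans ?_
  have b1 := abs_add_le (⟪fderiv ℝ B x (opZ B x) (G i x), G i x⟫_ℝ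
    + (divTrace (opZ B) x - m) * q) (2 * (F i x * ⟪G i x, opZ B x⟫_ℝ))
  have b2 := abs_add_le (⟪fderiv ℝ B x (opZ B x) (G i x), G i x⟫_ℝ) ((divTrace (opZ B) x - m) * q)
  linarith

section Spheres

variable {R' : ℝ} (hR' : R' < R)

include hR'

theorem ae_sphereIntegrable_dirichlet : ∀ᵐ r ∂volume.restrict (Ioo 0 R'), ∀ i,
    SphereIntegrable r (fun x => ⟪B x (G i x), G i x⟫_ℝ) :=
  ae_all_iff.mpr fun i => ae_sphereIntegrable h.one_le
    (h.critical.integrableOn_quadratic (closedBall_subset hR') h.critical.contDiffOn.continuousOn i)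

theorem ae_sphereIntegrable_flux : ∀ᵐ r ∂volume.restrict (Ioo 0 R'), ∀ i,
    SphereIntegrable r (fun x => ⟪opZ B x, G i x⟫_ℝ * ⟪B x (G i x), unitVec x⟫_ℝ) :=
  ae_all_iff.mpr fun i => ae_sphereIntegrable h.one_le
    (h.critical.integrableOn_flux (closedBall_subset hR') h.contDiffOn_field.continuousOn i)

/-- The Pohozaev identity for the field `|x|² B(x) x / ⟨B(x) x, x⟩`. -/
theorem ae_pohozaev : ∀ᵐ r ∂volume.restrict (Ioo 0 R'),
    r * sphereIntegral r (dirichletDensity B G) = (∫ x in ball 0 r,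
      ∑ i, pohozaevDensity (G i) B (F i) (opZ B) x) + 2 * sphereIntegral r
        (fun x => ∑ i, ⟪opZ B x, G i x⟫_ℝ * ⟪B x (G i x), unitVec x⟫_ℝ) := by
  filter_upwards [h.ae_sphereIntegrable_dirichlet hR', h.ae_sphereIntegrable_flux hR',
    h.critical.ae_sphereIntegral_pohozaevFlux h.one_le isOpen_ball (closedBall_subset hR')
    h.contDiffOn_field, ae_restrict_mem measurableSet_Ioo] with r h1 h2 h3 hr
  rw [← h3, ← sphereIntegral_const_mul, ← sphereIntegral_const_mul,
    sphereIntegral_congr (g := fun x => ∑ i, pohozaevFlux (G i) B (opZ B) x)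
      (h := fun x => r * dirichletDensity B G x
        - 2 * ∑ i, ⟪opZ B x, G i x⟫_ℝ * ⟪B x (G i x), unitVec x⟫_ℝ) hr.1.le fun x hx => ?_,
    SphereIntegrable.sphereIntegral_sub, sub_add_cancel]
  · exact (sphereIntegrable_sum h1).const_mul _
  · exact (sphereIntegrable_sum h2).const_mul _
  · rw [dirichletDensity, Finset.mul_sum, Finset.mul_sum, ← Finset.sum_sub_distrib]
    refine Finset.sum_congr rfl fun i _ => ?_
    rw [pohozaevFlux, (h.field_eq ⟨hr.1, hr.2.trans hR'⟩ hx).2]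

theorem abs_integral_pohozaevDensity_sub_le {r : ℝ} (hr : r ∈ Ioo 0 R') :
    |(∫ x in ball 0 r, ∑ i, pohozaevDensity (G i) B (F i) (opZ B) x)
      - (m - 2) * ∫ x in ball 0 r, dirichletDensity B G x|
    ≤ r * (((270 + 44 * m) * M + 6 * c) * (∫ x in ball 0 r, dirichletDensity B G x)
      + 3 * c * ∫ x in ball 0 r, squareDensity v x) := by
  have hrR := hr.2.trans hR'
  have i1 : IntegrableOn (fun x => ∑ i, pohozaevDensity (G i) B (F i) (opZ B) x) (ball 0 r) :=
    integrable_finsetSum _ fun i _ => h.critical.integrableOn_pohozaevDensity isOpen_ball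
      (closedBall_subset hrR) h.contDiffOn_field i
  have i2 := h.integrableOn_dirichletDensity hrR
  have i3 := integrableOn_of_continuousOn hrR h.continuousOn_squareDensity
  rw [← integral_const_mul, ← integral_sub i1 (i2.const_mul _), ← integral_const_mul,
    ← integral_const_mul, ← integral_add (i2.const_mul _) (i3.const_mul _), ← integral_const_mul]
  refine abs_integral_le_integral_abs.trans (setIntegral_mono_on (i1.sub (i2.const_mul _)).abs
    (((i2.const_mul _).add (i3.const_mul _)).const_mul _) measurableSet_ball fun x hx => ?_)
  have hxR := ball_subset_ball hrR.le hx
  refine (h.abs_pohozaevDensity_sub_le hxR).trans ?_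
  have hn : ‖x‖ ≤ r := (mem_ball_zero_iff.mp hx).le
  have h1 := h.dirichletDensity_nonneg hxR
  have h2 : 0 ≤ squareDensity v x := Finset.sum_nonneg fun i _ => sq_nonneg _
  have hM := h.constant_nonneg hxR
  have hc := h.nonneg
  have e : (270 + 44 * m) * M * dirichletDensity B G x
      + 3 * c * (squareDensity v x + 2 * dirichletDensity B G x)
      = ((270 + 44 * m) * M + 6 * c) * dirichletDensity B G x + 3 * c * squareDensity v x := by ring
  rw [e]
  gcongr

/-- The Cauchy–Schwarz inequality between the energy, the height and the surface flux. -/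
theorem ae_cauchySchwarz : ∀ᵐ r ∂volume.restrict (Ioo 0 R'),
    r ^ 2 * ((∫ x in ball 0 r, dirichletDensity B G x)
      - ∫ x in ball 0 r, reactionDensity F v x) ^ 2
    ≤ sphereIntegral r (fun x => ∑ i, ⟪opZ B x, G i x⟫_ℝ * ⟪B x (G i x), unitVec x⟫_ℝ)
      * ∫ x in ball 0 r, heightDensity B v G x := by
  filter_upwards [h.ae_sphereIntegrable_flux hR', h.ae_sphereIntegral_normal hR',
    ae_restrict_mem measurableSet_Ioo] with r h2 h3 hr
  have hrR : r ∈ Ioo 0 R := ⟨hr.1, hr.2.trans hR'⟩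
  have hr0 := hr.1
  have i1 : SphereIntegrable r
    (fun x => ∑ i, ⟪opZ B x, G i x⟫_ℝ * ⟪B x (G i x), unitVec x⟫_ℝ) :=
    sphereIntegrable_sum h2
  have i2 := h3.1
  have i3 := sphereIntegrable_of_continuousOn hr.1.le hrR.2 h.continuousOn_inner_mul
  set P := sphereIntegral r (fun x => ∑ i, ⟪opZ B x, G i x⟫_ℝ * ⟪B x (G i x), unitVec x⟫_ℝ)
  set X := (∫ x in ball 0 r, dirichletDensity B G x) - ∫ x in ball 0 r, reactionDensity F v x
  set Q := ∫ x in ball 0 r, heightDensity B v G x with hQ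
  -- The polynomial is the integral over the sphere of the sum of `(r g - t p v i) ^ 2 / (r p)`,
  -- with `g = ⟪G i, B x x⟫` and `p = ⟪x, B x x⟫`. Its discriminant is therefore not positive.
  have key : ∀ t : ℝ, 0 ≤ Q * (t * t) + (-2 * (r * X)) * t + P := fun t => by
    have e1 : sphereIntegral r (fun x => (1 / r * (t * t)) * (⟪x, B x x⟫_ℝ * squareDensity v x)
        + (-2 * t) * (∑ i, v i x * ⟪G i x, B x x⟫_ℝ)
        + ∑ i, ⟪opZ B x, G i x⟫_ℝ * ⟪B x (G i x), unitVec x⟫_ℝ)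
        = Q * (t * t) + (-2 * (r * X)) * t + P := by
      rw [SphereIntegrable.sphereIntegral_add
        ((i3.const_mul (1 / r * (t * t))).add (i2.const_mul (-2 * t))) i1,
        SphereIntegrable.sphereIntegral_add (i3.const_mul (1 / r * (t * t)))
        (i2.const_mul (-2 * t)), sphereIntegral_const_mul, sphereIntegral_const_mul, h3.2,
        h.sphereIntegral_height hrR]
      change 1 / r * (t * t) * (r * Q) + -2 * t * (r * X) + P = _
      field_simp
    rw [← e1, ← show sphereIntegral (m := m) r (fun _ => 0) = 0 by simp [sphereIntegral]]
    refine sphereIntegral_mono hr.1 (integrable_zero _ _ _)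
      (((i3.const_mul (1 / r * (t * t))).add (i2.const_mul (-2 * t))).add i1) fun x hx => ?_
    have hxR : x ∈ ball 0 R := by rw [mem_ball_zero_iff, hx]; exact hrR.2
    rw [squareDensity, Finset.mul_sum, Finset.mul_sum, Finset.mul_sum, ← Finset.sum_add_distrib,
      ← Finset.sum_add_distrib]
    refine Finset.sum_nonneg fun i _ => ?_
    rw [(h.field_eq hrR hx).1, inner_smul_left, unitVec, inner_smul_right, hx,
      h.critical.symm x hxR (G i x) x, real_inner_comm (G i x) (B x x)]
    simp only [conj_trivial]
    have hp := (h.inner_pos hrR hx).1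
    set g := ⟪G i x, B x x⟫_ℝ
    set p := ⟪x, B x x⟫_ℝ
    have e2 : 1 / r * (t * t) * (p * v i x ^ 2) + -2 * t * (v i x * g)
        + r ^ 2 / p * g * (r⁻¹ * g) = (r * g - t * p * v i x) ^ 2 / (r * p) := by
      field_simp
      ring
    rw [e2]
    positivity
  have := discrim_le_zero key
  rw [discrim] at this
  nlinarith

end Spheres

end IsNormalizedCritical

/-- The constant in the monotonicity formula. -/
def frequencyConstant (m : ℕ) (M c : ℝ) : ℝ := (540 + 88 * m) * M + (472 + 152 * m) * c + 1

namespace IsNormalizedCritical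

variable {ℓ : ℕ} {B : Euc m → Euc m →L[ℝ] Euc m} {F v : Fin ℓ → Euc m → ℝ}
  {G : Fin ℓ → Euc m → Euc m} {R M c : ℝ} (h : IsNormalizedCritical B F v G R M c)

include h

theorem abs_sphereIntegral_reaction_le {r : ℝ} (hr : r ∈ Ioo 0 R) :
    |sphereIntegral r (reactionDensity F v)| ≤ 2 * c / r * ∫ x in ball 0 r, heightDensity B v G x := by
  have hr0 := hr.1
  have i1 := sphereIntegrable_of_continuousOn hr.1.le hr.2 h.continuousOn_reactionDensity
  have i2 := (sphereIntegrable_of_continuousOn hr.1.le hr.2 h.continuousOn_inner_mul).const_mul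
    (2 * c / r ^ 2)
  have e2 : sphereIntegral r (fun x => 2 * c / r ^ 2 * (⟪x, B x x⟫_ℝ * squareDensity v x))
      = 2 * c / r * ∫ x in ball 0 r, heightDensity B v G x := by
    rw [sphereIntegral_const_mul, h.sphereIntegral_height hr]
    field_simp
  have hbound : ∀ x : Euc m, ‖x‖ = r → |reactionDensity F v x|
      ≤ 2 * c / r ^ 2 * (⟪x, B x x⟫_ℝ * squareDensity v x) := fun x hx => by
    have hxR : x ∈ ball 0 R := by rw [mem_ball_zero_iff, hx]; exact hr.2
    have hsq : 0 ≤ squareDensity v x := Finset.sum_nonneg fun i _ => sq_nonneg _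
    have h3 := (h.inner_pos hr hx).2
    have hc := h.nonneg
    refine (h.abs_reactionDensity_le hxR).trans ?_
    rw [div_mul_eq_mul_div, le_div_iff₀ (by positivity)]
    calc c * squareDensity v x * r ^ 2 ≤ c * squareDensity v x * (2 * ⟪x, B x x⟫_ℝ) := by gcongr
      _ = _ := by ring
  rw [← e2, abs_le, ← neg_one_mul, ← sphereIntegral_const_mul]
  refine ⟨sphereIntegral_mono hr.1 (i2.const_mul _) i1 fun x hx => ?_,
    sphereIntegral_mono hr.1 i1 i2 fun x hx => (abs_le.mp (hbound x hx)).2⟩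
  rw [neg_one_mul]
  exact (abs_le.mp (hbound x hx)).1

/-- The Pohozaev identity replaces the Dirichlet integral on the sphere by twice the flux plus a
bulk term close to `(m - 2)` times the energy, which cancels the derivative of the power of `r`. The
flux is kept as `b` and all the rest is bounded through the coercivity. -/
theorem ae_hasDerivAt_opEnergy {R' : ℝ} (hR' : R' < R) : ∀ᵐ r ∂volume.restrict (Ioo 0 R'),
    ∃ e b, HasDerivAt (opEnergy B F v G) e r ∧
      b - frequencyConstant m M c * (opEnergy B F v G r + opHeight B v G r) ≤ e ∧
      2 / r * opEnergy B F v G r ^ 2 ≤ b * opHeight B v G r := by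
  filter_upwards [h.ae_pohozaev hR', h.ae_cauchySchwarz hR',
    ae_hasDerivAt_integral_ball h.one_le (h.integrableOn_dirichletDensity hR'),
    ae_hasDerivAt_integral_ball h.one_le
      (integrableOn_of_continuousOn hR' h.continuousOn_reactionDensity),
    ae_restrict_mem measurableSet_Ioo] with r h1 h2 h3 h4 hr
  have hrR : r ∈ Ioo 0 R := ⟨hr.1, hr.2.trans hR'⟩
  have hr0 := hr.1
  have hr1 : r ≤ 1 := hrR.2.le.trans h.le_one
  have hp : 0 < r ^ m := pow_pos hr0 m
  have hM : 0 ≤ M := h.constant_nonneg (mem_ball_self (hr0.trans hrR.2))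
  have hc := h.nonneg
  have hm : (1 : ℝ) ≤ m := by exact_mod_cast h.one_le
  have h5 := h.abs_integral_pohozaevDensity_sub_le hR' hr
  have h6 := h.abs_sphereIntegral_reaction_le hrR
  have h7 := h.integral_squareDensity_le_energy hrR
  have h8 := h.rescaled_dirichlet_add_le hrR
  have h9 := h.rescaled_dirichlet_nonneg hrR
  have h10 := h.opHeight_nonneg hrR
  have h11 := h.abs_integral_reactionDensity_le hrR.2
  have hd := ((hasDerivAt_pow 2 r).div (hasDerivAt_pow m r) hp.ne').mul (h3.sub h4)
  set P := sphereIntegral r (fun x => ∑ i, ⟪opZ B x, G i x⟫_ℝ * ⟪B x (G i x), unitVec x⟫_ℝ)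
  set T := opEnergy B F v G r + opHeight B v G r with hT
  have hT0 : 0 ≤ T := by linarith
  refine ⟨_, 2 * r / r ^ m * P, hd, ?_, ?_⟩
  · have hH : opHeight B v G r = (∫ x in ball 0 r, heightDensity B v G x) / r ^ m := rfl
    simp only [Pi.div_apply, Pi.sub_apply]
    set D := ∫ x in ball 0 r, dirichletDensity B G x
    set J := ∫ x in ball 0 r, reactionDensity F v x
    set I := ∫ x in ball 0 r, squareDensity v x
    set Q := ∫ x in ball 0 r, heightDensity B v G x
    set SD := sphereIntegral r (dirichletDensity B G)
    set SF := sphereIntegral r (reactionDensity F v)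
    set Ph := ∫ x in ball 0 r, ∑ i, pohozaevDensity (G i) B (F i) (opZ B) x
    -- The bounds `k1`, `k2` and `k3` add up to the coefficients of `frequencyConstant`: `540 + 88
    -- m` for `M`, and `12 + 456 + 4 + 152 m` for `c`.
    have k1 : |r / r ^ m * ((m - 2) * J)| ≤ 152 * m * c * T := by
      have a1 : |(m : ℝ) - 2| ≤ m := by rw [abs_le]; constructor <;> linarith
      rw [abs_mul, abs_mul, abs_of_pos (by positivity : 0 < r / r ^ m)]
      calc r / r ^ m * (|(m : ℝ) - 2| * |J|) ≤ r / r ^ m * (m * (c * (r ^ m * (152 * T)))) := by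
            gcongr
            exact h11.trans (by gcongr)
        _ = r * (152 * m * c * T) := by field_simp
        _ ≤ 1 * (152 * m * c * T) := by gcongr
        _ = _ := one_mul _
    have k2 : |r / r ^ m * (Ph - (m - 2) * D)|
        ≤ 2 * ((270 + 44 * m) * M + 6 * c) * T + 456 * c * T := by
      rw [abs_mul, abs_of_pos (by positivity : 0 < r / r ^ m)]
      calc r / r ^ m * |Ph - (m - 2) * D|
          ≤ r / r ^ m * (r * (((270 + 44 * m) * M + 6 * c) * D + 3 * c * (r ^ m * (152 * T)))) := by
            refine mul_le_mul_of_nonneg_left (h5.trans ?_) (by positivity)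
            gcongr
        _ = ((270 + 44 * m) * M + 6 * c) * (r ^ 2 / r ^ m * D) + r ^ 2 * (456 * c * T) := by
            field_simp
            ring
        _ ≤ ((270 + 44 * m) * M + 6 * c) * (2 * T) + 1 * (456 * c * T) := by
            have a2 : r ^ 2 / r ^ m * D ≤ 2 * T := by linarith
            have a3 : r ^ 2 ≤ 1 := pow_le_one₀ hr0.le hr1
            refine add_le_add (mul_le_mul_of_nonneg_left a2 (by positivity))
              (mul_le_mul_of_nonneg_right a3 (by positivity))
        _ = _ := by ring
    have k3 : |r ^ 2 / r ^ m * SF| ≤ 4 * c * T := by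
      rw [abs_mul, abs_of_pos (by positivity : 0 < r ^ 2 / r ^ m)]
      calc r ^ 2 / r ^ m * |SF| ≤ r ^ 2 / r ^ m * (2 * c / r * Q) := by gcongr
        _ = r * (2 * c * opHeight B v G r) := by rw [hH]; field_simp
        _ ≤ 1 * (2 * c * (2 * T)) := by gcongr; linarith
        _ = _ := by ring
    -- After `r * SD` is replaced by `Ph + 2 * P`, the term `(m - 2) * D` is subtracted from `Ph`;
    -- the factor `(2 - m)` of the differentiated power then acts on `-J` alone.
    have e1 : (↑2 * r ^ (2 - 1) * r ^ m - r ^ 2 * (m * r ^ (m - 1))) / (r ^ m) ^ 2 * (D - J)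
        + r ^ 2 / r ^ m * (SD - SF)
        = 2 * r / r ^ m * P + r / r ^ m * ((m - 2) * J) + r / r ^ m * (Ph - (m - 2) * D)
          - r ^ 2 / r ^ m * SF := by
      have e2 : r ^ 2 / r ^ m * (SD - SF) = r / r ^ m * (r * SD) - r ^ 2 / r ^ m * SF := by ring
      rw [e2, h1]
      obtain ⟨k, rfl⟩ : ∃ k, m = k + 1 := ⟨m - 1, by have := h.one_le; omega⟩
      rw [Nat.add_sub_cancel]
      field_simp
      ring
    have e3 : (((2 : ℕ) : ℝ) * r ^ (2 - 1) * r ^ m - r ^ 2 * (m * r ^ (m - 1))) / (r ^ m) ^ 2 * (D - J)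
        + r ^ 2 / r ^ m * (SD - SF)
        = 2 * r / r ^ m * P + r / r ^ m * ((m - 2) * J) + r / r ^ m * (Ph - (m - 2) * D)
          - r ^ 2 / r ^ m * SF := by exact_mod_cast e1
    rw [e3, frequencyConstant]
    have l1 := (abs_le.mp k1).1
    have l2 := (abs_le.mp k2).1
    have l3 := (abs_le.mp k3).2
    linarith
  · rw [opEnergy, opHeight]
    have : 2 * r / (r ^ m) ^ 2 * (r ^ 2 * ((∫ x in ball 0 r, dirichletDensity B G x)
      - ∫ x in ball 0 r, reactionDensity F v x) ^ 2) ≤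
      2 * r / (r ^ m) ^ 2 * (P * ∫ x in ball 0 r, heightDensity B v G x) := by gcongr
    refine le_of_eq_of_le ?_ (this.trans_eq ?_) <;> field_simp

theorem absolutelyContinuous_opEnergy {a b : ℝ} (ha : 0 < a) (hab : a ≤ b) (hb : b < R) :
    AbsolutelyContinuousOnInterval (opEnergy B F v G) a b := by
  have h1 := absolutelyContinuousOn_integral_ball h.one_le (h.integrableOn_dirichletDensity hb)
    ha.le hab le_rfl
  have h2 := absolutelyContinuousOn_integral_ball h.one_le
    (integrableOn_of_continuousOn hb h.continuousOn_reactionDensity) ha.le hab le_rfl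
  have h3 : AbsolutelyContinuousOnInterval (fun r : ℝ => r ^ 2 / r ^ m) a b := by
    refine ContDiffOn.absolutelyContinuousOnInterval ?_
    rw [uIcc_of_le hab]
    exact (contDiff_id.pow 2).contDiffOn.div (contDiff_id.pow m).contDiffOn
      fun r hr => (pow_pos (ha.trans_le hr.1) m).ne'
  exact absolutelyContinuous_congr (h3.mul (h1.sub h2)) fun r _ => rfl

theorem frequencyEstimates (hR : 0 < R) {R' : ℝ} (hR' : R' < R) : FrequencyEstimates (opEnergy B F v G)
    (opHeight B v G) (heightRemainder B v) (frequencyConstant m M c) R' := by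
  have hsub : Ioo 0 R' ⊆ Ioo 0 R := Ioo_subset_Ioo_right hR'.le
  have hc := h.nonneg
  have hM : 0 ≤ M := h.constant_nonneg (mem_ball_self hR)
  exact
  { pos := by rw [frequencyConstant]; positivity
    absolutelyContinuous := fun a b ha hab hb =>
      h.absolutelyContinuous_opEnergy ha hab (hb.trans hR')
    height_nonneg := fun r hr => h.opHeight_nonneg (hsub hr)
    hasDerivAt_height := fun r hr => h.hasDerivAt_opHeight (hsub hr)
    abs_remainder_le := fun r hr => by
      refine (h.abs_heightRemainder_le (hsub hr)).trans
        (mul_le_mul_of_nonneg_right ?_ (h.opHeight_nonneg (hsub hr)))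
      rw [frequencyConstant]
      have : 0 ≤ (540 + 82 * m) * M + (472 + 152 * m) * c + 1 := by positivity
      linarith
    ae_hasDerivAt_energy := h.ae_hasDerivAt_opEnergy hR'
    half_height_le := fun r hr => h.half_opHeight_le (hsub hr)
    -- Vanishing height and energy force `v = 0` on the ball of radius `r`, hence on all the smaller
    -- spheres.
    height_eq_zero := fun r hr hH hE s hs => by
      have h0 := h.eq_zero_of_opHeight_eq_zero (hsub hr) hH hE
      refine h.opHeight_eq_zero ⟨hs.1, hs.2.trans (hsub hr).2⟩ fun x hx i => h0 x ?_ i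
      rw [mem_ball_zero_iff, hx]
      exact hs.2 }

end IsNormalizedCritical

/-! ### The identities in coordinates -/

theorem integral_add_add_sub {α : Type*} [MeasurableSpace α] {μ : Measure α} {a b c d : α → ℝ}
    (ha : Integrable a μ) (hb : Integrable b μ) (hc : Integrable c μ) (hd : Integrable d μ) :
    ∫ x, (a x + b x + 2 * c x - 2 * d x) ∂μ
      = (∫ x, a x ∂μ) + (∫ x, b x ∂μ) + 2 * (∫ x, c x ∂μ) - 2 * ∫ x, d x ∂μ := by
  have h1 : Integrable (fun x => a x + b x) μ := ha.add hb
  have h2 : Integrable (fun x => a x + b x + 2 * c x) μ := h1.add (hc.const_mul 2)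
  rw [integral_sub h2 (hd.const_mul 2), integral_add h1 (hc.const_mul 2), integral_add ha hb,
    integral_const_mul, integral_const_mul]

section Coordinates

variable {A : Euc m → Matrix (Fin m) (Fin m) ℝ}

theorem mu_eq (A : Euc m → Matrix (Fin m) (Fin m) ℝ) (x : Euc m) :
    mu A x = ⟪opField A x x, x⟫_ℝ / ‖x‖ ^ 2 := by
  rw [mu, matForm_eq, unitVec, map_smul, inner_smul_left, inner_smul_right, div_eq_mul_inv, ← inv_pow]
  simp only [conj_trivial]
  ring

theorem fieldZ_eq (A : Euc m → Matrix (Fin m) (Fin m) ℝ) : fieldZ A = opZ (opField A) := by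
  funext x
  rw [fieldZ, mu_eq, inv_div]
  rfl

theorem partialDeriv_component {W : Euc m → Euc m} {x : Euc m} (hW : DifferentiableAt ℝ W x)
    (h j : Fin m) : partialDeriv h (fun y => W y j) x = fderiv ℝ W x (stdVec h) j := by
  have hk : HasFDerivAt (fun y => W y j)
      ((EuclideanSpace.proj j : Euc m →L[ℝ] ℝ) ∘L fderiv ℝ W x) x :=
    (EuclideanSpace.proj j : Euc m →L[ℝ] ℝ).hasFDerivAt.comp x hW.hasFDerivAt
  rw [partialDeriv, hk.fderiv]
  rfl

theorem divergence_eq {W : Euc m → Euc m} {x : Euc m} (hW : DifferentiableAt ℝ W x) :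
    divergence W x = divTrace W x :=
  Finset.sum_congr rfl fun j _ => partialDeriv_component hW j j

theorem fderiv_sub_id {W : Euc m → Euc m} {x : Euc m} (hW : DifferentiableAt ℝ W x) (ξ : Euc m) :
    fderiv ℝ (fun y => W y - y) x ξ = fderiv ℝ W x ξ - ξ := by
  have hk : HasFDerivAt (fun y => W y - y) (fderiv ℝ W x - ContinuousLinearMap.id ℝ (Euc m)) x :=
    hW.hasFDerivAt.sub (hasFDerivAt_id x)
  rw [hk.fderiv]
  rfl

theorem divergence_sub_id {W : Euc m → Euc m} {x : Euc m} (hW : DifferentiableAt ℝ W x) :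
    divergence (fun y => W y - y) x = divTrace W x - m := by
  have hW' : DifferentiableAt ℝ (fun y => W y - y) x := hW.sub differentiableAt_id
  rw [divergence_eq hW', divTrace, divTrace]
  simp [fderiv_sub_id hW]

theorem inner_eq_sum (ξ ζ : Euc m) : ⟪ξ, ζ⟫_ℝ = ∑ j, ξ j * ζ j := by
  rw [PiLp.inner_apply]
  simp [mul_comm]

/-- The index sum is the derivative of `W` in the direction `A D`, paired with `D`. -/
theorem sum_coordinates_fderiv {W : Euc m → Euc m} {x : Euc m} (hW : DifferentiableAt ℝ W x)
    (D : Euc m) : ∑ h, ∑ l, ∑ j, A x h l * partialDeriv h (fun y => W y j) x * D j * D l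
      = ⟪fderiv ℝ W x (opField A x D), D⟫_ℝ := by
  have e : opField A x D = ∑ h, (∑ l, A x h l * D l) • stdVec h := by
    conv_lhs => rw [← sum_smul_stdVec (opField A x D)]
    simp only [opField_apply_apply]
  rw [e, map_sum, sum_inner]
  refine Finset.sum_congr rfl fun h _ => ?_
  rw [map_smul, inner_smul_left, inner_eq_sum]
  simp only [conj_trivial]
  rw [Finset.sum_mul]
  refine Finset.sum_congr rfl fun l _ => ?_
  rw [Finset.mul_sum]
  refine Finset.sum_congr rfl fun j _ => ?_
  rw [partialDeriv_component hW]
  ring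

theorem sum_coordinates_gradient {x : Euc m} (hA : DifferentiableAt ℝ (opField A) x)
    (ζ D : Euc m) : ∑ h, ∑ l, ⟪ζ, gradient (fun y => A y h l) x⟫_ℝ * D h * D l
      = ⟪fderiv ℝ (opField A) x ζ D, D⟫_ℝ := by
  have hent : ∀ h l, HasFDerivAt (fun y => A y h l) ((EuclideanSpace.proj h : Euc m →L[ℝ] ℝ) ∘L
      (fderiv ℝ (opField A) x).flip (stdVec l)) x := fun h l => by
    have h1 : HasFDerivAt (fun y => opField A y (stdVec l)) ((fderiv ℝ (opField A) x).flip (stdVec l)) x := by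
      have := hA.hasFDerivAt.clm_apply (hasFDerivAt_const (stdVec l : Euc m) x)
      simpa using this
    have h2 : HasFDerivAt (fun y => opField A y (stdVec l) h) _ x :=
      (EuclideanSpace.proj h : Euc m →L[ℝ] ℝ).hasFDerivAt.comp x h1
    refine h2.congr_of_eventuallyEq (Eventually.of_forall fun y => ?_)
    beta_reduce
    rw [opField_apply_apply]
    simp [stdVec]
  rw [inner_eq_sum]
  refine Finset.sum_congr rfl fun h _ => ?_
  have e : fderiv ℝ (opField A) x ζ D h
      = ∑ l, fderiv ℝ (opField A) x ζ (stdVec l) h * D l := by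
    conv_lhs => rw [← sum_smul_stdVec D]
    rw [map_sum, WithLp.ofLp_sum, Finset.sum_apply]
    simp [mul_comm]
  rw [e, Finset.sum_mul]
  refine Finset.sum_congr rfl fun l _ => ?_
  rw [real_inner_comm, inner_gradient_eq_fderiv, (hent h l).fderiv]
  simp
  ring

end Coordinates

section Identities

variable {ℓ : ℕ} {A : Euc m → Matrix (Fin m) (Fin m) ℝ} {f : Fin ℓ → Euc m → ℝ → ℝ}
  {v : Fin ℓ → Euc m → ℝ} {U : Set (Euc m)} {R M c : ℝ}
  (h : IsNormalizedCritical (opField A) (fun i x => f i x (v i x)) v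
    (fun i => weakGrad U (v i)) R M c)

theorem one_div_zpow_sub_two (m : ℕ) {r : ℝ} (hr : r ≠ 0) :
    1 / r ^ ((m : ℤ) - 2) = r ^ 2 / r ^ m := by
  rw [zpow_sub₀ hr, zpow_natCast]
  simp [zpow_ofNat]

theorem one_div_zpow_sub_one (m : ℕ) {r : ℝ} (hr : r ≠ 0) :
    1 / r ^ ((m : ℤ) - 1) = r / r ^ m := by
  rw [zpow_sub₀ hr, zpow_natCast]
  simp

include h

theorem energyDirichlet_eq {r : ℝ} (hr : r ∈ Ioo 0 R) :
    energyDirichlet U A v r = r ^ 2 / r ^ m *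
      ∫ x in ball 0 r, dirichletDensity (opField A) (fun i => weakGrad U (v i)) x := by
  rw [energyDirichlet, one_div_zpow_sub_two m hr.1.ne']
  simp only [dirichletDensity]
  rw [integral_finsetSum _ fun i _ => h.critical.integrableOn_quadratic
    (IsNormalizedCritical.closedBall_subset hr.2) h.critical.contDiffOn.continuousOn i]
  rfl

theorem energy_eq {r : ℝ} (hr : r ∈ Ioo 0 R) :
    energy U A f v r = opEnergy (opField A) (fun i x => f i x (v i x)) v
      (fun i => weakGrad U (v i)) r := by
  rw [energy, one_div_zpow_sub_two m hr.1.ne', opEnergy]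
  simp only [dirichletDensity, reactionDensity]
  have i1 := fun i => h.critical.integrableOn_quadratic
    (IsNormalizedCritical.closedBall_subset hr.2) h.critical.contDiffOn.continuousOn i
  have i2 : ∀ i, IntegrableOn (fun x => f i x (v i x) * v i x) (ball 0 r) := fun i =>
    IsNormalizedCritical.integrableOn_of_continuousOn hr.2
      ((h.critical.continuousOn_reaction i).mul (h.critical.continuousOn i))
  rw [integral_finsetSum _ fun i _ => i1 i, integral_finsetSum _ fun i _ => i2 i,
    ← Finset.sum_sub_distrib]
  congr 1
  exact Finset.sum_congr rfl fun i _ => integral_sub (i1 i) (i2 i)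

theorem height_eq {r : ℝ} (hr : r ∈ Ioo 0 R) :
    height A v r = opHeight (opField A) v (fun i => weakGrad U (v i)) r := by
  have hr0 := hr.1.ne'
  have e := h.sphereIntegral_height hr
  rw [height, one_div_zpow_sub_one m hr0, opHeight, sphereIntegral_congr
    (h := fun x => (1 / r ^ 2) * (⟪x, opField A x x⟫_ℝ * squareDensity v x)) hr.1.le fun x hx => ?_,
    sphereIntegral_const_mul, e]
  · field_simp
  · rw [mu_eq, hx, real_inner_comm, squareDensity]
    ring

/-- The densities of the Pohozaev identity, integrated separately. -/
theorem integral_pohozaevDensity {r : ℝ} (hr : r < R) :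
    ∫ x in ball 0 r, ∑ i, pohozaevDensity (weakGrad U (v i)) (opField A) (fun x => f i x (v i x))
      (opZ (opField A)) x
    = (∑ i, ∫ x in ball 0 r, ∑ h, ∑ l, inner ℝ (fieldZ A x) (gradient (fun y => A y h l) x)
          * weakGrad U (v i) x h * weakGrad U (v i) x l)
      + (∑ i, ∫ x in ball 0 r, divergence (fieldZ A) x
          * matForm (A x) (weakGrad U (v i) x) (weakGrad U (v i) x))
      + 2 * (∑ i, ∫ x in ball 0 r, f i x (v i x) * inner ℝ (weakGrad U (v i) x) (fieldZ A x))
      - 2 * (∑ i, ∫ x in ball 0 r, ∑ h, ∑ l, ∑ j,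
        A x h l * partialDeriv h (fun y => fieldZ A y j) x * weakGrad U (v i) x j
          * weakGrad U (v i) x l) ∧
    (∑ i, ∫ x in ball 0 r, divergence (fun y => fieldZ A y - y) x
          * matForm (A x) (weakGrad U (v i) x) (weakGrad U (v i) x))
      = (∑ i, ∫ x in ball 0 r, divergence (fieldZ A) x
          * matForm (A x) (weakGrad U (v i) x) (weakGrad U (v i) x))
        - m * ∫ x in ball 0 r, dirichletDensity (opField A) (fun i => weakGrad U (v i)) x ∧
    (∑ i, ∫ x in ball 0 r, ∑ h, ∑ l, ∑ j,
        A x h l * partialDeriv h (fun y => fieldZ A y j - y j) x * weakGrad U (v i) x j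
          * weakGrad U (v i) x l)
      = (∑ i, ∫ x in ball 0 r, ∑ h, ∑ l, ∑ j,
        A x h l * partialDeriv h (fun y => fieldZ A y j) x * weakGrad U (v i) x j
          * weakGrad U (v i) x l)
        - ∫ x in ball 0 r, dirichletDensity (opField A) (fun i => weakGrad U (v i)) x := by
  have hsub := IsNormalizedCritical.closedBall_subset (m := m) hr
  have hZ := h.contDiffOn_field
  have hB := h.critical.contDiffOn
  have hZd : ∀ x ∈ ball (0 : Euc m) r, DifferentiableAt ℝ (opZ (opField A)) x := fun x hx =>
    (hZ.contDiffAt (isOpen_ball.mem_nhds (ball_subset_ball hr.le hx))).differentiableAt one_ne_zero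
  have hBd : ∀ x ∈ ball (0 : Euc m) r, DifferentiableAt ℝ (opField A) x := fun x hx =>
    (hB.contDiffAt (isOpen_ball.mem_nhds (ball_subset_ball hr.le hx))).differentiableAt one_ne_zero
  have hB' := hB.continuousOn_fderiv_of_isOpen isOpen_ball le_rfl
  have hZ' := hZ.continuousOn_fderiv_of_isOpen isOpen_ball le_rfl
  have i0 := fun i => h.critical.integrableOn_quadratic hsub hB.continuousOn i
  have i1 := fun i => h.critical.integrableOn_quadratic hsub (hB'.clm_apply hZ.continuousOn) i
  have i2 : ∀ i, IntegrableOn (fun x => divTrace (opZ (opField A)) x *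
      ⟪opField A x (weakGrad U (v i) x), weakGrad U (v i) x⟫_ℝ) (ball 0 r) := fun i =>
    IntegrableOn.congr_fun (h.critical.integrableOn_quadratic hsub
      ((continuousOn_divTrace isOpen_ball hZ).smul hB.continuousOn) i)
      (fun x _ => by simp [inner_smul_left]) measurableSet_ball
  have i3 : ∀ i, IntegrableOn (fun x => f i x (v i x) *
      ⟪weakGrad U (v i) x, opZ (opField A) x⟫_ℝ) (ball 0 r) := fun i =>
    IntegrableOn.congr_fun (h.critical.integrableOn_linear hsub
      ((h.critical.continuousOn_reaction i).smul hZ.continuousOn) i)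
      (fun x _ => by simp [inner_smul_right]) measurableSet_ball
  have i4 : ∀ i, IntegrableOn (fun x => ⟪fderiv ℝ (opZ (opField A)) x
      (opField A x (weakGrad U (v i) x)), weakGrad U (v i) x⟫_ℝ) (ball 0 r) := fun i =>
    h.critical.integrableOn_quadratic hsub (hZ'.clm_comp hB.continuousOn) i
  have c1 : ∀ i, ∫ x in ball 0 r, ∑ h, ∑ l, inner ℝ (fieldZ A x) (gradient (fun y => A y h l) x)
          * weakGrad U (v i) x h * weakGrad U (v i) x l
      = ∫ x in ball 0 r, ⟪fderiv ℝ (opField A) x (opZ (opField A) x) (weakGrad U (v i) x),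
          weakGrad U (v i) x⟫_ℝ := fun i =>
    setIntegral_congr_fun measurableSet_ball fun x hx => by
      beta_reduce
      rw [sum_coordinates_gradient (hBd x hx), fieldZ_eq]
  have c2 : ∀ i, ∫ x in ball 0 r, divergence (fieldZ A) x
          * matForm (A x) (weakGrad U (v i) x) (weakGrad U (v i) x)
      = ∫ x in ball 0 r, divTrace (opZ (opField A)) x *
        ⟪opField A x (weakGrad U (v i) x), weakGrad U (v i) x⟫_ℝ := fun i =>
    setIntegral_congr_fun measurableSet_ball fun x hx => by
      beta_reduce
      rw [fieldZ_eq, divergence_eq (hZd x hx), matForm_eq]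
  have c4 : ∀ i, ∫ x in ball 0 r, ∑ h, ∑ l, ∑ j,
        A x h l * partialDeriv h (fun y => fieldZ A y j) x * weakGrad U (v i) x j
          * weakGrad U (v i) x l
      = ∫ x in ball 0 r, ⟪fderiv ℝ (opZ (opField A)) x (opField A x (weakGrad U (v i) x)),
          weakGrad U (v i) x⟫_ℝ := fun i =>
    setIntegral_congr_fun measurableSet_ball fun x hx => by
      beta_reduce
      rw [fieldZ_eq, sum_coordinates_fderiv (hZd x hx)]
  simp only [c1, c2, c4]
  rw [fieldZ_eq]
  refine ⟨?_, ?_, ?_⟩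
  · rw [integral_finsetSum _ fun i _ => h.critical.integrableOn_pohozaevDensity isOpen_ball hsub hZ i,
      Finset.mul_sum, Finset.mul_sum, ← Finset.sum_add_distrib, ← Finset.sum_add_distrib,
      ← Finset.sum_sub_distrib]
    refine Finset.sum_congr rfl fun i _ => ?_
    simp only [pohozaevDensity]
    exact integral_add_add_sub (i1 i) (i2 i) (i3 i) (i4 i)
  · simp only [dirichletDensity]
    rw [integral_finsetSum _ fun i _ => i0 i, Finset.mul_sum, ← Finset.sum_sub_distrib]
    refine Finset.sum_congr rfl fun i _ => ?_
    rw [← integral_const_mul, ← integral_sub (i2 i) ((i0 i).const_mul _)]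
    refine setIntegral_congr_fun measurableSet_ball fun x hx => ?_
    beta_reduce
    rw [divergence_sub_id (hZd x hx), matForm_eq, sub_mul]
  · simp only [dirichletDensity]
    rw [integral_finsetSum _ fun i _ => i0 i, ← Finset.sum_sub_distrib]
    refine Finset.sum_congr rfl fun i _ => ?_
    rw [← integral_sub (i4 i) (i0 i)]
    refine setIntegral_congr_fun measurableSet_ball fun x hx => ?_
    beta_reduce
    have := sum_coordinates_fderiv (A := A) (W := fun y => opZ (opField A) y - y)
      ((hZd x hx).sub differentiableAt_id) (weakGrad U (v i) x)
    rw [fderiv_sub_id (hZd x hx), inner_sub_left] at this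
    exact this

/-- The first identity is `ae_pohozaev` in coordinates. For the second, writing `Z` as `x + (Z - x)`
splits `(m - 2)` times the Dirichlet integral off the bulk terms, and this cancels the derivative of
`r ^ (2 - m)`. -/
theorem ae_pohozaevIdentity {R' : ℝ} (hR' : R' < R) : ∀ᵐ r ∂volume.restrict (Ioo 0 R'),
    PohozaevIdentity U A f v r ∧ EnergyDerivIdentity U A f v r := by
  filter_upwards [h.ae_pohozaev hR', h.ae_sphereIntegrable_dirichlet hR',
    h.ae_sphereIntegrable_flux hR', ae_hasDerivAt_integral_ball h.one_le
    (h.integrableOn_dirichletDensity hR'), ae_restrict_mem measurableSet_Ioo] with r h1 h2 h3 h4 hr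
  have hrR : r ∈ Ioo 0 R := ⟨hr.1, hr.2.trans hR'⟩
  have hr0 := hr.1.ne'
  obtain ⟨p1, p2, p3⟩ := integral_pohozaevDensity h hrR.2
  have s1 : sphereIntegral r (dirichletDensity (opField A) fun i => weakGrad U (v i))
      = ∑ i, sphereIntegral r
        (fun x => matForm (A x) (weakGrad U (v i) x) (weakGrad U (v i) x)) :=
    sphereIntegral_sum fun i _ => h2 i
  have s2 := sphereIntegral_sum (t := Finset.univ) fun i _ => h3 i
  -- On the sphere `⟪Z, G⟫ = r ⟪B G, ν⟫ / μ`, because `Z` is `B x x / μ` and `B` is symmetric.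
  have s3 : ∀ i, sphereIntegral r (fun x => matForm (A x) (weakGrad U (v i) x) (unitVec x) ^ 2
      / mu A x) = 1 / r * sphereIntegral r (fun x => ⟪opZ (opField A) x, weakGrad U (v i) x⟫_ℝ
        * ⟪opField A x (weakGrad U (v i) x), unitVec x⟫_ℝ) := fun i => by
    rw [← sphereIntegral_const_mul]
    refine sphereIntegral_congr hr.1.le fun x hx => ?_
    have hxR : x ∈ ball 0 R := by rw [mem_ball_zero_iff, hx]; exact hrR.2
    have hp := (h.inner_pos hrR hx).1
    rw [(h.field_eq hrR hx).1, mu_eq, matForm_eq, hx, real_inner_comm x (opField A x x), unitVec,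
      inner_smul_right, hx, inner_smul_left, h.critical.symm x hxR x, real_inner_comm x]
    simp only [conj_trivial]
    field_simp
  rw [p1, s1, s2] at h1
  refine ⟨?_, ?_⟩
  · rw [PohozaevIdentity]
    simp only
    rw [h1]
    simp only [fieldZ_eq, matForm_eq]
    ring
  · rw [EnergyDerivIdentity]
    simp only [s3, p2, p3]
    have hd := ((hasDerivAt_pow 2 r).div (hasDerivAt_pow m r) (pow_ne_zero m hr0)).mul h4
    have hd' : HasDerivAt (energyDirichlet U A v) _ r := hd.congr_of_eventuallyEq (by
      filter_upwards [Ioo_mem_nhds hrR.1 hrR.2] with t ht using energyDirichlet_eq h ht)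
    refine hd'.congr_deriv ?_
    have z2 := one_div_zpow_sub_two m hr0
    have z1 := one_div_zpow_sub_one m hr0
    have z2' : 2 / r ^ ((m : ℤ) - 2) = 2 * (r ^ 2 / r ^ m) := by rw [← z2]; ring
    have z1' : 2 / r ^ ((m : ℤ) - 1) = 2 * (r / r ^ m) := by rw [← z1]; ring
    rw [z1, z2', z1', ← Finset.mul_sum]
    obtain ⟨k, rfl⟩ : ∃ k, m = k + 1 := ⟨m - 1, by have := h.one_le; omega⟩
    have ec : ∀ i, ∫ x in ball 0 r, f i x (v i x) * ⟪fieldZ A x, weakGrad U (v i) x⟫_ℝ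
        = ∫ x in ball 0 r, f i x (v i x) * ⟪weakGrad U (v i) x, fieldZ A x⟫_ℝ := fun i => by
      congr 1
      funext x
      rw [real_inner_comm]
    simp only [ec]
    have h1' := eq_div_of_mul_eq hr0 ((mul_comm _ r).trans h1)
    rw [s1, h1', Pi.div_apply, Nat.add_sub_cancel]
    generalize (∫ x in ball 0 r, dirichletDensity (opField A) (fun i => weakGrad U (v i)) x) = D
    field_simp
    ring

end Identities

/-! ### Normalization of the matrix at a point -/

theorem matAct_mul (N N' : Matrix (Fin m) (Fin m) ℝ) (ξ : Euc m) :
    matAct (N * N') ξ = matAct N (matAct N' ξ) := by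
  simp [matAct, Matrix.toEuclideanLin, Matrix.toLpLin_mul_same]

theorem matAct_one (ξ : Euc m) : matAct (1 : Matrix (Fin m) (Fin m) ℝ) ξ = ξ := by
  simp [matAct, Matrix.toEuclideanLin, Matrix.toLpLin_one]

theorem matForm_eq_dotProduct (N : Matrix (Fin m) (Fin m) ℝ) (ξ : Euc m) :
    matForm N ξ ξ = star ξ.ofLp ⬝ᵥ (N.mulVec ξ.ofLp) := by
  rw [matForm, inner_eq_sum, dotProduct]
  refine Finset.sum_congr rfl fun i _ => ?_
  rw [mul_comm]
  rfl

theorem isHermitian_of_isSymm {N : Matrix (Fin m) (Fin m) ℝ} (hN : N.IsSymm) : N.IsHermitian := by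
  rw [Matrix.IsHermitian, Matrix.conjTranspose_eq_transpose_of_trivial]
  exact hN

section Normalization

variable {Ω : Set (Euc m)} {θ : ℝ} {A : Euc m → Matrix (Fin m) (Fin m) ℝ} {x₀ : Euc m}

theorem IsEllipticC1.posDef (hA : IsEllipticC1 Ω θ A) (hθ : 0 < θ) (hx₀ : x₀ ∈ Ω) :
    (A x₀).PosDef := by
  refine Matrix.PosDef.of_dotProduct_mulVec_pos (isHermitian_of_isSymm (hA.2.1 x₀ hx₀))
    fun x hx => ?_
  have h := hA.2.2 x₀ hx₀ (WithLp.toLp 2 x)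
  rw [matForm_eq_dotProduct] at h
  refine lt_of_lt_of_le ?_ h
  have : 0 < ‖(WithLp.toLp 2 x : Euc m)‖ := norm_pos_iff.mpr fun h0 => hx (by
    simpa using congrArg WithLp.ofLp h0)
  positivity

/-- Ellipticity makes the square root invertible. The equivalence keeps exactly what is used of it:
symmetry, `S² = A x₀`, and the agreement of its inverse with the matrix inverse. -/
theorem exists_normEquiv (hA : IsEllipticC1 Ω θ A) (hθ : 0 < θ) (hx₀ : x₀ ∈ Ω) :
    ∃ S : Euc m ≃L[ℝ] Euc m, (∀ ξ, S ξ = matAct (matSqrt (A x₀)) ξ) ∧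
      (∀ ξ, S.symm ξ = matAct (matSqrt (A x₀))⁻¹ ξ) ∧ (∀ ξ ζ, ⟪S ξ, ζ⟫_ℝ = ⟪ξ, S ζ⟫_ℝ) ∧
      ∀ ξ, S (S ξ) = matAct (A x₀) ξ := by
  have hp := hA.posDef hθ hx₀
  have hsq := matSqrt_mul_self hp.posSemidef
  have hdet : IsUnit (matSqrt (A x₀)).det := by
    have h1 : (matSqrt (A x₀)).det * (matSqrt (A x₀)).det = (A x₀).det := by
      rw [← Matrix.det_mul, hsq]
    have h2 := hp.det_pos
    rw [← h1] at h2
    exact isUnit_iff_ne_zero.mpr fun h0 => by simp [h0] at h2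
  set N := matSqrt (A x₀)
  have hl : Function.LeftInverse (opField (fun _ => N⁻¹) x₀) (opField (fun _ => N) x₀) := fun ξ => by
    rw [opField_apply, opField_apply, ← matAct_mul, Matrix.nonsing_inv_mul _ hdet, matAct_one]
  have hr : Function.RightInverse (opField (fun _ => N⁻¹) x₀) (opField (fun _ => N) x₀) := fun ξ => by
    rw [opField_apply, opField_apply, ← matAct_mul, Matrix.mul_nonsing_inv _ hdet, matAct_one]
  refine ⟨ContinuousLinearEquiv.equivOfInverse _ _ hl hr, fun ξ => rfl, fun ξ => rfl, ?_, ?_⟩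
  · have hN : N.IsSymm := by
      have := (matSqrt_posSemidef (A x₀)).isHermitian
      rwa [Matrix.IsHermitian, Matrix.conjTranspose_eq_transpose_of_trivial] at this
    exact fun ξ ζ => opField_symm (A := fun _ => N) (x := x₀) hN ξ ζ
  · intro ξ
    rw [← hsq, matAct_mul]
    rfl

variable {S : Euc m ≃L[ℝ] Euc m} (h1 : ∀ ξ, S ξ = matAct (matSqrt (A x₀)) ξ)

include h1 in
theorem normMap_eq : normMap A x₀ = affineHomeo S x₀ := by
  funext x
  rw [affineHomeo_apply, h1]
  rfl

include h1 in
theorem opField_normMatrix (h2 : ∀ ξ, S.symm ξ = matAct (matSqrt (A x₀))⁻¹ ξ) :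
    opField (normMatrix A x₀) = affineOp S x₀ (opField A) := by
  funext x
  ext1 ξ
  rw [opField_apply, normMatrix, matAct_mul, matAct_mul, ← h2, ← h2, normMap_eq h1]
  rfl

section Bounds

variable (h3 : ∀ ξ ζ, ⟪S ξ, ζ⟫_ℝ = ⟪ξ, S ζ⟫_ℝ) (h4 : ∀ ξ, S (S ξ) = matAct (A x₀) ξ)

include h3 h4

theorem sq_norm_normEquiv (ξ : Euc m) : ‖S ξ‖ ^ 2 = matForm (A x₀) ξ ξ := by
  rw [← real_inner_self_eq_norm_sq, matForm, ← h4, h3 (S ξ) ξ]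

/-- Since `‖S ξ‖² = ⟨A x₀ ξ, ξ⟩`, the optimal constant is the square root of `Λ`; `1 + |Λ|` is
larger and needs no sign condition. -/
theorem norm_normEquiv_le {Λ : ℝ} (hΛ : ∀ ξ, matForm (A x₀) ξ ξ ≤ Λ * ‖ξ‖ ^ 2) (ξ : Euc m) :
    ‖S ξ‖ ≤ (1 + |Λ|) * ‖ξ‖ := by
  refine abs_le_of_sq_le_sq' ?_ (by positivity) |>.2
  rw [sq_norm_normEquiv h3 h4, mul_pow]
  refine (hΛ ξ).trans (mul_le_mul_of_nonneg_right ?_ (sq_nonneg _))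
  nlinarith [le_abs_self Λ, abs_nonneg Λ]

theorem norm_normEquiv_symm_le (hθ : 0 < θ) (hA : ∀ ξ, θ * ‖ξ‖ ^ 2 ≤ matForm (A x₀) ξ ξ)
    (ξ : Euc m) : ‖S.symm ξ‖ ≤ (1 + 1 / θ) * ‖ξ‖ := by
  refine abs_le_of_sq_le_sq' ?_ (by positivity) |>.2
  have h5 := hA (S.symm ξ)
  rw [← sq_norm_normEquiv h3 h4, ContinuousLinearEquiv.apply_symm_apply] at h5
  rw [mul_pow]
  have h6 : ‖S.symm ξ‖ ^ 2 ≤ 1 / θ * ‖ξ‖ ^ 2 := by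
    rw [div_mul_eq_mul_div, one_mul, le_div_iff₀ hθ]
    linarith
  refine h6.trans (mul_le_mul_of_nonneg_right ?_ (sq_nonneg _))
  have : 0 < 1 / θ := by positivity
  nlinarith

end Bounds

end Normalization

theorem norm_elemOp_le (i j : Fin m) : ‖elemOp i j‖ ≤ 1 := by
  rw [elemOp, ContinuousLinearMap.norm_smulRight_apply, stdVec, PiLp.norm_single, norm_one,
    mul_one]
  refine ContinuousLinearMap.opNorm_le_bound _ zero_le_one fun ξ => ?_
  rw [one_mul]
  exact PiLp.norm_apply_le ξ j

theorem norm_fderiv_le_of_partialDeriv_le {g : Euc m → ℝ} {x : Euc m} {M : ℝ} (hM : 0 ≤ M)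
    (h : ∀ k, |partialDeriv k g x| ≤ M) : ‖fderiv ℝ g x‖ ≤ m * M := by
  refine ContinuousLinearMap.opNorm_le_bound _ (by positivity) fun ξ => ?_
  conv_lhs => rw [← sum_smul_stdVec ξ, map_sum]
  refine (norm_sum_le _ _).trans ?_
  have : ∀ k ∈ Finset.univ, ‖fderiv ℝ g x (ξ k • stdVec k)‖ ≤ M * ‖ξ‖ := fun k _ => by
    rw [map_smul, norm_smul, mul_comm]
    exact mul_le_mul (h k) (PiLp.norm_apply_le ξ k) (norm_nonneg _) hM
  refine (Finset.sum_le_sum this).trans_eq ?_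
  rw [Finset.sum_const, Finset.card_univ, Fintype.card_fin, nsmul_eq_mul, mul_assoc]

theorem norm_fderiv_sum_smul_le {F : Type*} [NormedAddCommGroup F] [NormedSpace ℝ F]
    {g : Fin m → Fin m → Euc m → ℝ} {e : Fin m → Fin m → F} {x : Euc m} {c : ℝ} (hc : 0 ≤ c)
    (hg : ∀ i j, DifferentiableAt ℝ (g i j) x) (hb : ∀ i j, ‖fderiv ℝ (g i j) x‖ ≤ c)
    (he : ∀ i j, ‖e i j‖ ≤ 1) :
    ‖fderiv ℝ (fun x => ∑ i, ∑ j, g i j x • e i j) x‖ ≤ m ^ 2 * c := by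
  have hd : HasFDerivAt (fun x => ∑ i, ∑ j, g i j x • e i j)
      (∑ i, ∑ j, (fderiv ℝ (g i j) x).smulRight (e i j)) x :=
    HasFDerivAt.fun_sum fun i _ => HasFDerivAt.fun_sum fun j _ =>
      (hg i j).hasFDerivAt.smul_const (e i j)
  rw [hd.fderiv]
  have hb' : ∀ i j, ‖(fderiv ℝ (g i j) x).smulRight (e i j)‖ ≤ c := fun i j => by
    rw [ContinuousLinearMap.norm_smulRight_apply]
    calc _ ≤ c * 1 := mul_le_mul (hb i j) (he i j) (norm_nonneg _) hc
      _ = _ := mul_one _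
  calc _ ≤ ∑ _i : Fin m, ∑ _j : Fin m, c :=
        (norm_sum_le _ _).trans (Finset.sum_le_sum fun i _ =>
          (norm_sum_le _ _).trans (Finset.sum_le_sum fun j _ => hb' i j))
    _ = _ := by simp; ring

/-- One factor `m` comes from the partial derivatives of an entry, and `m ^ 2` from the number of
entries. -/
theorem norm_fderiv_opField_le {A : Euc m → Matrix (Fin m) (Fin m) ℝ} {x : Euc m} {M : ℝ}
    (hM : 0 ≤ M) (hA : ∀ i j, DifferentiableAt ℝ (fun y => A y i j) x)
    (h : ∀ i j k, |partialDeriv k (fun y => A y i j) x| ≤ M) :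
    ‖fderiv ℝ (opField A) x‖ ≤ m ^ 3 * M := by
  have e : opField A = fun x => ∑ i, ∑ j, A x i j • elemOp i j := funext (opField_eq_sum A)
  have h1 := norm_fderiv_sum_smul_le (e := elemOp) (by positivity : 0 ≤ m * M) hA
    (fun i j => norm_fderiv_le_of_partialDeriv_le hM (h i j)) norm_elemOp_le
  rw [e]
  refine h1.trans_eq ?_
  ring

/-- The bound for the derivative of the normalized operators. -/
def normalizedConstant (m : ℕ) (θ Λ M : ℝ) : ℝ := m ^ 3 * |M| * (1 + |Λ|) * (1 + 1 / θ) ^ 2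

/-! ### The profile in normalized coordinates -/

section Main

variable {ℓ : ℕ} {Ω K : Set (Euc m)} {A : Euc m → Matrix (Fin m) (Fin m) ℝ}
  {f : Fin ℓ → Euc m → ℝ → ℝ} {a : Euc m → ℝ} {γ θ Λ M : ℝ} {w : ℝ → Fin ℓ → Euc m → ℝ}
  {u : Fin ℓ → Euc m → ℝ}

/-- The chain rule bounds the derivative of `S⁻¹ A(T x) S⁻¹` by the entry bound, one factor for `S`
and two for its inverse, which is `normalizedConstant`. All the smallness conditions concern `R`
alone, so the radius is uniform in the centre. -/
theorem IsSegregatedLimit.isNormalizedCritical (hm : 1 ≤ m)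
    (h : IsSegregatedLimit Ω A f a γ w u) (hΩ : IsOpen Ω)
    (hθ : 0 < θ) (hA : IsEllipticC1 Ω θ A) (hf : IsAdmissibleReaction Ω f)
    (ha : ContDiffOn ℝ 1 a Ω) (hγ : 0 < γ) (hKΩ : K ⊆ Ω)
    (hΛ : ∀ x ∈ K, ∀ ξ : Euc m, matForm (A x) ξ ξ ≤ Λ * ‖ξ‖ ^ 2)
    (hM : ∀ x ∈ K, ∀ i j k, |partialDeriv k (fun y => A y i j) x| ≤ M)
    {c : ℝ} (hc : 0 ≤ c) (hfc : ∀ i, ∀ x ∈ K, |f i x (u i x)| ≤ c * |u i x|)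
    {x₀ : Euc m} {R : ℝ} (hR : 0 < R) (hR1 : R ≤ 1) (hRK : closedBall x₀ ((1 + |Λ|) * R) ⊆ K)
    (hRM : normalizedConstant m θ Λ M * R ≤ 1 / 4) (hRc : 144 * c * R ^ 2 ≤ 1) :
    MapsTo (normMap A x₀) (closedBall 0 R) K ∧
    (∀ i, MemH1 (normDomain A Ω x₀) (normProfile A u x₀ i)) ∧
    IsNormalizedCritical (opField (normMatrix A x₀))
      (fun i x => normReaction A f x₀ i x (normProfile A u x₀ i x)) (normProfile A u x₀)
      (fun i => weakGrad (normDomain A Ω x₀) (normProfile A u x₀ i)) R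
      (normalizedConstant m θ Λ M) c := by
  have hx₀ : x₀ ∈ K := hRK (mem_closedBall_self (by positivity))
  obtain ⟨S, h1, h2, h3, h4⟩ := exists_normEquiv hA hθ (hKΩ hx₀)
  have hS := norm_normEquiv_le h3 h4 (hΛ x₀ hx₀)
  have hS' := norm_normEquiv_symm_le h3 h4 hθ (hA.2.2 x₀ (hKΩ hx₀))
  have hT : normMap A x₀ = affineHomeo S x₀ := normMap_eq h1
  have hmaps : MapsTo (normMap A x₀) (closedBall 0 R) K := fun x hx => hRK (by
    rw [mem_closedBall_zero_iff] at hx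
    rw [hT, affineHomeo_apply, mem_closedBall, dist_self_add_left]
    exact (hS x).trans (by gcongr))
  have hD : normDomain A Ω x₀ = affineHomeo S x₀ ⁻¹' Ω := by rw [normDomain, hT]
  have hv : normProfile A u x₀ = fun i x => u i (affineHomeo S x₀ x) := by
    funext i x; rw [normProfile, hT]
  have hH1 := fun i => (h.memH1 i).comp_affineHomeo h3 x₀ hΩ
  have hcrit := ((h.isCritical hΩ hθ hA hf ha hγ).comp_affineHomeo h3 x₀ hΩ).congr_ae
    (hΩ.preimage (affineHomeo S x₀).continuous) fun i => (hH1 i).2.symm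
  have hB := opField_normMatrix h1 h2
  have hsub : ball (0 : Euc m) R ⊆ affineHomeo S x₀ ⁻¹' Ω := fun x hx => by
    have := hmaps (ball_subset_closedBall hx)
    rw [hT] at this
    exact hKΩ this
  have hBd : ∀ x ∈ Ω, DifferentiableAt ℝ (opField A) x := fun x hx =>
    (hA.contDiffOn_opField.contDiffAt (hΩ.mem_nhds hx)).differentiableAt one_ne_zero
  have hF : (fun i x => normReaction A f x₀ i x (normProfile A u x₀ i x))
      = fun i x => f i (affineHomeo S x₀ x) (u i (affineHomeo S x₀ x)) := by
    funext i x; rw [normReaction, normProfile, hT]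
  refine ⟨hmaps, fun i => ?_, ?_⟩
  · rw [hD, hv]; exact (hH1 i).1
  rw [hF, hB, hD, hv]
  refine ⟨hm, hcrit.mono hsub, ?_, ?_, hR1, hRM, hc, ?_, hRc⟩
  · ext1 ξ
    change S.symm (opField A (affineHomeo S x₀ 0) (S.symm ξ)) = ξ
    rw [affineHomeo_apply, map_zero, add_zero, opField_apply, ← h4,
      ContinuousLinearEquiv.apply_symm_apply, ContinuousLinearEquiv.symm_apply_apply]
  · intro x hx
    have hxK : affineHomeo S x₀ x ∈ K := by
      have := hmaps (ball_subset_closedBall hx)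
      rwa [hT] at this
    have hfd := norm_fderiv_opField_le (abs_nonneg M)
      (fun i j => ((hA.1 i j).contDiffAt (hΩ.mem_nhds (hKΩ hxK))).differentiableAt one_ne_zero)
      fun i j k => (hM _ hxK i j k).trans (le_abs_self M)
    have hn : 0 ≤ normalizedConstant m θ Λ M := by rw [normalizedConstant]; positivity
    refine ContinuousLinearMap.opNorm_le_bound _ hn fun e => ?_
    refine ContinuousLinearMap.opNorm_le_bound _ (by positivity) fun ξ => ?_
    rw [fderiv_affineOp x₀ (hBd _ (hKΩ hxK))]
    refine (hS' _).trans ?_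
    have k1 : ‖fderiv ℝ (opField A) (affineHomeo S x₀ x) (S e) (S.symm ξ)‖
        ≤ m ^ 3 * |M| * ((1 + |Λ|) * ‖e‖) * ((1 + 1 / θ) * ‖ξ‖) := by
      refine (ContinuousLinearMap.le_opNorm _ _).trans
        (mul_le_mul ?_ (hS' ξ) (norm_nonneg _) (by positivity))
      exact (ContinuousLinearMap.le_opNorm _ _).trans
        (mul_le_mul hfd (hS e) (norm_nonneg _) (by positivity))
    calc _ ≤ (1 + 1 / θ) * (m ^ 3 * |M| * ((1 + |Λ|) * ‖e‖) * ((1 + 1 / θ) * ‖ξ‖)) := by gcongr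
      _ = _ := by rw [normalizedConstant]; ring
  · intro i x hx
    have := hmaps (ball_subset_closedBall hx)
    rw [hT] at this
    exact hfc i _ this

end Main

/-! ### Unique continuation -/

namespace IsNormalizedCritical

variable {ℓ : ℕ} {B : Euc m → Euc m →L[ℝ] Euc m} {F v : Fin ℓ → Euc m → ℝ}
  {G : Fin ℓ → Euc m → Euc m} {R M c : ℝ} (h : IsNormalizedCritical B F v G R M c)

include h

/-- `FrequencyEstimates` is available only on radii strictly below `R`; a radius beyond both the
given point and the zero of the height is chosen, and the dichotomy is applied there. -/
theorem eq_zero_or_height_pos (hR : 0 < R) :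
    (∀ x ∈ ball 0 R, ∀ i, v i x = 0) ∨ ∀ r ∈ Ioo 0 R, 0 < opHeight B v G r := by
  by_contra! hcon
  obtain ⟨⟨x, hx, i, hne⟩, r, hr, hle⟩ := hcon
  have hx' : ‖x‖ < R := mem_ball_zero_iff.mp hx
  obtain ⟨t, ht, htR⟩ := exists_between (max_lt hr.2 hx')
  obtain ⟨R', hR', hR'R⟩ := exists_between htR
  have hrt : r < t := (le_max_left _ _).trans_lt ht
  have hFE := h.frequencyEstimates hR hR'R
  have ht' : t ∈ Ioo 0 R' := ⟨hr.1.trans hrt, hR'⟩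
  rcases hFE.height_eq_zero_or_pos with h0 | hpos
  · exact hne (h.eq_zero_of_opHeight_eq_zero ⟨ht'.1, htR⟩ (h0 t ht')
      (hFE.energy_eq_zero ht' (h0 t ht')) x
      (mem_ball_zero_iff.mpr ((le_max_right _ _).trans_lt ht)) i)
  · exact absurd (hpos r ⟨hr.1, hrt.trans hR'⟩) (not_lt.mpr hle)

/-- Unique continuation: a profile vanishing near the origin has height zero on small spheres, which
excludes the positive alternative. The size of the ball does not depend on where the vanishing was
observed. -/
theorem eq_zero_of_eventually_eq_zero (hR : 0 < R) (h0 : ∀ᶠ x in 𝓝 0, ∀ i, v i x = 0) :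
    ∀ x ∈ ball 0 R, ∀ i, v i x = 0 := by
  refine (h.eq_zero_or_height_pos hR).resolve_right fun hpos => ?_
  obtain ⟨ε, hε, hb⟩ := Metric.eventually_nhds_iff_ball.mp h0
  obtain ⟨r, hr, hr'⟩ := exists_between (lt_min hε hR)
  have hrR : r ∈ Ioo 0 R := ⟨hr, hr'.trans_le (min_le_right _ _)⟩
  refine (hpos r hrR).ne' (h.opHeight_eq_zero hrR fun x hx i => hb x ?_ i)
  rw [mem_ball_zero_iff, hx]
  exact hr'.trans_le (min_le_left _ _)

end IsNormalizedCritical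

theorem exists_radius {δ : ℝ} (hδ : 0 < δ) (Λ M c : ℝ) : ∃ R > 0, R ≤ 1 ∧ (1 + |Λ|) * R ≤ δ ∧
    M * R ≤ 1 / 4 ∧ 144 * c * R ^ 2 ≤ 1 := by
  have hΛ : 0 ≤ |Λ| := abs_nonneg Λ
  have hM : 0 ≤ |M| := abs_nonneg M
  have hc : 0 ≤ |c| := abs_nonneg c
  -- Each summand takes care of one requirement on `R = 1 / q`; the quadratic one follows from the
  -- linear one, as `R ≤ 1`.
  set q := 1 + (1 + |Λ|) / δ + 4 * |M| + 144 * |c| with hq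
  have hd : 0 ≤ (1 + |Λ|) / δ := by positivity
  have hq1 : 1 ≤ q := by linarith
  have hq0 : 0 < q := by linarith
  have hle : 1 / q ≤ 1 := by rw [div_le_one hq0]; exact hq1
  refine ⟨1 / q, by positivity, hle, ?_, ?_, ?_⟩
  · rw [mul_one_div, div_le_iff₀ hq0, ← div_le_iff₀' hδ]
    linarith
  · rw [mul_one_div, div_le_iff₀ hq0]
    linarith [le_abs_self M]
  · have h1 : (1 / q) ^ 2 ≤ 1 / q := by rw [sq]; exact mul_le_of_le_one_left (by positivity) hle
    calc 144 * c * (1 / q) ^ 2 ≤ 144 * |c| * (1 / q) := by gcongr; exact le_abs_self c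
      _ ≤ 1 := by rw [mul_one_div, div_le_iff₀ hq0]; linarith

theorem exists_common_bound {ι X : Type*} [Fintype ι] {g : ι → X → ℝ} {s : Set X}
    (h : ∀ i, ∃ C, ∀ x ∈ s, |g i x| ≤ C) : ∃ C, 0 ≤ C ∧ ∀ i, ∀ x ∈ s, |g i x| ≤ C := by
  choose C hC using h
  refine ⟨∑ i, |C i|, Finset.sum_nonneg fun i _ => abs_nonneg _, fun i x hx => ?_⟩
  exact ((hC i x hx).trans (le_abs_self _)).trans
    (Finset.single_le_sum (f := fun i => |C i|) (fun j _ => abs_nonneg _) (Finset.mem_univ i))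

/-- For `|s| ≤ 1` this is the assumption; for `1 ≤ |s| ≤ L` a bound by a constant, from compactness,
is also a linear bound. -/
theorem IsAdmissibleReaction.exists_bound {ℓ : ℕ} {Ω K : Set (Euc m)} {f : Fin ℓ → Euc m → ℝ → ℝ}
    (hf : IsAdmissibleReaction Ω f) (hK : IsCompact K) (hKΩ : K ⊆ Ω) (L : ℝ) :
    ∃ c, 0 ≤ c ∧ ∀ i, ∀ x ∈ K, ∀ s, |s| ≤ L → |f i x s| ≤ c * |s| := by
  obtain ⟨hcont, c₁, hc₁, hb⟩ := hf
  have hc := hK.prod (isCompact_Icc (a := -L) (b := L))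
  obtain ⟨C, hC0, hC⟩ := exists_common_bound (g := fun i (p : Euc m × ℝ) => f i p.1 p.2)
    fun i => hc.exists_bound_of_continuousOn
      ((hcont i).mono (prod_mono hKΩ (subset_univ _)))
  refine ⟨c₁ + C, by positivity, fun i x hx s hs => ?_⟩
  rcases le_total |s| 1 with h1 | h1
  · exact (hb i x (hKΩ hx) s h1).trans (by gcongr; linarith)
  · have h2 := hC i (x, s) ⟨hx, abs_le.mp hs⟩
    calc |f i x s| ≤ C * 1 := by rw [mul_one]; exact h2
      _ ≤ (c₁ + C) * |s| := by gcongr; linarith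

section UniqueContinuation

variable {ℓ : ℕ} {Ω : Set (Euc m)} {A : Euc m → Matrix (Fin m) (Fin m) ℝ}
  {f : Fin ℓ → Euc m → ℝ → ℝ} {a : Euc m → ℝ} {γ θ : ℝ} {w : ℝ → Fin ℓ → Euc m → ℝ}
  {u : Fin ℓ → Euc m → ℝ}

theorem IsEllipticC1.exists_upper_bound (hA : IsEllipticC1 Ω θ A) {K : Set (Euc m)}
    (hK : IsCompact K) (hKΩ : K ⊆ Ω) :
    ∃ Λ, ∀ x ∈ K, ∀ ξ : Euc m, matForm (A x) ξ ξ ≤ Λ * ‖ξ‖ ^ 2 := by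
  obtain ⟨Λ, hΛ⟩ := hK.exists_bound_of_continuousOn (hA.contDiffOn_opField.continuousOn.mono hKΩ)
  refine ⟨Λ, fun x hx ξ => ?_⟩
  rw [matForm_eq]
  refine (real_inner_le_norm _ _).trans ?_
  calc ‖opField A x ξ‖ * ‖ξ‖ ≤ Λ * ‖ξ‖ * ‖ξ‖ := by
        gcongr
        exact (ContinuousLinearMap.le_opNorm _ _).trans (by gcongr; exact hΛ x hx)
    _ = _ := by ring

theorem IsEllipticC1.exists_partialDeriv_bound (hA : IsEllipticC1 Ω θ A) (hΩ : IsOpen Ω)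
    {K : Set (Euc m)} (hK : IsCompact K) (hKΩ : K ⊆ Ω) :
    ∃ M, ∀ x ∈ K, ∀ i j k, |partialDeriv k (fun y => A y i j) x| ≤ M := by
  obtain ⟨M, -, hM⟩ := exists_common_bound (s := K)
    (g := fun (p : Fin m × Fin m × Fin m) x => partialDeriv p.2.2 (fun y => A y p.1 p.2.1) x)
    fun p => hK.exists_bound_of_continuousOn
      ((((hA.1 p.1 p.2.1).continuousOn_fderiv_of_isOpen hΩ le_rfl).clm_apply
        continuousOn_const).mono hKΩ)
  exact ⟨M, fun x hx i j k => hM (i, j, k) x hx⟩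

/-- The inverse of the normalizing map stretches by at most `1 + 1 / θ`, so the image of the ball
contains one whose radius does not depend on the centre. -/
theorem eq_zero_of_normProfile_eq_zero (hA : IsEllipticC1 Ω θ A) (hθ : 0 < θ) {x₀ : Euc m}
    (hx₀ : x₀ ∈ Ω) {R : ℝ} (h0 : ∀ x ∈ ball 0 R, ∀ i, normProfile A u x₀ i x = 0) :
    ∀ y ∈ ball x₀ (R / (1 + 1 / θ)), ∀ i, u i y = 0 := by
  intro y hy i
  obtain ⟨S, h1, -, h3, h4⟩ := exists_normEquiv hA hθ hx₀
  have hn := norm_normEquiv_symm_le h3 h4 hθ (hA.2.2 x₀ hx₀) (y - x₀)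
  have hp : 0 < 1 + 1 / θ := by positivity
  rw [mem_ball_iff_norm, lt_div_iff₀' hp] at hy
  have := h0 (S.symm (y - x₀)) (mem_ball_zero_iff.mpr (hn.trans_lt hy)) i
  rwa [normProfile, normMap_eq h1, affineHomeo_apply, ContinuousLinearEquiv.apply_symm_apply,
    add_sub_cancel] at this

theorem eventually_normProfile_eq_zero (hA : IsEllipticC1 Ω θ A) (hθ : 0 < θ) {x₀ : Euc m}
    (hx₀ : x₀ ∈ Ω) (h0 : ∀ᶠ y in 𝓝 x₀, ∀ i, u i y = 0) :
    ∀ᶠ x in 𝓝 0, ∀ i, normProfile A u x₀ i x = 0 := by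
  obtain ⟨S, h1, -⟩ := exists_normEquiv hA hθ hx₀
  have ht : Tendsto (normMap A x₀) (𝓝 0) (𝓝 x₀) := by
    have := (affineHomeo S x₀).continuous.tendsto 0
    rwa [affineHomeo_apply, map_zero, add_zero, ← normMap_eq h1] at this
  exact ht.eventually h0

/-- The set of points near which `u` vanishes is open. It is also relatively closed in the connected
component, because around each of its points close to `x₁` the profile vanishes on a ball of a fixed
radius; it would then be the whole component. -/
theorem IsSegregatedLimit.not_eventually_eq_zero (hm : 1 ≤ m)
    (h : IsSegregatedLimit Ω A f a γ w u) (hΩ : IsOpen Ω)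
    (hθ : 0 < θ) (hA : IsEllipticC1 Ω θ A) (hf : IsAdmissibleReaction Ω f)
    (ha : ContDiffOn ℝ 1 a Ω) (hγ : 0 < γ) {x₀ : Euc m} (hx₀ : x₀ ∈ Ω) :
    ¬ ∀ᶠ y in 𝓝 x₀, ∀ i, u i y = 0 := by
  intro h0
  set V : Set (Euc m) := {x | ∀ᶠ y in 𝓝 x, ∀ i, u i y = 0} with hV
  have hVo : IsOpen V := isOpen_setOfPred_eventually_nhds
  have hsub : connectedComponentIn Ω x₀ ⊆ V := by
    refine isPreconnected_connectedComponentIn.subset_of_closure_inter_subset hVo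
      ⟨x₀, mem_connectedComponentIn hx₀, h0⟩ ?_
    rintro x₁ ⟨hx₁, hx₁'⟩
    have hx₁Ω := connectedComponentIn_subset Ω x₀ hx₁'
    obtain ⟨δ, hδ, hδΩ⟩ := Metric.nhds_basis_closedBall.mem_iff.mp (hΩ.mem_nhds hx₁Ω)
    have hK := isCompact_closedBall x₁ δ
    obtain ⟨Λ, hΛ⟩ := hA.exists_upper_bound hK hδΩ
    obtain ⟨M, hM⟩ := hA.exists_partialDeriv_bound hΩ hK hδΩ
    obtain ⟨L, -, hL⟩ := exists_common_bound (s := closedBall x₁ δ) (g := u) fun i =>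
      hK.exists_bound_of_continuousOn ((h.continuousOn_profile i).mono hδΩ)
    obtain ⟨c, hc, hfc⟩ := hf.exists_bound hK hδΩ L
    obtain ⟨R, hR, hR1, hRδ, hRM, hRc⟩ :=
      exists_radius (half_pos hδ) Λ (normalizedConstant m θ Λ M) c
    have hp : 0 < R / (1 + 1 / θ) := by positivity
    -- The point `x₂` is so close to `x₁` that the ball of vanishing around `x₂` contains `x₁`, and
    -- the data needed at `x₂` are controlled on the ball of radius `δ` around `x₁`.
    obtain ⟨x₂, hx₂, hd⟩ := Metric.mem_closure_iff.mp hx₁ _ (lt_min hp (half_pos hδ))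
    have hd1 : dist x₁ x₂ < R / (1 + 1 / θ) := hd.trans_le (min_le_left _ _)
    have hd2 : dist x₂ x₁ ≤ δ / 2 := by rw [dist_comm]; exact (hd.trans_le (min_le_right _ _)).le
    have hRK : closedBall x₂ ((1 + |Λ|) * R) ⊆ closedBall x₁ δ :=
      closedBall_subset_closedBall' (by linarith)
    have hx₂Ω : x₂ ∈ Ω := hδΩ (mem_closedBall.mpr (by linarith))
    have hN := (h.isNormalizedCritical hm hΩ hθ hA hf ha hγ hδΩ hΛ hM hc
      (fun i x hx => hfc i x hx _ (hL i x hx)) hR hR1 hRK hRM hRc).2.2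
    have hz := eq_zero_of_normProfile_eq_zero hA hθ hx₂Ω (hN.eq_zero_of_eventually_eq_zero hR
      (eventually_normProfile_eq_zero hA hθ hx₂Ω hx₂))
    exact Filter.eventually_of_mem (isOpen_ball.mem_nhds (mem_ball.mpr hd1)) hz
  obtain ⟨y, hy, i, hne⟩ := h.nontrivial x₀ hx₀
  exact hne ((hsub hy).self_of_nhds i)

end UniqueContinuation

end SegregatedProfile

end

/-! ### The monotonicity formula -/

theorem theoremC3 (m ℓ : ℕ) (hm : 1 ≤ m) (Ω : Set (Euc m)) (hΩ : IsOpen Ω)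
    -- `ω` is compactly contained in `Ω`, with a compact neighbourhood `K` of its closure
    (ω K : Set (Euc m)) (hK : IsCompact K) (hKΩ : K ⊆ Ω) (hωK : closure ω ⊆ interior K)
    (f : Fin ℓ → Euc m → ℝ → ℝ) (hf : IsAdmissibleReaction Ω f)
    -- bounds on which the constants may depend
    (θ Λ M L : ℝ) (hθ : 0 < θ) :
    ∃ C > 0, ∃ R > 0,
      ∀ (γ : ℝ) (a : Euc m → ℝ) (A : Euc m → Matrix (Fin m) (Fin m) ℝ)
        (w : ℝ → Fin ℓ → Euc m → ℝ) (u : Fin ℓ → Euc m → ℝ),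
      0 < γ → ContDiffOn ℝ 1 a Ω → (∀ x ∈ Ω, 0 < a x) → IsEllipticC1 Ω θ A →
      IsSegregatedLimit Ω A f a γ w u →
      (∀ x ∈ K, ∀ ξ : Euc m, matForm (A x) ξ ξ ≤ Λ * ‖ξ‖ ^ 2) →
      (∀ x ∈ K, ∀ i j k, |partialDeriv k (fun y => A y i j) x| ≤ M) →
      (∀ x ∈ K, ∀ i, |u i x| ≤ L) →
      ∀ x₀ ∈ ω,
        -- the quantities below are well defined for radii up to `R`
        MapsTo (normMap A x₀) (closedBall 0 R) Ω ∧
        (∀ i, MemH1 (normDomain A Ω x₀) (normProfile A u x₀ i)) ∧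
        -- the two identities of Pohozaev type
        (∀ᵐ r ∂(volume.restrict (Ioo (0 : ℝ) R)),
          PohozaevIdentity (normDomain A Ω x₀) (normMatrix A x₀) (normReaction A f x₀)
            (normProfile A u x₀) r ∧
          EnergyDerivIdentity (normDomain A Ω x₀) (normMatrix A x₀) (normReaction A f x₀)
            (normProfile A u x₀) r) ∧
        (∀ r ∈ Ioo (0 : ℝ) R, heightAt A u x₀ r ≠ 0) ∧
        -- the limit at zero, and absolute continuity (including the endpoints of `[0, R]`)
        (∃ N₀ : ℝ, Tendsto (almgrenQuotient Ω A f u x₀) (𝓝[>] 0) (𝓝 N₀) ∧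
          AbsolutelyContinuousOnInterval
            (Function.update (almgrenQuotient Ω A f u x₀) 0 N₀) 0 R) ∧
        (∀ᵐ r ∂(volume.restrict (Ioo (0 : ℝ) R)),
          DifferentiableAt ℝ (almgrenQuotient Ω A f u x₀) r ∧
          -C * (almgrenQuotient Ω A f u x₀ r + 1) ≤ deriv (almgrenQuotient Ω A f u x₀) r) ∧
        MonotoneOn (fun r => Real.exp (C * r) * (almgrenQuotient Ω A f u x₀ r + 1))
          (Ioo (0 : ℝ) R) ∧
        ∀ r ∈ Ioo (0 : ℝ) R,
          DifferentiableAt ℝ (fun t => Real.log (heightAt A u x₀ t)) r ∧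
          |deriv (fun t => Real.log (heightAt A u x₀ t)) r
            - 2 / r * almgrenQuotient Ω A f u x₀ r| ≤ C := by
  have hωc : IsCompact (closure ω) :=
    hK.of_isClosed_subset isClosed_closure (hωK.trans interior_subset)
  -- One distance `δ` serves all the centres in `ω`, so the radius and the constant are fixed before
  -- the centre and the profile are given.
  obtain ⟨δ, hδ, hδK⟩ := hωc.exists_cthickening_subset_open isOpen_interior hωK
  obtain ⟨c, hc, hfc⟩ := hf.exists_bound hK hKΩ L
  obtain ⟨R₁, hR₁, hR1, hRδ, hRM, hRc⟩ := exists_radius hδ Λ (normalizedConstant m θ Λ M) c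
  have hM' : 0 ≤ normalizedConstant m θ Λ M := by rw [normalizedConstant]; positivity
  have hC : 0 < 2 * frequencyConstant m (normalizedConstant m θ Λ M) c := by
    rw [frequencyConstant]; positivity
  -- The radius is halved twice: `frequencyEstimates` holds strictly inside `R₁`, and absolute
  -- continuity up to and including the right endpoint needs a radius strictly inside that one.
  refine ⟨2 * frequencyConstant m (normalizedConstant m θ Λ M) c, hC, R₁ / 4, by positivity, ?_⟩
  intro γ a A w u hγ ha _ hA h hΛ hM hL x₀ hx₀
  have hRK : closedBall x₀ ((1 + |Λ|) * R₁) ⊆ K :=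
    ((closedBall_subset_closedBall hRδ).trans
      (closedBall_subset_cthickening (subset_closure hx₀) δ)).trans (hδK.trans interior_subset)
  have hx₀Ω : x₀ ∈ Ω := hKΩ (hRK (mem_closedBall_self (by positivity)))
  obtain ⟨hmaps, hH1, hN⟩ := h.isNormalizedCritical hm hΩ hθ hA hf ha hγ hKΩ hΛ hM hc
    (fun i x hx => hfc i x hx _ (hL x hx i)) hR₁ hR1 hRK hRM hRc
  have h2 : R₁ / 2 < R₁ := by linarith
  have h4 : R₁ / 4 < R₁ / 2 := by linarith
  have hFE := hN.frequencyEstimates hR₁ h2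
  -- The alternative of a vanishing profile would make `u` zero on a ball around `x₀`, against
  -- unique continuation.
  have hpos := (hN.eq_zero_or_height_pos hR₁).resolve_left fun h0 =>
    h.not_eventually_eq_zero hm hΩ hθ hA hf ha hγ hx₀Ω (Filter.eventually_of_mem
      (ball_mem_nhds x₀ (by positivity)) (eq_zero_of_normProfile_eq_zero hA hθ hx₀Ω h0))
  have hsub1 : Ioo 0 (R₁ / 2) ⊆ Ioo 0 R₁ := Ioo_subset_Ioo_right h2.le
  have hsub2 : Ioo 0 (R₁ / 4) ⊆ Ioo 0 (R₁ / 2) := Ioo_subset_Ioo_right h4.le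
  have hH : ∀ r ∈ Ioo 0 R₁, heightAt A u x₀ r = opHeight (opField (normMatrix A x₀))
      (normProfile A u x₀) (fun i => weakGrad (normDomain A Ω x₀) (normProfile A u x₀ i)) r :=
    fun r hr => height_eq hN hr
  have hQ : ∀ r ∈ Ioo 0 R₁, almgrenQuotient Ω A f u x₀ r = opEnergy (opField (normMatrix A x₀))
      (fun i x => normReaction A f x₀ i x (normProfile A u x₀ i x)) (normProfile A u x₀)
      (fun i => weakGrad (normDomain A Ω x₀) (normProfile A u x₀ i)) r /
      opHeight (opField (normMatrix A x₀))
      (normProfile A u x₀) (fun i => weakGrad (normDomain A Ω x₀) (normProfile A u x₀ i)) r :=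
    fun r hr => by rw [almgrenQuotient, hH r hr, energyAt, energy_eq hN hr]
  have hnhds : ∀ r ∈ Ioo 0 (R₁ / 4), ∀ᶠ t in 𝓝 r, t ∈ Ioo 0 R₁ := fun r hr =>
    Ioo_mem_nhds hr.1 (hsub1 (hsub2 hr)).2
  have hpos' := fun r hr => hpos r (hsub1 hr)
  refine ⟨fun x hx => hKΩ (hmaps (closedBall_subset_closedBall (by linarith) hx)), hH1,
    ae_pohozaevIdentity hN (h4.trans h2), fun r hr => ?_, ?_, ?_, ?_, ?_⟩
  · rw [hH r (hsub1 (hsub2 hr))]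
    exact (hpos r (hsub1 (hsub2 hr))).ne'
  · obtain ⟨N₀, hlim, hac⟩ := hFE.exists_limit hpos' (by positivity) h4
    refine ⟨N₀, hlim.congr' ?_, absolutelyContinuous_congr hac fun r hr => ?_⟩
    · filter_upwards [Ioo_mem_nhdsGT hR₁] with r hr using (hQ r hr).symm
    · rw [uIcc_of_le (by positivity)] at hr
      rcases hr.1.eq_or_lt with rfl | hr0
      · simp
      · rw [Function.update_of_ne hr0.ne', Function.update_of_ne hr0.ne',
          hQ r ⟨hr0, hr.2.trans_lt (h4.trans h2)⟩]
  · filter_upwards [ae_restrict_of_ae_restrict_of_subset hsub2 (hFE.ae_deriv_quotient hpos'),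
      ae_restrict_mem measurableSet_Ioo] with r hr hrR
    have he : almgrenQuotient Ω A f u x₀ =ᶠ[𝓝 r] _ := (hnhds r hrR).mono hQ
    rw [he.deriv_eq, hQ r (hsub1 (hsub2 hrR))]
    exact ⟨hr.1.congr_of_eventuallyEq he, hr.2⟩
  · refine ((hFE.monotoneOn_quotient hpos').mono hsub2).congr fun r hr => ?_
    simp only
    rw [hQ r (hsub1 (hsub2 hr))]
  · intro r hr
    have hd := hFE.hasDerivAt_log_height hpos' (hsub2 hr)
    have he : (fun t => Real.log (heightAt A u x₀ t)) =ᶠ[𝓝 r] _ :=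
      (hnhds r hr).mono fun t ht => congrArg Real.log (hH t ht)
    rw [he.deriv_eq, hQ r (hsub1 (hsub2 hr))]
    refine ⟨hd.1.congr_of_eventuallyEq he, hd.2.trans ?_⟩
    linarith
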